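/- Let $d\ge 1$, $Q=[-\frac12,\frac12]^d$, $I_N=[-\frac N2,\frac N2]^d$, and let $(e_i)$ be the canonical basis of $\mathbb R^d$. Let $(\Omega,\mathcal F,\mathbb P)$ be a probability space with a measure-preserving ergodic action $(\tau_k)_{k\in\mathbb Z^d}$ of $\mathbb Z^d$. Call a field $F$ stationary if $F(x+k,\omega)=F(x,\tau_k\omega)$ for all $k\in\mathbb Z^d$ and a.e. $(x,\omega)$. Let $A_{per},C_{per}:\mathbb R^d\to\mathbb R^{d\times d}$ be $\mathbb Z^d$-periodic tensor fields, and let $M>0$, $0<\alpha\le\beta$ be such that, for a.e. $x$, all $s\in[-M,M]$ and all $\xi\in\mathbb R^d$, $$\alpha|\xi|^2\le (A_{per}+sC_{per})(x)\xi\cdot\xi,\qquad |(A_{per}+sC_{per})(x)\xi|\le\beta|\xi|.$$ Let $B_\eta$ ($\eta>0$) be random variables with $|B_\eta|\le M$ almost surely such that, for each $\eta$, the variables $B_\eta\circ\tau_k$, $k\in\mathbb Z^d$, are independent (hence i.i.d.). Assume that for some $\bar B_0,\bar R_0\in L^2(\Omega)$ $$B_\eta=\eta\bar B_0+\eta^2\bar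 R_0+o(\eta^2)\quad\text{weakly in }L^2(\Omega)\text{ as }\eta\to0^+ .$$ Assume moreover that the law of $B_\eta$ has a second-order expansion: there are distributions $d\bar P_1,d\bar P_2$ with compact support in $]-M,M[$ such that, for every smooth $\varphi$, as $\eta\to0^+$, $$\mathbb E\,\varphi(B_\eta)=\varphi(0)+\eta\langle d\bar P_1,\varphi\rangle+\eta^2\langle d\bar P_2,\varphi\rangle+o(\eta^2).$$ Put $A_\eta(x,\omega)=A_{per}(x)+\sum_{k\in\mathbb Z^d}\mathbf 1_{Q+k}(x)B_\eta(\tau_k\omega)\,C_{per}(x)$. *Homogenized tensors.* $A_\eta^*e_i=\mathbb E\int_Q A_\eta(\nabla w_i^\eta+e_i)$, where $-\operatorname{div}(A_\eta(\nabla w_i^\eta+e_i))=0$ in $\mathbb R^d$, $\nabla w_i^\eta$ is stationary and $\mathbb E\int_Q\nabla w_i^\eta=0$. Likewise $A_{per}^*e_i=\int_Q A_{per}(\nabla w_i^0+e_i)$, where $-\operatorname{div}(A_{per}(\nabla w_i^0+e_i))=0$ and $w_i^0$ is $\mathbb Z^d$-periodic. Let $\tilde w_j^0$ be the analogous periodic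 corrector for $A_{per}^T$. *Rigorous coefficients.* Let $\bar b_0(x,\omega)=\sum_k\mathbf 1_{Q+k}(x)\bar B_0(\tau_k\omega)$ and let $v_i^0$ solve $-\operatorname{div}(A_{per}\nabla v_i^0)=\operatorname{div}(\bar b_0C_{per}(\nabla w_i^0+e_i))$ in $\mathbb R^d$ with $\nabla v_i^0$ stationary and $\mathbb E\int_Q\nabla v_i^0=0$. Set $$\tilde A_1^*e_i=\int_Q\mathbb E(\bar b_0)\,C_{per}(\nabla w_i^0+e_i)+\int_Q A_{per}\nabla\mathbb E(v_i^0).$$ Let $t_i$ solve $-\operatorname{div}(A_{per}\nabla t_i)=\operatorname{div}(\mathbf 1_QC_{per}(\nabla w_i^0+e_i))$ in $\mathbb R^d$ with $\nabla t_i\in L^2(\mathbb R^d)$. Let $s_i$ be $\mathbb Z^d$-periodic with $-\operatorname{div}(A_{per}\nabla s_i)=\operatorname{div}(C_{per}(\nabla w_i^0+e_i))$. Set $$\begin{aligned}\tilde A_2^*e_i\cdot e_j&=\mathbb E(\bar R_0)\int_Q C_{per}(\nabla w_i^0+e_i)\cdot(\nabla\tilde w_j^0+e_j)+\operatorname{Var}(\bar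 B_0)\int_Q C_{per}\nabla t_i\cdot(\nabla\tilde w_j^0+e_j)\\&\quad+(\mathbb E\bar B_0)^2\int_Q C_{per}\nabla s_i\cdot(\nabla\tilde w_j^0+e_j)\\&\quad+\sum_{k\ne0}\operatorname{cov}(\bar B_0,\bar B_0\circ\tau_k)\int_Q C_{per}\nabla t_i(\cdot-k)\cdot(\nabla\tilde w_j^0+e_j).\end{aligned}$$ *Supercell coefficients.* For odd $N$, $\mathcal T_N=\{k\in\mathbb Z^d:\ Q+k\subset I_N\}$ and a tensor field $A$ on $I_N$, let $\Phi_N(A)e_i=\int_{I_N}A(\nabla w_i+e_i)$, where $-\operatorname{div}(A(\nabla w_i+e_i))=0$ in $I_N$ and $w_i$ is $(N\mathbb Z)^d$-periodic. Set $$A_1^{*,N}=\big\langle d\bar P_1(s),\ \Phi_N(A_{per}+s\mathbf 1_QC_{per})\big\rangle,$$ $$A_2^{*,N}=\frac12\sum_{k\in\mathcal T_N,\,k\ne0}\big\langle d\bar P_1(s)\,d\bar P_1(t),\ \Phi_N(A_{per}+s\mathbf 1_QC_{per}+t\mathbf 1_{Q+k}C_{per})\big\rangle+\big\langle d\bar P_2(s),\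 \Phi_N(A_{per}+s\mathbf 1_QC_{per})\big\rangle .$$ Then: 1. $A_1^{*,N}=\tilde A_1^*$ for every odd $N$; in particular $A_1^{*,N}$ does not depend on $N$. 2. $A_2^{*,N}\to\tilde A_2^*$ as $N\to\infty$ ($N$ odd). 3. With $\bar A_1^*=\lim_N A_1^{*,N}=\tilde A_1^*$ and $\bar A_2^*=\lim_N A_2^{*,N}=\tilde A_2^*$, the formal expansion is correct to second order: as $\eta\to0^+$, $$A_\eta^*=A_{per}^*+\eta\bar A_1^*+\eta^2\bar A_2^*+o(\eta^2).$$ -/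

import Mathlib

open MeasureTheory ProbabilityTheory Filter Topology Asymptotics Set
open scoped Distributions

namespace WeaklyRandom

noncomputable section

/-! ### Geometry of the lattice -/

/-- The ambient Euclidean space `ℝ^d`. -/
abbrev E (d : ℕ) := EuclideanSpace ℝ (Fin d)

/-- Tensor fields `ℝ^d → ℝ^{d × d}`; the tensor `A x` acts on vectors as a linear map. -/
abbrev TensorField (d : ℕ) := E d → (E d →L[ℝ] E d)

/-- The canonical basis vector `e_i`. -/
def e {d : ℕ} (i : Fin d) : E d := EuclideanSpace.single i (1 : ℝ)

/-- The lattice `ℤ^d` inside `ℝ^d`. -/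
def lat {d : ℕ} (k : Fin d → ℤ) : E d := WithLp.toLp 2 (fun i => (k i : ℝ))

/-- The cube `I_N = [-N/2, N/2]^d` up to its (null) right faces; `Q = cube d 1` is the unit cell.
With this half-open convention the cells `Q + k` partition `ℝ^d`. -/
def cube (d N : ℕ) : Set (E d) := {x | ∀ i, -((N : ℝ) / 2) ≤ x i ∧ x i < (N : ℝ) / 2}

/-- The translated cell `Q + k`. -/
def cell {d : ℕ} (k : Fin d → ℤ) : Set (E d) := {x | x - lat k ∈ cube d 1}

/-- For odd `N`, the cells `k` with `Q + k ⊂ I_N`: all `|k_i| ≤ (N - 1) / 2`. -/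
def cellsIn (d N : ℕ) : Finset (Fin d → ℤ) :=
  Fintype.piFinset fun _ => Finset.Icc (-(((N - 1) / 2 : ℕ) : ℤ)) (((N - 1) / 2 : ℕ) : ℤ)

/-- `(Nℤ)^d`-periodicity, almost everywhere. -/
def IsPeriodic {d : ℕ} {α : Type*} (N : ℕ) (f : E d → α) : Prop :=
  ∀ k : Fin d → ℤ, ∀ᵐ x : E d, f (x + (N : ℝ) • lat k) = f x

/-! ### Weak gradients and weak solutions -/

/-- `u ∈ H¹_loc(ℝ^d)` with weak gradient `G`. -/
def IsWeakGradient {d : ℕ} (u : E d → ℝ) (G : E d → E d) : Prop :=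
  (∀ K : Set (E d), IsCompact K → MemLp u 2 (volume.restrict K)) ∧
  (∀ K : Set (E d), IsCompact K → MemLp G 2 (volume.restrict K)) ∧
  ∀ φ : E d → ℝ, ContDiff ℝ ((⊤ : ℕ∞) : WithTop ℕ∞) φ → HasCompactSupport φ → ∀ v : E d,
    ∫ x, u x * fderiv ℝ φ x v = - ∫ x, inner ℝ (G x) v * φ x

/-- `-div (A G) = div F` in the sense of distributions on `ℝ^d`. -/
def SolvesInSpace {d : ℕ} (A : TensorField d) (F G : E d → E d) : Prop :=
  ∀ φ : E d → ℝ, ContDiff ℝ ((⊤ : ℕ∞) : WithTop ℕ∞) φ → HasCompactSupport φ →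
    ∫ x, fderiv ℝ φ x (A x (G x) + F x) = 0

/-- `G = ∇u` with `-div (A ∇u) = div F` in `I_N` and `u` `(Nℤ)^d`-periodic: weak form on the torus
`ℝ^d / (Nℤ)^d`, tested with smooth periodic functions. -/
def IsPeriodicSolution {d : ℕ} (N : ℕ) (A : TensorField d) (F G : E d → E d) : Prop :=
  ∃ u : E d → ℝ, IsWeakGradient u G ∧ IsPeriodic N u ∧
    ∀ φ : E d → ℝ, ContDiff ℝ ((⊤ : ℕ∞) : WithTop ℕ∞) φ →
      (∀ (k : Fin d → ℤ) (x : E d), φ (x + (N : ℝ) • lat k) = φ x) →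
      ∫ x in cube d N, fderiv ℝ φ x (A x (G x) + F x) = 0

/-- The gradient of the solution (unique up to a constant) of the periodic problem
`-div (A ∇u) = div F` in `I_N`. -/
def periodicGrad {d : ℕ} (N : ℕ) (A : TensorField d) (F : E d → E d) : E d → E d :=
  Classical.epsilon (IsPeriodicSolution N A F)

/-- `G = ∇u ∈ L²(ℝ^d)` with `-div (A ∇u) = div F` in `ℝ^d`, `u ∈ L²_loc`. -/
def IsDecayingSolution {d : ℕ} (A : TensorField d) (F G : E d → E d) : Prop :=
  (∃ u : E d → ℝ, IsWeakGradient u G) ∧ MemLp G 2 volume ∧ SolvesInSpace A F G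

/-- The gradient of the solution (unique up to a constant) of `-div (A ∇u) = div F` in `ℝ^d`,
`∇u ∈ L²(ℝ^d)`. -/
def decayingGrad {d : ℕ} (A : TensorField d) (F : E d → E d) : E d → E d :=
  Classical.epsilon (IsDecayingSolution A F)

/-! ### Stationary problems -/

section Stochastic

variable {d : ℕ} {Ω : Type*} [MeasurableSpace Ω] [AddAction (Fin d → ℤ) Ω]

/-- `F (x + k, ω) = F (x, τ_k ω)` for almost all `(x, ω)`. -/
def IsStationary {α : Type*} (P : Measure Ω) (F : E d → Ω → α) : Prop :=
  ∀ k : Fin d → ℤ, ∀ᵐ p : E d × Ω ∂(volume.prod P), F (p.1 + lat k) p.2 = F p.1 (k +ᵥ p.2)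

/-- `G = ∇u` almost surely, with `-div (A ∇u) = div F` in `ℝ^d` almost surely, `∇u` stationary and
square integrable on `Q × Ω`, and `𝔼 ∫_Q ∇u = 0`. -/
def IsStationarySolution (P : Measure Ω) (A : E d → Ω → (E d →L[ℝ] E d))
    (F G : E d → Ω → E d) : Prop :=
  MemLp (Function.uncurry G) 2 ((volume.restrict (cube d 1)).prod P) ∧
  IsStationary P G ∧
  (∫ ω, (∫ x in cube d 1, G x ω) ∂P) = 0 ∧
  (∀ᵐ ω ∂P, ∃ u : E d → ℝ, IsWeakGradient u (fun x => G x ω)) ∧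
  (∀ᵐ ω ∂P, SolvesInSpace (fun x => A x ω) (fun x => F x ω) (fun x => G x ω))

/-- The gradient of the solution (unique up to a random constant) of the stationary problem. -/
def stationaryGrad (P : Measure Ω) (A : E d → Ω → (E d →L[ℝ] E d)) (F : E d → Ω → E d) :
    E d → Ω → E d :=
  Classical.epsilon (IsStationarySolution P A F)

/-- The random field equal to `X (τ_k ω)` on each cell `Q + k`. -/
def cellField (X : Ω → ℝ) (x : E d) (ω : Ω) : ℝ :=
  ∑' k : Fin d → ℤ, (cell k).indicator (fun _ => X (k +ᵥ ω)) x

/-- The homogenized tensor of a stationary random tensor field: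
`A^* e_i = 𝔼 ∫_Q A (∇w_i + e_i)`, with `w_i` the stochastic corrector. The entry `j i` of a matrix
is the `j`-th coordinate of the image of `e_i`. -/
def homogenizedTensor (P : Measure Ω) (A : E d → Ω → (E d →L[ℝ] E d)) :
    Matrix (Fin d) (Fin d) ℝ :=
  Matrix.of fun j i =>
    ∫ ω, (∫ x in cube d 1,
      (A x ω (stationaryGrad P A (fun y ω' => A y ω' (e i)) x ω + e i)) j) ∂P

/-- `A_η = A_per + b_η C_per`, with `b_η` equal to `B_η ∘ τ_k` on `Q + k`. -/
def perturbedField (A C : TensorField d) (X : Ω → ℝ) (x : E d) (ω : Ω) : E d →L[ℝ] E d :=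
  A x + cellField X x ω • C x

end Stochastic

/-! ### Periodic correctors -/

section Periodic

variable {d : ℕ}

/-- `∇w_i`, for the `i`-th cell problem `-div (A (∇w_i + e_i)) = 0` in `I_N`, `w_i` periodic. -/
def correctorGrad (N : ℕ) (A : TensorField d) (i : Fin d) : E d → E d :=
  periodicGrad N A (fun x => A x (e i))

/-- The gradient `∇w̃_j^0` of the corrector of the transposed field, in the unit cell. -/
def adjointCorrectorGrad (A : TensorField d) (j : Fin d) : E d → E d :=
  correctorGrad 1 (fun x => ContinuousLinearMap.adjoint (A x)) j

/-- The matrix with columns `∫_{I_N} A (∇w_i + e_i)`. For `N = 1` this is the periodic homogenized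
tensor. -/
def cellFlux (N : ℕ) (A : TensorField d) : Matrix (Fin d) (Fin d) ℝ :=
  Matrix.of fun j i => ∫ x in cube d N, (A x (correctorGrad N A i x + e i)) j

/-- `A_per + s 1_Q C_per`: one defect of amplitude `s`, in `Q`. -/
def oneDefect (A C : TensorField d) (s : ℝ) : TensorField d :=
  fun x => A x + (cube d 1).indicator (fun _ => s) x • C x

/-- `A_per + s 1_Q C_per + t 1_{Q+k} C_per`: two defects, in `Q` and `Q + k`. -/
def twoDefects (A C : TensorField d) (s t : ℝ) (k : Fin d → ℤ) : TensorField d :=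
  fun x => A x + (cube d 1).indicator (fun _ => s) x • C x + (cell k).indicator (fun _ => t) x • C x

end Periodic

/-! ### Distributions with compact support -/

/-- The open interval `]-M, M[`. -/
def openInterval (M : ℝ) : TopologicalSpace.Opens ℝ := ⟨Ioo (-M) M, isOpen_Ioo⟩

/-- The space `𝓔'(O)` of distributions on `O` with compact support in `O`. -/
structure CompactDistribution (O : TopologicalSpace.Opens ℝ) where
  /-- the underlying distribution -/
  toDistribution : 𝓓'(O, ℝ)
  /-- it vanishes off some compact subset of `O` -/
  exists_compact : ∃ K : Set ℝ, IsCompact K ∧ K ⊆ O ∧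
    Distribution.IsVanishingOn toDistribution Kᶜ

namespace CompactDistribution

variable {O : TopologicalSpace.Opens ℝ}

/-- A compact subset of `O` off which `T` vanishes. -/
def carrier (T : CompactDistribution O) : Set ℝ := T.exists_compact.choose

open Classical in
/-- The action `⟨T, f⟩` on functions `f` smooth on `O`: it is `T (χ f)` for any cut-off `χ` that
equals `1` near the carrier, that is, `T g` for any test function `g` equal to `f` near the
carrier. -/
def pair (T : CompactDistribution O) (f : ℝ → ℝ) : ℝ :=
  if h : ∃ g : 𝓓(O, ℝ), ∀ᶠ x in 𝓝ˢ T.carrier, g x = f x then T.toDistribution h.choose else 0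

/-- The pairing does not depend on the choice of the test function. -/
theorem pair_eq (T : CompactDistribution O) (f : ℝ → ℝ) (g : 𝓓(O, ℝ))
    (hg : ∀ᶠ x in 𝓝ˢ T.carrier, g x = f x) : T.pair f = T.toDistribution g := by
  have h : ∃ g : 𝓓(O, ℝ), ∀ᶠ x in 𝓝ˢ T.carrier, g x = f x := ⟨g, hg⟩
  rw [pair, dif_pos h, ← sub_eq_zero, ← map_sub]
  refine T.exists_compact.choose_spec.2.2 _ ?_
  rw [subset_compl_comm]
  intro x hx
  have h1 := (eventually_nhdsSet_iff_forall.1 (h.choose_spec.and hg)) x hx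
  rw [mem_compl_iff, notMem_tsupport_iff_eventuallyEq]
  filter_upwards [h1] with y hy
  change h.choose y - g y = 0
  rw [hy.1, hy.2, sub_self]

end CompactDistribution

/-- The expansion `dP_η = δ_0 + η dP_1 + η² dP_2 + o(η²)` of the law `dP_η` of `B_η` (supported in
`[-M, M]`), tested against smooth functions. -/
def HasLawExpansion {Ω : Type*} [MeasurableSpace Ω] (P : Measure Ω) {M : ℝ} (B : ℝ → Ω → ℝ)
    (P₁ P₂ : CompactDistribution (openInterval M)) : Prop :=
  ∀ φ : ℝ → ℝ, ContDiff ℝ ((⊤ : ℕ∞) : WithTop ℕ∞) φ →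
    (fun η : ℝ => (∫ s, φ s ∂(P.map (B η))) - (φ 0 + η * P₁.pair φ + η ^ 2 * P₂.pair φ))
      =o[𝓝[>] 0] fun η : ℝ => η ^ 2

/-- `B_η = η B_0 + η² R_0 + o(η²)` weakly in `L²(Ω)`. -/
def HasWeakExpansion {Ω : Type*} [MeasurableSpace Ω] (P : Measure Ω) (B : ℝ → Ω → ℝ)
    (B₀ R₀ : Ω → ℝ) : Prop :=
  ∀ Y : Ω → ℝ, MemLp Y 2 P →
    (fun η : ℝ => ∫ ω, (B η ω - (η * B₀ ω + η ^ 2 * R₀ ω)) * Y ω ∂P)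
      =o[𝓝[>] 0] fun η : ℝ => η ^ 2

/-! ### The coefficients -/

section Coefficients

variable {d : ℕ}

/-- The supercell coefficient `A_1^{*,N}`. -/
def supercellFirst {M : ℝ} (A C : TensorField d) (P₁ : CompactDistribution (openInterval M))
    (N : ℕ) : Matrix (Fin d) (Fin d) ℝ :=
  Matrix.of fun j i => P₁.pair fun s => cellFlux N (oneDefect A C s) j i

/-- The supercell coefficient `A_2^{*,N}`; the tensor product `dP_1(s) dP_1(t)` acts by iterated
pairing. -/
def supercellSecond {M : ℝ} (A C : TensorField d) (P₁ P₂ : CompactDistribution (openInterval M))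
    (N : ℕ) : Matrix (Fin d) (Fin d) ℝ :=
  Matrix.of fun j i =>
    (1 / 2 : ℝ) * ∑ k ∈ (cellsIn d N).erase 0,
      P₁.pair (fun s => P₁.pair fun t => cellFlux N (twoDefects A C s t k) j i)
    + P₂.pair fun s => cellFlux N (oneDefect A C s) j i

variable {Ω : Type*} [MeasurableSpace Ω] [AddAction (Fin d → ℤ) Ω]

/-- `∇v_i^0`: stationary solution of `-div (A ∇v) = div (b_0 C (∇w_i^0 + e_i))`, with `b_0` equal
to `B_0 ∘ τ_k` on `Q + k`. -/
def firstOrderGrad (P : Measure Ω) (A C : TensorField d) (B₀ : Ω → ℝ) (i : Fin d) :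
    E d → Ω → E d :=
  stationaryGrad P (fun x _ => A x)
    (fun x ω => cellField B₀ x ω • C x (correctorGrad 1 A i x + e i))

/-- The rigorous first-order coefficient:
`Ã_1 e_i = ∫_Q 𝔼(b_0) C (∇w_i^0 + e_i) + ∫_Q A 𝔼(∇v_i^0)`. -/
def rigorousFirst (P : Measure Ω) (A C : TensorField d) (B₀ : Ω → ℝ) :
    Matrix (Fin d) (Fin d) ℝ :=
  Matrix.of fun j i =>
    (∫ x in cube d 1, (∫ ω, cellField B₀ x ω ∂P) * (C x (correctorGrad 1 A i x + e i)) j)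
    + ∫ x in cube d 1, (A x (∫ ω, firstOrderGrad P A C B₀ i x ω ∂P)) j

/-- `∫_Q C H · (∇w̃_j^0 + e_j)`. -/
def adjointFlux (A C : TensorField d) (j : Fin d) (H : E d → E d) : ℝ :=
  ∫ x in cube d 1, inner ℝ (C x (H x)) (adjointCorrectorGrad A j x + e j)

/-- `∇t_i`: `-div (A ∇t_i) = div (1_Q C (∇w_i^0 + e_i))` in `ℝ^d`, `∇t_i ∈ L²(ℝ^d)`. -/
def tGrad (A C : TensorField d) (i : Fin d) : E d → E d :=
  decayingGrad A ((cube d 1).indicator fun x => C x (correctorGrad 1 A i x + e i))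

/-- `∇s_i`: `-div (A ∇s_i) = div (C (∇w_i^0 + e_i))` in `Q`, `s_i` periodic. -/
def sGrad (A C : TensorField d) (i : Fin d) : E d → E d :=
  periodicGrad 1 A fun x => C x (correctorGrad 1 A i x + e i)

/-- The rigorous second-order coefficient. -/
def rigorousSecond (P : Measure Ω) (A C : TensorField d) (B₀ R₀ : Ω → ℝ) :
    Matrix (Fin d) (Fin d) ℝ :=
  Matrix.of fun j i =>
    (∫ ω, R₀ ω ∂P) * adjointFlux A C j (fun x => correctorGrad 1 A i x + e i)
    + variance B₀ P * adjointFlux A C j (tGrad A C i)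
    + (∫ ω, B₀ ω ∂P) ^ 2 * adjointFlux A C j (sGrad A C i)
    + ∑' k : {k : Fin d → ℤ // k ≠ 0},
        covariance B₀ (fun ω => B₀ (k.1 +ᵥ ω)) P
          * adjointFlux A C j (fun x => tGrad A C i (x - lat k.1))

end Coefficients

end

end WeaklyRandom

open WeaklyRandom

namespace WeaklyRandom

/-! ### Coercive variational problems in a closed subspace of a Hilbert space -/

/-! All the tensors are fluxes of one abstract object. In a Hilbert space with a closed subspace `V`
of gradients, a coercive `T` has a solution operator `solOp V T` (Lax–Milgram), correctors z in x +
V with T z orthogonal to `V`, and `flux` = ⟨T z, y⟩. Three subspaces occur: periodic gradients on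
I_N (`perV`), square integrable gradients on ℝ^d (`decV`), stationary gradients on Q × Ω (`stV`),
each the closure of explicit smooth gradients. The link with the PDE definitions is that every weak
gradient of the right class lies in that closure: subtracting its projection leaves a curl-free and
divergence-free field, to which a Liouville theorem for weakly harmonic functions applies. Existence
and uniqueness then identify the gradients picked by `Classical.epsilon` with values of `solOp`.

Law of B_η. By uniform boundedness, a weak o(η²) remainder is a strong O(η²), so B_η = η B₀ + O(η²)
in norm (`exists_strong_expansion`). With |B_η| ≤ M, Taylor's formula expands 𝔼 φ(B_η) up to o(η²),
and comparison with the assumed expansion of the law shows that dP₁ acts as f ↦ 𝔼(B₀) f'(0) and dP₂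
as f ↦ 𝔼(R₀) f'(0) + 𝔼(B₀²) f''(0)/2 (`pair_of_expansion`). Independence passes to the limit B_η/η →
B₀, so the shifts of B₀ are uncorrelated and the covariance series in Ã₂ vanishes.

Supercell. Let z and z̃ be the direct and adjoint periodic correctors. The first derivative of the
one-defect flux is ⟨C z, z̃⟩ over Q, whatever N is; this gives claim 1. The second-order terms are
⟨C' S C'' z, z̃⟩, with S = `solOp` and C', C'' the restrictions of C to two cells. Summed over all
cells they give the s_i term; the sum in A₂^{*,N} omits the diagonal k = 0, a term T_N. Hence
A₂^{*,N} consists of the 𝔼(R₀) term, (𝔼B₀)² times the s_i term, and Var(B₀) T_N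
(`Admissible.supercellSecond_eq`). Only T_N depends on N, and it tends to the t_i term because the
periodic response to a single defect converges weakly to the decaying one (`tendsto_periodicGrad`).

Homogenized tensor. An exact perturbation identity (`flux_eq`) gives the expansion
`tendsto_flux_expansion`, although multiplication by B_η C tends to zero only strongly. Its
quadratic limit is ⟨S(B₀ C z), B₀ Cᵀ z̃⟩ up to the sign conventions built into S. Write B₀ = 𝔼B₀ +
X. The mean contributes the s_i term and the cross terms vanish. For X, the correlation x ↦ 𝔼(X
v(x,·)) of the stationary solution v with X is square integrable on ℝ^d by Bessel's inequality, and
it solves the decaying problem with source Var(B₀) 1_Q C z (`correl_solOp_ae`). So it equals Var(B₀)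
∇t_i, and the limit is Ã₂. -/

theorem _root_.HasDerivAt.ringInverse {R : Type*} [NormedRing R] [HasSummableGeomSeries R]
    [NormedAlgebra ℝ R] {c : ℝ → R} {c' : R} {t : ℝ} (hc : HasDerivAt c c' t) {u : Rˣ}
    (hu : (u : R) = c t) :
    HasDerivAt (fun s => Ring.inverse (c s)) (-(↑u⁻¹ * c' * ↑u⁻¹)) t := by
  have h := hasFDerivAt_ringInverse (𝕜 := ℝ) u
  rw [hu] at h
  have h2 := h.comp_hasDerivAt t hc
  convert! h2 using 1

theorem hasDerivAt_add_smul {F : Type*} [NormedAddCommGroup F] [NormedSpace ℝ F] (a b : F) :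
    HasDerivAt (fun t : ℝ => a + t • b) b 0 := by
  simpa using ((hasDerivAt_id (0 : ℝ)).smul_const b).const_add a

set_option linter.unusedSectionVars false

section Hilbert

variable {H : Type*} [NormedAddCommGroup H] [InnerProductSpace ℝ H] [CompleteSpace H]

/-- `T` is coercive on the subspace `V`. -/
def CoerciveOn (V : Submodule ℝ H) (T : H →L[ℝ] H) : Prop :=
  ∃ α : ℝ, 0 < α ∧ ∀ v ∈ V, α * ‖v‖ ^ 2 ≤ inner ℝ (T v) v

variable (V : Submodule ℝ H) [V.HasOrthogonalProjection]

/-- The compression of `T` to `V`. -/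
noncomputable def compress (T : H →L[ℝ] H) : V →L[ℝ] V :=
  V.orthogonalProjectionOnto ∘L T ∘L V.subtypeL

/-- The map `F ↦ G`, where `G ∈ V` and `T G + F` is orthogonal to `V`. -/
noncomputable def solOp (T : H →L[ℝ] H) : H →L[ℝ] H :=
  -(V.subtypeL ∘L Ring.inverse (compress V T) ∘L V.orthogonalProjectionOnto)

variable {V}

theorem inner_compress (T : H →L[ℝ] H) (v w : V) :
    inner ℝ (compress V T v) w = inner ℝ (T v) (w : H) := by
  simp [compress]

theorem solOp_mem (T : H →L[ℝ] H) (F : H) : solOp V T F ∈ V := by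
  simp [solOp]

/-- Lax–Milgram: the operator representing the coercive form of the compression is the compression
itself. Since `Ring.inverse` is zero off the units, this is what turns `solOp` into a solution
operator. -/
theorem CoerciveOn.isUnit {T : H →L[ℝ] H} (hT : CoerciveOn V T) : IsUnit (compress V T) := by
  have : CompleteSpace V := by
    have hc : IsClosed (V : Set H) := by
      rw [← V.orthogonal_orthogonal]
      exact Submodule.isClosed_orthogonal _
    exact hc.completeSpace_coe
  obtain ⟨α, hα, h⟩ := hT
  have hco : IsCoercive ((innerSL ℝ).comp (compress V T) : V →L[ℝ] V →L[ℝ] ℝ) := by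
    refine ⟨α, hα, fun v => ?_⟩
    have := h v v.2
    rw [ContinuousLinearMap.comp_apply, innerSL_apply_apply, inner_compress]
    rw [Submodule.coe_norm]
    nlinarith
  have heq : (hco.continuousLinearEquivOfBilin : V →L[ℝ] V) = compress V T := by
    ext1 v
    exact ((hco.unique_continuousLinearEquivOfBilin (v := v) (f := compress V T v)
      fun w => by simp)).symm
  rw [← heq]
  exact ⟨ContinuousLinearEquiv.toUnit hco.continuousLinearEquivOfBilin, rfl⟩

theorem CoerciveOn.inner_solOp {T : H →L[ℝ] H} (hT : CoerciveOn V T) (F : H) {h : H}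
    (hh : h ∈ V) : inner ℝ (T (solOp V T F) + F) h = 0 := by
  have h1 : compress V T (Ring.inverse (compress V T) (V.orthogonalProjectionOnto F)) =
      V.orthogonalProjectionOnto F := by
    have := Ring.mul_inverse_cancel _ hT.isUnit
    exact congrArg (fun S : V →L[ℝ] V => S (V.orthogonalProjectionOnto F)) this
  have h2 := inner_compress T (Ring.inverse (compress V T) (V.orthogonalProjectionOnto F)) ⟨h, hh⟩
  rw [h1] at h2
  have h3 : inner ℝ (V.orthogonalProjectionOnto F) (⟨h, hh⟩ : V) = inner ℝ F h := by simp
  rw [h3] at h2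
  rw [inner_add_left, h2]
  simp [solOp]

/-- Uniqueness: coercivity applied to the difference of two solutions. Every concrete periodic,
decaying or stationary solution is identified through this. -/
theorem CoerciveOn.eq_solOp {T : H →L[ℝ] H} (hT : CoerciveOn V T) {F G : H} (hG : G ∈ V)
    (h : ∀ v ∈ V, inner ℝ (T G + F) v = 0) : G = solOp V T F := by
  obtain ⟨α, hα, hco⟩ := id hT
  have hm : G - solOp V T F ∈ V := V.sub_mem hG (solOp_mem T F)
  have h1 := h _ hm
  have h2 := hT.inner_solOp F hm
  have h3 := hco _ hm
  have h4 : inner ℝ (T (G - solOp V T F)) (G - solOp V T F) = 0 := by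
    rw [map_sub, inner_sub_left]
    rw [inner_add_left] at h1 h2
    linarith
  rw [h4] at h3
  have h5 : ‖G - solOp V T F‖ = 0 := by
    by_contra hne
    have : 0 < ‖G - solOp V T F‖ ^ 2 := by positivity
    nlinarith
  exact sub_eq_zero.1 (norm_eq_zero.1 h5)

/-- Energy estimate, testing with the solution itself. The constant depends on `α` only, hence is
uniform in the period and in `η`. -/
theorem norm_solOp_le {T : H →L[ℝ] H} {α : ℝ} (hα : 0 < α)
    (hco : ∀ v ∈ V, α * ‖v‖ ^ 2 ≤ inner ℝ (T v) v) (F : H) :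
    ‖solOp V T F‖ ≤ α⁻¹ * ‖F‖ := by
  have hT : CoerciveOn V T := ⟨α, hα, hco⟩
  have hm := solOp_mem (V := V) T F
  have h1 := hco _ hm
  have h2 := hT.inner_solOp F hm
  rw [inner_add_left] at h2
  have h3 := real_inner_le_norm F (solOp V T F)
  have h4 := abs_real_inner_le_norm F (solOp V T F)
  rw [abs_le] at h4
  rw [inv_mul_eq_div, le_div_iff₀ hα]
  by_cases h0 : ‖solOp V T F‖ = 0
  · rw [h0]; simp
  · have : 0 < ‖solOp V T F‖ := lt_of_le_of_ne (norm_nonneg _) (Ne.symm h0)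
    nlinarith

theorem CoerciveOn.adjoint {T : H →L[ℝ] H} (hT : CoerciveOn V T) :
    CoerciveOn V (ContinuousLinearMap.adjoint T) := by
  obtain ⟨α, hα, h⟩ := hT
  refine ⟨α, hα, fun v hv => ?_⟩
  rw [ContinuousLinearMap.adjoint_inner_left, real_inner_comm]
  exact h v hv

/-- Each equation is tested with the solution of the other one; the two bilinear terms agree. This
duality moves the response from a defect to the test field, where it is easier to compute. -/
theorem CoerciveOn.inner_solOp_comm {T : H →L[ℝ] H} (hT : CoerciveOn V T) (F K : H) :
    inner ℝ (solOp V T F) K = inner ℝ (solOp V (ContinuousLinearMap.adjoint T) K) F := by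
  have h1 := hT.inner_solOp F (solOp_mem (V := V) (ContinuousLinearMap.adjoint T) K)
  have h2 := hT.adjoint.inner_solOp K (solOp_mem (V := V) T F)
  rw [inner_add_left] at h1 h2
  rw [ContinuousLinearMap.adjoint_inner_left, real_inner_comm] at h2
  rw [real_inner_comm, real_inner_comm F]
  linarith

theorem compress_add_smul (T C : H →L[ℝ] H) (s : ℝ) :
    compress V (T + s • C) = compress V T + s • compress V C := by
  ext1 v
  simp [compress]

/-- Inversion is smooth on units. Smoothness in the amplitude is needed because fluxes are paired
with distributions. -/
theorem contDiffAt_solOp {T : ℝ → H →L[ℝ] H} {s : ℝ} (h : ContDiffAt ℝ ((⊤ : ℕ∞) : WithTop ℕ∞) T s)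
    (hT : CoerciveOn V (T s)) :
    ContDiffAt ℝ ((⊤ : ℕ∞) : WithTop ℕ∞) (fun s => solOp V (T s)) s := by
  have : CompleteSpace V := by
    have hc : IsClosed (V : Set H) := by
      rw [← V.orthogonal_orthogonal]
      exact Submodule.isClosed_orthogonal _
    exact hc.completeSpace_coe
  have h1 : ContDiffAt ℝ ((⊤ : ℕ∞) : WithTop ℕ∞) (fun s => compress V (T s)) s := by
    unfold compress
    exact contDiffAt_const.clm_comp (h.clm_comp contDiffAt_const)
  obtain ⟨u, hu⟩ := hT.isUnit
  have h2 : ContDiffAt ℝ ((⊤ : ℕ∞) : WithTop ℕ∞) Ring.inverse (compress V (T s)) := by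
    rw [← hu]; exact contDiffAt_ringInverse (R := V →L[ℝ] V) ℝ u
  have h3 := h2.comp s h1
  unfold solOp
  exact (contDiffAt_const.clm_comp (h3.clm_comp contDiffAt_const)).neg

/-- The derivative of the inverse is -R⁻¹CR⁻¹; together with the minus sign in `solOp` this gives a
plus sign and two factors `solOp`. -/
theorem hasDerivAt_solOp {T C : H →L[ℝ] H} (hT : CoerciveOn V T) :
    HasDerivAt (fun t : ℝ => solOp V (T + t • C)) (solOp V T ∘L C ∘L solOp V T) 0 := by
  have : CompleteSpace V := by
    have hc : IsClosed (V : Set H) := by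
      rw [← V.orthogonal_orthogonal]
      exact Submodule.isClosed_orthogonal _
    exact hc.completeSpace_coe
  obtain ⟨u, hu⟩ := hT.isUnit
  have h1 : HasDerivAt (fun t : ℝ => compress V (T + t • C)) (compress V C) 0 := by
    simp only [compress_add_smul]
    exact hasDerivAt_add_smul (F := V →L[ℝ] V) (compress V T) (compress V C)
  have h3 := HasDerivAt.ringInverse (R := V →L[ℝ] V) h1 (u := u)
    (by rw [zero_smul, add_zero, hu])
  have h4 := ((hasDerivAt_const (0 : ℝ) V.subtypeL).clm_comp
    (h3.clm_comp (hasDerivAt_const (0 : ℝ) V.orthogonalProjectionOnto))).neg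
  convert! h4 using 1
  ext1 v
  have hi : Ring.inverse (compress V T) = ((u⁻¹ : (V →L[ℝ] V)ˣ) : V →L[ℝ] V) := by
    rw [← hu, Ring.inverse_unit]
  simp only [compress] at hi
  simp [solOp, hi, compress]

end Hilbert

end WeaklyRandom

namespace WeaklyRandom

/-! ### A Liouville theorem for weakly harmonic functions -/

section Liouville

variable {d : ℕ}

/-- Smooth compactly supported functions. -/
def IsTest (φ : E d → ℝ) : Prop :=
  ContDiff ℝ ((⊤ : ℕ∞) : WithTop ℕ∞) φ ∧ HasCompactSupport φ

/-- The Laplacian. -/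
noncomputable def lap (φ : E d → ℝ) (x : E d) : ℝ :=
  ∑ i, fderiv ℝ (fun z => fderiv ℝ φ z (e i)) x (e i)

/-- `f` is harmonic in the sense of distributions. -/
def WeaklyHarmonic (f : E d → ℝ) : Prop := ∀ φ : E d → ℝ, IsTest φ → ∫ x, f x * lap φ x = 0

theorem inner_e (x : E d) (i : Fin d) : inner ℝ x (e i) = x i := by
  simp [e, EuclideanSpace.inner_single_right]

theorem sum_smul_e (x : E d) : ∑ i, x i • e i = x := by
  have := (EuclideanSpace.basisFun (Fin d) ℝ).sum_repr x
  simpa [e] using this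

theorem IsTest.fderiv_apply {φ : E d → ℝ} (h : IsTest φ) (v : E d) :
    IsTest fun x => fderiv ℝ φ x v := by
  refine ⟨(h.1.fderiv_right (m := ((⊤ : ℕ∞) : WithTop ℕ∞)) (by simp)).clm_apply contDiff_const, ?_⟩
  exact h.2.fderiv_apply (𝕜 := ℝ) v

theorem IsTest.comp_affine {φ : E d → ℝ} (h : IsTest φ) {l : ℝ} (hl : l ≠ 0) (y : E d) :
    IsTest fun x => φ (l • (x - y)) := by
  refine ⟨h.1.comp (by fun_prop), ?_⟩
  have := h.2.comp_homeomorph ((Homeomorph.subRight y).trans (Homeomorph.smulOfNeZero l hl))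
  exact this

variable (d) in
-- With ∇ψ = ρ(x) x, the Laplacian of ψ is dρ + x·∇ρ, which is the derivative in the scale of the
-- dilated kernel at scale one. Weak harmonicity tested with ψ therefore says that averages against
-- ρ do not change with the scale.
theorem exists_radial_pair : ∃ ρ ψ : E d → ℝ, IsTest ρ ∧ IsTest ψ ∧
    (∀ x v, fderiv ℝ ψ x v = ρ x * inner ℝ x v) ∧ (∀ x, 0 ≤ ρ x) ∧ ∫ x, ρ x = 1 ∧
    Function.support ρ ⊆ Metric.closedBall 0 2 := by
  let b : ContDiffBump (0 : ℝ) := ⟨1, 2, by norm_num, by norm_num⟩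
  -- Starting the primitive at 3, beyond the support of `b`, makes it vanish for s ≥ 2, so that ψ
  -- has compact support.
  let p : ℝ → ℝ := fun s => ∫ t in (3 : ℝ)..s, b t
  have hp : ∀ s, HasDerivAt p (b s) s := fun s =>
    intervalIntegral.integral_hasDerivAt_right (b.continuous.intervalIntegrable _ _)
      b.continuous.stronglyMeasurable.stronglyMeasurableAtFilter b.continuous.continuousAt
  have hpd : ContDiff ℝ ((⊤ : ℕ∞) : WithTop ℕ∞) p := by
    rw [contDiff_infty_iff_deriv]
    refine ⟨fun s => (hp s).differentiableAt, ?_⟩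
    have : deriv p = b := funext fun s => (hp s).deriv
    rw [this]
    exact b.contDiff
  have hb0 : ∀ t : ℝ, 2 ≤ t → b t = 0 := fun t ht => b.zero_of_le_dist (by
    simp only [dist_zero_right, Real.norm_eq_abs, b]; exact ht.trans (le_abs_self t))
  have hp0 : ∀ s, 2 ≤ s → p s = 0 := by
    intro s hs
    refine (intervalIntegral.integral_congr (g := fun _ => (0 : ℝ)) ?_).trans (by simp)
    intro t ht
    refine hb0 t ?_
    rcases le_total 3 s with h | h
    · rw [uIcc_of_le h] at ht; linarith [ht.1]
    · rw [uIcc_of_ge h] at ht; linarith [ht.1]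
  have hn : ContDiff ℝ ((⊤ : ℕ∞) : WithTop ℕ∞) fun x : E d => ‖x‖ ^ 2 := contDiff_norm_sq ℝ
  have hcs : ∀ q : ℝ → ℝ, (∀ s, 2 ≤ s → q s = 0) → HasCompactSupport fun x : E d => q (‖x‖ ^ 2) := by
    intro q hq
    refine HasCompactSupport.of_support_subset_isCompact (isCompact_closedBall (0 : E d) 2) ?_
    intro x hx
    by_contra h
    rw [Metric.mem_closedBall, dist_zero_right, not_le] at h
    exact hx (hq _ (by nlinarith))
  let ρ₀ : E d → ℝ := fun x => 2 * b (‖x‖ ^ 2)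
  have hρ₀ : Continuous ρ₀ := by
    have := b.continuous
    fun_prop
  have hρc : HasCompactSupport ρ₀ := hcs (fun s => 2 * b s) fun s hs => by simp [hb0 s hs]
  have hρn : ∀ x, 0 ≤ ρ₀ x := fun x => mul_nonneg (by norm_num) (b.nonneg)
  have hpos : 0 < ∫ x, ρ₀ x := by
    refine hρ₀.integral_pos_of_hasCompactSupport_nonneg_nonzero hρc (fun x => hρn x) (x := 0) ?_
    have : b (0 : ℝ) = 1 := b.one_of_mem_closedBall (by simp [b])
    simp [ρ₀, this]
  refine ⟨fun x => (∫ x, ρ₀ x)⁻¹ * ρ₀ x, fun x => (∫ x, ρ₀ x)⁻¹ * p (‖x‖ ^ 2), ⟨?_, ?_⟩, ⟨?_, ?_⟩,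
    ?_, ?_, ?_, ?_⟩
  · exact contDiff_const.mul (contDiff_const.mul (b.contDiff.comp hn))
  · exact hρc.mul_left
  · exact contDiff_const.mul (hpd.comp hn)
  · exact (hcs p hp0).mul_left
  · intro x v
    have h1 : HasFDerivAt (fun x : E d => ‖x‖ ^ 2) (2 • innerSL ℝ x) x :=
      (hasStrictFDerivAt_norm_sq x).hasFDerivAt
    have h2 := ((hp (‖x‖ ^ 2)).comp_hasFDerivAt x h1).const_mul (∫ x, ρ₀ x)⁻¹
    have h3 : fderiv ℝ (fun x : E d => (∫ x, ρ₀ x)⁻¹ * p (‖x‖ ^ 2)) x = _ := h2.fderiv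
    rw [h3]
    simp [ρ₀]
    ring
  · intro x
    exact mul_nonneg (inv_nonneg.2 hpos.le) (hρn x)
  · rw [integral_const_mul, inv_mul_cancel₀ hpos.ne']
  · intro x hx
    by_contra h
    rw [Metric.mem_closedBall, dist_zero_right, not_le] at h
    exact hx (by simp [ρ₀, hb0 (‖x‖ ^ 2) (by nlinarith)])

/-- The bracket is l^(1-d) times the derivative in l of l^d ρ(l(x - y)), so this Laplacian is
l^(3-d) times the scale derivative of the kernel. -/
theorem lap_comp_affine {ρ ψ : E d → ℝ} (hρ : IsTest ρ) (hψ : IsTest ψ)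
    (h : ∀ x v, fderiv ℝ ψ x v = ρ x * inner ℝ x v) (l : ℝ) (y x : E d) :
    lap (fun x => ψ (l • (x - y))) x =
      l ^ 2 * (d * ρ (l • (x - y)) + fderiv ℝ ρ (l • (x - y)) (l • (x - y))) := by
  have ha : ∀ z, HasFDerivAt (fun x : E d => l • (x - y)) (l • ContinuousLinearMap.id ℝ (E d)) z :=
    fun z => ((hasFDerivAt_id z).sub_const y).const_smul l
  have hρd : Differentiable ℝ ρ := hρ.1.differentiable (by simp)
  have hψd : Differentiable ℝ ψ := hψ.1.differentiable (by simp)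
  have h1 : ∀ z v, fderiv ℝ (fun x => ψ (l • (x - y))) z v =
      l * (ρ (l • (z - y)) * inner ℝ (l • (z - y)) v) := by
    intro z v
    have := ((hψd (l • (z - y))).hasFDerivAt.comp z (ha z)).fderiv
    change fderiv ℝ (ψ ∘ fun x => l • (x - y)) z v = _
    rw [this]
    simp [h]
  have h2 : ∀ i, fderiv ℝ (fun z => fderiv ℝ (fun x => ψ (l • (x - y))) z (e i)) x (e i) =
      l ^ 2 * (ρ (l • (x - y)) + fderiv ℝ ρ (l • (x - y)) ((l • (x - y)) i • e i)) := by
    intro i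
    simp_rw [h1]
    have h3 := (hρd (l • (x - y))).hasFDerivAt.comp x (ha x)
    have h4 : HasFDerivAt (fun z : E d => inner ℝ (l • (z - y)) (e i))
        (l • innerSL ℝ (e i)) x := by
      have : (fun z : E d => inner ℝ (l • (z - y)) (e i)) = fun z => innerSL ℝ (e i) (l • (z - y)) := by
        ext z; simp [real_inner_comm (e i), inner_smul_right]
      rw [this]
      convert! (innerSL ℝ (e i : E d)).hasFDerivAt.comp x (ha x) using 1
      ext v; simp
    have h5 := ((h3.mul h4).const_mul l).fderiv
    have h6 : fderiv ℝ (fun z => l * (ρ (l • (z - y)) * inner ℝ (l • (z - y)) (e i))) x = _ := h5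
    rw [h6]
    have hee : inner ℝ (e i : E d) (e i) = 1 := by simp [e]
    simp only [smul_apply, add_apply, Function.comp,
      ContinuousLinearMap.comp_apply, innerSL_apply_apply, hee, inner_e, map_smul, smul_eq_mul,
      ContinuousLinearMap.id_apply]
    ring
  unfold lap
  simp_rw [h2]
  rw [← Finset.mul_sum, Finset.sum_add_distrib, ← map_sum, sum_smul_e]
  simp

theorem IsTest.integrable_mul {f φ : E d → ℝ} (hf : LocallyIntegrable f volume) (hφ : IsTest φ) :
    Integrable fun x => f x * φ x := by
  have := hf.integrable_smul_left_of_hasCompactSupport hφ.1.continuous hφ.2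
  simpa [mul_comm] using this

/-- Averages of a weakly harmonic function against a dilated radial kernel do not depend on the
scale. -/
theorem WeaklyHarmonic.hasDerivAt_average {f : E d → ℝ} (hf : LocallyIntegrable f volume)
    (hh : WeaklyHarmonic f) {ρ ψ : E d → ℝ} (hρ : IsTest ρ) (hψ : IsTest ψ)
    (h : ∀ x v, fderiv ℝ ψ x v = ρ x * inner ℝ x v)
    (hs : Function.support ρ ⊆ Metric.closedBall 0 2) (y : E d) {l : ℝ} (hl : 0 < l) :
    HasDerivAt (fun l : ℝ => ∫ x, f x * (l ^ d * ρ (l • (x - y)))) 0 l := by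
  have hρd : Differentiable ℝ ρ := hρ.1.differentiable (by simp)
  let D : ℝ → E d → ℝ := fun l x =>
    d * l ^ (d - 1) * ρ (l • (x - y)) + l ^ d * fderiv ℝ ρ (l • (x - y)) (x - y)
  have hcont : Continuous fun p : ℝ × E d => D p.1 p.2 := by
    have h1 : Continuous ρ := hρ.1.continuous
    have h2 : Continuous (fderiv ℝ ρ) := hρ.1.continuous_fderiv (by simp)
    have h3 : Continuous fun p : ℝ × E d => fderiv ℝ ρ (p.1 • (p.2 - y)) (p.2 - y) :=
      (h2.comp (by fun_prop)).clm_apply (by fun_prop)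
    fun_prop
  -- For k > l/2 the kernel lives in |x - y| ≤ 2/k < 4/l. This ball does not depend on k and carries
  -- the dominating function.
  have hzero : ∀ k ∈ Metric.ball l (l / 2), ∀ x, x ∉ Metric.closedBall y (4 / l) → D k x = 0 := by
    intro k hk x hx
    rw [Metric.mem_ball, Real.dist_eq, abs_lt] at hk
    have hk0 : 0 < k := by linarith
    have hout : k • (x - y) ∉ tsupport ρ := by
      intro hmem
      have := closure_minimal hs Metric.isClosed_closedBall hmem
      rw [Metric.mem_closedBall, dist_zero_right, norm_smul, Real.norm_of_nonneg hk0.le] at this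
      rw [Metric.mem_closedBall, dist_eq_norm, not_le, div_lt_iff₀ hl] at hx
      nlinarith [norm_nonneg (x - y)]
    have h1 : ρ (k • (x - y)) = 0 := image_eq_zero_of_notMem_tsupport hout
    have h2 : fderiv ℝ ρ (k • (x - y)) = 0 := fderiv_of_notMem_tsupport (𝕜 := ℝ) hout
    simp [D, h1, h2]
  obtain ⟨B, hB⟩ : ∃ B, ∀ k ∈ Metric.closedBall l (l / 2), ∀ x ∈ Metric.closedBall y (4 / l),
      ‖D k x‖ ≤ B := by
    have hc : IsCompact (Metric.closedBall l (l / 2) ×ˢ Metric.closedBall y (4 / l)) :=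
      (isCompact_closedBall _ _).prod (isCompact_closedBall _ _)
    obtain ⟨B, hB⟩ := hc.exists_bound_of_continuousOn hcont.continuousOn
    exact ⟨B, fun k hk x hx => hB (k, x) ⟨hk, hx⟩⟩
  have hint : IntegrableOn f (Metric.closedBall y (4 / l)) :=
    hf.integrableOn_isCompact (isCompact_closedBall _ _)
  have key := hasDerivAt_integral_of_dominated_loc_of_deriv_le (μ := volume) (𝕜 := ℝ)
    (F := fun (k : ℝ) x => f x * (k ^ d * ρ (k • (x - y)))) (F' := fun k x => f x * D k x)
    (x₀ := l) (s := Metric.ball l (l / 2))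
    (bound := (Metric.closedBall y (4 / l)).indicator fun x => B * ‖f x‖)
    (Metric.ball_mem_nhds _ (by positivity)) ?_ ?_ ?_ ?_ ?_ ?_
  · have h1 := hh _ (hψ.comp_affine hl.ne' y)
    simp_rw [lap_comp_affine hρ hψ h] at h1
    have h2 : ∀ x, f x * D l x = (l ^ d / l ^ 3) *
        (f x * (l ^ 2 * (d * ρ (l • (x - y)) + fderiv ℝ ρ (l • (x - y)) (l • (x - y))))) := by
      intro x
      -- The truncated exponent `d - 1` is harmless at d = 0, where the prefactor vanishes.
      have : (d : ℝ) * l ^ (d - 1) = d * l ^ d / l := by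
        rcases Nat.eq_zero_or_pos d with h0 | h0
        · simp [h0]
        · obtain ⟨m, rfl⟩ : ∃ m, d = m + 1 := ⟨d - 1, by omega⟩
          field_simp
          simp [pow_succ]
      simp only [D, this, map_smul, smul_eq_mul]
      field_simp
    have h3 : ∫ x, f x * D l x = 0 := by
      refine (integral_congr_ae (Eventually.of_forall h2)).trans ?_
      rw [integral_const_mul, h1, mul_zero]
    have h4 := key.2
    rw [h3] at h4
    exact h4
  · filter_upwards [] with k
    refine hf.aestronglyMeasurable.mul (Continuous.aestronglyMeasurable ?_)
    have := hρ.1.continuous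
    fun_prop
  · have := (IsTest.integrable_mul hf (hρ.comp_affine hl.ne' y)).const_mul (l ^ d)
    refine this.congr (Eventually.of_forall fun x => ?_)
    ring
  · refine hf.aestronglyMeasurable.mul (Continuous.aestronglyMeasurable ?_)
    exact hcont.comp (by fun_prop : Continuous fun x : E d => (l, x))
  · filter_upwards [] with x k hk
    by_cases hx : x ∈ Metric.closedBall y (4 / l)
    · rw [indicator_of_mem hx, norm_mul, mul_comm]
      exact mul_le_mul_of_nonneg_right (hB k (Metric.ball_subset_closedBall hk) x hx) (norm_nonneg _)
    · rw [indicator_of_notMem hx, hzero k hk x hx]; simp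
  · exact IntegrableOn.integrable_indicator (hint.norm.const_mul B)
      Metric.isClosed_closedBall.measurableSet
  · filter_upwards [] with x k hk
    have h1 : HasDerivAt (fun k : ℝ => k • (x - y)) (x - y) k := by
      simpa using (hasDerivAt_id k).smul_const (x - y)
    have h2 := (hρd (k • (x - y))).hasFDerivAt.comp_hasDerivAt k h1
    have h3 := ((hasDerivAt_pow d k).mul h2).const_mul (f x)
    exact h3

theorem integral_dilate {ρ : E d → ℝ} (h1 : ∫ x, ρ x = 1) (y : E d) {l : ℝ} (hl : 0 < l) :
    ∫ x, l ^ d * ρ (l • (x - y)) = 1 := by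
  rw [integral_const_mul, integral_sub_right_eq_self (fun x => ρ (l • x)),
    Measure.integral_comp_smul, h1]
  simp [abs_of_pos hl]
  field_simp

/-- A locally integrable function whose averages against all dilated and translated kernels are
equal to `c` is almost everywhere equal to `c`. -/
theorem ae_eq_const_of_average {f : E d → ℝ} (hf : LocallyIntegrable f volume) {ρ : E d → ℝ}
    (hρ : IsTest ρ) (h1 : ∫ x, ρ x = 1) (hs : Function.support ρ ⊆ Metric.closedBall 0 2) {c : ℝ}
    (h : ∀ y, ∀ l : ℝ, 0 < l → ∫ x, f x * (l ^ d * ρ (l • (x - y))) = c) :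
    ∀ᵐ x, f x = c := by
  obtain ⟨B, hB⟩ := hρ.1.continuous.bounded_above_of_compact_support hρ.2
  filter_upwards [(Besicovitch.vitaliFamily (volume : Measure (E d))).ae_tendsto_average_norm_sub hf]
    with y hy
  have hr : Tendsto (fun n : ℕ => 2 / ((n : ℝ) + 1)) atTop (𝓝[>] 0) := by
    refine tendsto_nhdsWithin_iff.2 ⟨?_, Eventually.of_forall fun n => ?_⟩
    · have := (tendsto_one_div_add_atTop_nhds_zero_nat (𝕜 := ℝ)).const_mul 2
      simpa [div_eq_mul_inv] using this
    · simp only [mem_Ioi]; positivity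
  have h3 := (hy.comp (Besicovitch.tendsto_filterAt volume y)).comp hr
  have h4 := tendsto_integral_smul_of_tendsto_average_norm_sub (f := f) (μ := volume)
    (g := fun (n : ℕ) x => ((n : ℝ) + 1) ^ d * ρ (((n : ℝ) + 1) • (x - y)))
    (B * 2 ^ d * volume.real (Metric.ball (0 : E d) 1)) h3 ?_ ?_ ?_ ?_
  · refine tendsto_nhds_unique h4 (tendsto_const_nhds.congr fun n => ?_)
    rw [← h y (n + 1) (by positivity)]
    exact integral_congr_ae (Eventually.of_forall fun x => mul_comm _ _)
  · filter_upwards with n using hf.integrableOn_isCompact (isCompact_closedBall _ _)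
  · exact tendsto_const_nhds.congr fun n => (integral_dilate h1 y (by positivity)).symm
  · filter_upwards with n
    intro x hx
    have h5 : ρ (((n : ℝ) + 1) • (x - y)) ≠ 0 := right_ne_zero_of_mul hx
    have h6 := hs h5
    have hn : (0 : ℝ) < n + 1 := by positivity
    rw [Metric.mem_closedBall, dist_zero_right, norm_smul, Real.norm_of_nonneg hn.le] at h6
    rw [Metric.mem_closedBall, dist_eq_norm, le_div_iff₀ hn]
    linarith
  · filter_upwards with n
    intro x
    have hn : (0 : ℝ) < n + 1 := by positivity
    rw [Measure.addHaar_real_closedBall _ _ (by positivity), abs_mul,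
      abs_of_pos (pow_pos hn d)]
    have hb : 0 < volume.real (Metric.ball (0 : E d) 1) := by
      rw [Measure.real, ENNReal.toReal_pos_iff]
      exact ⟨Metric.measure_ball_pos _ _ one_pos, measure_ball_lt_top⟩
    have h7 : (n + 1 : ℝ) ^ d * B = B * 2 ^ d * volume.real (Metric.ball (0 : E d) 1) /
        ((2 / ((n : ℝ) + 1)) ^ Module.finrank ℝ (E d) * volume.real (Metric.ball (0 : E d) 1)) := by
      simp only [finrank_euclideanSpace, Fintype.card_fin, div_pow]
      field_simp
    rw [← h7]
    exact mul_le_mul_of_nonneg_left (hB _) (by positivity)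

/-- **Liouville theorem**: a weakly harmonic function that grows less than linearly on average is
constant. -/
theorem WeaklyHarmonic.ae_eq_const {f : E d → ℝ} (hf : LocallyIntegrable f volume)
    (hh : WeaklyHarmonic f) {R : ℕ → ℝ} (hR : Tendsto R atTop atTop)
    (hgr : Tendsto (fun m => (R m ^ (d + 1))⁻¹ * ∫ x in Metric.closedBall 0 (R m), |f x|) atTop
      (𝓝 0)) : ∃ c : ℝ, ∀ᵐ x, f x = c := by
  obtain ⟨ρ, ψ, hρ, hψ, h, hn, h1, hs⟩ := exists_radial_pair d
  let F : E d → ℝ → ℝ := fun y l => ∫ x, f x * (l ^ d * ρ (l • (x - y)))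
  have hder : ∀ y, ∀ l : ℝ, 0 < l → HasDerivAt (F y) 0 l := fun y l hl =>
    hh.hasDerivAt_average hf hρ hψ h hs y hl
  have hscale : ∀ y, ∀ l : ℝ, 0 < l → F y l = F y 1 := fun y l hl =>
    isOpen_Ioi.is_const_of_deriv_eq_zero isPreconnected_Ioi
      (fun k hk => (hder y k hk).differentiableAt.differentiableWithinAt)
      (fun k hk => (hder y k hk).deriv) (mem_Ioi.2 hl) (mem_Ioi.2 one_pos)
  obtain ⟨L, hL⟩ := hρ.1.lipschitzWith_of_hasCompactSupport hρ.2 (by simp)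
  have hint : ∀ y, ∀ l : ℝ, 0 < l → Integrable fun x => f x * (l ^ d * ρ (l • (x - y))) := by
    intro y l hl
    refine ((IsTest.integrable_mul hf (hρ.comp_affine hl.ne' y)).const_mul (l ^ d)).congr
      (Eventually.of_forall fun x => ?_)
    ring
  have hcenter : ∀ y, F y 1 = F 0 1 := by
    intro y
    -- At scale l = 4/R the kernels centred at y and at 0 both live in the ball of radius R, since
    -- R/2 + |y| ≤ R. They differ by at most l^d · L · l|y| = 4^(d+1) L|y| / R^(d+1), hence the
    -- constant.
    have hbound : ∀ᶠ m in atTop, |F y 1 - F 0 1| ≤ (4 ^ (d + 1) * L * ‖y‖) *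
        ((R m ^ (d + 1))⁻¹ * ∫ x in Metric.closedBall 0 (R m), |f x|) := by
      filter_upwards [hR.eventually_gt_atTop 0, hR.eventually_ge_atTop (2 * ‖y‖)] with m hm hmy
      have hl : 0 < 4 / R m := by positivity
      rw [← hscale y _ hl, ← hscale 0 _ hl]
      simp only [F]
      rw [← integral_sub (hint y _ hl) (hint 0 _ hl), ← Real.norm_eq_abs]
      refine (norm_integral_le_integral_norm _).trans ?_
      rw [← mul_assoc, ← integral_const_mul, ← integral_indicator Metric.isClosed_closedBall.measurableSet]
      refine integral_mono ((hint y _ hl).sub (hint 0 _ hl)).norm ?_ fun x => ?_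
      · exact IntegrableOn.integrable_indicator ((hf.integrableOn_isCompact
          (isCompact_closedBall _ _)).abs.const_mul _) Metric.isClosed_closedBall.measurableSet
      by_cases hx : x ∈ Metric.closedBall (0 : E d) (R m)
      · rw [indicator_of_mem hx]
        have h2 : |ρ ((4 / R m) • (x - y)) - ρ ((4 / R m) • (x - 0))| ≤ L * (4 / R m * ‖y‖) := by
          have := hL.dist_le_mul ((4 / R m) • (x - y)) ((4 / R m) • (x - 0))
          rw [dist_eq_norm, dist_eq_norm, ← smul_sub, norm_smul, Real.norm_of_nonneg hl.le] at this
          simpa using this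
        rw [← mul_sub, ← mul_sub, norm_mul, norm_mul, Real.norm_eq_abs, Real.norm_eq_abs,
          Real.norm_eq_abs, abs_of_pos (pow_pos hl d)]
        calc |f x| * ((4 / R m) ^ d * |ρ ((4 / R m) • (x - y)) - ρ ((4 / R m) • (x - 0))|)
            ≤ |f x| * ((4 / R m) ^ d * (L * (4 / R m * ‖y‖))) := by gcongr
          _ = _ := by rw [div_pow]; field_simp; ring
      · rw [indicator_of_notMem hx]
        rw [Metric.mem_closedBall, dist_zero_right, not_le] at hx
        have hout : ∀ z : E d, ‖z‖ ≤ ‖y‖ → ρ ((4 / R m) • (x - z)) = 0 := by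
          intro z hz
          by_contra hne
          have h6 := hs hne
          rw [Metric.mem_closedBall, dist_zero_right, norm_smul, Real.norm_of_nonneg hl.le] at h6
          have h7 : R m / 2 < ‖x - z‖ := by
            have := norm_sub_norm_le x z
            linarith
          have h8 : 4 / R m * (R m / 2) = 2 := by field_simp; norm_num
          nlinarith
        rw [hout y le_rfl, hout 0 (by simp)]
        simp
    have h9 := hgr.const_mul (4 ^ (d + 1) * L * ‖y‖)
    rw [mul_zero] at h9
    have h10 : |F y 1 - F 0 1| ≤ 0 := ge_of_tendsto h9 hbound
    exact sub_eq_zero.1 (abs_nonpos_iff.1 h10)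
  exact ⟨F 0 1, ae_eq_const_of_average hf hρ h1 hs fun y l hl =>
    (hscale y l hl).trans (hcenter y)⟩

end Liouville

end WeaklyRandom

namespace WeaklyRandom

/-! ### The Poincaré inequality and limits of gradients -/

section Poincare

open scoped ENNReal NNReal

variable {d : ℕ}

theorem inner_gradient_eq (φ : E d → ℝ) (x v : E d) :
    inner ℝ (gradient φ x) v = fderiv ℝ φ x v := by
  simp [gradient]

theorem norm_gradient_eq (φ : E d → ℝ) (x : E d) : ‖gradient φ x‖ = ‖fderiv ℝ φ x‖ := by
  simp [gradient]

theorem continuous_gradient {φ : E d → ℝ} (h : ContDiff ℝ ((⊤ : ℕ∞) : WithTop ℕ∞) φ) :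
    Continuous (gradient φ) :=
  (InnerProductSpace.toDual ℝ (E d)).symm.continuous.comp (h.continuous_fderiv (by simp))

theorem eLpNorm_two_sq {X F : Type*} [MeasurableSpace X] [NormedAddCommGroup F] (f : X → F)
    (μ : Measure X) : eLpNorm f 2 μ ^ 2 = ∫⁻ x, ‖f x‖ₑ ^ 2 ∂μ := by
  have := eLpNorm_nnreal_pow_eq_lintegral (f := f) (μ := μ) (p := 2) (by norm_num)
  simpa using this

/-- The Jacobian s^(-d) is at most 2^d. On a segment y + t(x - y), one of t and 1 - t is at least
1/2, so one of the two endpoints can always be integrated out at this cost. -/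
theorem lintegral_comp_add_smul_le {k : E d → ℝ≥0∞} (hk : Measurable k) (a : E d) {s : ℝ}
    (hs : 1 / 2 ≤ s) : ∫⁻ x, k (a + s • x) ≤ 2 ^ d * ∫⁻ x, k x := by
  have hs0 : 0 < s := by linarith
  have h1 : ∫⁻ x, k (a + s • x) = ∫⁻ x, k (a + x) ∂(Measure.map (fun x => s • x) volume) := by
    rw [lintegral_map (by fun_prop) (by fun_prop)]
  rw [h1, Measure.map_addHaar_smul _ hs0.ne', lintegral_smul_measure,
    lintegral_add_left_eq_self (fun x => k x), smul_eq_mul]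
  gcongr
  rw [abs_of_pos (by positivity), finrank_euclideanSpace, Fintype.card_fin]
  refine (ENNReal.ofReal_le_ofReal (q := 2 ^ d) ?_).trans (by simp [ENNReal.ofReal_pow])
  rw [← inv_pow]
  gcongr
  rw [inv_le_comm₀ hs0 (by norm_num)]
  linarith

theorem sq_integral_le {g : ℝ → ℝ} (hg : Continuous g) :
    (∫ t in (0 : ℝ)..1, g t) ^ 2 ≤ ∫ t in (0 : ℝ)..1, g t ^ 2 := by
  set c := ∫ t in (0 : ℝ)..1, g t with hc
  have h1 : 0 ≤ ∫ t in (0 : ℝ)..1, (g t - c) ^ 2 :=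
    intervalIntegral.integral_nonneg (by norm_num) fun t _ => sq_nonneg _
  have h2 : ∫ t in (0 : ℝ)..1, (g t - c) ^ 2 =
      (∫ t in (0 : ℝ)..1, g t ^ 2) - 2 * c * (∫ t in (0 : ℝ)..1, g t) + c ^ 2 := by
    have : ∀ t, (g t - c) ^ 2 = g t ^ 2 - 2 * c * g t + c ^ 2 := fun t => by ring
    simp_rw [this]
    rw [intervalIntegral.integral_add, intervalIntegral.integral_sub,
      intervalIntegral.integral_const_mul, intervalIntegral.integral_const]
    · simp
    all_goals exact Continuous.intervalIntegrable (by fun_prop) _ _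
  rw [← hc] at h2
  nlinarith

/-- The fundamental theorem of calculus along the segment, followed by Jensen's inequality for the
square. -/
theorem enorm_sub_sq_le {u : E d → ℝ} (hu : ContDiff ℝ ((⊤ : ℕ∞) : WithTop ℕ∞) u) (x y : E d) :
    ‖u x - u y‖ₑ ^ 2 ≤
      ‖x - y‖ₑ ^ 2 * ∫⁻ t in Icc (0 : ℝ) 1, ‖gradient u (y + t • (x - y))‖ₑ ^ 2 := by
  have hgc := continuous_gradient hu
  have hc : Continuous fun t : ℝ => gradient u (y + t • (x - y)) := hgc.comp (by fun_prop)
  have hder : ∀ t : ℝ, HasDerivAt (fun t : ℝ => u (y + t • (x - y)))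
      (inner ℝ (gradient u (y + t • (x - y))) (x - y)) t := by
    intro t
    rw [inner_gradient_eq]
    have h1 : HasDerivAt (fun t : ℝ => y + t • (x - y)) (x - y) t := by
      simpa using ((hasDerivAt_id t).smul_const (x - y)).const_add y
    exact ((hu.differentiable (by simp)) _).hasFDerivAt.comp_hasDerivAt t h1
  have h1 := intervalIntegral.integral_eq_sub_of_hasDerivAt (a := 0) (b := 1) (fun t _ => hder t)
    (Continuous.intervalIntegrable (by fun_prop) _ _)
  simp only [one_smul, zero_smul, add_zero, add_sub_cancel] at h1
  have h2 : (u x - u y) ^ 2 ≤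
      ‖x - y‖ ^ 2 * ∫ t in (0 : ℝ)..1, ‖gradient u (y + t • (x - y))‖ ^ 2 := by
    rw [← h1, ← intervalIntegral.integral_const_mul]
    refine (sq_integral_le (by fun_prop)).trans ?_
    refine intervalIntegral.integral_mono_on (by norm_num)
      (Continuous.intervalIntegrable (by fun_prop) _ _)
      (Continuous.intervalIntegrable (by fun_prop) _ _) fun t _ => ?_
    rw [← mul_pow, mul_comm]
    exact sq_le_sq' (by
      have := abs_real_inner_le_norm (gradient u (y + t • (x - y))) (x - y)
      rw [abs_le] at this; linarith) (real_inner_le_norm _ _)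
  have h3 : ∫⁻ t in Icc (0 : ℝ) 1, ‖gradient u (y + t • (x - y))‖ₑ ^ 2 =
      ENNReal.ofReal (∫ t in (0 : ℝ)..1, ‖gradient u (y + t • (x - y))‖ ^ 2) := by
    rw [intervalIntegral.integral_of_le (by norm_num), ← integral_Icc_eq_integral_Ioc,
      ofReal_integral_eq_lintegral_ofReal]
    · refine lintegral_congr fun t => ?_
      rw [ENNReal.ofReal_pow (norm_nonneg _), ofReal_norm]
    · exact (Continuous.continuousOn (by fun_prop)).integrableOn_Icc
    · exact Eventually.of_forall fun t => by positivity
  rw [h3, ← ofReal_norm, ← ofReal_norm, ← ENNReal.ofReal_pow (norm_nonneg _),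
    ← ENNReal.ofReal_pow (norm_nonneg _), ← ENNReal.ofReal_mul (by positivity)]
  refine ENNReal.ofReal_le_ofReal ?_
  rw [Real.norm_eq_abs, sq_abs]
  exact h2

/-- The Poincaré inequality on balls, in double integral form. -/
theorem poincare_ball {u : E d → ℝ} (hu : ContDiff ℝ ((⊤ : ℕ∞) : WithTop ℕ∞) u) (R : ℝ) :
    ∫⁻ x in Metric.closedBall 0 R, ∫⁻ y in Metric.closedBall 0 R, ‖u x - u y‖ₑ ^ 2 ≤
      (ENNReal.ofReal (2 * R) ^ 2 * 2 ^ d * volume (Metric.closedBall (0 : E d) R)) *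
        ∫⁻ x in Metric.closedBall 0 R, ‖gradient u x‖ₑ ^ 2 := by
  set K := Metric.closedBall (0 : E d) R with hK
  have hKm : MeasurableSet K := Metric.isClosed_closedBall.measurableSet
  let k : E d → ℝ≥0∞ := K.indicator fun x => ‖gradient u x‖ₑ ^ 2
  have hgc := continuous_gradient hu
  have hk : Measurable k := by
    refine Measurable.indicator ?_ hKm
    exact hgc.enorm.measurable.pow_const 2
  have hconv : Convex ℝ K := convex_closedBall _ _
  have h1 : ∀ x ∈ K, ∀ y ∈ K, ‖u x - u y‖ₑ ^ 2 ≤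
      ENNReal.ofReal (2 * R) ^ 2 * ∫⁻ t in Icc (0 : ℝ) 1, k (y + t • (x - y)) := by
    intro x hx y hy
    refine (enorm_sub_sq_le hu x y).trans ?_
    gcongr ?_ ^ 2 * ?_
    · rw [← ofReal_norm]
      refine ENNReal.ofReal_le_ofReal ?_
      rw [hK, mem_closedBall_zero_iff] at hx hy
      linarith [norm_sub_le x y]
    · refine setLIntegral_mono' measurableSet_Icc fun t ht => ?_
      have : y + t • (x - y) ∈ K := hconv.add_smul_sub_mem hy hx ht
      simp only [k, indicator_of_mem this]
      exact le_rfl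
  have hkm : Measurable fun p : (E d × E d) × ℝ => k (p.1.2 + p.2 • (p.1.1 - p.1.2)) :=
    hk.comp (by fun_prop)
  have h2 : ∀ t ∈ Icc (0 : ℝ) 1, ∫⁻ x in K, ∫⁻ y in K, k (y + t • (x - y)) ≤
      2 ^ d * volume K * ∫⁻ x, k x := by
    intro t ht
    have hx : ∀ f : E d → ℝ≥0∞, (∀ a, f a ≤ 2 ^ d * ∫⁻ x, k x) → ∫⁻ a in K, f a ≤
        2 ^ d * volume K * ∫⁻ x, k x := by
      intro f hf
      refine (lintegral_mono hf).trans ?_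
      rw [lintegral_const, Measure.restrict_apply_univ]
      exact (by ring : _ = _).le
    -- Integrate first in x when t ≥ 1/2 and first in y otherwise, so that the dilation factor stays
    -- away from zero.
    rcases le_total (1 / 2) t with h | h
    · rw [lintegral_lintegral_swap]
      · refine hx _ fun y => (setLIntegral_le_lintegral _ _).trans ?_
        have : ∀ x, y + t • (x - y) = (y - t • y) + t • x := fun x => by rw [smul_sub]; abel
        simp_rw [this]
        exact lintegral_comp_add_smul_le hk _ h
      · exact (hkm.comp (by fun_prop : Measurable fun p : E d × E d => (p, t))).aemeasurable
    · refine hx _ fun x => (setLIntegral_le_lintegral _ _).trans ?_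
      have : ∀ y, y + t • (x - y) = t • x + (1 - t) • y := fun y => by
        rw [smul_sub, sub_smul, one_smul]; abel
      simp_rw [this]
      exact lintegral_comp_add_smul_le hk _ (by linarith)
  calc ∫⁻ x in K, ∫⁻ y in K, ‖u x - u y‖ₑ ^ 2
      ≤ ∫⁻ x in K, ∫⁻ y in K, ENNReal.ofReal (2 * R) ^ 2 *
          ∫⁻ t in Icc (0 : ℝ) 1, k (y + t • (x - y)) :=
        setLIntegral_mono' hKm fun x hx => setLIntegral_mono' hKm fun y hy => h1 x hx y hy
    _ = ENNReal.ofReal (2 * R) ^ 2 * ∫⁻ t in Icc (0 : ℝ) 1, ∫⁻ x in K, ∫⁻ y in K,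
          k (y + t • (x - y)) := by
        simp_rw [lintegral_const_mul' _ _ (ENNReal.pow_ne_top ENNReal.ofReal_ne_top : ENNReal.ofReal (2 * R) ^ 2 ≠ ∞)]
        congr 1
        refine (lintegral_congr fun x => lintegral_lintegral_swap ?_).trans
          (lintegral_lintegral_swap ?_)
        · exact (hkm.comp (by fun_prop :
            Measurable fun p : E d × ℝ => ((x, p.1), p.2))).aemeasurable
        · refine Measurable.aemeasurable ?_
          have := hkm.comp (by fun_prop :
            Measurable fun p : (E d × ℝ) × E d => ((p.1.1, p.2), p.1.2))
          exact Measurable.lintegral_prod_right' (f := fun p : (E d × ℝ) × E d =>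
            k (p.2 + p.1.2 • (p.1.1 - p.2))) this
    _ ≤ ENNReal.ofReal (2 * R) ^ 2 * ∫⁻ t in Icc (0 : ℝ) 1, 2 ^ d * volume K * ∫⁻ x, k x := by
        exact mul_le_mul' le_rfl (setLIntegral_mono' measurableSet_Icc h2)
    _ = _ := by
        rw [lintegral_const, Measure.restrict_apply_univ, Real.volume_Icc, lintegral_indicator hKm]
        simp
        ring

/-- The Poincaré inequality on large balls, for functions with zero average on the unit ball. -/
theorem exists_poincare_const (d : ℕ) (R : ℝ) (hR : 1 ≤ R) : ∃ C : ℝ≥0, ∀ u : E d → ℝ,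
    ContDiff ℝ ((⊤ : ℕ∞) : WithTop ℕ∞) u → ∫ y in Metric.closedBall 0 1, u y = 0 →
    eLpNorm u 2 (volume.restrict (Metric.closedBall 0 R)) ≤
      C * eLpNorm (gradient u) 2 (volume.restrict (Metric.closedBall 0 R)) := by
  set K := Metric.closedBall (0 : E d) R with hK
  set K₁ := Metric.closedBall (0 : E d) 1 with hK₁
  have hKm : MeasurableSet K := Metric.isClosed_closedBall.measurableSet
  have hv0 : volume K₁ ≠ 0 := (Metric.measure_closedBall_pos _ _ one_pos).ne'
  have hvt : volume K₁ ≠ ∞ := measure_closedBall_lt_top.ne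
  set D : ℝ≥0∞ := (volume K₁)⁻¹ * (ENNReal.ofReal (2 * R) ^ 2 * 2 ^ d * volume K) with hD
  have hDt : D ≠ ∞ := by
    refine ENNReal.mul_ne_top (ENNReal.inv_ne_top.2 hv0) (ENNReal.mul_ne_top (ENNReal.mul_ne_top
      (ENNReal.pow_ne_top ENNReal.ofReal_ne_top) (by simp)) measure_closedBall_lt_top.ne)
  -- `D + 1` replaces the square root of `D`, since D ≤ (D + 1)².
  refine ⟨(D + 1).toNNReal, fun u hu h0 => ?_⟩
  rw [ENNReal.coe_toNNReal (by simp [hDt])]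
  have hint : IntegrableOn u K₁ :=
    (hu.continuous.continuousOn).integrableOn_compact (isCompact_closedBall _ _)
  have hint2 : IntegrableOn (fun y => u y ^ 2) K₁ :=
    ((hu.continuous.pow 2).continuousOn).integrableOn_compact (isCompact_closedBall _ _)
  -- The zero mean on the unit ball removes the cross term when (u x - u y)² is integrated in y.
  have h1 : ∀ x, volume K₁ * ‖u x‖ₑ ^ 2 ≤ ∫⁻ y in K₁, ‖u x - u y‖ₑ ^ 2 := by
    intro x
    have hi : Integrable (fun y => (u x - u y) ^ 2) (volume.restrict K₁) :=
      ((((continuous_const).sub hu.continuous).pow 2).continuousOn).integrableOn_compact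
        (isCompact_closedBall _ _)
    have h2 : ∫ y in K₁, (u x - u y) ^ 2 = volume.real K₁ * u x ^ 2 + ∫ y in K₁, u y ^ 2 := by
      have : ∀ y, (u x - u y) ^ 2 = u x ^ 2 - 2 * u x * u y + u y ^ 2 := fun y => by ring
      simp_rw [this]
      have hcst : Integrable (fun _ : E d => u x ^ 2) (volume.restrict K₁) :=
        integrableOn_const hvt
      have h3 := integral_add (hcst.sub (hint.const_mul (2 * u x))) hint2
      simp only [Pi.sub_apply] at h3
      rw [h3, integral_sub hcst (hint.const_mul _), integral_const_mul, h0]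
      simp
    have h3 : ∫⁻ y in K₁, ‖u x - u y‖ₑ ^ 2 = ENNReal.ofReal (∫ y in K₁, (u x - u y) ^ 2) := by
      rw [ofReal_integral_eq_lintegral_ofReal hi (Eventually.of_forall fun y => sq_nonneg _)]
      refine lintegral_congr fun y => ?_
      rw [← ofReal_norm, ← ENNReal.ofReal_pow (norm_nonneg _), Real.norm_eq_abs, sq_abs]
    rw [h3, h2, ← ENNReal.ofReal_toReal hvt, ← ofReal_norm, ← ENNReal.ofReal_pow (norm_nonneg _),
      ← ENNReal.ofReal_mul ENNReal.toReal_nonneg, Real.norm_eq_abs, sq_abs]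
    refine ENNReal.ofReal_le_ofReal ?_
    have : 0 ≤ ∫ y in K₁, u y ^ 2 := integral_nonneg fun y => sq_nonneg _
    rw [Measure.real]; linarith
  have h2 : eLpNorm u 2 (volume.restrict K) ^ 2 ≤
      D * eLpNorm (gradient u) 2 (volume.restrict K) ^ 2 := by
    rw [eLpNorm_two_sq, eLpNorm_two_sq, hD, mul_assoc]
    rw [← ENNReal.mul_le_iff_le_inv hv0 hvt]
    refine le_trans ?_ (poincare_ball hu R)
    rw [← lintegral_const_mul' _ _ hvt]
    refine lintegral_mono fun x => (h1 x).trans ?_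
    exact lintegral_mono_set (Metric.closedBall_subset_closedBall hR)
  have h3 : eLpNorm u 2 (volume.restrict K) ^ 2 ≤
      ((D + 1) * eLpNorm (gradient u) 2 (volume.restrict K)) ^ 2 := by
    refine h2.trans ?_
    rw [mul_pow]
    gcongr
    calc D ≤ (D + 1) * 1 := by simp
      _ ≤ (D + 1) * (D + 1) := by gcongr; simp
      _ = (D + 1) ^ 2 := by ring
  exact (ENNReal.pow_le_pow_left_iff (by norm_num)).1 h3

theorem tendsto_integral_inner {X F : Type*} [MeasurableSpace X] [NormedAddCommGroup F]
    [InnerProductSpace ℝ F] {μ : Measure X} {ι : Type*} {l : Filter ι} {g : ι → X → F} {g₀ z : X → F}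
    (hg : ∀ i, MemLp (g i) 2 μ) (hg₀ : MemLp g₀ 2 μ) (hz : MemLp z 2 μ)
    (h : Tendsto (fun i => eLpNorm (g i - g₀) 2 μ) l (𝓝 0)) :
    Tendsto (fun i => ∫ x, inner ℝ (g i x) (z x) ∂μ) l (𝓝 (∫ x, inner ℝ (g₀ x) (z x) ∂μ)) := by
  have h1 : Tendsto (fun i => (hg i).toLp (g i)) l (𝓝 (hg₀.toLp g₀)) :=
    (Lp.tendsto_Lp_iff_tendsto_eLpNorm'' _ hg _ hg₀).2 h
  have h2 : ∀ f : X → F, ∀ hf : MemLp f 2 μ, inner ℝ (hf.toLp f) (hz.toLp z) =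
      ∫ x, inner ℝ (f x) (z x) ∂μ := by
    intro f hf
    rw [L2.inner_def]
    refine integral_congr_ae ?_
    filter_upwards [hf.coeFn_toLp, hz.coeFn_toLp] with x h3 h4
    rw [h3, h4]
  have h3 := h1.inner (𝕜 := ℝ) (tendsto_const_nhds (x := hz.toLp z))
  simp_rw [h2] at h3
  exact h3

theorem memLp_of_continuous {F : Type*} [NormedAddCommGroup F] [SecondCountableTopology F]
    {f : E d → F} (hf : Continuous f) {K : Set (E d)} (hK : IsCompact K) :
    MemLp f 2 (volume.restrict K) := by
  obtain ⟨B, hB⟩ := hK.exists_bound_of_continuousOn hf.continuousOn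
  have : IsFiniteMeasure (volume.restrict K) := ⟨by
    rw [Measure.restrict_apply_univ]; exact hK.measure_lt_top⟩
  exact MemLp.of_bound hf.aestronglyMeasurable B
    ((ae_restrict_iff' hK.measurableSet).2 (Eventually.of_forall hB))

theorem _root_.IsCompact.exists_subset_closedBall_nat {K : Set (E d)} (hK : IsCompact K) :
    ∃ n : ℕ, 1 ≤ n ∧ K ⊆ Metric.closedBall 0 (n : ℝ) := by
  obtain ⟨r, hr⟩ := hK.isBounded.subset_closedBall 0
  obtain ⟨n, hn⟩ := exists_nat_ge r
  exact ⟨n + 1, by omega, hr.trans (Metric.closedBall_subset_closedBall (by push_cast; linarith))⟩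

theorem setIntegral_eq_of_support {F : Type*} [NormedAddCommGroup F] [NormedSpace ℝ F]
    {X : Type*} [MeasurableSpace X] {μ : Measure X}
    {f : X → F} {K : Set X} (h : ∀ x ∉ K, f x = 0) : ∫ x, f x ∂μ = ∫ x in K, f x ∂μ :=
  (setIntegral_eq_integral_of_forall_compl_eq_zero h).symm

theorem IsTest.eq_zero_of_notMem {φ : E d → ℝ} {K : Set (E d)} (h : tsupport φ ⊆ K) {x : E d}
    (hx : x ∉ K) : φ x = 0 ∧ fderiv ℝ φ x = 0 :=
  ⟨image_eq_zero_of_notMem_tsupport fun hm => hx (h hm),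
    fderiv_of_notMem_tsupport (𝕜 := ℝ) fun hm => hx (h hm)⟩

/-- If the gradients of smooth functions converge to `G` in `L²_loc`, then `G` is a weak gradient,
and the functions themselves converge in `L²_loc` up to additive constants. -/
theorem exists_isWeakGradient_of_tendsto {u : ℕ → E d → ℝ} {G : E d → E d}
    (hu : ∀ n, ContDiff ℝ ((⊤ : ℕ∞) : WithTop ℕ∞) (u n))
    (hG : ∀ R : ℕ, MemLp G 2 (volume.restrict (Metric.closedBall 0 (R : ℝ))))
    (h : ∀ R : ℕ, Tendsto (fun n => eLpNorm (gradient (u n) - G) 2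
      (volume.restrict (Metric.closedBall 0 (R : ℝ)))) atTop (𝓝 0)) :
    ∃ (w : E d → ℝ) (c : ℕ → ℝ), IsWeakGradient w G ∧
      ∀ R : ℕ, 1 ≤ R → Tendsto (fun n => eLpNorm ((fun x => u n x - c n) - w) 2
        (volume.restrict (Metric.closedBall 0 (R : ℝ)))) atTop (𝓝 0) := by
  let μ : ℕ → Measure (E d) := fun R => volume.restrict (Metric.closedBall 0 (R : ℝ))
  let K₁ := Metric.closedBall (0 : E d) 1
  have hvt : volume K₁ ≠ ∞ := measure_closedBall_lt_top.ne
  have hv0 : volume.real K₁ ≠ 0 := by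
    rw [Measure.real, ENNReal.toReal_ne_zero]
    exact ⟨(Metric.measure_closedBall_pos _ _ one_pos).ne', hvt⟩
  -- The constants are fixed by the mean over the unit ball, whatever the radius R, so the limits
  -- obtained on different balls fit together.
  let c : ℕ → ℝ := fun n => (volume.real K₁)⁻¹ * ∫ y in K₁, u n y
  let v : ℕ → E d → ℝ := fun n x => u n x - c n
  have hv : ∀ n, ContDiff ℝ ((⊤ : ℕ∞) : WithTop ℕ∞) (v n) := fun n => (hu n).sub contDiff_const
  have hgv : ∀ n, gradient (v n) = gradient (u n) := by
    intro n
    ext1 x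
    simp only [gradient, v]
    rw [fderiv_sub_const]
  have hvint : ∀ n, ∫ y in K₁, v n y = 0 := by
    intro n
    have hint : IntegrableOn (u n) K₁ :=
      ((hu n).continuous.continuousOn).integrableOn_compact (isCompact_closedBall _ _)
    simp only [v]
    rw [integral_sub hint (integrableOn_const hvt)]
    simp only [integral_const, measureReal_restrict_apply_univ, smul_eq_mul, c]
    field_simp
    ring
  have hvm : ∀ n R, MemLp (v n) 2 (μ R) := fun n R =>
    memLp_of_continuous (hv n).continuous (isCompact_closedBall _ _)
  have hgm : ∀ n R, MemLp (gradient (u n)) 2 (μ R) := fun n R =>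
    memLp_of_continuous (continuous_gradient (hu n)) (isCompact_closedBall _ _)
  have hlim : ∀ R : ℕ, 1 ≤ R → ∃ w : E d → ℝ, MemLp w 2 (μ R) ∧
      Tendsto (fun n => eLpNorm (v n - w) 2 (μ R)) atTop (𝓝 0) := by
    intro R hR
    obtain ⟨C, hC⟩ := exists_poincare_const d R (by exact_mod_cast hR)
    have hcau : CauchySeq fun n => (hvm n R).toLp (v n) := by
      rw [Lp.cauchySeq_Lp_iff_cauchySeq_eLpNorm]
      have h0 : Tendsto (fun n : ℕ × ℕ => (C : ℝ≥0∞) * (eLpNorm (gradient (u n.1) - G) 2 (μ R) +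
          eLpNorm (gradient (u n.2) - G) 2 (μ R))) atTop (𝓝 0) := by
        rw [← prod_atTop_atTop_eq]
        have := ((h R).comp (tendsto_fst (f := atTop) (g := atTop))).add
          ((h R).comp (tendsto_snd (f := atTop) (g := atTop)))
        have h2 := ENNReal.Tendsto.const_mul (a := (C : ℝ≥0∞)) this (Or.inr ENNReal.coe_ne_top)
        simpa using h2
      refine tendsto_of_tendsto_of_tendsto_of_le_of_le tendsto_const_nhds h0 (fun _ => zero_le) ?_
      intro n
      have h3 := hC (v n.1 - v n.2) ((hv n.1).sub (hv n.2)) (by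
        have hi : ∀ n, IntegrableOn (v n) K₁ := fun n =>
          ((hv n).continuous.continuousOn).integrableOn_compact (isCompact_closedBall _ _)
        simp only [Pi.sub_apply]
        rw [integral_sub (hi _) (hi _), hvint, hvint, sub_zero])
      refine (le_of_eq (eLpNorm_congr_ae ((hvm _ R).coeFn_toLp.sub (hvm _ R).coeFn_toLp))).trans
        (h3.trans (mul_le_mul' le_rfl ?_))
      have h4 : gradient (v n.1 - v n.2) = (gradient (u n.1) - G) - (gradient (u n.2) - G) := by
        rw [← hgv, ← hgv]
        ext1 x
        simp only [gradient, Pi.sub_apply, sub_sub_sub_cancel_right]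
        rw [fderiv_sub ((hv _).differentiable (by simp) x) ((hv _).differentiable (by simp) x),
          map_sub]
      rw [h4]
      exact eLpNorm_sub_le ((hgm _ R).sub (hG R)).1 ((hgm _ R).sub (hG R)).1 (by norm_num)
    obtain ⟨w, hw⟩ := cauchySeq_tendsto_of_complete hcau
    refine ⟨w, Lp.memLp w, ?_⟩
    rw [← Lp.toLp_coeFn w (Lp.memLp w)] at hw
    exact (Lp.tendsto_Lp_iff_tendsto_eLpNorm'' _ (fun n => hvm n R) _ (Lp.memLp w)).1 hw
  choose! W hWm hWt using hlim
  -- Gluing: for x in the ball of radius R the index ⌈|x|⌉ + 1 is at most R + 1 and its ball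
  -- contains x, so `w` agrees with `W (R + 1)` almost everywhere on that ball.
  let w : E d → ℝ := fun x => W (⌈‖x‖⌉₊ + 1) x
  have hmono : ∀ R R' : ℕ, R ≤ R' → μ R ≤ μ R' := fun R R' hRR =>
    Measure.restrict_mono (Metric.closedBall_subset_closedBall (by exact_mod_cast hRR)) le_rfl
  have hcomp : ∀ R R' : ℕ, 1 ≤ R → R ≤ R' → W R =ᵐ[μ R] W R' := by
    intro R R' h1 hRR
    have hm' : MemLp (W R') 2 (μ R) := (hWm R' (h1.trans hRR)).mono_measure (hmono R R' hRR)
    have ht' : Tendsto (fun n => eLpNorm (v n - W R') 2 (μ R)) atTop (𝓝 0) :=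
      tendsto_of_tendsto_of_tendsto_of_le_of_le tendsto_const_nhds (hWt R' (h1.trans hRR))
        (fun _ => zero_le) fun n => eLpNorm_mono_measure _ (hmono R R' hRR)
    have a1 := (Lp.tendsto_Lp_iff_tendsto_eLpNorm'' _ (fun n => hvm n R) _ (hWm R h1)).2 (hWt R h1)
    have a2 := (Lp.tendsto_Lp_iff_tendsto_eLpNorm'' _ (fun n => hvm n R) _ hm').2 ht'
    exact (MemLp.toLp_eq_toLp_iff _ _).1 (tendsto_nhds_unique a1 a2)
  have hwW : ∀ R : ℕ, 1 ≤ R → w =ᵐ[μ R] W (R + 1) := by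
    intro R hR
    have hall : ∀ᵐ x ∂(volume : Measure (E d)), ∀ r : ℕ, 1 ≤ r → r ≤ R + 1 →
        x ∈ Metric.closedBall (0 : E d) (r : ℝ) → W r x = W (R + 1) x := by
      rw [ae_all_iff]; intro r
      by_cases h1 : 1 ≤ r ∧ r ≤ R + 1
      · have := (ae_restrict_iff' Metric.isClosed_closedBall.measurableSet).1 (hcomp r (R + 1) h1.1 h1.2)
        filter_upwards [this] with x hx _ _ hm using hx hm
      · exact Eventually.of_forall fun x a b => absurd ⟨a, b⟩ h1
    refine (ae_restrict_iff' Metric.isClosed_closedBall.measurableSet).2 ?_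
    filter_upwards [hall] with x hx hm
    rw [mem_closedBall_zero_iff] at hm
    refine hx (⌈‖x‖⌉₊ + 1) (by omega) ?_ ?_
    · have : ⌈‖x‖⌉₊ ≤ R := Nat.ceil_le.2 hm
      omega
    · rw [mem_closedBall_zero_iff]
      push_cast
      linarith [Nat.le_ceil ‖x‖]
  have hwm : ∀ R : ℕ, 1 ≤ R → MemLp w 2 (μ R) := fun R hR =>
    ((hWm (R + 1) (by omega)).mono_measure (hmono R (R + 1) (by omega))).ae_eq (hwW R hR).symm
  have hwt : ∀ R : ℕ, 1 ≤ R → Tendsto (fun n => eLpNorm (v n - w) 2 (μ R)) atTop (𝓝 0) := by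
    intro R hR
    refine tendsto_of_tendsto_of_tendsto_of_le_of_le tendsto_const_nhds (hWt (R + 1) (by omega))
        (fun _ => zero_le) fun n => ?_
    refine le_trans (le_of_eq (eLpNorm_congr_ae ?_))
      (eLpNorm_mono_measure _ (hmono R (R + 1) (by omega)))
    filter_upwards [hwW R hR] with x hx
    simp [hx]
  refine ⟨w, c, ⟨?_, ?_, ?_⟩, hwt⟩
  · intro K hK
    obtain ⟨n, hn1, hn⟩ := hK.exists_subset_closedBall_nat
    exact (hwm n hn1).mono_measure (Measure.restrict_mono hn le_rfl)
  · intro K hK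
    obtain ⟨n, hn1, hn⟩ := hK.exists_subset_closedBall_nat
    exact (hG n).mono_measure (Measure.restrict_mono hn le_rfl)
  · intro φ hφ hφc a
    obtain ⟨R, hR1, hR⟩ := hφc.isCompact.exists_subset_closedBall_nat
    have hz := fun x (hx : x ∉ Metric.closedBall (0 : E d) (R : ℝ)) => IsTest.eq_zero_of_notMem hR hx
    have hd : Continuous fun x => fderiv ℝ φ x a :=
      (hφ.continuous_fderiv (by simp)).clm_apply continuous_const
    have t1 := tendsto_integral_inner (fun n => hvm n R) (hwm R hR1)
      (memLp_of_continuous hd (isCompact_closedBall _ _)) (hwt R hR1)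
    have t2 := tendsto_integral_inner (fun n => hgm n R) (hG R)
      (memLp_of_continuous (hφ.continuous.smul (continuous_const (y := a)))
        (isCompact_closedBall _ _)) (h R)
    have heq : ∀ n, ∫ x in Metric.closedBall 0 (R : ℝ), inner ℝ (v n x) (fderiv ℝ φ x a) =
        -∫ x in Metric.closedBall 0 (R : ℝ), inner ℝ (gradient (u n) x) (φ x • a) := by
      intro n
      rw [← setIntegral_eq_of_support, ← setIntegral_eq_of_support]
      · have hvd : Continuous fun x => fderiv ℝ (v n) x a :=
          ((hv n).continuous_fderiv (by simp)).clm_apply continuous_const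
        have := integral_mul_fderiv_eq_neg_fderiv_mul_of_integrable (μ := volume) (f := v n) (g := φ)
          (v := a) ((hvd.mul hφ.continuous).integrable_of_hasCompactSupport hφc.mul_left)
          (((hv n).continuous.mul hd).integrable_of_hasCompactSupport
            (hφc.fderiv_apply (𝕜 := ℝ) a).mul_left)
          (((hv n).continuous.mul hφ.continuous).integrable_of_hasCompactSupport hφc.mul_left)
          (fun x _ => (hv n).differentiable (by simp) x)
          (fun x _ => hφ.differentiable (by simp) x)
        have e1 : ∀ x, inner ℝ (v n x) (fderiv ℝ φ x a) = v n x * fderiv ℝ φ x a := fun x => by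
          simp [mul_comm]
        have e2 : ∀ x, inner ℝ (gradient (u n) x) (φ x • a) = fderiv ℝ (v n) x a * φ x := fun x => by
          rw [inner_smul_right, ← hgv, inner_gradient_eq, mul_comm]
        simp_rw [e1, e2]
        exact this
      · intro x hx; simp [(hz x hx).1]
      · intro x hx; simp [(hz x hx).2]
    have t3 := tendsto_nhds_unique (t1.congr heq) t2.neg
    rw [← setIntegral_eq_of_support, ← setIntegral_eq_of_support] at t3
    · have e1 : ∀ x, inner ℝ (w x) (fderiv ℝ φ x a) = w x * fderiv ℝ φ x a := fun x => by
        simp [mul_comm]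
      have e2 : ∀ x, inner ℝ (G x) (φ x • a) = inner ℝ (G x) a * φ x := fun x => by
        rw [inner_smul_right, mul_comm]
      exact (integral_congr_ae (Eventually.of_forall fun x => (e1 x).symm)).trans
        (t3.trans (congrArg Neg.neg (integral_congr_ae (Eventually.of_forall e2))))
    · intro x hx; simp [(hz x hx).1]
    · intro x hx; simp [(hz x hx).2]

end Poincare

end WeaklyRandom

namespace WeaklyRandom

/-! ### Lattice cells and periodization -/

section Lattice

open scoped ENNReal

variable {d : ℕ}

@[simp] theorem lat_apply (k : Fin d → ℤ) (i : Fin d) : (lat k : E d) i = k i := rfl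

theorem lat_add (k m : Fin d → ℤ) : (lat (k + m) : E d) = lat k + lat m := by
  ext i; simp

theorem lat_neg (k : Fin d → ℤ) : (lat (-k) : E d) = -lat k := by
  ext i; simp

@[simp] theorem lat_zero : (lat (0 : Fin d → ℤ) : E d) = 0 := by
  ext i; simp

/-- The translated cube `I_N + N k`. -/
def cellN (N : ℕ) (k : Fin d → ℤ) : Set (E d) := {x | x - (N : ℝ) • lat k ∈ cube d N}

/-- The index `k` of the cube `I_N + N k` that contains `x`. -/
noncomputable def cellIdx (N : ℕ) (x : E d) : Fin d → ℤ := fun i => ⌊x i / N + 1 / 2⌋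

/-- The representative of `x` in `I_N` modulo `(Nℤ)^d`. -/
noncomputable def red (N : ℕ) (x : E d) : E d := x - (N : ℝ) • lat (cellIdx N x)

theorem cell_eq (k : Fin d → ℤ) : (cell k : Set (E d)) = cellN 1 k := by
  simp [cell, cellN]

theorem cellN_zero (N : ℕ) : cellN N (0 : Fin d → ℤ) = cube d N := by
  simp [cellN]

theorem cell_zero : (cell (0 : Fin d → ℤ) : Set (E d)) = cube d 1 := by
  simp [cell]

theorem measurableSet_cube (N : ℕ) : MeasurableSet (cube d N) := by
  have : cube d N = ⋂ i, {x : E d | -((N : ℝ) / 2) ≤ x i ∧ x i < (N : ℝ) / 2} := by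
    ext x; simp [cube]
  rw [this]
  refine MeasurableSet.iInter fun i => ?_
  have hm : Measurable fun x : E d => x i := by fun_prop
  exact (measurableSet_le measurable_const hm).inter (measurableSet_lt hm measurable_const)

theorem measurableSet_cellN (N : ℕ) (k : Fin d → ℤ) : MeasurableSet (cellN N k : Set (E d)) :=
  (measurable_id.sub_const _) (measurableSet_cube N)

theorem measurableSet_cell (k : Fin d → ℤ) : MeasurableSet (cell k : Set (E d)) := by
  rw [cell_eq]; exact measurableSet_cellN 1 k

theorem mem_cellN_iff {N : ℕ} (hN : 0 < N) {k : Fin d → ℤ} {x : E d} :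
    x ∈ cellN N k ↔ cellIdx N x = k := by
  have hN' : (0 : ℝ) < N := by exact_mod_cast hN
  simp only [cellN, cube, mem_ofPred_eq, funext_iff, cellIdx, Int.floor_eq_iff, PiLp.sub_apply,
    PiLp.smul_apply, lat_apply, smul_eq_mul]
  refine forall_congr' fun i => and_congr ?_ ?_
  · rw [← sub_le_iff_le_add, le_div_iff₀ hN']
    constructor <;> intro h <;> linarith
  · rw [← lt_sub_iff_add_lt, div_lt_iff₀ hN']
    constructor <;> intro h <;> linarith

theorem mem_cell_iff {k : Fin d → ℤ} {x : E d} : x ∈ cell k ↔ cellIdx 1 x = k := by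
  rw [cell_eq, mem_cellN_iff one_pos]

theorem mem_cube_iff {N : ℕ} (hN : 0 < N) {x : E d} : x ∈ cube d N ↔ cellIdx N x = 0 := by
  rw [← cellN_zero, mem_cellN_iff hN]

theorem cellIdx_add {N : ℕ} (hN : 0 < N) (x : E d) (k : Fin d → ℤ) :
    cellIdx N (x + (N : ℝ) • lat k) = cellIdx N x + k := by
  have hN' : (N : ℝ) ≠ 0 := by exact_mod_cast hN.ne'
  ext i
  simp only [cellIdx, PiLp.add_apply, PiLp.smul_apply, lat_apply, smul_eq_mul, Pi.add_apply]
  rw [← Int.floor_add_intCast]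
  congr 1
  field_simp
  ring

theorem red_mem {N : ℕ} (hN : 0 < N) (x : E d) : red N x ∈ cube d N := by
  have : x ∈ cellN N (cellIdx N x) := (mem_cellN_iff hN).2 rfl
  exact this

theorem red_add {N : ℕ} (hN : 0 < N) (x : E d) (k : Fin d → ℤ) :
    red N (x + (N : ℝ) • lat k) = red N x := by
  rw [red, cellIdx_add hN, red, lat_add, smul_add]
  abel

theorem red_of_mem {N : ℕ} (hN : 0 < N) {x : E d} (hx : x ∈ cube d N) : red N x = x := by
  rw [red, (mem_cube_iff hN).1 hx]; simp

theorem measurable_cellIdx (N : ℕ) : Measurable (cellIdx N : E d → Fin d → ℤ) := by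
  refine measurable_pi_lambda _ fun i => ?_
  exact Int.measurable_floor.comp (by fun_prop)

theorem measurable_lat : Measurable (lat : (Fin d → ℤ) → E d) := measurable_of_countable _

theorem measurable_red (N : ℕ) : Measurable (red N : E d → E d) :=
  measurable_id.sub ((measurable_lat.comp (measurable_cellIdx N)).const_smul (N : ℝ))

/-- Translation by a lattice vector, as a measurable equivalence. -/
def latShift (N : ℕ) (k : Fin d → ℤ) : E d ≃ᵐ E d :=
  (Homeomorph.addRight ((N : ℝ) • lat k)).toMeasurableEquiv

@[simp] theorem latShift_apply (N : ℕ) (k : Fin d → ℤ) (x : E d) :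
    latShift N k x = x + (N : ℝ) • lat k := rfl

theorem measurePreserving_latShift (N : ℕ) (k : Fin d → ℤ) :
    MeasurePreserving (latShift N k : E d → E d) volume volume :=
  measurePreserving_add_right volume _

theorem latShift_image_cube (N : ℕ) (k : Fin d → ℤ) : latShift N k '' cube d N = cellN N k := by
  ext x
  simp only [mem_image, latShift_apply, cellN, mem_ofPred_eq]
  constructor
  · rintro ⟨y, hy, rfl⟩; simpa using hy
  · intro h; exact ⟨_, h, by simp⟩

theorem card_cellsIn (m : ℕ) : (cellsIn d (2 * m + 1)).card = (2 * m + 1) ^ d := by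
  have : (2 * m + 1 - 1) / 2 = m := by omega
  simp only [cellsIn, Fintype.card_piFinset, Int.card_Icc, Finset.prod_const, Finset.card_univ,
    Fintype.card_fin, this]
  congr 1
  omega

/-- Writing odd sizes as `2 * m + 1` makes the truncated division in `cellsIn` exact. The box |k_i|
≤ m also serves as a finite index set for the coarser lattice (Nℤ)^d. -/
theorem mem_cellsIn_iff {m : ℕ} {k : Fin d → ℤ} :
    k ∈ cellsIn d (2 * m + 1) ↔ ∀ i, |k i| ≤ m := by
  have : (2 * m + 1 - 1) / 2 = m := by omega
  simp [cellsIn, abs_le]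

theorem mem_cube_iff_cellIdx {m : ℕ} {x : E d} :
    x ∈ cube d (2 * m + 1) ↔ cellIdx 1 x ∈ cellsIn d (2 * m + 1) := by
  rw [mem_cellsIn_iff]
  simp only [cube, mem_ofPred_eq, cellIdx, abs_le]
  refine forall_congr' fun i => and_congr ?_ ?_
  · rw [Int.le_floor]; push_cast; constructor <;> intro h <;> linarith
  · rw [← Int.lt_add_one_iff, Int.floor_lt]; push_cast; constructor <;> intro h <;> linarith

theorem abs_apply_le_norm (x : E d) (i : Fin d) : |x i| ≤ ‖x‖ := by
  simpa using PiLp.norm_apply_le x i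

theorem closedBall_subset_cellN {N : ℕ} (hN : 0 < N) (m : ℕ) {x : E d}
    (hx : x ∈ Metric.closedBall 0 (m : ℝ)) : cellIdx N x ∈ cellsIn d (2 * m + 1) := by
  rw [mem_closedBall_zero_iff] at hx
  have hN' : (1 : ℝ) ≤ N := by exact_mod_cast hN
  rw [mem_cellsIn_iff]
  intro i
  have h1 : |x i / N| ≤ m := by
    rw [abs_div, abs_of_pos (by linarith : (0 : ℝ) < N), div_le_iff₀ (by linarith)]
    have := abs_apply_le_norm x i
    nlinarith [abs_nonneg (x i)]
  rw [abs_le] at h1 ⊢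
  simp only [cellIdx]
  constructor
  · rw [Int.le_floor]; push_cast; linarith [h1.1]
  · rw [← Int.lt_add_one_iff, Int.floor_lt]; push_cast; linarith [h1.2]

/-- A set covered by finitely many images of `S` under measure-preserving maps: integrals of
invariant functions. -/
theorem lintegral_le_card_mul {X κ : Type*} [MeasurableSpace X] {μ : Measure X} {S K : Set X}
    {s : Finset κ} {σ : κ → X ≃ᵐ X} (hσ : ∀ k, MeasurePreserving (σ k) μ μ) {h : X → ℝ≥0∞}
    (hinv : ∀ k, ∀ᵐ x ∂μ, h (σ k x) = h x) (hK : ∀ x ∈ K, ∃ k ∈ s, x ∈ σ k '' S) :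
    ∫⁻ x in K, h x ∂μ ≤ s.card * ∫⁻ x in S, h x ∂μ := by
  have h1 : ∀ k, ∫⁻ x in σ k '' S, h x ∂μ = ∫⁻ x in S, h x ∂μ := by
    intro k
    rw [← (hσ k).setLIntegral_comp_emb (σ k).measurableEmbedding]
    exact lintegral_congr_ae (ae_restrict_of_ae (hinv k))
  have h2 : K ⊆ ⋃ k ∈ s, σ k '' S := fun x hx => by
    obtain ⟨k, hk, hm⟩ := hK x hx
    exact mem_biUnion (by exact_mod_cast hk) hm
  refine (lintegral_mono_set h2).trans ?_
  have h3 : ∀ s : Finset κ, ∫⁻ x in ⋃ k ∈ s, σ k '' S, h x ∂μ ≤ s.card * ∫⁻ x in S, h x ∂μ := by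
    classical
    intro s
    induction s using Finset.induction_on with
    | empty => simp
    | insert a s ha ih =>
      rw [Finset.set_biUnion_insert, Finset.card_insert_of_notMem ha]
      refine (lintegral_union_le _ _ _).trans ?_
      rw [h1]
      push_cast
      rw [add_mul, one_mul, add_comm]
      gcongr
  exact h3 s

/-- A ball of radius m is covered by (2m+1)^d cells, so a periodic function has mass of order m^d
there. This is one order below the growth allowed in the Liouville theorem. -/
theorem tendsto_card_div (d : ℕ) :
    Tendsto (fun m : ℕ => (((m : ℝ)) ^ (d + 1))⁻¹ * ((2 * m + 1 : ℝ) ^ d)) atTop (𝓝 0) := by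
  have h0 : Tendsto (fun m : ℕ => (3 : ℝ) ^ d * ((m : ℝ))⁻¹) atTop (𝓝 0) := by
    simpa using (tendsto_inv_atTop_nhds_zero_nat (𝕜 := ℝ)).const_mul ((3 : ℝ) ^ d)
  refine tendsto_of_tendsto_of_tendsto_of_le_of_le' tendsto_const_nhds h0
    (Eventually.of_forall fun m => by positivity) ?_
  filter_upwards [eventually_ge_atTop 1] with m hm
  have hm' : (1 : ℝ) ≤ m := by exact_mod_cast hm
  rw [inv_mul_le_iff₀ (by positivity)]
  have : (3 : ℝ) ^ d * (m : ℝ)⁻¹ = (3 * m) ^ d / m ^ (d + 1) := by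
    rw [mul_pow, pow_succ]; field_simp
  rw [this, mul_div_cancel₀ _ (by positivity)]
  gcongr
  linarith

/-- The function `∑ c_k φ(x + N k)`. -/
noncomputable def periodize (N : ℕ) (c : (Fin d → ℤ) → ℝ) (φ : E d → ℝ) (x : E d) : ℝ :=
  ∑' k, c k * φ (x + (N : ℝ) • lat k)

/-- Local finiteness of the periodization: over a ball, one finite box of translates suffices. This
permits differentiating the series term by term. -/
theorem IsTest.exists_cells {φ : E d → ℝ} (hφ : IsTest φ) {N : ℕ} (hN : 0 < N) (R : ℝ) :
    ∃ m : ℕ, ∀ x ∈ Metric.closedBall (0 : E d) R, ∀ k ∉ cellsIn d (2 * m + 1),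
      x + (N : ℝ) • lat k ∉ tsupport φ := by
  obtain ⟨n, -, hn⟩ := hφ.2.isCompact.exists_subset_closedBall_nat
  obtain ⟨m, hm⟩ := exists_nat_ge (R + n)
  refine ⟨m, fun x hx k hk hmem => hk ?_⟩
  rw [mem_cellsIn_iff]
  intro i
  have h1 := hn hmem
  rw [mem_closedBall_zero_iff] at h1 hx
  have h2 : ‖(N : ℝ) • (lat k : E d)‖ ≤ m := by
    have := norm_sub_le (x + (N : ℝ) • lat k) x
    rw [add_sub_cancel_left] at this
    linarith
  have h3 := (abs_apply_le_norm _ i).trans h2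
  have hN' : (1 : ℝ) ≤ N := by exact_mod_cast hN
  simp only [PiLp.smul_apply, lat_apply, smul_eq_mul, abs_mul, Nat.abs_cast] at h3
  have h4 : |(k i : ℝ)| ≤ m := by nlinarith [abs_nonneg (k i : ℝ)]
  exact_mod_cast h4

theorem IsTest.periodize_eq {φ : E d → ℝ} (hφ : IsTest φ) {N : ℕ} {R : ℝ} {m : ℕ}
    (hm : ∀ x ∈ Metric.closedBall (0 : E d) R, ∀ k ∉ cellsIn d (2 * m + 1),
      x + (N : ℝ) • lat k ∉ tsupport φ) :
    ∀ c : (Fin d → ℤ) → ℝ, ∀ x ∈ Metric.ball (0 : E d) R,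
      periodize N c φ x = ∑ k ∈ cellsIn d (2 * m + 1), c k * φ (x + (N : ℝ) • lat k) ∧
      fderiv ℝ (periodize N c φ) x =
        ∑ k ∈ cellsIn d (2 * m + 1), c k • fderiv ℝ φ (x + (N : ℝ) • lat k) ∧
      ContDiffAt ℝ ((⊤ : ℕ∞) : WithTop ℕ∞) (periodize N c φ) x := by
  intro c
  have h1 : ∀ x ∈ Metric.ball (0 : E d) R, periodize N c φ x =
      ∑ k ∈ cellsIn d (2 * m + 1), c k * φ (x + (N : ℝ) • lat k) := fun x hx =>
    tsum_eq_sum fun k hk => by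
      rw [image_eq_zero_of_notMem_tsupport (hm x (Metric.ball_subset_closedBall hx) k hk), mul_zero]
  intro x hx
  have h2 : periodize N c φ =ᶠ[𝓝 x]
      fun x => ∑ k ∈ cellsIn d (2 * m + 1), c k * φ (x + (N : ℝ) • lat k) := by
    filter_upwards [Metric.isOpen_ball.mem_nhds hx] with y hy using h1 y hy
  have h3 : ∀ k, ContDiff ℝ ((⊤ : ℕ∞) : WithTop ℕ∞) fun x : E d => φ (x + (N : ℝ) • lat k) :=
    fun k => hφ.1.comp (by fun_prop)
  refine ⟨h1 x hx, ?_, ?_⟩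
  · rw [h2.fderiv_eq, fderiv_fun_sum fun k _ => ((h3 k).differentiable (by simp) x).const_mul _]
    refine Finset.sum_congr rfl fun k _ => ?_
    rw [fderiv_const_mul ((h3 k).differentiable (by simp) x), fderiv_comp_add_right]
  · exact (ContDiff.sum fun k _ => contDiff_const.mul (h3 k)).contDiffAt.congr_of_eventuallyEq h2

theorem IsTest.contDiff_periodize {φ : E d → ℝ} (hφ : IsTest φ) {N : ℕ} (hN : 0 < N)
    (c : (Fin d → ℤ) → ℝ) : ContDiff ℝ ((⊤ : ℕ∞) : WithTop ℕ∞) (periodize N c φ) := by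
  rw [contDiff_iff_contDiffAt]
  intro x
  obtain ⟨m, hm⟩ := hφ.exists_cells hN (‖x‖ + 1)
  exact (hφ.periodize_eq hm c x (by simp)).2.2

/-- Reindexing transfers the translation to the weights. Constant weights yield periodicity; the
random weights 1_s(τ_{-k} ω) yield stationarity. -/
theorem periodize_add (N : ℕ) (c : (Fin d → ℤ) → ℝ) (φ : E d → ℝ) (x : E d) (m : Fin d → ℤ) :
    periodize N c φ (x + (N : ℝ) • lat m) = periodize N (fun k => c (k - m)) φ x := by
  unfold periodize
  rw [← (Equiv.addRight m).tsum_eq (fun k => c (k - m) * φ (x + (N : ℝ) • lat k))]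
  refine tsum_congr fun k => ?_
  simp only [Equiv.coe_addRight, add_sub_cancel_right, lat_add, smul_add]
  rw [add_assoc, add_comm ((N : ℝ) • lat m : E d)]

end Lattice

end WeaklyRandom

namespace WeaklyRandom

/-! ### Multiplication operators on `L²` -/

section Multiplication

open scoped ENNReal

variable {d : ℕ} {X : Type*} [MeasurableSpace X] {μ : Measure X}

open Classical in
/-- Multiplication by a bounded tensor field, on `L²`. -/
noncomputable def mulL (μ : Measure X) (a : X → (E d →L[ℝ] E d)) : Lp (E d) 2 μ →L[ℝ] Lp (E d) 2 μ :=
  if h : MemLp a ⊤ μ then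
    (ContinuousLinearMap.id ℝ (E d →L[ℝ] E d)).holderL μ ⊤ 2 2 (h.toLp a)
  else 0

theorem coeFn_mulL {a : X → (E d →L[ℝ] E d)} (ha : MemLp a ⊤ μ) (f : Lp (E d) 2 μ) :
    mulL μ a f =ᵐ[μ] fun x => a x (f x) := by
  rw [mulL, dif_pos ha]
  have h1 := (ContinuousLinearMap.id ℝ (E d →L[ℝ] E d)).coeFn_holder (r := 2) (ha.toLp a) f
  filter_upwards [h1, ha.coeFn_toLp] with x h2 h3
  rw [h3] at h2
  exact h2

theorem memLp_mul {a : X → (E d →L[ℝ] E d)} (ha : MemLp a ⊤ μ) {f : X → E d} (hf : MemLp f 2 μ) :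
    MemLp (fun x => a x (f x)) 2 μ := by
  refine (Lp.memLp (mulL μ a (hf.toLp f))).ae_eq ?_
  filter_upwards [coeFn_mulL ha (hf.toLp f), hf.coeFn_toLp] with x h1 h2
  rw [h1, h2]

theorem mulL_toLp {a : X → (E d →L[ℝ] E d)} (ha : MemLp a ⊤ μ) {f : X → E d} (hf : MemLp f 2 μ) :
    mulL μ a (hf.toLp f) = (memLp_mul ha hf).toLp _ := by
  refine Lp.ext ?_
  filter_upwards [coeFn_mulL ha (hf.toLp f), hf.coeFn_toLp, (memLp_mul ha hf).coeFn_toLp]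
    with x h1 h2 h3
  rw [h1, h2, h3]

theorem memLp_add_smul {F : Type*} [NormedAddCommGroup F] [NormedSpace ℝ F] {p : ℝ≥0∞} {a b : X → F}
    (ha : MemLp a p μ) (hb : MemLp b p μ) (s : ℝ) : MemLp (fun x => a x + s • b x) p μ :=
  ha.add (hb.const_smul s)

theorem mulL_add_smul {a b : X → (E d →L[ℝ] E d)} (ha : MemLp a ⊤ μ) (hb : MemLp b ⊤ μ) (s : ℝ) :
    mulL μ (fun x => a x + s • b x) = mulL μ a + s • mulL μ b := by
  have hab : MemLp (fun x => a x + s • b x) ⊤ μ := memLp_add_smul ha hb s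
  refine ContinuousLinearMap.ext fun f => Lp.ext ?_
  rw [add_apply, smul_apply]
  filter_upwards [coeFn_mulL hab f, coeFn_mulL ha f, coeFn_mulL hb f,
    Lp.coeFn_add (mulL μ a f) (s • mulL μ b f), Lp.coeFn_smul s (mulL μ b f)] with x h1 h2 h3 h4 h5
  rw [h1, h4, Pi.add_apply, h2, h5, Pi.smul_apply, h3]
  simp

theorem mulL_congr {a b : X → (E d →L[ℝ] E d)} (h : a =ᵐ[μ] b) : mulL μ a = mulL μ b := by
  by_cases ha : MemLp a ⊤ μ
  · have hb := ha.ae_eq h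
    refine ContinuousLinearMap.ext fun f => Lp.ext ?_
    filter_upwards [coeFn_mulL ha f, coeFn_mulL hb f, h] with x h1 h2 h3
    rw [h1, h2, h3]
  · have hb : ¬ MemLp b ⊤ μ := fun hb => ha (hb.ae_eq h.symm)
    rw [mulL, mulL, dif_neg ha, dif_neg hb]

theorem inner_toLp {f g : X → E d} (hf : MemLp f 2 μ) (hg : MemLp g 2 μ) :
    inner ℝ (hf.toLp f) (hg.toLp g) = ∫ x, inner ℝ (f x) (g x) ∂μ := by
  rw [L2.inner_def]
  refine integral_congr_ae ?_
  filter_upwards [hf.coeFn_toLp, hg.coeFn_toLp] with x h3 h4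
  rw [h3, h4]

theorem memLp_adjoint {a : X → (E d →L[ℝ] E d)} (ha : MemLp a ⊤ μ) :
    MemLp (fun x => ContinuousLinearMap.adjoint (a x)) ⊤ μ := by
  refine MemLp.of_le ha ?_ (Eventually.of_forall fun x => ?_)
  · exact ContinuousLinearMap.adjoint.continuous.comp_aestronglyMeasurable ha.1
  · rw [LinearIsometryEquiv.norm_map]

theorem mulL_adjoint {a : X → (E d →L[ℝ] E d)} (ha : MemLp a ⊤ μ) :
    mulL μ (fun x => ContinuousLinearMap.adjoint (a x)) = ContinuousLinearMap.adjoint (mulL μ a) := by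
  rw [ContinuousLinearMap.eq_adjoint_iff]
  intro f g
  rw [L2.inner_def, L2.inner_def]
  refine integral_congr_ae ?_
  filter_upwards [coeFn_mulL ha g, coeFn_mulL (memLp_adjoint ha) f] with x h1 h2
  rw [h1, h2, ContinuousLinearMap.adjoint_inner_left]

theorem coercive_mulL {a : X → (E d →L[ℝ] E d)} (ha : MemLp a ⊤ μ) {α : ℝ}
    (h : ∀ᵐ x ∂μ, ∀ ξ : E d, α * ‖ξ‖ ^ 2 ≤ inner ℝ (a x ξ) ξ) (f : Lp (E d) 2 μ) :
    α * ‖f‖ ^ 2 ≤ inner ℝ (mulL μ a f) f := by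
  rw [← real_inner_self_eq_norm_sq, L2.inner_def, L2.inner_def, ← integral_const_mul]
  refine integral_mono_ae ((L2.integrable_inner f f).const_mul α)
    (L2.integrable_inner (mulL μ a f) f) ?_
  filter_upwards [h, coeFn_mulL ha f] with x h1 h2
  rw [h2, real_inner_self_eq_norm_sq]
  exact h1 _

end Multiplication

/-! ### Weak gradients, curl-free and divergence-free fields -/

section WeakGradient

open scoped ENNReal

variable {d : ℕ}

/-- Local square integrability. -/
def LocL2 {F : Type*} [NormedAddCommGroup F] (G : E d → F) : Prop :=
  ∀ K : Set (E d), IsCompact K → MemLp G 2 (volume.restrict K)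

theorem locL2_of_closedBall {F : Type*} [NormedAddCommGroup F] {G : E d → F}
    (h : ∀ R : ℕ, MemLp G 2 (volume.restrict (Metric.closedBall 0 (R : ℝ)))) : LocL2 G := by
  intro K hK
  obtain ⟨n, -, hn⟩ := hK.exists_subset_closedBall_nat
  exact (h n).mono_measure (Measure.restrict_mono hn le_rfl)

theorem LocL2.locallyIntegrable {F : Type*} [NormedAddCommGroup F] {G : E d → F} (h : LocL2 G) :
    LocallyIntegrable G volume := by
  rw [locallyIntegrable_iff]
  intro K hK
  have : IsFiniteMeasure (volume.restrict K) := ⟨by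
    rw [Measure.restrict_apply_univ]; exact hK.measure_lt_top⟩
  exact (h K hK).integrable (by norm_num)

theorem LocL2.inner_const {G : E d → E d} (h : LocL2 G) (v : E d) :
    LocL2 fun x => inner ℝ (G x) v := fun K hK => (h K hK).inner_const v

theorem LocL2.sub {F : Type*} [NormedAddCommGroup F] {G G' : E d → F} (h : LocL2 G)
    (h' : LocL2 G') : LocL2 fun x => G x - G' x := fun K hK => (h K hK).sub (h' K hK)

theorem LocL2.add {F : Type*} [NormedAddCommGroup F] {G G' : E d → F} (h : LocL2 G)
    (h' : LocL2 G') : LocL2 fun x => G x + G' x := fun K hK => (h K hK).add (h' K hK)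

theorem LocL2.mul {G : E d → E d} (h : LocL2 G) {a : TensorField d} (ha : MemLp a ⊤ volume) :
    LocL2 fun x => a x (G x) := fun K hK => memLp_mul (ha.restrict K) (h K hK)

/-- `div G = 0` in the sense of distributions. -/
def DivFree (G : E d → E d) : Prop := ∀ φ : E d → ℝ, IsTest φ → ∫ x, fderiv ℝ φ x (G x) = 0

/-- `curl G = 0` in the sense of distributions. -/
def CurlFree (G : E d → E d) : Prop := ∀ φ : E d → ℝ, IsTest φ → ∀ v w : E d,
  ∫ x, inner ℝ (G x) v * fderiv ℝ φ x w = ∫ x, inner ℝ (G x) w * fderiv ℝ φ x v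

theorem solvesInSpace_iff {A : TensorField d} {F G : E d → E d} :
    SolvesInSpace A F G ↔ DivFree fun x => A x (G x) + F x :=
  ⟨fun h φ hφ => h φ hφ.1 hφ.2, fun h φ h1 h2 => h φ ⟨h1, h2⟩⟩

theorem fderiv_fderiv_comm {φ : E d → ℝ} (hφ : IsTest φ) (x v w : E d) :
    fderiv ℝ (fun z => fderiv ℝ φ z v) x w = fderiv ℝ (fun z => fderiv ℝ φ z w) x v := by
  have hd : DifferentiableAt ℝ (fderiv ℝ φ) x :=
    ((hφ.1.fderiv_right (m := ((⊤ : ℕ∞) : WithTop ℕ∞)) (by simp)).differentiable (by simp)) x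
  rw [fderiv_clm_apply hd (differentiableAt_const _), fderiv_clm_apply hd (differentiableAt_const _)]
  have hs : IsSymmSndFDerivAt ℝ φ x := hφ.1.contDiffAt.isSymmSndFDerivAt (by
    simp only [minSmoothness_of_isRCLikeNormedField]
    exact WithTop.coe_le_coe.2 (le_top : (2 : ℕ∞) ≤ ⊤))
  simpa using hs w v

theorem IsTest.integrable_inner {G : E d → E d} (hG : LocL2 G) {φ : E d → ℝ} (hφ : IsTest φ)
    (v : E d) : Integrable fun x => inner ℝ (G x) v * φ x :=
  IsTest.integrable_mul (hG.inner_const v).locallyIntegrable hφ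

theorem fderiv_eq_sum (φ : E d → ℝ) (x y : E d) :
    fderiv ℝ φ x y = ∑ i, inner ℝ y (e i) * fderiv ℝ φ x (e i) := by
  conv_lhs => rw [← sum_smul_e y]
  simp [inner_e]

theorem IsTest.integrable_fderiv {G : E d → E d} (hG : LocL2 G) {φ : E d → ℝ} (hφ : IsTest φ) :
    Integrable fun x => fderiv ℝ φ x (G x) := by
  simp_rw [fderiv_eq_sum _ _ (G _)]
  exact integrable_finsetSum _ fun i _ => (hφ.fderiv_apply (e i)).integrable_inner hG (e i)

/-- Second derivatives of test functions commute. Curl-freeness, unlike the existence of a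
potential, passes directly to weak limits and to averages over `ω`. -/
theorem weakGradient_curlFree {u : E d → ℝ} {G : E d → E d} (h : IsWeakGradient u G) :
    CurlFree G := by
  intro φ hφ v w
  have h1 := h.2.2 _ (hφ.fderiv_apply w).1 (hφ.fderiv_apply w).2 v
  have h2 := h.2.2 _ (hφ.fderiv_apply v).1 (hφ.fderiv_apply v).2 w
  simp_rw [fderiv_fderiv_comm hφ _ w v] at h1
  linarith

theorem CurlFree.sub {G G' : E d → E d} (hG : LocL2 G) (hG' : LocL2 G') (h : CurlFree G)
    (h' : CurlFree G') : CurlFree fun x => G x - G' x := by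
  intro φ hφ v w
  simp_rw [inner_sub_left, sub_mul]
  rw [integral_sub ((hφ.fderiv_apply w).integrable_inner hG v)
    ((hφ.fderiv_apply w).integrable_inner hG' v), h φ hφ, h' φ hφ,
    integral_sub ((hφ.fderiv_apply v).integrable_inner hG w)
    ((hφ.fderiv_apply v).integrable_inner hG' w)]

theorem DivFree.congr {G G' : E d → E d} (h : DivFree G) (hG : G =ᵐ[volume] G') : DivFree G' := by
  intro φ hφ
  rw [← h φ hφ]
  refine integral_congr_ae ?_
  filter_upwards [hG] with x hx
  rw [hx]

theorem CurlFree.congr {G G' : E d → E d} (h : CurlFree G) (hG : G =ᵐ[volume] G') : CurlFree G' := by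
  intro φ hφ v w
  rw [integral_congr_ae (g := fun x => inner ℝ (G x) v * fderiv ℝ φ x w), h φ hφ v w]
  · refine integral_congr_ae ?_
    filter_upwards [hG] with x hx
    rw [hx]
  · filter_upwards [hG] with x hx
    rw [hx]

theorem weakGradient_sub {u u' : E d → ℝ} {G G' : E d → E d} (h : IsWeakGradient u G)
    (h' : IsWeakGradient u' G') : IsWeakGradient (fun x => u x - u' x) fun x => G x - G' x := by
  refine ⟨LocL2.sub h.1 h'.1, LocL2.sub h.2.1 h'.2.1, fun φ h1 h2 v => ?_⟩
  have hφ : IsTest φ := ⟨h1, h2⟩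
  simp_rw [inner_sub_left, sub_mul]
  rw [integral_sub, integral_sub (hφ.integrable_inner h.2.1 v) (hφ.integrable_inner h'.2.1 v),
    h.2.2 φ h1 h2, h'.2.2 φ h1 h2]
  · ring
  · exact IsTest.integrable_mul (LocL2.locallyIntegrable h.1) (hφ.fderiv_apply v)
  · exact IsTest.integrable_mul (LocL2.locallyIntegrable h'.1) (hφ.fderiv_apply v)

/-- The components of a curl-free and divergence-free field are harmonic. -/
theorem weaklyHarmonic_of_curlFree_divFree {G : E d → E d} (hG : LocL2 G) (hc : CurlFree G)
    (hd : DivFree G) (v : E d) : WeaklyHarmonic fun x => inner ℝ (G x) v := by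
  intro φ hφ
  have h1 := hd _ (hφ.fderiv_apply v)
  simp_rw [fderiv_eq_sum _ _ (G _)] at h1
  rw [integral_finsetSum _ fun i _ =>
    ((hφ.fderiv_apply v).fderiv_apply (e i)).integrable_inner hG (e i)] at h1
  simp_rw [lap, Finset.mul_sum]
  rw [integral_finsetSum _ fun i _ =>
    ((hφ.fderiv_apply (e i)).fderiv_apply (e i)).integrable_inner hG v, ← h1]
  refine Finset.sum_congr rfl fun i _ => ?_
  -- Curl-freeness trades the component of G along v for its component along e_i. The Laplacian test
  -- of φ becomes the divergence test of ∂_v φ.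
  rw [hc _ (hφ.fderiv_apply (e i)) v (e i)]
  simp_rw [fderiv_fderiv_comm hφ _ (e i) v]

/-- A potential of a divergence-free field is harmonic. -/
theorem weaklyHarmonic_of_divFree {u : E d → ℝ} {G : E d → E d} (h : IsWeakGradient u G)
    (hd : DivFree G) : WeaklyHarmonic u := by
  intro φ hφ
  have h1 := hd _ hφ
  simp_rw [fderiv_eq_sum _ _ (G _)] at h1
  rw [integral_finsetSum _ fun i _ =>
    (hφ.fderiv_apply (e i)).integrable_inner h.2.1 (e i)] at h1
  simp_rw [lap, Finset.mul_sum]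
  rw [integral_finsetSum _ fun i _ => IsTest.integrable_mul (LocL2.locallyIntegrable h.1)
    ((hφ.fderiv_apply (e i)).fderiv_apply (e i))]
  have h2 : ∀ i, ∫ x, u x * fderiv ℝ (fun z => fderiv ℝ φ z (e i)) x (e i) =
      -∫ x, inner ℝ (G x) (e i) * fderiv ℝ φ x (e i) := fun i =>
    h.2.2 _ (hφ.fderiv_apply (e i)).1 (hφ.fderiv_apply (e i)).2 (e i)
  simp_rw [h2]
  rw [Finset.sum_neg_distrib, h1, neg_zero]

/-- A field with a constant potential vanishes. -/
theorem ae_eq_zero_of_const_potential {u : E d → ℝ} {G : E d → E d} (h : IsWeakGradient u G) {c : ℝ}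
    (hc : ∀ᵐ x, u x = c) : ∀ᵐ x, G x = 0 := by
  have h1 : ∀ i : Fin d, ∀ᵐ x, inner ℝ (G x) (e i) = 0 := by
    intro i
    refine ae_eq_zero_of_integral_contDiff_smul_eq_zero
      (LocL2.inner_const h.2.1 (e i)).locallyIntegrable fun φ h1 h2 => ?_
    have h3 := h.2.2 φ h1 h2 (e i)
    have h4 : ∫ x, u x * fderiv ℝ φ x (e i) = 0 := by
      rw [integral_congr_ae (g := fun x => c * fderiv ℝ φ x (e i))]
      · have hφ : IsTest φ := ⟨h1, h2⟩
        have := integral_mul_fderiv_eq_neg_fderiv_mul_of_integrable (μ := (volume : Measure (E d)))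
          (f := fun _ => c) (g := φ) (v := (e i : E d)) (by simp) ((hφ.fderiv_apply _).1.continuous.integrable_of_hasCompactSupport
            (hφ.fderiv_apply _).2 |>.const_mul c)
          ((h1.continuous.integrable_of_hasCompactSupport h2).const_mul c)
          (fun x _ => by fun_prop) (fun x _ => h1.differentiable (by simp) x)
        rw [this]; simp
      · filter_upwards [hc] with x hx
        rw [hx]
    rw [h4] at h3
    simp_rw [smul_eq_mul, mul_comm (φ _)]
    linarith
  filter_upwards [ae_all_iff.2 h1] with x hx
  ext i
  rw [← inner_e, hx i]; rfl

end WeakGradient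

end WeaklyRandom

namespace WeaklyRandom

/-! ### Periodic gradients -/

section PeriodicTheory

open scoped ENNReal

variable {d : ℕ}

theorem norm_le_sum_abs (x : E d) : ‖x‖ ≤ ∑ i, |x i| := by
  conv_lhs => rw [← sum_smul_e x]
  refine (norm_sum_le _ _).trans (Finset.sum_le_sum fun i _ => ?_)
  simp [norm_smul, e]

theorem cube_subset_closedBall (N : ℕ) : cube d N ⊆ Metric.closedBall 0 ((d * N : ℕ) : ℝ) := by
  intro x hx
  rw [mem_closedBall_zero_iff]
  refine (norm_le_sum_abs x).trans ?_
  refine (Finset.sum_le_sum (g := fun _ => (N : ℝ)) fun i _ => ?_).trans (by simp)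
  have := hx i
  rw [abs_le]
  constructor <;> linarith [this.1, this.2, (Nat.cast_nonneg N : (0 : ℝ) ≤ N)]

theorem volume_cube_lt_top (N : ℕ) : volume (cube d N) < ⊤ :=
  (measure_mono (cube_subset_closedBall N)).trans_lt measure_closedBall_lt_top

instance isFiniteMeasure_cube (N : ℕ) : IsFiniteMeasure (volume.restrict (cube d N)) :=
  ⟨by rw [Measure.restrict_apply_univ]; exact volume_cube_lt_top N⟩

theorem LocL2.memLp_cube {F : Type*} [NormedAddCommGroup F] {G : E d → F} (h : LocL2 G) (N : ℕ) :
    MemLp G 2 (volume.restrict (cube d N)) :=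
  (h _ (isCompact_closedBall 0 _)).mono_measure
    (Measure.restrict_mono (cube_subset_closedBall N) le_rfl)

theorem lintegral_closedBall_le {N : ℕ} (hN : 0 < N) (m : ℕ) {h : E d → ℝ≥0∞}
    (hinv : ∀ k : Fin d → ℤ, ∀ᵐ x, h (x + (N : ℝ) • lat k) = h x) :
    ∫⁻ x in Metric.closedBall 0 (m : ℝ), h x ≤ ((2 * m + 1) ^ d : ℕ) * ∫⁻ x in cube d N, h x := by
  rw [← card_cellsIn]
  refine lintegral_le_card_mul (σ := latShift N) (measurePreserving_latShift N) hinv fun x hx => ?_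
  exact ⟨_, closedBall_subset_cellN hN m hx, by
    rw [latShift_image_cube, mem_cellN_iff hN]⟩

theorem locL2_of_periodic {F : Type*} [NormedAddCommGroup F] {N : ℕ} (hN : 0 < N) {G : E d → F}
    (hm : AEStronglyMeasurable G volume) (hG : IsPeriodic N G)
    (h : MemLp G 2 (volume.restrict (cube d N))) : LocL2 G := by
  refine locL2_of_closedBall fun R => ⟨hm.restrict, ?_⟩
  have h1 : eLpNorm G 2 (volume.restrict (Metric.closedBall 0 (R : ℝ))) ^ 2 < ⊤ := by
    rw [eLpNorm_two_sq]
    refine (lintegral_closedBall_le hN R fun k => ?_).trans_lt ?_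
    · filter_upwards [hG k] with x hx
      rw [hx]
    · rw [← eLpNorm_two_sq]
      exact ENNReal.mul_lt_top (ENNReal.natCast_lt_top _) (ENNReal.pow_lt_top h.2)
  simpa using h1

theorem integral_abs_closedBall_le {N : ℕ} (hN : 0 < N) (m : ℕ) {u : E d → ℝ} (hu : LocL2 u)
    (hp : IsPeriodic N u) :
    ∫ x in Metric.closedBall 0 (m : ℝ), |u x| ≤ (2 * m + 1 : ℝ) ^ d * ∫ x in cube d N, |u x| := by
  have h1 : ∀ S : Set (E d), Integrable u (volume.restrict S) →
      ∫ x in S, |u x| = (∫⁻ x in S, ‖u x‖ₑ).toReal := by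
    intro S hS
    rw [integral_eq_lintegral_of_nonneg_ae (Eventually.of_forall fun x => abs_nonneg _)
      hS.abs.aestronglyMeasurable]
    congr 1
    refine lintegral_congr fun x => ?_
    rw [← ofReal_norm, Real.norm_eq_abs]
  have i1 : Integrable u (volume.restrict (Metric.closedBall 0 (m : ℝ))) :=
    hu.locallyIntegrable.integrableOn_isCompact (isCompact_closedBall _ _)
  have i2 : Integrable u (volume.restrict (cube d N)) := (hu.memLp_cube N).integrable (by norm_num)
  rw [h1 _ i1, h1 _ i2]
  have h2 := lintegral_closedBall_le hN m (h := fun x => ‖u x‖ₑ) fun k => by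
    filter_upwards [hp k] with x hx
    rw [hx]
  have h3 := ENNReal.toReal_mono (ENNReal.mul_ne_top (ENNReal.natCast_ne_top _) i2.2.ne) h2
  rw [ENNReal.toReal_mul, ENNReal.toReal_natCast] at h3
  exact_mod_cast h3

/-- A periodic harmonic function is constant. -/
theorem ae_eq_const_of_periodic {N : ℕ} (hN : 0 < N) {u : E d → ℝ} (hu : LocL2 u)
    (hp : IsPeriodic N u) (hh : WeaklyHarmonic u) : ∃ c : ℝ, ∀ᵐ x, u x = c := by
  refine hh.ae_eq_const hu.locallyIntegrable (R := fun m => (m : ℝ)) tendsto_natCast_atTop_atTop ?_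
  have h0 := (tendsto_card_div d).mul_const (∫ x in cube d N, |u x|)
  rw [zero_mul] at h0
  refine tendsto_of_tendsto_of_tendsto_of_le_of_le tendsto_const_nhds h0 (fun m => ?_) fun m => ?_
  · exact mul_nonneg (by positivity) (integral_nonneg fun x => abs_nonneg _)
  · rw [mul_assoc]
    exact mul_le_mul_of_nonneg_left (integral_abs_closedBall_le hN m hu hp) (by positivity)

/-- The periodic extension of a function on `I_N`. -/
noncomputable def extN {F : Type*} (N : ℕ) (g : E d → F) (x : E d) : F := g (red N x)

theorem extN_add {F : Type*} {N : ℕ} (hN : 0 < N) (g : E d → F) (x : E d) (k : Fin d → ℤ) :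
    extN N g (x + (N : ℝ) • lat k) = extN N g x := by
  rw [extN, red_add hN, extN]

theorem isPeriodic_extN {F : Type*} {N : ℕ} (hN : 0 < N) (g : E d → F) : IsPeriodic N (extN N g) :=
  fun k => Eventually.of_forall fun x => extN_add hN g x k

theorem extN_ae_eq {F : Type*} {N : ℕ} (hN : 0 < N) (g : E d → F) :
    extN N g =ᵐ[volume.restrict (cube d N)] g := by
  refine (ae_restrict_iff' (measurableSet_cube N)).2 (Eventually.of_forall fun x hx => ?_)
  rw [extN, red_of_mem hN hx]

theorem locL2_extN {F : Type*} [NormedAddCommGroup F] {N : ℕ} (hN : 0 < N) {g : E d → F}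
    (hg : StronglyMeasurable g) (h : MemLp g 2 (volume.restrict (cube d N))) : LocL2 (extN N g) :=
  locL2_of_periodic hN (hg.comp_measurable (measurable_red N)).aestronglyMeasurable
    (isPeriodic_extN hN g) (h.ae_eq (extN_ae_eq hN g).symm)

theorem gradient_add {Φ : E d → ℝ} {y : E d} (h : ∀ x, Φ (x + y) = Φ x) (x : E d) :
    gradient Φ (x + y) = gradient Φ x := by
  have : (fun x => Φ (x + y)) = Φ := funext h
  rw [gradient, gradient, ← fderiv_comp_add_right, this]

/-- The gradients of smooth periodic functions. -/
def perGrads (d N : ℕ) : Submodule ℝ (Lp (E d) 2 (volume.restrict (cube d N))) where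
  carrier := {g | ∃ Φ : E d → ℝ, ContDiff ℝ ((⊤ : ℕ∞) : WithTop ℕ∞) Φ ∧
    (∀ (k : Fin d → ℤ) (x : E d), Φ (x + (N : ℝ) • lat k) = Φ x) ∧
    g =ᵐ[volume.restrict (cube d N)] gradient Φ}
  add_mem' := by
    rintro f g ⟨Φ, h1, h2, h3⟩ ⟨Ψ, k1, k2, k3⟩
    refine ⟨Φ + Ψ, h1.add k1, fun k x => by simp [h2, k2], ?_⟩
    filter_upwards [h3, k3, Lp.coeFn_add f g] with x a b c
    rw [c, Pi.add_apply, a, b]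
    simp only [gradient]
    rw [fderiv_add (h1.differentiable (by simp) x) (k1.differentiable (by simp) x), map_add]
  zero_mem' := by
    refine ⟨0, contDiff_const, fun k x => rfl, ?_⟩
    filter_upwards [Lp.coeFn_zero (E d) 2 (volume.restrict (cube d N))] with x hx
    rw [hx]
    simp [gradient]
  smul_mem' := by
    rintro c g ⟨Φ, h1, h2, h3⟩
    refine ⟨c • Φ, h1.const_smul c, fun k x => by simp [h2], ?_⟩
    filter_upwards [h3, Lp.coeFn_smul c g] with x a b
    rw [b, Pi.smul_apply, a]
    simp only [gradient]
    rw [fderiv_const_smul (h1.differentiable (by simp) x), map_smul]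

/-- The space of gradients of periodic `H¹` functions. -/
noncomputable def perV (d N : ℕ) : Submodule ℝ (Lp (E d) 2 (volume.restrict (cube d N))) :=
  (perGrads d N).topologicalClosure

noncomputable instance (N : ℕ) : (perV d N).HasOrthogonalProjection := by
  have : CompleteSpace (perV d N) :=
    (Submodule.isClosed_topologicalClosure _).completeSpace_coe
  infer_instance

theorem weakGradient_translate {u : E d → ℝ} {G : E d → E d} (h : IsWeakGradient u G) (y : E d) :
    IsWeakGradient (fun x => u (x + y)) fun x => G (x + y) := by
  have hl : ∀ {F : Type} [NormedAddCommGroup F] {g : E d → F}, LocL2 g → LocL2 fun x => g (x + y) := by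
    intro F _ g hg K hK
    have hmp := (measurePreserving_add_right (volume : Measure (E d)) y).restrict_image_emb
      (measurableEmbedding_addRight y) K
    exact (hg _ (hK.image (continuous_add_const y))).comp_measurePreserving hmp
  refine ⟨hl h.1, hl h.2.1, fun φ h1 h2 v => ?_⟩
  have h3 := h.2.2 (fun x => φ (x - y)) (h1.comp (by fun_prop))
    (h2.comp_homeomorph (Homeomorph.subRight y)) v
  rw [← integral_add_right_eq_self _ y, ← integral_add_right_eq_self (fun x => inner ℝ (G x) v * _) y]
    at h3
  simp_rw [fderiv_comp_sub] at h3
  simpa using h3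

/-- The field minus its translate has a potential that is almost everywhere zero. -/
theorem isPeriodic_of_weakGradient {N : ℕ} {u : E d → ℝ} {G : E d → E d} (h : IsWeakGradient u G)
    (hp : IsPeriodic N u) : IsPeriodic N G := by
  intro k
  have h1 := weakGradient_sub (weakGradient_translate h ((N : ℝ) • lat k)) h
  have h2 := ae_eq_zero_of_const_potential h1 (c := 0) (by
    filter_upwards [hp k] with x hx
    rw [hx, sub_self])
  filter_upwards [h2] with x hx
  exact sub_eq_zero.1 hx

/-- Convergence of smooth periodic gradients on one cell spreads to all balls by periodicity, which
produces a limiting potential. The subtracted constants are the same at x and at x + Nk, so the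
potential inherits the periodicity. -/
theorem exists_periodic_potential {N : ℕ} (hN : 0 < N)
    {g : Lp (E d) 2 (volume.restrict (cube d N))} (hg : g ∈ perV d N) :
    ∃ u : E d → ℝ, IsWeakGradient u (extN N g) ∧ IsPeriodic N u := by
  obtain ⟨w, hw, hwg⟩ := mem_closure_iff_seq_limit.1 hg
  choose Φ h1 h2 h3 using hw
  have hloc : LocL2 (extN N g) := locL2_extN hN (Lp.stronglyMeasurable g) (Lp.memLp g)
  have hcube : Tendsto (fun n => eLpNorm (gradient (Φ n) - extN N g) 2 (volume.restrict (cube d N)))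
      atTop (𝓝 0) := by
    have h4 : Tendsto (fun n => eLpNorm (⇑(w n) - ⇑g) 2 (volume.restrict (cube d N))) atTop (𝓝 0) :=
      (Lp.tendsto_Lp_iff_tendsto_eLpNorm' _ _).1 hwg
    refine h4.congr fun n => eLpNorm_congr_ae ?_
    filter_upwards [h3 n, extN_ae_eq hN g] with x a b
    rw [Pi.sub_apply, Pi.sub_apply, a, b]
  have hball : ∀ R : ℕ, Tendsto (fun n => eLpNorm (gradient (Φ n) - extN N g) 2
      (volume.restrict (Metric.closedBall 0 (R : ℝ)))) atTop (𝓝 0) := by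
    intro R
    have h5 : Tendsto (fun n => (((2 * R + 1) ^ d : ℕ) : ℝ≥0∞) *
        eLpNorm (gradient (Φ n) - extN N g) 2 (volume.restrict (cube d N))) atTop (𝓝 0) := by
      have := ENNReal.Tendsto.const_mul (a := (((2 * R + 1) ^ d : ℕ) : ℝ≥0∞)) hcube
        (Or.inr (ENNReal.natCast_ne_top _))
      simpa using this
    refine tendsto_of_tendsto_of_tendsto_of_le_of_le tendsto_const_nhds h5 (fun _ => zero_le)
      fun n => ?_
    refine (ENNReal.pow_le_pow_left_iff two_ne_zero).1 ?_
    rw [mul_pow, eLpNorm_two_sq, eLpNorm_two_sq]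
    refine (lintegral_closedBall_le hN R fun k => Eventually.of_forall fun x => ?_).trans ?_
    · simp only [Pi.sub_apply]
      rw [gradient_add (h2 n k), extN_add hN]
    · gcongr
      exact_mod_cast Nat.le_self_pow two_ne_zero _
  obtain ⟨u, c, hu, hlim⟩ := exists_isWeakGradient_of_tendsto h1
    (fun R => hloc _ (isCompact_closedBall _ _)) hball
  refine ⟨u, hu, fun k => ?_⟩
  have h6 : ∀ R : ℕ, 1 ≤ R → ∀ᵐ x ∂(volume.restrict (Metric.closedBall 0 (R : ℝ))),
      u (x + (N : ℝ) • lat k) = u x := by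
    intro R hR
    set y : E d := (N : ℝ) • lat k
    have hu' := (weakGradient_translate hu y).1
    obtain ⟨n', hn'⟩ := exists_nat_ge (R + ‖y‖)
    have hn1 : 1 ≤ n' := by
      have h8 : (R : ℝ) ≤ n' := by linarith [norm_nonneg y]
      have h9 : R ≤ n' := by exact_mod_cast h8
      omega
    have hc : ∀ n, MemLp (fun x => Φ n x - c n) 2 (volume.restrict (Metric.closedBall 0 (R : ℝ))) :=
      fun n => memLp_of_continuous ((h1 n).continuous.sub continuous_const) (isCompact_closedBall _ _)
    have t1 := (Lp.tendsto_Lp_iff_tendsto_eLpNorm'' _ hc _ (hu.1 _ (isCompact_closedBall _ _))).2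
      (hlim R hR)
    have t2 := (Lp.tendsto_Lp_iff_tendsto_eLpNorm'' _ hc _ (hu' _ (isCompact_closedBall _ _))).2
      (by
        refine tendsto_of_tendsto_of_tendsto_of_le_of_le tendsto_const_nhds (hlim n' hn1)
          (fun _ => zero_le) fun n => ?_
        have hmp := (measurePreserving_add_right (volume : Measure (E d)) y).restrict_image_emb
          (measurableEmbedding_addRight y) (Metric.closedBall 0 (R : ℝ))
        have hsub : (fun x => x + y) '' Metric.closedBall 0 (R : ℝ) ⊆ Metric.closedBall 0 (n' : ℝ) := by
          rintro _ ⟨x, hx, rfl⟩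
          rw [mem_closedBall_zero_iff] at hx ⊢
          exact (norm_add_le _ _).trans (by linarith)
        have e1 : ((fun x => Φ n x - c n) - fun x => u (x + y)) =
            ((fun x => Φ n x - c n) - u) ∘ fun x => x + y := by
          ext x
          simp only [Pi.sub_apply, Function.comp]
          rw [h2 n k]
        have hms : AEStronglyMeasurable ((fun x => Φ n x - c n) - u)
            (volume.restrict ((fun x => x + y) '' Metric.closedBall 0 (R : ℝ))) :=
          (((h1 n).continuous.sub continuous_const).aestronglyMeasurable).sub
            (LocL2.locallyIntegrable hu.1).aestronglyMeasurable.restrict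
        rw [e1, eLpNorm_comp_measurePreserving hms hmp]
        exact eLpNorm_mono_measure _ (Measure.restrict_mono hsub le_rfl))
    exact ((MemLp.toLp_eq_toLp_iff _ _).1 (tendsto_nhds_unique t2 t1))
  have h7 : ∀ R : ℕ, ∀ᵐ x, x ∈ Metric.closedBall (0 : E d) ((R + 1 : ℕ) : ℝ) →
      u (x + (N : ℝ) • lat k) = u x := fun R =>
    (ae_restrict_iff' Metric.isClosed_closedBall.measurableSet).1 (h6 (R + 1) (by omega))
  filter_upwards [ae_all_iff.2 h7] with x hx
  obtain ⟨R, hR⟩ := exists_nat_ge ‖x‖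
  exact hx R (by rw [mem_closedBall_zero_iff]; push_cast; linarith)

/-- Unfolding of the integral of a compactly supported function over the cells. -/
theorem IsTest.integral_unfold {φ : E d → ℝ} (hφ : IsTest φ) {N : ℕ} (hN : 0 < N) :
    ∃ m : ℕ, (∀ c : (Fin d → ℤ) → ℝ, ∀ x ∈ cube d N, fderiv ℝ (periodize N c φ) x =
        ∑ k ∈ cellsIn d (2 * m + 1), c k • fderiv ℝ φ (x + (N : ℝ) • lat k)) ∧
      (∀ x, x ∈ tsupport φ → cellIdx N x ∈ cellsIn d (2 * m + 1)) ∧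
      ∀ f : E d → ℝ, (∀ x ∉ tsupport φ, f x = 0) → Integrable f →
        ∫ x, f x = ∑ k ∈ cellsIn d (2 * m + 1), ∫ x in cube d N, f (x + (N : ℝ) • lat k) := by
  obtain ⟨m, hm⟩ := hφ.exists_cells hN ((d * N : ℕ) + 1 : ℝ)
  have hidx : ∀ x, x ∈ tsupport φ → cellIdx N x ∈ cellsIn d (2 * m + 1) := by
    intro x hx
    by_contra h
    refine hm (red N x) (Metric.closedBall_subset_closedBall (by linarith)
      (cube_subset_closedBall N (red_mem hN x))) _ h ?_
    rwa [red, sub_add_cancel]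
  refine ⟨m, fun c x hx => ?_, hidx, fun f hf hfi => ?_⟩
  · have hxb := cube_subset_closedBall N hx
    rw [mem_closedBall_zero_iff] at hxb
    exact (hφ.periodize_eq hm c x (by rw [mem_ball_zero_iff]; linarith)).2.1
  · have h1 : ∫ x, f x = ∫ x in ⋃ k ∈ cellsIn d (2 * m + 1), cellN N k, f x := by
      refine setIntegral_eq_of_support fun x hx => hf x fun hs => hx ?_
      exact mem_biUnion (hidx x hs) ((mem_cellN_iff hN).2 rfl)
    rw [h1, integral_biUnion_finset _ (fun k _ => measurableSet_cellN N k) ?_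
      fun k _ => hfi.integrableOn]
    · refine Finset.sum_congr rfl fun k _ => ?_
      rw [← latShift_image_cube]
      exact (measurePreserving_latShift N k).setIntegral_image_emb
        (latShift N k).measurableEmbedding f (cube d N)
    · intro k _ k' _ hkk
      refine Set.disjoint_left.2 fun x h1 h2 => hkk ?_
      rw [mem_cellN_iff hN] at h1 h2
      rw [← h1, h2]

end PeriodicTheory

end WeaklyRandom

namespace WeaklyRandom

/-! ### Periodic solutions -/

section PeriodicSolutions

open scoped ENNReal

variable {d : ℕ}

theorem integrable_inner_of_memLp {α F : Type*} [MeasurableSpace α] [NormedAddCommGroup F]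
    [InnerProductSpace ℝ F] {μ : Measure α} {f g : α → F} (hf : MemLp f 2 μ) (hg : MemLp g 2 μ) :
    Integrable (fun x => inner ℝ (f x) (g x)) μ :=
  (L2.integrable_inner (𝕜 := ℝ) (hf.toLp f) (hg.toLp g)).congr (by
    filter_upwards [hf.coeFn_toLp, hg.coeFn_toLp] with x a b
    rw [a, b])

theorem fderiv_extend {φ : E d → ℝ} {x : E d}
    (hx : x ∉ tsupport φ) (y : E d) : fderiv ℝ φ x y = 0 := by
  rw [fderiv_of_notMem_tsupport (𝕜 := ℝ) hx]; rfl

theorem periodize_one_add (N : ℕ) (φ : E d → ℝ) (k : Fin d → ℤ) (x : E d) :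
    periodize N (fun _ => 1) φ (x + (N : ℝ) • lat k) = periodize N (fun _ => 1) φ x :=
  periodize_add N _ φ x k

/-- Testing a periodic field with a compactly supported function is the same as testing it, on one
cell, with the periodized function. -/
theorem integral_fderiv_periodic {N : ℕ} (hN : 0 < N) {H : E d → E d} (hH : LocL2 H)
    (hp : IsPeriodic N H) {φ : E d → ℝ} (hφ : IsTest φ) :
    ∫ x, fderiv ℝ φ x (H x) = ∫ x in cube d N, fderiv ℝ (periodize N (fun _ => 1) φ) x (H x) := by
  obtain ⟨m, hm, -, hu⟩ := hφ.integral_unfold hN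
  have hi := hφ.integrable_fderiv hH
  rw [hu _ (fun x hx => fderiv_extend hx _) hi]
  have h1 : ∀ k : Fin d → ℤ, ∫ x in cube d N, fderiv ℝ φ (x + (N : ℝ) • lat k) (H (x + (N : ℝ) • lat k))
      = ∫ x in cube d N, fderiv ℝ φ (x + (N : ℝ) • lat k) (H x) := by
    intro k
    refine integral_congr_ae (ae_restrict_of_ae ?_)
    filter_upwards [hp k] with x hx
    rw [hx]
  simp_rw [h1]
  rw [← integral_finsetSum]
  · refine setIntegral_congr_fun (measurableSet_cube N) fun x hx => ?_
    rw [hm _ x hx]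
    simp
  · intro k _
    have h2 : IsTest fun x : E d => φ (x + (N : ℝ) • lat k) :=
      ⟨hφ.1.comp (by fun_prop), hφ.2.comp_homeomorph (Homeomorph.addRight _)⟩
    have h3 := (h2.integrable_fderiv hH).restrict (s := cube d N)
    simp_rw [fderiv_comp_add_right] at h3
    exact h3

theorem inner_gradient_toLp {N : ℕ} {Φ : E d → ℝ} (h1 : ContDiff ℝ ((⊤ : ℕ∞) : WithTop ℕ∞) Φ) :
    MemLp (gradient Φ) 2 (volume.restrict (cube d N)) :=
  (show LocL2 (gradient Φ) from fun _ hK => memLp_of_continuous (continuous_gradient h1) hK).memLp_cube N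

theorem gradient_mem_perV {N : ℕ} {Φ : E d → ℝ} (h1 : ContDiff ℝ ((⊤ : ℕ∞) : WithTop ℕ∞) Φ)
    (h2 : ∀ (k : Fin d → ℤ) (x : E d), Φ (x + (N : ℝ) • lat k) = Φ x) :
    (inner_gradient_toLp (N := N) h1).toLp _ ∈ perV d N :=
  Submodule.le_topologicalClosure _ ⟨Φ, h1, h2, MemLp.coeFn_toLp _⟩

/-- The gradient of a periodic function belongs to the closure of the smooth periodic gradients. -/
theorem toLp_mem_perV {N : ℕ} (hN : 0 < N) {u : E d → ℝ} {G : E d → E d} (hG : IsWeakGradient u G)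
    (hp : IsPeriodic N u) (hm : MemLp G 2 (volume.restrict (cube d N))) :
    hm.toLp G ∈ perV d N := by
  set g := hm.toLp G
  set h := (perV d N).starProjection g
  have hh : h ∈ perV d N := Submodule.starProjection_apply_mem _ _
  obtain ⟨v, hv, hvp⟩ := exists_periodic_potential hN hh
  have hGp := isPeriodic_of_weakGradient hG hp
  have hw := weakGradient_sub hG hv
  have hwp : IsPeriodic N fun x => u x - v x := fun k => by
    filter_upwards [hp k, hvp k] with x a b
    rw [a, b]
  have hHp : IsPeriodic N fun x => G x - extN N h x := isPeriodic_of_weakGradient hw hwp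
  -- Orthogonality to smooth periodic gradients becomes, after periodizing the test function,
  -- vanishing divergence on ℝ^d. The potential of G - h is then periodic and harmonic, hence
  -- constant.
  have hdiv : DivFree fun x => G x - extN N h x := by
    intro φ hφ
    rw [integral_fderiv_periodic hN hw.2.1 hHp hφ]
    have hΦ := hφ.contDiff_periodize hN (fun _ => 1)
    have h1 := gradient_mem_perV hΦ fun k x => periodize_one_add N φ k x
    have h2 : inner ℝ (g - h) ((inner_gradient_toLp (N := N) hΦ).toLp _) = 0 :=
      (Submodule.sub_starProjection_mem_orthogonal (K := perV d N) g) _ h1 |> (by rw [real_inner_comm]; exact ·)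
    rw [L2.inner_def] at h2
    rw [← h2]
    refine integral_congr_ae ?_
    filter_upwards [MemLp.coeFn_toLp (inner_gradient_toLp (N := N) hΦ), hm.coeFn_toLp,
      Lp.coeFn_sub g h, extN_ae_eq hN h] with x a b c e
    rw [a, c, Pi.sub_apply, b, e, real_inner_comm, inner_gradient_eq]
  obtain ⟨c, hc⟩ := ae_eq_const_of_periodic hN hw.1 hwp (weaklyHarmonic_of_divFree hw hdiv)
  have h0 := ae_eq_zero_of_const_potential hw hc
  have : g = h := by
    refine Lp.ext ?_
    filter_upwards [ae_restrict_of_ae h0, hm.coeFn_toLp, extN_ae_eq hN h] with x a b c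
    rw [b, ← c]
    exact sub_eq_zero.1 a
  rw [this]
  exact hh

theorem isPeriodicSolution_extN {N : ℕ} (hN : 0 < N) {a : TensorField d}
    (ha : MemLp a ⊤ (volume.restrict (cube d N))) {F : E d → E d}
    (hF : MemLp F 2 (volume.restrict (cube d N))) {g : Lp (E d) 2 (volume.restrict (cube d N))}
    (hg : g ∈ perV d N) (h : ∀ v ∈ perV d N, inner ℝ (mulL _ a g + hF.toLp F) v = 0) :
    IsPeriodicSolution N a F (extN N g) := by
  obtain ⟨u, hu, hup⟩ := exists_periodic_potential hN hg
  refine ⟨u, hu, hup, fun φ h1 h2 => ?_⟩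
  rw [← h _ (gradient_mem_perV h1 h2), L2.inner_def]
  refine integral_congr_ae ?_
  filter_upwards [(inner_gradient_toLp (N := N) h1).coeFn_toLp, hF.coeFn_toLp, coeFn_mulL ha g,
    Lp.coeFn_add (mulL _ a g) (hF.toLp F), extN_ae_eq hN g] with x a1 a2 a3 a4 a5
  rw [a1, a4, Pi.add_apply, a2, a3, a5, real_inner_comm, inner_gradient_eq]

theorem IsPeriodicSolution.memLp {N : ℕ} {a : TensorField d} {F G : E d → E d}
    (h : IsPeriodicSolution N a F G) : MemLp G 2 (volume.restrict (cube d N)) := by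
  obtain ⟨u, hu, -⟩ := h
  exact LocL2.memLp_cube hu.2.1 N

theorem IsPeriodicSolution.isPeriodic {N : ℕ} {a : TensorField d} {F G : E d → E d}
    (h : IsPeriodicSolution N a F G) : IsPeriodic N G := by
  obtain ⟨u, hu, hp, -⟩ := h
  exact isPeriodic_of_weakGradient hu hp

theorem IsPeriodicSolution.locL2 {N : ℕ} {a : TensorField d} {F G : E d → E d}
    (h : IsPeriodicSolution N a F G) : LocL2 G := by
  obtain ⟨u, hu, -⟩ := h
  exact hu.2.1

theorem IsPeriodicSolution.toLp_mem {N : ℕ} (hN : 0 < N) {a : TensorField d} {F G : E d → E d}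
    (h : IsPeriodicSolution N a F G) : h.memLp.toLp G ∈ perV d N := by
  obtain ⟨u, hu, hp, -⟩ := id h
  exact toLp_mem_perV hN hu hp _

theorem IsPeriodicSolution.inner_eq {N : ℕ} {a : TensorField d}
    (ha : MemLp a ⊤ (volume.restrict (cube d N))) {F G : E d → E d}
    (hF : MemLp F 2 (volume.restrict (cube d N))) (h : IsPeriodicSolution N a F G)
    {v : Lp (E d) 2 (volume.restrict (cube d N))} (hv : v ∈ perV d N) :
    inner ℝ (mulL _ a (h.memLp.toLp G) + hF.toLp F) v = 0 := by
  set f := mulL _ a (h.memLp.toLp G) + hF.toLp F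
  have hcl : IsClosed {v : Lp (E d) 2 (volume.restrict (cube d N)) | inner ℝ f v = 0} :=
    isClosed_eq (by fun_prop) continuous_const
  have hv' : v ∈ closure (perGrads d N : Set (Lp (E d) 2 (volume.restrict (cube d N)))) := hv
  refine closure_minimal ?_ hcl hv'
  rintro w ⟨Φ, h1, h2, h3⟩
  obtain ⟨u, hu, hp, ht⟩ := id h
  change inner ℝ f w = 0
  rw [← ht Φ h1 h2, L2.inner_def]
  refine integral_congr_ae ?_
  filter_upwards [h3, hF.coeFn_toLp, coeFn_mulL ha (h.memLp.toLp G), h.memLp.coeFn_toLp,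
    Lp.coeFn_add (mulL _ a (h.memLp.toLp G)) (hF.toLp F)] with x a1 a2 a3 a4 a5
  rw [a1, a5, Pi.add_apply, a2, a3, a4, real_inner_comm, inner_gradient_eq]

/-- Uniqueness of periodic solutions. -/
theorem IsPeriodicSolution.toLp_eq {N : ℕ} (hN : 0 < N) {a : TensorField d}
    (ha : MemLp a ⊤ (volume.restrict (cube d N))) (hco : CoerciveOn (perV d N) (mulL _ a))
    {F G : E d → E d} (hF : MemLp F 2 (volume.restrict (cube d N)))
    (h : IsPeriodicSolution N a F G) :
    h.memLp.toLp G = solOp (perV d N) (mulL _ a) (hF.toLp F) :=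
  hco.eq_solOp (h.toLp_mem hN) fun _ hv => h.inner_eq ha hF hv

/-- The existence given by `solOp` ensures that the value of `Classical.epsilon` is a genuine
solution. -/
theorem isPeriodicSolution_periodicGrad {N : ℕ} (hN : 0 < N) {a : TensorField d}
    (ha : MemLp a ⊤ (volume.restrict (cube d N))) (hco : CoerciveOn (perV d N) (mulL _ a))
    {F : E d → E d} (hF : MemLp F 2 (volume.restrict (cube d N))) :
    IsPeriodicSolution N a F (periodicGrad N a F) :=
  Classical.epsilon_spec ⟨_, isPeriodicSolution_extN hN ha hF (solOp_mem (mulL _ a) (hF.toLp F))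
    fun _ hv => hco.inner_solOp _ hv⟩

theorem periodicGrad_ae_eq {N : ℕ} (hN : 0 < N) {a : TensorField d}
    (ha : MemLp a ⊤ (volume.restrict (cube d N))) (hco : CoerciveOn (perV d N) (mulL _ a))
    {F : E d → E d} (hF : MemLp F 2 (volume.restrict (cube d N))) :
    periodicGrad N a F =ᵐ[volume.restrict (cube d N)] solOp (perV d N) (mulL _ a) (hF.toLp F) := by
  have h := isPeriodicSolution_periodicGrad hN ha hco hF
  rw [← h.toLp_eq hN ha hco hF]
  exact h.memLp.coeFn_toLp.symm

/-- A periodic solution with periodic data solves the equation in the whole space. -/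
theorem IsPeriodicSolution.divFree {N : ℕ} (hN : 0 < N) {a : TensorField d} {F G : E d → E d}
    (h : IsPeriodicSolution N a F G) (ha : MemLp a ⊤ volume) (hap : IsPeriodic N a)
    (hF : LocL2 F) (hFp : IsPeriodic N F) : DivFree fun x => a x (G x) + F x := by
  intro φ hφ
  have hGp := h.isPeriodic
  have hp : IsPeriodic N fun x => a x (G x) + F x := fun k => by
    filter_upwards [hap k, hFp k, hGp k] with x h1 h2 h3
    rw [h1, h2, h3]
  rw [integral_fderiv_periodic hN ((h.locL2.mul ha).add hF) hp hφ]
  obtain ⟨u, hu, -, ht⟩ := h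
  exact ht _ (hφ.contDiff_periodize hN _) fun k x => periodize_one_add N φ k x

/-- The box |k_i| ≤ n is a complete system of residues modulo 2n+1. Centred remainders `Int.bmod`
realize the translation by m as a permutation of it. -/
theorem sum_cellsIn_shift {n : ℕ} {f : (Fin d → ℤ) → ℝ}
    (hf : ∀ k m : Fin d → ℤ, f (k + ((2 * n + 1 : ℕ) : ℤ) • m) = f k) (m : Fin d → ℤ) :
    ∑ k ∈ cellsIn d (2 * n + 1), f (k + m) = ∑ k ∈ cellsIn d (2 * n + 1), f k := by
  let r : (Fin d → ℤ) → (Fin d → ℤ) := fun k i => Int.bmod (k i) (2 * n + 1)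
  have hr : ∀ k, r k ∈ cellsIn d (2 * n + 1) := by
    intro k
    rw [mem_cellsIn_iff]
    intro i
    have h1 := Int.le_bmod (x := k i) (m := 2 * n + 1) (by omega)
    have h2 := Int.bmod_le (x := k i) (m := 2 * n + 1) (by omega)
    rw [abs_le]
    simp only [r]
    push_cast at h1 h2
    omega
  have hrf : ∀ k, f (r k) = f k := by
    intro k
    have : k = r k + ((2 * n + 1 : ℕ) : ℤ) • fun i => Int.bdiv (k i) (2 * n + 1) := by
      ext i
      simp only [r, Pi.add_apply, Pi.smul_apply, smul_eq_mul]
      exact (Int.bmod_add_bdiv (k i) (2 * n + 1)).symm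
    conv_rhs => rw [this, hf]
  have hid : ∀ k ∈ cellsIn d (2 * n + 1), ∀ p : Fin d → ℤ, r (r (k + p) - p) = k := by
    intro k hk p
    rw [mem_cellsIn_iff] at hk
    ext i
    have h1 := hk i
    rw [abs_le] at h1
    simp only [r, Pi.sub_apply, Pi.add_apply]
    rw [Int.bmod_sub_bmod, add_sub_cancel_right]
    exact Int.bmod_eq_of_le (by push_cast; omega) (by push_cast; omega)
  refine Finset.sum_nbij' (fun k => r (k + m)) (fun k => r (k - m)) (fun k _ => hr _)
    (fun k _ => hr _) (fun k hk => hid k hk m) (fun k hk => ?_) (fun k _ => (hrf _).symm)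
  have := hid k hk (-m)
  simpa [sub_eq_add_neg] using this

theorem integral_cube_eq_sum {n : ℕ} {f : E d → ℝ}
    (hf : IntegrableOn f (cube d (2 * n + 1))) :
    ∫ x in cube d (2 * n + 1), f x = ∑ k ∈ cellsIn d (2 * n + 1), ∫ x in cube d 1, f (x + lat k) := by
  have h0 : cube d (2 * n + 1) = ⋃ k ∈ cellsIn d (2 * n + 1), (cellN 1 k : Set (E d)) := by
    ext x
    rw [mem_cube_iff_cellIdx]
    simp [mem_cellN_iff]
  rw [h0] at hf ⊢
  rw [integral_biUnion_finset _ (fun k _ => measurableSet_cellN 1 k) ?_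
      fun k hk => hf.mono_set (subset_biUnion_of_mem (u := fun k => cellN 1 k) (by exact_mod_cast hk))]
  · refine Finset.sum_congr rfl fun k _ => ?_
    rw [← latShift_image_cube]
    have := (measurePreserving_latShift 1 k (d := d)).setIntegral_image_emb
      (latShift 1 k).measurableEmbedding f (cube d 1)
    simpa using this
  · intro k _ k' _ hkk
    refine Set.disjoint_left.2 fun x h1 h2 => hkk ?_
    rw [mem_cellN_iff one_pos] at h1 h2
    rw [← h1, h2]

theorem IsPeriodic.of_one {α : Type*} {f : E d → α} (h : IsPeriodic 1 f) (N : ℕ) :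
    IsPeriodic N f := by
  intro k
  have := h ((N : ℤ) • k)
  have e1 : ((1 : ℕ) : ℝ) • (lat ((N : ℤ) • k) : E d) = (N : ℝ) • lat k := by
    ext i; simp
  rw [e1] at this
  exact this

/-- A periodic solution with period `1` is a periodic solution with any odd period. -/
theorem IsPeriodicSolution.of_one {n : ℕ} {a : TensorField d} {F G : E d → E d}
    (h : IsPeriodicSolution 1 a F G) (ha : MemLp a ⊤ volume) (hap : IsPeriodic 1 a)
    (hF : LocL2 F) (hFp : IsPeriodic 1 F) : IsPeriodicSolution (2 * n + 1) a F G := by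
  have hloc : LocL2 fun x => a x (G x) + F x := (h.locL2.mul ha).add hF
  have hGp := h.isPeriodic
  obtain ⟨u, hu, hp, ht⟩ := h
  refine ⟨u, hu, hp.of_one _, fun φ h1 h2 => ?_⟩
  have hint : ∀ ψ : E d → ℝ, ContDiff ℝ ((⊤ : ℕ∞) : WithTop ℕ∞) ψ → ∀ N : ℕ,
      IntegrableOn (fun x => fderiv ℝ ψ x (a x (G x) + F x)) (cube d N) := by
    intro ψ hψ N
    have := integrable_inner_of_memLp (inner_gradient_toLp (N := N) hψ) (hloc.memLp_cube N)
    simp_rw [inner_gradient_eq] at this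
    exact this
  rw [integral_cube_eq_sum (hint φ h1 _)]
  have e1 : ∀ k : Fin d → ℤ, ∫ x in cube d 1, fderiv ℝ φ (x + lat k) (a (x + lat k) (G (x + lat k))
      + F (x + lat k)) = ∫ x in cube d 1, fderiv ℝ (fun y => φ (y + lat k)) x (a x (G x) + F x) := by
    intro k
    refine integral_congr_ae (ae_restrict_of_ae ?_)
    filter_upwards [hap k, hFp k, hGp k] with x b1 b2 b3
    simp only [Nat.cast_one, one_smul] at b1 b2 b3
    rw [b1, b2, b3, fderiv_comp_add_right]
  simp_rw [e1]
  have hs : ∀ k : Fin d → ℤ, ContDiff ℝ ((⊤ : ℕ∞) : WithTop ℕ∞) fun y : E d => φ (y + lat k) :=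
    fun k => h1.comp (by fun_prop)
  rw [← integral_finsetSum _ fun k _ => hint _ (hs k) 1]
  have e2 : ∀ x, ∑ k ∈ cellsIn d (2 * n + 1), fderiv ℝ (fun y => φ (y + lat k)) x (a x (G x) + F x) =
      fderiv ℝ (fun y => ∑ k ∈ cellsIn d (2 * n + 1), φ (y + lat k)) x (a x (G x) + F x) := by
    intro x
    rw [fderiv_fun_sum fun k _ => (hs k).differentiable (by simp) x, _root_.sum_apply]
  simp_rw [e2]
  -- Summing the translates of a (2n+1)-periodic test function over one supercell gives a 1-periodic
  -- function, which is admissible in the unit-cell problem.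
  refine ht _ (ContDiff.sum fun k _ => hs k) fun m x => ?_
  have e3 := sum_cellsIn_shift (n := n) (f := fun k => φ (x + lat k)) (fun k m' => by
    rw [lat_add, ← add_assoc]
    have := h2 m' (x + lat k)
    rw [← this]
    congr 2
    ext i; simp) m
  rw [← e3]
  refine Finset.sum_congr rfl fun k _ => ?_
  rw [lat_add, Nat.cast_one, one_smul, add_assoc, add_comm (lat k : E d)]

end PeriodicSolutions

end WeaklyRandom

namespace WeaklyRandom

/-! ### Decaying solutions -/

section Decaying

open scoped ENNReal

variable {d : ℕ}

/-- Bounded sequences of a Hilbert space converge weakly along ultrafilters. -/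
theorem exists_weak_limit {H : Type*} [NormedAddCommGroup H] [InnerProductSpace ℝ H]
    [CompleteSpace H] {ι : Type*} (𝒰 : Ultrafilter ι) {g : ι → H} {K : ℝ} (hg : ∀ i, ‖g i‖ ≤ K) :
    ∃ G : H, ∀ Z : H, Tendsto (fun i => (inner ℝ (g i) Z : ℝ)) 𝒰 (𝓝 (inner ℝ G Z)) := by
  let T : ι → WeakDual ℝ H := fun i => StrongDual.toWeakDual (innerSL ℝ (g i))
  have hc := WeakDual.isCompact_closedBall (𝕜 := ℝ) (E := H) 0 K
  obtain ⟨L, -, hL⟩ := hc.ultrafilter_le_nhds (𝒰.map T) (by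
    rw [le_principal_iff]
    refine Filter.mem_map.2 (Filter.univ_mem' fun i => ?_)
    simp only [T, mem_preimage, mem_closedBall_zero_iff]
    change ‖(innerSL ℝ) (g i)‖ ≤ K
    rw [innerSL_apply_norm]
    exact hg i)
  refine ⟨(InnerProductSpace.toDual ℝ H).symm (WeakDual.toStrongDual L), fun Z => ?_⟩
  have h1 : Tendsto T 𝒰 (𝓝 L) := hL
  have h2 := (WeakDual.eval_continuous (𝕜 := ℝ) Z).continuousAt.tendsto.comp h1
  rw [InnerProductSpace.toDual_symm_apply]
  exact h2

/-- The gradients of test functions. -/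
def decGrads (d : ℕ) : Submodule ℝ (Lp (E d) 2 (volume : Measure (E d))) where
  carrier := {g | ∃ φ : E d → ℝ, IsTest φ ∧ g =ᵐ[volume] gradient φ}
  add_mem' := by
    rintro f g ⟨Φ, h1, h3⟩ ⟨Ψ, k1, k3⟩
    refine ⟨Φ + Ψ, ⟨h1.1.add k1.1, h1.2.add k1.2⟩, ?_⟩
    filter_upwards [h3, k3, Lp.coeFn_add f g] with x a b c
    rw [c, Pi.add_apply, a, b]
    simp only [gradient]
    rw [fderiv_add (h1.1.differentiable (by simp) x) (k1.1.differentiable (by simp) x), map_add]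
  zero_mem' := by
    refine ⟨0, ⟨contDiff_const, HasCompactSupport.zero⟩, ?_⟩
    filter_upwards [Lp.coeFn_zero (E d) 2 (volume : Measure (E d))] with x hx
    rw [hx]
    simp [gradient]
  smul_mem' := by
    rintro c g ⟨Φ, h1, h3⟩
    refine ⟨c • Φ, ⟨h1.1.const_smul c, h1.2.smul_left (f := fun _ => c)⟩, ?_⟩
    filter_upwards [h3, Lp.coeFn_smul c g] with x a b
    rw [b, Pi.smul_apply, a]
    simp only [gradient]
    rw [fderiv_const_smul (h1.1.differentiable (by simp) x), map_smul]

/-- The space of square integrable gradients on `ℝ^d`. -/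
noncomputable def decV (d : ℕ) : Submodule ℝ (Lp (E d) 2 (volume : Measure (E d))) :=
  (decGrads d).topologicalClosure

noncomputable instance : (decV d).HasOrthogonalProjection := by
  have : CompleteSpace (decV d) :=
    (Submodule.isClosed_topologicalClosure _).completeSpace_coe
  infer_instance

theorem locL2_of_memLp {F : Type*} [NormedAddCommGroup F] {G : E d → F} (h : MemLp G 2 volume) :
    LocL2 G := fun _ _ => h.restrict _

theorem IsTest.memLp_gradient {φ : E d → ℝ} (hφ : IsTest φ) : MemLp (gradient φ) 2 volume := by
  refine (continuous_gradient hφ.1).memLp_of_hasCompactSupport ?_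
  refine (hφ.2.fderiv ℝ).mono fun x hx h => hx ?_
  rw [gradient, h, map_zero]

theorem IsTest.gradient_mem_decV {φ : E d → ℝ} (hφ : IsTest φ) :
    hφ.memLp_gradient.toLp _ ∈ decV d :=
  Submodule.le_topologicalClosure _ ⟨φ, hφ, MemLp.coeFn_toLp _⟩

theorem exists_decaying_potential {g : Lp (E d) 2 (volume : Measure (E d))} (hg : g ∈ decV d) :
    ∃ u : E d → ℝ, IsWeakGradient u g := by
  obtain ⟨w, hw, hwg⟩ := mem_closure_iff_seq_limit.1 hg
  choose Φ h1 h3 using hw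
  have h4 : Tendsto (fun n => eLpNorm (⇑(w n) - ⇑g) 2 volume) atTop (𝓝 0) :=
    (Lp.tendsto_Lp_iff_tendsto_eLpNorm' _ _).1 hwg
  obtain ⟨u, c, hu, -⟩ := exists_isWeakGradient_of_tendsto (fun n => (h1 n).1)
    (fun R => (Lp.memLp g).restrict _) fun R => by
      refine tendsto_of_tendsto_of_tendsto_of_le_of_le tendsto_const_nhds h4 (fun _ => zero_le)
        fun n => ?_
      rw [eLpNorm_congr_ae ((h3 n).sub (EventuallyEq.refl _ ⇑g))]
      exact eLpNorm_mono_measure _ Measure.restrict_le_self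
  exact ⟨u, hu⟩

theorem volume_closedBall_le (m : ℕ) :
    volume (Metric.closedBall (0 : E d) (m : ℝ)) ≤ ((2 * m + 1) ^ d : ℕ) * volume (cube d 1) := by
  have := lintegral_closedBall_le (d := d) one_pos m (h := fun _ => 1)
    fun k => Eventually.of_forall fun x => rfl
  simpa using this

/-- A square integrable harmonic function vanishes. -/
theorem ae_eq_zero_of_memLp {f : E d → ℝ} (hd : 0 < d) (hf : MemLp f 2 volume)
    (hh : WeaklyHarmonic f) : ∀ᵐ x, f x = 0 := by
  -- Positive dimension makes the total volume infinite, so a square integrable constant must be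
  -- zero.
  have : Nonempty (Fin d) := ⟨⟨0, hd⟩⟩
  have hsq : Integrable fun x => f x ^ 2 := hf.integrable_sq
  obtain ⟨c, hc⟩ := hh.ae_eq_const (locL2_of_memLp hf).locallyIntegrable (R := fun m => (m : ℝ))
    tendsto_natCast_atTop_atTop (by
      -- The growth condition of the Liouville theorem follows from |f| ≤ 1 + f²: the mass on a ball
      -- of radius m is at most its volume plus a constant.
      have h0 := (tendsto_card_div d).mul_const ((volume (cube d 1)).toReal + ∫ x, f x ^ 2)
      rw [zero_mul] at h0
      refine tendsto_of_tendsto_of_tendsto_of_le_of_le tendsto_const_nhds h0 (fun m => ?_)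
        fun m => ?_
      · exact mul_nonneg (by positivity) (integral_nonneg fun x => abs_nonneg _)
      · rw [mul_assoc]
        refine mul_le_mul_of_nonneg_left ?_ (by positivity)
        have hfin : volume (Metric.closedBall (0 : E d) (m : ℝ)) < ⊤ := measure_closedBall_lt_top
        have i1 : IntegrableOn (fun _ : E d => (1 : ℝ)) (Metric.closedBall 0 (m : ℝ)) :=
          integrableOn_const hfin.ne
        calc ∫ x in Metric.closedBall 0 (m : ℝ), |f x|
            ≤ ∫ x in Metric.closedBall 0 (m : ℝ), (1 + f x ^ 2) := by
              refine integral_mono_of_nonneg (Eventually.of_forall fun x => abs_nonneg _)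
                (i1.add hsq.integrableOn) (Eventually.of_forall fun x => ?_)
              simp only
              nlinarith [sq_abs (f x), sq_nonneg (|f x| - 1), abs_nonneg (f x)]
          _ = (volume (Metric.closedBall (0 : E d) (m : ℝ))).toReal
              + ∫ x in Metric.closedBall 0 (m : ℝ), f x ^ 2 := by
              rw [integral_add i1 hsq.integrableOn]
              simp [Measure.real]
          _ ≤ (2 * m + 1 : ℝ) ^ d * (volume (cube d 1)).toReal + (2 * m + 1 : ℝ) ^ d * ∫ x, f x ^ 2 := by
              have h2 := ENNReal.toReal_mono
                (ENNReal.mul_ne_top (ENNReal.natCast_ne_top _) (volume_cube_lt_top 1).ne)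
                (volume_closedBall_le (d := d) m)
              rw [ENNReal.toReal_mul, ENNReal.toReal_natCast] at h2
              have h3 : ∫ x in Metric.closedBall 0 (m : ℝ), f x ^ 2 ≤ ∫ x, f x ^ 2 :=
                setIntegral_le_integral hsq (Eventually.of_forall fun x => sq_nonneg _)
              have h4 : (1 : ℝ) ≤ (2 * m + 1 : ℝ) ^ d := one_le_pow₀ (by linarith [(Nat.cast_nonneg m : (0:ℝ) ≤ m)])
              have h5 : 0 ≤ ∫ x, f x ^ 2 := integral_nonneg fun x => sq_nonneg _
              push_cast at h2
              nlinarith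
          _ = _ := by ring)
  have h1 := (memLp_const_iff (by norm_num : (2 : ℝ≥0∞) ≠ 0) (by norm_num)).1 (hf.ae_eq hc)
  have h2 : volume (univ : Set (E d)) = ⊤ := by
    have : NoncompactSpace (E d) := NormedSpace.noncompactSpace ℝ (E d)
    exact measure_univ_of_isAddLeftInvariant volume
  rcases h1 with h1 | h1
  · filter_upwards [hc] with x hx
    rw [hx, h1]
  · exact absurd h2 h1.ne

/-- A square integrable curl-free field is a limit of gradients of test functions. -/
theorem toLp_mem_decV {G : E d → E d} (hm : MemLp G 2 volume) (hc : CurlFree G) :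
    hm.toLp G ∈ decV d := by
  set g := hm.toLp G
  set h := (decV d).starProjection g
  have hh : h ∈ decV d := Submodule.starProjection_apply_mem _ _
  obtain ⟨v, hv⟩ := exists_decaying_potential hh
  have hml := hm.sub (Lp.memLp h)
  have hloc : LocL2 fun x => G x - h x := locL2_of_memLp hml
  have hcurl : CurlFree fun x => G x - h x :=
    hc.sub (locL2_of_memLp hm) hv.2.1 (weakGradient_curlFree hv)
  have hdiv : DivFree fun x => G x - h x := by
    intro φ hφ
    have h2 : inner ℝ (g - h) (hφ.memLp_gradient.toLp _) = 0 :=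
      (Submodule.sub_starProjection_mem_orthogonal (K := decV d) g) _ hφ.gradient_mem_decV
        |> (by rw [real_inner_comm]; exact ·)
    rw [L2.inner_def] at h2
    rw [← h2]
    refine integral_congr_ae ?_
    filter_upwards [hφ.memLp_gradient.coeFn_toLp, hm.coeFn_toLp, Lp.coeFn_sub g h] with x a b c
    rw [a, c, Pi.sub_apply, b, real_inner_comm, inner_gradient_eq]
  -- Liouville is applied to the components of the field, which are square integrable, and not to a
  -- potential, whose growth is not controlled.
  have h0 : ∀ i : Fin d, ∀ᵐ x, inner ℝ (G x - h x) (e i) = 0 := fun i =>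
    ae_eq_zero_of_memLp (i.pos) (hml.inner_const (e i))
      (weaklyHarmonic_of_curlFree_divFree hloc hcurl hdiv (e i))
  have : g = h := by
    refine Lp.ext ?_
    filter_upwards [ae_all_iff.2 h0, hm.coeFn_toLp] with x a b
    rw [b]
    refine sub_eq_zero.1 ?_
    ext i
    rw [← inner_e, a i]; rfl
  rw [this]
  exact hh

theorem isDecayingSolution_of_mem {a : TensorField d} (ha : MemLp a ⊤ volume) {F : E d → E d}
    (hF : MemLp F 2 volume) {g : Lp (E d) 2 (volume : Measure (E d))} (hg : g ∈ decV d)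
    (h : ∀ v ∈ decV d, inner ℝ (mulL _ a g + hF.toLp F) v = 0) : IsDecayingSolution a F g := by
  refine ⟨exists_decaying_potential hg, Lp.memLp g, solvesInSpace_iff.2 fun φ hφ => ?_⟩
  rw [← h _ hφ.gradient_mem_decV, L2.inner_def]
  refine integral_congr_ae ?_
  filter_upwards [hφ.memLp_gradient.coeFn_toLp, hF.coeFn_toLp, coeFn_mulL ha g,
    Lp.coeFn_add (mulL _ a g) (hF.toLp F)] with x a1 a2 a3 a4
  rw [a1, a4, Pi.add_apply, a2, a3, real_inner_comm, inner_gradient_eq]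

/-- Uniqueness of decaying solutions. -/
theorem toLp_eq_of_decaying {a : TensorField d} (ha : MemLp a ⊤ volume)
    (hco : CoerciveOn (decV d) (mulL volume a)) {F G : E d → E d} (hF : MemLp F 2 volume)
    (hG : MemLp G 2 volume) (hc : CurlFree G) (hd : DivFree fun x => a x (G x) + F x) :
    hG.toLp G = solOp (decV d) (mulL _ a) (hF.toLp F) := by
  refine hco.eq_solOp (toLp_mem_decV hG hc) fun v hv => ?_
  set f := mulL _ a (hG.toLp G) + hF.toLp F
  have hcl : IsClosed {v : Lp (E d) 2 (volume : Measure (E d)) | inner ℝ f v = 0} :=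
    isClosed_eq (by fun_prop) continuous_const
  have hv' : v ∈ closure (decGrads d : Set (Lp (E d) 2 (volume : Measure (E d)))) := hv
  refine closure_minimal ?_ hcl hv'
  rintro w ⟨φ, h1, h3⟩
  change inner ℝ f w = 0
  rw [← hd φ h1, L2.inner_def]
  refine integral_congr_ae ?_
  filter_upwards [h3, hF.coeFn_toLp, coeFn_mulL ha (hG.toLp G), hG.coeFn_toLp,
    Lp.coeFn_add (mulL _ a (hG.toLp G)) (hF.toLp F)] with x a1 a2 a3 a4 a5
  rw [a1, a5, Pi.add_apply, a2, a3, a4, real_inner_comm, inner_gradient_eq]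

theorem isDecayingSolution_decayingGrad {a : TensorField d} (ha : MemLp a ⊤ volume)
    (hco : CoerciveOn (decV d) (mulL volume a)) {F : E d → E d} (hF : MemLp F 2 volume) :
    IsDecayingSolution a F (decayingGrad a F) :=
  Classical.epsilon_spec ⟨_, isDecayingSolution_of_mem ha hF (solOp_mem (mulL _ a) (hF.toLp F))
    fun _ hv => hco.inner_solOp _ hv⟩

/-- A curl-free square integrable solution is the decaying solution. -/
theorem ae_eq_decayingGrad {a : TensorField d} (ha : MemLp a ⊤ volume)
    (hco : CoerciveOn (decV d) (mulL volume a)) {F G : E d → E d} (hF : MemLp F 2 volume)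
    (hG : MemLp G 2 volume) (hc : CurlFree G) (hd : DivFree fun x => a x (G x) + F x) :
    G =ᵐ[volume] decayingGrad a F := by
  obtain ⟨⟨u, hu⟩, h1, h2⟩ := isDecayingSolution_decayingGrad ha hco hF
  have h3 := toLp_eq_of_decaying ha hco hF hG hc hd
  rw [← toLp_eq_of_decaying ha hco hF h1 (weakGradient_curlFree hu) (solvesInSpace_iff.1 h2)] at h3
  exact (MemLp.toLp_eq_toLp_iff _ _).1 h3

theorem IsCompact.exists_subset_cube {K : Set (E d)} (hK : IsCompact K) :
    ∃ n₀ : ℕ, ∀ n ≥ n₀, K ⊆ cube d (2 * n + 1) := by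
  obtain ⟨n, -, hn⟩ := hK.exists_subset_closedBall_nat
  refine ⟨n, fun n' hn' x hx i => ?_⟩
  have h1 := mem_closedBall_zero_iff.1 (hn hx)
  have h2 := abs_le.1 ((abs_apply_le_norm x i).trans h1)
  have h3 : (n : ℝ) ≤ n' := by exact_mod_cast hn'
  push_cast
  constructor <;> linarith [h2.1, h2.2]

theorem setIntegral_cube_eq {K : Set (E d)} {N : ℕ} (h : K ⊆ cube d N) {f : E d → ℝ}
    (hf : ∀ x ∉ K, f x = 0) : ∫ x in cube d N, f x = ∫ x, f x :=
  (setIntegral_eq_of_support fun x hx => hf x fun hk => hx (h hk)).symm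

/-- On a large period, the periodic solution converges weakly to the decaying one. -/
theorem tendsto_periodicGrad {a : TensorField d} (ha : MemLp a ⊤ volume) {α : ℝ} (hα : 0 < α)
    (hco : ∀ᵐ x : E d, ∀ ξ : E d, α * ‖ξ‖ ^ 2 ≤ inner ℝ (a x ξ) ξ) {F Z : E d → E d}
    (hF : MemLp F 2 volume) (hZ : MemLp Z 2 volume) :
    Tendsto (fun n : ℕ => ∫ x in cube d (2 * n + 1), inner ℝ (periodicGrad (2 * n + 1) a F x) (Z x))
      atTop (𝓝 (∫ x, inner ℝ (decayingGrad a F x) (Z x))) := by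
  have hcoN : ∀ N, CoerciveOn (perV d N) (mulL _ a) := fun N =>
    ⟨α, hα, fun v _ => coercive_mulL (ha.restrict _) (ae_restrict_of_ae hco) v⟩
  have hcoD : CoerciveOn (decV d) (mulL volume a) := ⟨α, hα, fun v _ => coercive_mulL ha hco v⟩
  have hsol : ∀ n : ℕ, IsPeriodicSolution (2 * n + 1) a F (periodicGrad (2 * n + 1) a F) := fun n =>
    isPeriodicSolution_periodicGrad (by omega) (ha.restrict _) (hcoN _) (hF.restrict _)
  set t : ℕ → E d → E d := fun n => periodicGrad (2 * n + 1) a F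
  have hti : ∀ n, MemLp ((cube d (2 * n + 1)).indicator (t n)) 2 volume := fun n =>
    (memLp_indicator_iff_restrict (measurableSet_cube _)).2 (hsol n).memLp
  let g : ℕ → Lp (E d) 2 (volume : Measure (E d)) := fun n => (hti n).toLp _
  have hgi : ∀ n {Y : E d → E d} (hY : MemLp Y 2 volume),
      inner ℝ (g n) (hY.toLp Y) = ∫ x in cube d (2 * n + 1), inner ℝ (t n x) (Y x) := by
    intro n Y hY
    rw [inner_toLp, ← integral_indicator (measurableSet_cube _)]
    congr 1
    ext x
    by_cases hx : x ∈ cube d (2 * n + 1) <;> simp [hx]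
  -- The energy bound does not see the period, so the truncated gradients stay bounded in L²(ℝ^d).
  have hgb : ∀ n, ‖g n‖ ≤ α⁻¹ * ‖hF.toLp F‖ := by
    intro n
    have h1 : ‖g n‖ = ‖(hsol n).memLp.toLp (t n)‖ := by
      rw [Lp.norm_toLp, Lp.norm_toLp, eLpNorm_indicator_eq_eLpNorm_restrict (measurableSet_cube _)]
    rw [h1, (hsol n).toLp_eq (by omega) (ha.restrict _) (hcoN _) (hF.restrict _)]
    refine (norm_solOp_le hα (fun v _ => coercive_mulL (ha.restrict _) (ae_restrict_of_ae hco) v)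
      _).trans ?_
    refine mul_le_mul_of_nonneg_left ?_ (by positivity)
    rw [Lp.norm_toLp, Lp.norm_toLp]
    exact ENNReal.toReal_mono hF.2.ne (eLpNorm_mono_measure _ Measure.restrict_le_self)
  -- Along each ultrafilter a weak limit exists. It is identified as the decaying solution, so all
  -- these limits coincide and the sequence itself converges.
  rw [tendsto_iff_ultrafilter]
  intro 𝒰 h𝒰
  obtain ⟨G, hG⟩ := exists_weak_limit 𝒰 hgb
  -- Truncation to the cube creates jumps on its boundary, but a compactly supported test function
  -- does not see them once the cube contains its support.
  have hcurl : CurlFree G := by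
    intro φ hφ v w
    have hv := (hφ.fderiv_apply v)
    have hw := (hφ.fderiv_apply w)
    let Y : E d → E d := fun x => fderiv ℝ φ x w • v - fderiv ℝ φ x v • w
    have hY : MemLp Y 2 volume := by
      refine Continuous.memLp_of_hasCompactSupport ?_ ?_
      · exact (hw.1.continuous.smul continuous_const).sub (hv.1.continuous.smul continuous_const)
      · exact (hw.2.smul_right (f' := fun _ => v)).sub (hv.2.smul_right (f' := fun _ => w))
    have hin : ∀ (X : E d → E d), LocL2 X → ∫ x, inner ℝ (X x) (Y x) =
        (∫ x, inner ℝ (X x) v * fderiv ℝ φ x w) - ∫ x, inner ℝ (X x) w * fderiv ℝ φ x v := by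
      intro X hX
      rw [← integral_sub (hw.integrable_inner hX v) (hv.integrable_inner hX w)]
      congr 1
      ext x
      simp only [Y, inner_sub_right, inner_smul_right]
      ring
    have h1 := hG (hY.toLp Y)
    obtain ⟨n₀, hn₀⟩ := IsCompact.exists_subset_cube hφ.2.isCompact
    have h2 : ∀ᶠ n in (𝒰 : Filter ℕ), (inner ℝ (g n) (hY.toLp Y) : ℝ) = 0 := by
      filter_upwards [h𝒰 (eventually_ge_atTop n₀)] with n hn
      rw [hgi, setIntegral_cube_eq (hn₀ n hn), hin _ (hsol n).locL2, sub_eq_zero]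
      · obtain ⟨u, hu, -⟩ := hsol n
        exact weakGradient_curlFree hu φ hφ v w
      · intro x hx
        simp [Y, fderiv_extend hx]
    have h3 := tendsto_nhds_unique h1 ((tendsto_congr' h2).2 tendsto_const_nhds)
    rw [L2.inner_def, integral_congr_ae (g := fun x => inner ℝ (G x) (Y x)),
      hin _ (locL2_of_memLp (Lp.memLp G)), sub_eq_zero] at h3
    · exact h3
    · filter_upwards [hY.coeFn_toLp] with x hx
      rw [hx]
  have hdiv : DivFree fun x => a x (G x) + F x := by
    intro φ hφ
    have hadj := memLp_adjoint ha
    have hY := memLp_mul hadj hφ.memLp_gradient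
    have h1 := hG (hY.toLp _)
    have hi2 := hφ.integrable_fderiv (locL2_of_memLp hF)
    have hin : ∀ X : E d → E d, LocL2 X →
        ∫ x, fderiv ℝ φ x (a x (X x) + F x) = (∫ x, inner ℝ (X x)
          (ContinuousLinearMap.adjoint (a x) (gradient φ x))) + ∫ x, fderiv ℝ φ x (F x) := by
      intro X hX
      have hi1 := hφ.integrable_fderiv (hX.mul ha)
      simp_rw [map_add]
      rw [integral_add hi1 hi2]
      congr 2
      ext x
      rw [ContinuousLinearMap.adjoint_inner_right, real_inner_comm, inner_gradient_eq]
    obtain ⟨n₀, hn₀⟩ := IsCompact.exists_subset_cube hφ.2.isCompact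
    have h2 : ∀ᶠ n in (𝒰 : Filter ℕ), (inner ℝ (g n) (hY.toLp _) : ℝ) =
        - ∫ x, fderiv ℝ φ x (F x) := by
      filter_upwards [h𝒰 (eventually_ge_atTop n₀)] with n hn
      rw [hgi, setIntegral_cube_eq (hn₀ n hn), eq_neg_iff_add_eq_zero, ← hin _ (hsol n).locL2]
      · have hN : 0 < 2 * n + 1 := by omega
        -- `F` is not periodic, so the flux is first extended periodically from the cube. On the
        -- support of φ nothing changes, and the equation on the torus may be tested with the
        -- periodized φ.
        let X : E d → E d := fun x => a x (t n x) + F x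
        have hX : LocL2 X := ((hsol n).locL2.mul ha).add (locL2_of_memLp hF)
        have hXl := hX.memLp_cube (2 * n + 1)
        let x' := hXl.toLp X
        have hex : extN (2 * n + 1) x' =ᵐ[volume.restrict (cube d (2 * n + 1))] X :=
          (extN_ae_eq hN _).trans hXl.coeFn_toLp
        have h4 := integral_fderiv_periodic hN (locL2_extN hN (Lp.stronglyMeasurable x')
          (Lp.memLp x')) (isPeriodic_extN hN x') hφ
        have h5 : ∀ ψ : E d → ℝ, ∫ x in cube d (2 * n + 1), fderiv ℝ ψ x (extN (2 * n + 1) x' x) =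
            ∫ x in cube d (2 * n + 1), fderiv ℝ ψ x (X x) := by
          intro ψ
          refine integral_congr_ae ?_
          filter_upwards [hex] with x hx
          rw [hx]
        rw [← setIntegral_cube_eq (hn₀ n hn) fun x hx => fderiv_extend hx _] at h4
        rw [h5, h5] at h4
        change ∫ x, fderiv ℝ φ x (X x) = 0
        rw [← setIntegral_cube_eq (hn₀ n hn) fun x hx => fderiv_extend hx _, h4]
        obtain ⟨u, hu, -, ht⟩ := hsol n
        exact ht _ (hφ.contDiff_periodize hN _) fun k x => periodize_one_add _ φ k x
      · intro x hx
        rw [ContinuousLinearMap.adjoint_inner_right, real_inner_comm, inner_gradient_eq,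
          fderiv_extend hx]
    have h3 := tendsto_nhds_unique h1 ((tendsto_congr' h2).2 tendsto_const_nhds)
    rw [hin _ (locL2_of_memLp (Lp.memLp G)), ← eq_neg_iff_add_eq_zero, ← h3, L2.inner_def]
    refine integral_congr_ae ?_
    filter_upwards [hY.coeFn_toLp] with x hx
    rw [hx]
  have hGt := ae_eq_decayingGrad ha hcoD hF (Lp.memLp G) hcurl hdiv
  have h1 := hG (hZ.toLp Z)
  simp_rw [hgi] at h1
  convert h1 using 2
  rw [L2.inner_def]
  refine integral_congr_ae ?_
  filter_upwards [hGt, hZ.coeFn_toLp] with x a1 a2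
  rw [a1, a2]

end Decaying

end WeaklyRandom

namespace WeaklyRandom

/-! ### Stationary fields -/

section StationaryFields

set_option linter.unusedSectionVars false

open scoped ENNReal

variable {d : ℕ} {Ω : Type*} [MeasurableSpace Ω]

/-- The measure of `Q × Ω`. -/
noncomputable abbrev cellMeasure (d : ℕ) (P : Measure Ω) : Measure (E d × Ω) :=
  (volume.restrict (cube d 1)).prod P

theorem cellMeasure_eq (P : Measure Ω) [SFinite P] :
    cellMeasure d P = (volume.prod P).restrict (cube d 1 ×ˢ univ) := by
  rw [cellMeasure, ← Measure.prod_restrict, Measure.restrict_univ]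

theorem volume_cube_one : volume (cube d 1) = 1 := by
  have h : cube d 1 = (MeasurableEquiv.toLp 2 (Fin d → ℝ)).symm ⁻¹'
      (univ.pi fun _ : Fin d => Ico (-(1 / 2 : ℝ)) (1 / 2)) := by
    ext x
    simp [cube]
  rw [h, (EuclideanSpace.volume_preserving_symm_measurableEquiv_toLp (Fin d)).measure_preimage
    (MeasurableSet.univ_pi fun _ => measurableSet_Ico).nullMeasurableSet, volume_pi_pi]
  simp
  norm_num

instance : IsProbabilityMeasure ((volume : Measure (E d)).restrict (cube d 1)) :=
  ⟨by rw [Measure.restrict_apply_univ, volume_cube_one]⟩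

/-- Fubini for almost everywhere statements, second variable first. -/
theorem ae_ae_swap {X Y : Type*} [MeasurableSpace X] [MeasurableSpace Y] {μ : Measure X}
    {ν : Measure Y} [SFinite μ] [SFinite ν] {p : X × Y → Prop} (h : ∀ᵐ z ∂μ.prod ν, p z) :
    ∀ᵐ y ∂ν, ∀ᵐ x ∂μ, p (x, y) :=
  Measure.ae_ae_of_ae_prod (p := fun z : Y × X => p z.swap)
    (Measure.measurePreserving_swap.quasiMeasurePreserving.ae h)

variable [AddAction (Fin d → ℤ) Ω]

/-- The reduction of `(x, ω)` to the unit cell. -/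
noncomputable def foldMap (p : E d × Ω) : E d × Ω := (red 1 p.1, cellIdx 1 p.1 +ᵥ p.2)

/-- The stationary extension of a function on `Q × Ω`. -/
noncomputable def stExt {F : Type*} (g : E d × Ω → F) (p : E d × Ω) : F := g (foldMap p)

theorem foldMap_add (x : E d) (k : Fin d → ℤ) (ω : Ω) :
    foldMap (x + lat k, ω) = foldMap (x, k +ᵥ ω) := by
  have h1 := red_add one_pos x k
  have h2 := cellIdx_add one_pos x k
  simp only [Nat.cast_one, one_smul] at h1 h2
  rw [foldMap, foldMap, h1, h2, add_vadd]

theorem stExt_add {F : Type*} (g : E d × Ω → F) (x : E d) (k : Fin d → ℤ) (ω : Ω) :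
    stExt g (x + lat k, ω) = stExt g (x, k +ᵥ ω) := by
  rw [stExt, foldMap_add, stExt]

theorem foldMap_of_mem {x : E d} (hx : x ∈ cube d 1) (ω : Ω) : foldMap (x, ω) = (x, ω) := by
  rw [foldMap, red_of_mem one_pos hx, (mem_cube_iff one_pos).1 hx, zero_vadd]

theorem stExt_of_mem {F : Type*} (g : E d × Ω → F) {x : E d} (hx : x ∈ cube d 1) (ω : Ω) :
    stExt g (x, ω) = g (x, ω) := by
  rw [stExt, foldMap_of_mem hx]

theorem ae_cellMeasure_mem (P : Measure Ω) [SFinite P] : ∀ᵐ p ∂(cellMeasure d P), p.1 ∈ cube d 1 :=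
  Measure.quasiMeasurePreserving_fst.ae (ae_restrict_mem (measurableSet_cube 1))

theorem stExt_ae_eq {F : Type*} (P : Measure Ω) [SFinite P] (g : E d × Ω → F) :
    stExt g =ᵐ[cellMeasure d P] g := by
  filter_upwards [ae_cellMeasure_mem P] with p hp
  exact stExt_of_mem g hp p.2

variable [MeasurableConstVAdd (Fin d → ℤ) Ω]

theorem measurable_foldMap : Measurable (foldMap : E d × Ω → E d × Ω) := by
  have h : Measurable fun q : (Fin d → ℤ) × Ω => q.1 +ᵥ q.2 :=
    measurable_from_prod_countable_right fun k => measurable_const_vadd k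
  exact ((measurable_red 1).comp measurable_fst).prodMk
    (h.comp (((measurable_cellIdx 1).comp measurable_fst).prodMk measurable_snd))

/-- The simultaneous shift of space and of the environment. -/
def stShift (k : Fin d → ℤ) : E d × Ω ≃ᵐ E d × Ω :=
  (latShift 1 k).prodCongr (MeasurableEquiv.vadd (-k))

@[simp] theorem stShift_apply (k : Fin d → ℤ) (x : E d) (ω : Ω) :
    stShift k (x, ω) = (x + lat k, -k +ᵥ ω) := by
  simp [stShift, MeasurableEquiv.prodCongr, MeasurableEquiv.vadd, Prod.map]

/-- Stationarity is invariance under the joint shift (x, ω) ↦ (x + k, τ_{-k} ω), for which Q × Ω is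
a fundamental domain. Stationary fields can thus be handled like periodic ones with `stShift` in
place of lattice translations. -/
theorem stExt_stShift {F : Type*} (g : E d × Ω → F) (k : Fin d → ℤ) (p : E d × Ω) :
    stExt g (stShift k p) = stExt g p := by
  obtain ⟨x, ω⟩ := p
  rw [stShift_apply, stExt_add, vadd_vadd, add_neg_cancel, zero_vadd]

variable {P : Measure Ω} [IsProbabilityMeasure P] [VAddInvariantMeasure (Fin d → ℤ) Ω P]

variable (P) in
theorem measurePreserving_stShift (k : Fin d → ℤ) :
    MeasurePreserving (stShift k) ((volume : Measure (E d)).prod P) (volume.prod P) :=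
  (measurePreserving_latShift 1 k).prod (measurePreserving_vadd (-k) P)

/-- A property holds almost everywhere if all its shifts hold almost everywhere on `Q × Ω`. -/
theorem ae_of_forall_stShift {p : E d × Ω → Prop}
    (h : ∀ k : Fin d → ℤ, ∀ᵐ q ∂(cellMeasure d P), p (stShift k q)) :
    ∀ᵐ q ∂((volume : Measure (E d)).prod P), p q := by
  have h1 : ∀ k : Fin d → ℤ, ∀ᵐ q ∂((volume : Measure (E d)).prod P), cellIdx 1 q.1 = k → p q := by
    intro k
    have h2 := h k
    rw [cellMeasure_eq, ae_restrict_iff' ((measurableSet_cube 1).prod MeasurableSet.univ)] at h2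
    have h3 := (measurePreserving_stShift P (-k) (d := d)).quasiMeasurePreserving.ae h2
    filter_upwards [h3] with q hq hk
    obtain ⟨x, ω⟩ := q
    have hx : x + lat (-k) ∈ cube d 1 := by
      have := mem_cell_iff.2 hk
      rw [lat_neg, ← sub_eq_add_neg]
      exact this
    rw [stShift_apply] at hq
    have := hq ⟨hx, mem_univ _⟩
    rwa [stShift_apply, add_assoc, ← lat_add, neg_add_cancel, lat_zero, add_zero, vadd_vadd,
      neg_neg, neg_add_cancel, zero_vadd] at this
  filter_upwards [ae_all_iff.2 h1] with q hq
  exact hq _ rfl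

theorem foldMap_stShift (k : Fin d → ℤ) (p : E d × Ω) : foldMap (stShift k p) = foldMap p := by
  obtain ⟨x, ω⟩ := p
  rw [stShift_apply, foldMap_add, vadd_vadd, add_neg_cancel, zero_vadd]

variable (P) in
-- Null sets of Q × Ω pull back to null sets of ℝ^d × Ω, so `stExt` respects almost everywhere
-- equality.
theorem quasiMeasurePreserving_foldMap : Measure.QuasiMeasurePreserving (foldMap : E d × Ω → E d × Ω)
    ((volume : Measure (E d)).prod P) (cellMeasure d P) := by
  refine ⟨measurable_foldMap, Measure.AbsolutelyContinuous.mk fun s hs h0 => ?_⟩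
  rw [Measure.map_apply measurable_foldMap hs, measure_eq_zero_iff_ae_notMem]
  refine ae_of_forall_stShift fun k => ?_
  rw [measure_eq_zero_iff_ae_notMem] at h0
  filter_upwards [h0, ae_cellMeasure_mem P] with q hq hm
  rw [mem_preimage, foldMap_stShift]
  rwa [show foldMap q = q from foldMap_of_mem hm q.2]

/-- A stationary field is the extension of its restriction to `Q × Ω`. -/
theorem ae_eq_stExt {F : Type*} {H : E d × Ω → F} {g : E d × Ω → F}
    (hs : ∀ k : Fin d → ℤ, ∀ᵐ p ∂((volume : Measure (E d)).prod P),
      H (p.1 + lat k, p.2) = H (p.1, k +ᵥ p.2)) (h : H =ᵐ[cellMeasure d P] g) :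
    H =ᵐ[(volume : Measure (E d)).prod P] stExt g := by
  refine ae_of_forall_stShift fun k => ?_
  have h1 := ((MeasurePreserving.id (volume : Measure (E d))).prod
    (measurePreserving_vadd (-k) P)).quasiMeasurePreserving.ae (hs k)
  have h2 : cellMeasure d P ≪ (volume : Measure (E d)).prod P := by
    rw [cellMeasure_eq]
    exact Measure.restrict_le_self.absolutelyContinuous
  filter_upwards [h2.ae_le h1, h, ae_cellMeasure_mem P] with q hq hg hm
  obtain ⟨x, ω⟩ := q
  simp only [Prod.map, id] at hq
  rw [stShift_apply, hq, stExt, foldMap_add, vadd_vadd, add_neg_cancel, zero_vadd, hg,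
    foldMap_of_mem hm]

theorem lintegral_stExt_le (h : E d × Ω → ℝ≥0∞) (m : ℕ) :
    ∫⁻ p in Metric.closedBall 0 (m : ℝ) ×ˢ univ, stExt h p ∂((volume : Measure (E d)).prod P) ≤
      ((2 * m + 1) ^ d : ℕ) * ∫⁻ p, h p ∂(cellMeasure d P) := by
  rw [← lintegral_congr_ae (stExt_ae_eq P h), cellMeasure_eq, ← card_cellsIn]
  refine lintegral_le_card_mul (σ := stShift) (measurePreserving_stShift P)
    (fun k => Eventually.of_forall fun p => stExt_stShift h k p) fun p hp => ?_
  obtain ⟨x, ω⟩ := p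
  refine ⟨cellIdx 1 x, closedBall_subset_cellN one_pos m hp.1,
    ⟨(red 1 x, cellIdx 1 x +ᵥ ω), ⟨red_mem one_pos x, mem_univ _⟩, ?_⟩⟩
  rw [stShift_apply, vadd_vadd, neg_add_cancel, zero_vadd, red]
  simp

theorem stronglyMeasurable_stExt {F : Type*} [TopologicalSpace F] {g : E d × Ω → F}
    (hg : StronglyMeasurable g) : StronglyMeasurable (stExt g) :=
  hg.comp_measurable measurable_foldMap

theorem memLp_stExt {F : Type*} [NormedAddCommGroup F] {g : E d × Ω → F}
    (hg : StronglyMeasurable g) (h2 : MemLp g 2 (cellMeasure d P)) (m : ℕ) :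
    MemLp (stExt g) 2 (((volume : Measure (E d)).restrict (Metric.closedBall 0 (m : ℝ))).prod P) := by
  refine ⟨(stronglyMeasurable_stExt hg).aestronglyMeasurable, ?_⟩
  have h1 : eLpNorm (stExt g) 2 (((volume : Measure (E d)).restrict
      (Metric.closedBall 0 (m : ℝ))).prod P) ^ 2 < ⊤ := by
    rw [eLpNorm_two_sq, ← Measure.restrict_univ (μ := P), Measure.prod_restrict]
    refine (lintegral_stExt_le (fun p => ‖g p‖ₑ ^ 2) m).trans_lt ?_
    rw [← eLpNorm_two_sq]
    exact ENNReal.mul_lt_top (ENNReal.natCast_lt_top _) (ENNReal.pow_lt_top h2.2)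
  simpa using h1

theorem ae_memLp_slice {X Y F : Type*} [MeasurableSpace X] [MeasurableSpace Y]
    [NormedAddCommGroup F] {μ : Measure X} {ν : Measure Y} [SFinite μ] [SFinite ν] {f : X × Y → F}
    (hf : StronglyMeasurable f) (h : MemLp f 2 (μ.prod ν)) :
    ∀ᵐ y ∂ν, MemLp (fun x => f (x, y)) 2 μ := by
  have h1 : ∫⁻ p, ‖f p‖ₑ ^ 2 ∂(μ.prod ν) ≠ ⊤ := by
    rw [← eLpNorm_two_sq]
    exact (ENNReal.pow_lt_top h.2).ne
  have hm : Measurable fun p => ‖f p‖ₑ ^ 2 := hf.enorm.pow_const 2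
  rw [lintegral_prod_symm _ hm.aemeasurable] at h1
  filter_upwards [ae_lt_top hm.lintegral_prod_left' h1] with y hy
  refine ⟨(hf.comp_measurable measurable_prodMk_right).aestronglyMeasurable, ?_⟩
  rw [← eLpNorm_two_sq] at hy
  simpa using hy

theorem ae_locL2_stExt {F : Type*} [NormedAddCommGroup F] {g : E d × Ω → F}
    (hg : StronglyMeasurable g) (h2 : MemLp g 2 (cellMeasure d P)) :
    ∀ᵐ ω ∂P, LocL2 fun x => stExt g (x, ω) := by
  have h : ∀ m : ℕ, ∀ᵐ ω ∂P,
      MemLp (fun x => stExt g (x, ω)) 2 (volume.restrict (Metric.closedBall 0 (m : ℝ))) := fun m =>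
    ae_memLp_slice (stronglyMeasurable_stExt hg) (memLp_stExt hg h2 m)
  filter_upwards [ae_all_iff.2 h] with ω hω
  exact locL2_of_closedBall hω

omit [AddAction (Fin d → ℤ) Ω] [MeasurableConstVAdd (Fin d → ℤ) Ω] [IsProbabilityMeasure P]
  [VAddInvariantMeasure (Fin d → ℤ) Ω P] in
-- Borel–Cantelli in L¹ form: a series with finite expectation is almost surely finite, so its terms
-- tend to zero. It replaces an extraction of subsequences and also the ergodic theorem.
theorem ae_tendsto_zero_of_tsum {f : ℕ → Ω → ℝ≥0∞} (hf : ∀ n, Measurable (f n))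
    (h : ∑' n, ∫⁻ ω, f n ω ∂P ≠ ⊤) : ∀ᵐ ω ∂P, Tendsto (fun n => f n ω) atTop (𝓝 0) := by
  rw [← lintegral_tsum fun n => (hf n).aemeasurable] at h
  filter_upwards [ae_lt_top (Measurable.tsum hf) h] with ω hω
  exact ENNReal.tendsto_atTop_zero_of_tsum_ne_top hω.ne

theorem setLIntegral_prod_univ (h : E d × Ω → ℝ≥0∞) (hm : Measurable h) (S : Set (E d)) :
    ∫⁻ p in S ×ˢ univ, h p ∂((volume : Measure (E d)).prod P) = ∫⁻ ω, (∫⁻ x in S, h (x, ω)) ∂P := by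
  rw [← Measure.prod_restrict, Measure.restrict_univ, lintegral_prod_symm _ hm.aemeasurable]

end StationaryFields

end WeaklyRandom

namespace WeaklyRandom

/-! ### Stationary gradients -/

section StationaryGradients

set_option linter.unusedSectionVars false

open scoped ENNReal

variable {d : ℕ} {Ω : Type*} [MeasurableSpace Ω] [AddAction (Fin d → ℤ) Ω]

/-- The weights `1_s(τ_{-k} ω)`. -/
noncomputable def weight (s : Set Ω) (ω : Ω) (k : Fin d → ℤ) : ℝ :=
  s.indicator (fun _ => (1 : ℝ)) (-k +ᵥ ω)

/-- The stationary gradient field `∇ ∑_k 1_s(τ_{-k} ω) φ(x + k)`. -/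
noncomputable def stGen (s : Set Ω) (φ : E d → ℝ) (p : E d × Ω) : E d :=
  gradient (periodize 1 (weight s p.2) φ) p.1

theorem stGen_add (s : Set Ω) (φ : E d → ℝ) (x : E d) (k : Fin d → ℤ) (ω : Ω) :
    stGen s φ (x + lat k, ω) = stGen s φ (x, k +ᵥ ω) := by
  have h1 : (fun y => periodize 1 (weight s ω) φ (y + lat k)) =
      periodize 1 (weight s (k +ᵥ ω)) φ := by
    ext y
    have := periodize_add 1 (weight s ω) φ y k
    rw [Nat.cast_one, one_smul] at this
    rw [this]
    congr 1
    ext j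
    rw [weight, weight, vadd_vadd, neg_sub, sub_eq_neg_add]
  simp only [stGen, gradient]
  rw [← h1, fderiv_comp_add_right]

theorem abs_weight_le (s : Set Ω) (ω : Ω) (k : Fin d → ℤ) : |weight s ω k| ≤ 1 := by
  rw [weight]
  by_cases h : -k +ᵥ ω ∈ s <;> simp [h]

variable [MeasurableConstVAdd (Fin d → ℤ) Ω] {P : Measure Ω} [IsProbabilityMeasure P]

theorem measurable_weight {s : Set Ω} (hs : MeasurableSet s) (k : Fin d → ℤ) :
    Measurable fun ω => weight s ω k :=
  (measurable_const.indicator hs).comp (measurable_const_vadd (-k))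

theorem IsTest.stGen_eq {φ : E d → ℝ} (hφ : IsTest φ) : ∃ m : ℕ,
    (∀ x, x ∈ tsupport φ → cellIdx 1 x ∈ cellsIn d (2 * m + 1)) ∧
    ∀ (s : Set Ω) (p : E d × Ω), p.1 ∈ cube d 1 →
      stGen s φ p = ∑ k ∈ cellsIn d (2 * m + 1), weight s p.2 k • gradient φ (p.1 + lat k) := by
  obtain ⟨m, h1, h2, -⟩ := hφ.integral_unfold one_pos
  refine ⟨m, h2, fun s p hp => ?_⟩
  rw [stGen, gradient, h1 _ _ hp, map_sum]
  simp only [Nat.cast_one, one_smul, map_smul, gradient]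

theorem IsTest.exists_gradient_bound {φ : E d → ℝ} (hφ : IsTest φ) :
    ∃ C : ℝ, 0 ≤ C ∧ ∀ x, ‖gradient φ x‖ ≤ C := by
  obtain ⟨C, hC⟩ := (hφ.2.fderiv ℝ).exists_bound_of_continuous (hφ.1.continuous_fderiv (by simp))
  refine ⟨C, (norm_nonneg _).trans (hC 0), fun x => ?_⟩
  rw [norm_gradient_eq]
  exact hC x

variable (P) in
theorem IsTest.memLp_stGen {φ : E d → ℝ} (hφ : IsTest φ) {s : Set Ω} (hs : MeasurableSet s) :
    MemLp (stGen s φ) 2 (cellMeasure d P) := by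
  obtain ⟨m, -, hm⟩ := hφ.stGen_eq (Ω := Ω)
  obtain ⟨C, hC0, hC⟩ := hφ.exists_gradient_bound
  have h : MemLp (fun p : E d × Ω => ∑ k ∈ cellsIn d (2 * m + 1),
      weight s p.2 k • gradient φ (p.1 + lat k)) 2 (cellMeasure d P) := by
    refine memLp_finsetSum _ fun k _ => ?_
    refine MemLp.of_bound ?_ C (Eventually.of_forall fun p => ?_)
    · refine Measurable.aestronglyMeasurable ?_
      exact ((measurable_weight hs k).comp measurable_snd).smul
        ((continuous_gradient hφ.1).measurable.comp (measurable_fst.add_const _))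
    · rw [norm_smul, Real.norm_eq_abs]
      exact (mul_le_mul (abs_weight_le s p.2 k) (hC _) (norm_nonneg _) zero_le_one).trans
        (by rw [one_mul])
  refine h.ae_eq ?_
  filter_upwards [ae_cellMeasure_mem P] with p hp
  exact (hm s p hp).symm

/-- The fields `∇ ∑_k 1_s(τ_{-k} ω) φ(x + k)` as elements of `L²(Q × Ω)`. -/
def stGens (d : ℕ) {Ω : Type*} [MeasurableSpace Ω] [AddAction (Fin d → ℤ) Ω] (P : Measure Ω) :
    Set (Lp (E d) 2 (cellMeasure d P)) :=
  {g | ∃ (s : Set Ω) (φ : E d → ℝ), MeasurableSet s ∧ IsTest φ ∧ g =ᵐ[cellMeasure d P] stGen s φ}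

/-- The space of stationary gradients. -/
noncomputable def stV (d : ℕ) {Ω : Type*} [MeasurableSpace Ω] [AddAction (Fin d → ℤ) Ω]
    (P : Measure Ω) : Submodule ℝ (Lp (E d) 2 (cellMeasure d P)) :=
  (Submodule.span ℝ (stGens d P)).topologicalClosure

noncomputable instance : (stV d P).HasOrthogonalProjection := by
  have : CompleteSpace (stV d P) :=
    (Submodule.isClosed_topologicalClosure _).completeSpace_coe
  infer_instance

theorem IsTest.stGen_mem {φ : E d → ℝ} (hφ : IsTest φ) {s : Set Ω} (hs : MeasurableSet s) :
    (hφ.memLp_stGen P hs).toLp _ ∈ stV d P :=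
  Submodule.le_topologicalClosure _ (Submodule.subset_span ⟨s, φ, hs, hφ, MemLp.coeFn_toLp _⟩)

/-- A field orthogonal to the generators is orthogonal to all stationary gradients. -/
theorem inner_eq_zero_of_stGen {f : Lp (E d) 2 (cellMeasure d P)}
    (h : ∀ (s : Set Ω) (hs : MeasurableSet s) (φ : E d → ℝ) (hφ : IsTest φ),
      inner ℝ f ((hφ.memLp_stGen P hs).toLp _) = 0) {v : Lp (E d) 2 (cellMeasure d P)}
    (hv : v ∈ stV d P) : inner ℝ f v = 0 := by
  have hcl : IsClosed {v : Lp (E d) 2 (cellMeasure d P) | inner ℝ f v = 0} :=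
    isClosed_eq (by fun_prop) continuous_const
  have hv' : v ∈ closure (Submodule.span ℝ (stGens d P) : Set (Lp (E d) 2 (cellMeasure d P))) := hv
  refine closure_minimal (fun w hw => ?_) hcl hv'
  change inner ℝ f w = 0
  induction hw using Submodule.span_induction with
  | mem w hw =>
    obtain ⟨s, φ, hs, hφ, hw⟩ := hw
    rw [← h s hs φ hφ]
    congr 1
    exact Lp.ext (hw.trans (hφ.memLp_stGen P hs).coeFn_toLp.symm)
  | zero => simp
  | add x y _ _ hx hy => rw [inner_add_right, hx, hy, add_zero]
  | smul a x _ hx => rw [inner_smul_right, hx, mul_zero]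

variable [VAddInvariantMeasure (Fin d → ℤ) Ω P]

theorem IsTest.integrable_fderiv_stExt {φ : E d → ℝ} (hφ : IsTest φ)
    (f : Lp (E d) 2 (cellMeasure d P)) {X : Ω → ℝ} (hX : MemLp X 2 P) :
    Integrable (fun p : E d × Ω => X p.2 * fderiv ℝ φ p.1 (stExt f p))
      ((volume : Measure (E d)).prod P) := by
  obtain ⟨m, -, hm⟩ := hφ.2.isCompact.exists_subset_closedBall_nat
  obtain ⟨C, hC0, hC⟩ := hφ.exists_gradient_bound
  set B := Metric.closedBall (0 : E d) (m : ℝ)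
  have : IsFiniteMeasure ((volume : Measure (E d)).restrict B) := ⟨by
    rw [Measure.restrict_apply_univ]; exact measure_closedBall_lt_top⟩
  have h1 := memLp_stExt (Lp.stronglyMeasurable f) (Lp.memLp f) m
  have h2 : MemLp (fun p : E d × Ω => X p.2) 2 (((volume : Measure (E d)).restrict B).prod P) :=
    hX.comp_snd _
  have h3 : Integrable (fun p : E d × Ω => X p.2 * fderiv ℝ φ p.1 (stExt f p))
      (((volume : Measure (E d)).restrict B).prod P) := by
    have h4 : MemLp (fun p : E d × Ω => fderiv ℝ φ p.1 (stExt f p)) 2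
        (((volume : Measure (E d)).restrict B).prod P) := by
      refine MemLp.of_le_mul (c := C) h1 ?_ (Eventually.of_forall fun p => ?_)
      · have : AEStronglyMeasurable (fun p : E d × Ω => gradient φ p.1)
            (((volume : Measure (E d)).restrict B).prod P) :=
          ((continuous_gradient hφ.1).measurable.comp measurable_fst).aestronglyMeasurable
        have h5 := this.inner (𝕜 := ℝ) h1.1
        simp only [inner_gradient_eq] at h5
        exact h5
      · rw [← inner_gradient_eq]
        exact (norm_inner_le_norm _ _).trans (mul_le_mul_of_nonneg_right (hC _) (norm_nonneg _))
    exact h2.integrable_mul h4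
  have h5 : IntegrableOn (fun p : E d × Ω => X p.2 * fderiv ℝ φ p.1 (stExt f p)) (B ×ˢ univ)
      ((volume : Measure (E d)).prod P) := by
    rw [IntegrableOn, ← Measure.prod_restrict, Measure.restrict_univ]
    exact h3
  refine (integrableOn_univ).1 (h5.of_forall_sdiff_eq_zero MeasurableSet.univ fun p hp => ?_)
  have : p.1 ∉ B := fun h => hp.2 ⟨h, mem_univ _⟩
  rw [(IsTest.eq_zero_of_notMem hm this).2]
  simp

/-- Unfolding: testing with a generator is testing the stationary extension with `1_s φ`. -/
theorem IsTest.inner_stGen {φ : E d → ℝ} (hφ : IsTest φ) {s : Set Ω} (hs : MeasurableSet s)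
    (f : Lp (E d) 2 (cellMeasure d P)) :
    inner ℝ f ((hφ.memLp_stGen P hs).toLp _) =
      ∫ ω in s, (∫ x, fderiv ℝ φ x (stExt f (x, ω))) ∂P := by
  obtain ⟨m, hsup, hm⟩ := hφ.stGen_eq (Ω := Ω)
  set H : E d × Ω → ℝ := fun p => s.indicator (fun _ => (1 : ℝ)) p.2 * fderiv ℝ φ p.1 (stExt f p)
  have hH : Integrable H ((volume : Measure (E d)).prod P) :=
    hφ.integrable_fderiv_stExt f (memLp_indicator_const 2 hs 1 (Or.inr (measure_ne_top _ _)))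
  have h1 : ∫ p, H p ∂((volume : Measure (E d)).prod P) =
      ∫ ω in s, (∫ x, fderiv ℝ φ x (stExt f (x, ω))) ∂P := by
    rw [integral_prod_symm _ hH, ← integral_indicator hs]
    congr 1
    ext ω
    by_cases h : ω ∈ s <;> simp [H, h]
  -- The slabs (Q + k) × Ω are the images of Q × Ω under the joint shifts, which leave `stExt f`
  -- unchanged and turn 1_s(ω) into the weight 1_s(τ_{-k} ω) of the generator.
  have h2 : ∫ p, H p ∂((volume : Measure (E d)).prod P) =
      ∑ k ∈ cellsIn d (2 * m + 1), ∫ p, H (stShift k p) ∂(cellMeasure d P) := by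
    have h3 : ∫ p, H p ∂((volume : Measure (E d)).prod P) = ∫ p in ⋃ k ∈ cellsIn d (2 * m + 1),
        stShift k '' (cube d 1 ×ˢ (univ : Set Ω)), H p ∂((volume : Measure (E d)).prod P) := by
      refine setIntegral_eq_of_support fun p hp => ?_
      by_cases h : p.1 ∈ tsupport φ
      · refine absurd (mem_biUnion (hsup _ h) ?_) hp
        obtain ⟨x, ω⟩ := p
        refine ⟨(red 1 x, cellIdx 1 x +ᵥ ω), ⟨red_mem one_pos x, mem_univ _⟩, ?_⟩
        rw [stShift_apply, vadd_vadd, neg_add_cancel, zero_vadd, red]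
        simp
      · simp [H, fderiv_extend h]
    rw [h3, integral_biUnion_finset _ (fun k _ => (stShift k).measurableSet_image.2
      ((measurableSet_cube 1).prod MeasurableSet.univ)) ?_ fun k _ => hH.integrableOn]
    · refine Finset.sum_congr rfl fun k _ => ?_
      rw [cellMeasure_eq]
      exact (measurePreserving_stShift P k).setIntegral_image_emb
        (stShift k).measurableEmbedding H _
    · intro k _ k' _ hkk
      refine Set.disjoint_left.2 ?_
      rintro _ ⟨⟨x, ω⟩, hx, rfl⟩ ⟨⟨x', ω'⟩, hx', h⟩
      refine hkk ?_
      rw [stShift_apply, stShift_apply, Prod.mk.injEq] at h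
      have e1 := cellIdx_add one_pos x k
      have e2 := cellIdx_add one_pos x' k'
      simp only [Nat.cast_one, one_smul] at e1 e2
      rw [h.1, e1, (mem_cube_iff one_pos).1 hx.1, (mem_cube_iff one_pos).1 hx'.1] at e2
      simpa using e2
  rw [← h1, h2, ← integral_finsetSum _ fun k _ => ?_, L2.inner_def]
  · refine integral_congr_ae ?_
    filter_upwards [(hφ.memLp_stGen P hs).coeFn_toLp, ae_cellMeasure_mem P, stExt_ae_eq P f]
      with p a b c
    rw [a, hm s p b, inner_sum]
    refine Finset.sum_congr rfl fun k _ => ?_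
    simp only [H]
    rw [stExt_stShift, c]
    obtain ⟨x, ω⟩ := p
    rw [stShift_apply, inner_smul_right, real_inner_comm, inner_gradient_eq, weight]
  · have h4 := ((measurePreserving_stShift P k).integrable_comp_emb
      (stShift k).measurableEmbedding).2 hH
    have h5 := h4.integrableOn (s := cube d 1 ×ˢ univ)
    rw [IntegrableOn, ← cellMeasure_eq] at h5
    exact h5

end StationaryGradients

end WeaklyRandom

namespace WeaklyRandom

/-! ### Potentials, divergence and mean of stationary gradient fields -/

section StationaryPotentials

set_option linter.unusedSectionVars false

open scoped ENNReal

variable {d : ℕ} {Ω : Type*} [MeasurableSpace Ω] [AddAction (Fin d → ℤ) Ω]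
  [MeasurableConstVAdd (Fin d → ℤ) Ω] {P : Measure Ω} [IsProbabilityMeasure P]
  [VAddInvariantMeasure (Fin d → ℤ) Ω P]

theorem stExt_congr {F : Type*} {f g : E d × Ω → F} (h : f =ᵐ[cellMeasure d P] g) :
    stExt f =ᵐ[(volume : Measure (E d)).prod P] stExt g :=
  (quasiMeasurePreserving_foldMap P).ae h

theorem tendsto_zero_of_sq {ι : Type*} {l : Filter ι} {f : ι → ℝ≥0∞}
    (h : Tendsto (fun i => f i ^ 2) l (𝓝 0)) : Tendsto f l (𝓝 0) := by
  have h1 := ((ENNReal.continuous_rpow_const (y := (1 / 2 : ℝ))).tendsto 0).comp h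
  rw [ENNReal.zero_rpow_of_pos (by norm_num)] at h1
  refine h1.congr fun i => ?_
  simp only [Function.comp]
  rw [← ENNReal.rpow_natCast, ← ENNReal.rpow_mul]
  norm_num

/-- Combinations of generators have potentials that are smooth for every `ω`. -/
theorem exists_smooth_potential {w : Lp (E d) 2 (cellMeasure d P)}
    (hw : w ∈ Submodule.span ℝ (stGens d P)) : ∃ U : Ω → E d → ℝ,
    (∀ ω, ContDiff ℝ ((⊤ : ℕ∞) : WithTop ℕ∞) (U ω)) ∧
    ∀ᵐ p ∂((volume : Measure (E d)).prod P), stExt w p = gradient (U p.2) p.1 := by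
  induction hw using Submodule.span_induction with
  | mem w hw =>
    obtain ⟨s, φ, hs, hφ, hw⟩ := hw
    refine ⟨fun ω => periodize 1 (weight s ω) φ, fun ω => hφ.contDiff_periodize one_pos _, ?_⟩
    have := ae_eq_stExt (H := stGen s φ) (P := P)
      (fun k => Eventually.of_forall fun p => stGen_add s φ p.1 k p.2) hw.symm
    filter_upwards [this] with p hp
    rw [← hp, stGen]
  | zero =>
    refine ⟨fun _ _ => 0, fun _ => contDiff_const, ?_⟩
    filter_upwards [stExt_congr (Lp.coeFn_zero (E d) 2 (cellMeasure d P))] with p hp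
    rw [hp]
    simp [gradient, stExt]
  | add x y _ _ hx hy =>
    obtain ⟨U, h1, h2⟩ := hx
    obtain ⟨V, k1, k2⟩ := hy
    refine ⟨fun ω => U ω + V ω, fun ω => (h1 ω).add (k1 ω), ?_⟩
    filter_upwards [h2, k2, stExt_congr (Lp.coeFn_add x y)] with p a b c
    have : stExt (⇑x + ⇑y) p = stExt x p + stExt y p := rfl
    rw [c, this, a, b]
    simp only [gradient]
    rw [fderiv_add ((h1 _).differentiable (by simp) _) ((k1 _).differentiable (by simp) _), map_add]
  | smul a x _ hx =>
    obtain ⟨U, h1, h2⟩ := hx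
    refine ⟨fun ω => a • U ω, fun ω => (h1 ω).const_smul a, ?_⟩
    filter_upwards [h2, stExt_congr (Lp.coeFn_smul a x)] with p b c
    have : stExt (a • ⇑x) p = a • stExt x p := rfl
    rw [c, this, b]
    simp only [gradient]
    rw [fderiv_const_smul ((h1 _).differentiable (by simp) _), map_smul]

/-- Almost every realization of a stationary gradient is a weak gradient. -/
theorem ae_exists_potential {g : Lp (E d) 2 (cellMeasure d P)} (hg : g ∈ stV d P) :
    ∀ᵐ ω ∂P, ∃ u : E d → ℝ, IsWeakGradient u fun x => stExt g (x, ω) := by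
  have hg' : g ∈ closure (Submodule.span ℝ (stGens d P) : Set (Lp (E d) 2 (cellMeasure d P))) := hg
  rw [Metric.mem_closure_iff] at hg'
  -- A geometric rate makes the squared distances summable, so that almost surely the whole sequence
  -- of realizations converges on every ball.
  choose w hw hwg using fun n : ℕ => hg' ((1 / 2) ^ n) (by positivity)
  choose U hU hUw using fun n => exists_smooth_potential (hw n)
  let h : ℕ → E d × Ω → ℝ≥0∞ := fun n p => ‖(w n - g) p‖ₑ ^ 2
  have hhm : ∀ n, Measurable (h n) := fun n => (Lp.stronglyMeasurable _).enorm.pow_const 2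
  have hsm : ∀ n, Measurable (stExt (h n)) := fun n => (hhm n).comp measurable_foldMap
  have hint : ∀ n, ∫⁻ p, h n p ∂(cellMeasure d P) ≤ (2⁻¹ : ℝ≥0∞) ^ n := by
    intro n
    rw [← eLpNorm_two_sq, ← Lp.enorm_def]
    have h1 : ‖w n - g‖ₑ ≤ (2⁻¹ : ℝ≥0∞) ^ n := by
      have h2 := (hwg n).le
      rw [dist_comm, dist_eq_norm] at h2
      rw [← ofReal_norm]
      refine (ENNReal.ofReal_le_ofReal h2).trans ?_
      rw [ENNReal.ofReal_pow (by norm_num)]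
      gcongr
      rw [one_div, ENNReal.ofReal_inv_of_pos (by norm_num)]
      simp
    calc ‖w n - g‖ₑ ^ 2 ≤ ((2⁻¹ : ℝ≥0∞) ^ n) ^ 2 := by gcongr
      _ ≤ ((2⁻¹ : ℝ≥0∞) ^ n) ^ 1 :=
          pow_le_pow_right_of_le_one' (pow_le_one' (by simp) n) (by norm_num)
      _ = _ := pow_one _
  have hae : ∀ R : ℕ, ∀ᵐ ω ∂P, Tendsto (fun n => ∫⁻ x in Metric.closedBall 0 (R : ℝ),
      stExt (h n) (x, ω)) atTop (𝓝 0) := by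
    intro R
    refine ae_tendsto_zero_of_tsum (fun n => (hsm n).lintegral_prod_left') ?_
    refine ne_top_of_le_ne_top (b := ∑' n : ℕ, (((2 * R + 1) ^ d : ℕ) : ℝ≥0∞) * (2⁻¹ : ℝ≥0∞) ^ n) ?_
      (ENNReal.tsum_le_tsum fun n => ?_)
    · rw [ENNReal.tsum_mul_left, ENNReal.tsum_geometric]
      refine ENNReal.mul_ne_top (ENNReal.natCast_ne_top _) ?_
      rw [ENNReal.one_sub_inv_two, inv_inv]
      norm_num
    · rw [← setLIntegral_prod_univ _ (hsm n)]
      exact (lintegral_stExt_le (h n) R).trans (by gcongr; exact hint n)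
  have hUae : ∀ᵐ ω ∂P, ∀ n, ∀ᵐ x, stExt (w n) (x, ω) = gradient (U n ω) x :=
    ae_all_iff.2 fun n => ae_ae_swap (hUw n)
  have hsub : ∀ᵐ ω ∂P, ∀ n, ∀ᵐ x, stExt (w n - g : Lp (E d) 2 (cellMeasure d P)) (x, ω) =
      stExt (w n) (x, ω) - stExt g (x, ω) :=
    ae_all_iff.2 fun n => ae_ae_swap (stExt_congr (Lp.coeFn_sub (w n) g))
  filter_upwards [ae_all_iff.2 hae, hUae, hsub,
    ae_locL2_stExt (Lp.stronglyMeasurable g) (Lp.memLp g)] with ω h1 h2 h3 h4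
  obtain ⟨u, -, hu, -⟩ := exists_isWeakGradient_of_tendsto (u := fun n => U n ω)
    (G := fun x => stExt g (x, ω)) (fun n => hU n ω)
    (fun R => h4 _ (isCompact_closedBall _ _)) fun R => by
      refine tendsto_zero_of_sq ((h1 R).congr fun n => ?_)
      rw [eLpNorm_two_sq]
      refine lintegral_congr_ae (ae_restrict_of_ae ?_)
      filter_upwards [h2 n, h3 n] with x a b
      rw [Pi.sub_apply, ← a, ← b]
      rfl
  exact ⟨u, hu⟩

/-- A field orthogonal to the stationary gradients is almost surely divergence free. -/
theorem ae_divFree_of_inner {f : Lp (E d) 2 (cellMeasure d P)}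
    (h : ∀ v ∈ stV d P, inner ℝ f v = 0) : ∀ᵐ ω ∂P, DivFree fun x => stExt f (x, ω) := by
  have h1 : ∀ φ : E d → ℝ, IsTest φ → ∀ᵐ ω ∂P, ∫ x, fderiv ℝ φ x (stExt f (x, ω)) = 0 := by
    intro φ hφ
    have hi := (hφ.integrable_fderiv_stExt f (memLp_const (μ := P) 1)).integral_prod_right
    simp only [one_mul] at hi
    refine hi.ae_eq_zero_of_forall_setIntegral_eq_zero fun s hs _ => ?_
    rw [← hφ.inner_stGen hs f]
    exact h _ (hφ.stGen_mem hs)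
  let B : ℕ → Set (E d) := fun R => Metric.closedBall 0 (R : ℝ)
  -- The exceptional null set obtained above depends on φ. Gradients of test functions supported in
  -- a ball form a separable subset of L², so a countable dense family of them yields a single null
  -- set for all φ.
  let S : ∀ R : ℕ, Set (Lp (E d) 2 ((volume : Measure (E d)).restrict (B R))) := fun R =>
    {g | ∃ φ, IsTest φ ∧ tsupport φ ⊆ B R ∧ g =ᵐ[volume.restrict (B R)] gradient φ}
  have : Fact ((2 : ℝ≥0∞) ≠ ⊤) := ⟨by norm_num⟩
  have hS : ∀ R, ∃ t ⊆ S R, t.Countable ∧ S R ⊆ closure t := fun R =>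
    (TopologicalSpace.IsSeparable.of_separableSpace (S R)).exists_countable_dense_subset
  choose t ht htc htS using hS
  have h2 : ∀ᵐ ω ∂P, ∀ R, ∀ z ∈ t R, ∀ φ, (hz : IsTest φ ∧ tsupport φ ⊆ B R ∧
      z =ᵐ[volume.restrict (B R)] gradient φ) →
      ∫ x in B R, inner ℝ (stExt f (x, ω)) (z x) = 0 := by
    refine ae_all_iff.2 fun R => (ae_ball_iff (htc R)).2 fun z hz => ?_
    obtain ⟨φ, hφ, hs, hzφ⟩ := ht R hz
    filter_upwards [h1 φ hφ] with ω hω ψ _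
    rw [← hω, setIntegral_eq_of_support (f := fun x => fderiv ℝ φ x (stExt f (x, ω))) (K := B R)
      fun x hx => ?_]
    · refine integral_congr_ae ?_
      filter_upwards [hzφ] with x hx
      rw [hx, real_inner_comm, inner_gradient_eq]
    · rw [(IsTest.eq_zero_of_notMem hs hx).2]; rfl
  filter_upwards [h2, ae_locL2_stExt (Lp.stronglyMeasurable f) (Lp.memLp f)] with ω hω hl φ hφ
  obtain ⟨R, -, hR⟩ := hφ.2.isCompact.exists_subset_closedBall_nat
  have hF := hl (B R) (isCompact_closedBall _ _)
  have hG : MemLp (gradient φ) 2 (volume.restrict (B R)) := hφ.memLp_gradient.restrict _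
  have hcl : IsClosed {z : Lp (E d) 2 ((volume : Measure (E d)).restrict (B R)) |
      inner ℝ (hF.toLp _) z = 0} := isClosed_eq (by fun_prop) continuous_const
  have h3 : hG.toLp _ ∈ closure (t R) := htS R ⟨φ, hφ, hR, hG.coeFn_toLp⟩
  have h4 : inner ℝ (hF.toLp _) (hG.toLp _) = 0 := by
    refine closure_minimal (fun z hz => ?_) hcl h3
    obtain ⟨ψ, hψ⟩ := ht R hz
    change inner ℝ (hF.toLp _) z = 0
    rw [← hω R z hz ψ hψ, L2.inner_def]
    refine integral_congr_ae ?_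
    filter_upwards [hF.coeFn_toLp] with x hx
    rw [hx]
  rw [inner_toLp] at h4
  rw [setIntegral_eq_of_support (f := fun x => fderiv ℝ φ x (stExt f (x, ω))) (K := B R)
      fun x hx => ?_, ← h4]
  · refine integral_congr_ae (Eventually.of_forall fun x => ?_)
    simp only
    rw [real_inner_comm, inner_gradient_eq]
  · rw [(IsTest.eq_zero_of_notMem hR hx).2]; rfl

/-- Conversely, testing with stationary gradients. -/
theorem inner_eq_zero_of_ae_divFree {f : Lp (E d) 2 (cellMeasure d P)}
    (h : ∀ᵐ ω ∂P, DivFree fun x => stExt f (x, ω)) {v : Lp (E d) 2 (cellMeasure d P)}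
    (hv : v ∈ stV d P) : inner ℝ f v = 0 := by
  refine inner_eq_zero_of_stGen (fun s hs φ hφ => ?_) hv
  rw [hφ.inner_stGen hs f]
  refine integral_eq_zero_of_ae (ae_restrict_of_ae ?_)
  filter_upwards [h] with ω hω
  exact hω φ hφ

theorem IsTest.integral_fderiv {φ : E d → ℝ} (hφ : IsTest φ) (v : E d) :
    ∫ x, fderiv ℝ φ x v = 0 := by
  have := integral_mul_fderiv_eq_neg_fderiv_mul_of_integrable (μ := (volume : Measure (E d)))
    (f := fun _ => (1 : ℝ)) (g := φ) (v := v) (by simp)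
    (((hφ.fderiv_apply _).1.continuous.integrable_of_hasCompactSupport
      (hφ.fderiv_apply _).2).const_mul 1)
    ((hφ.1.continuous.integrable_of_hasCompactSupport hφ.2).const_mul 1)
    (fun x _ => by fun_prop) (fun x _ => hφ.1.differentiable (by simp) x)
  simpa using this

/-- Stationary gradients have mean zero. -/
theorem integral_eq_zero_of_mem_stV {v : Lp (E d) 2 (cellMeasure d P)} (hv : v ∈ stV d P) :
    ∫ p, v p ∂(cellMeasure d P) = 0 := by
  have hi : Integrable v (cellMeasure d P) := (Lp.memLp v).integrable (by norm_num)
  ext i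
  rw [← inner_e, real_inner_comm, ← integral_inner hi]
  have hc : MemLp (fun _ : E d × Ω => (e i : E d)) 2 (cellMeasure d P) := memLp_const _
  -- A constant field is divergence free, hence orthogonal to every stationary gradient.
  have h := inner_eq_zero_of_ae_divFree (f := hc.toLp _) (v := v) ?_ hv
  · rw [L2.inner_def] at h
    rw [PiLp.zero_apply, ← h]
    refine integral_congr_ae ?_
    filter_upwards [hc.coeFn_toLp] with p hp
    rw [hp]
  · filter_upwards [ae_ae_swap (stExt_congr hc.coeFn_toLp)] with ω hω
    refine DivFree.congr (G := fun _ => e i) (fun φ hφ => hφ.integral_fderiv _) ?_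
    filter_upwards [hω] with x hx
    rw [hx]; rfl

end StationaryPotentials

end WeaklyRandom

namespace WeaklyRandom

/-! ### Ergodicity, and well-posedness of the stationary problem -/

section StationarySolutions

set_option linter.unusedSectionVars false

open scoped ENNReal

variable {d : ℕ} {Ω : Type*} [MeasurableSpace Ω] [AddAction (Fin d → ℤ) Ω]
  [MeasurableConstVAdd (Fin d → ℤ) Ω] {P : Measure Ω} [IsProbabilityMeasure P]

/-- An invariant function is almost surely constant. -/
theorem ae_eq_const_of_invariant [ErgodicVAdd (Fin d → ℤ) Ω P] {c : Ω → E d} (hc : Measurable c)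
    (h : ∀ k : Fin d → ℤ, ∀ᵐ ω ∂P, c (k +ᵥ ω) = c ω) : ∃ c₀, ∀ᵐ ω ∂P, c ω = c₀ := by
  refine exists_eventuallyEq_const_of_forall_separating MeasurableSet fun U hU => ?_
  have h1 : EventuallyConst (c ⁻¹' U) (ae P) :=
    aeconst_of_forall_preimage_vadd_ae_eq (Fin d → ℤ) (hc hU).nullMeasurableSet fun k => by
      refine Filter.Eventually.set_eq ?_
      filter_upwards [h k] with ω hω
      rw [mem_preimage, mem_preimage, mem_preimage, hω]
  rw [eventuallyConst_set] at h1
  exact h1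

section

variable [VAddInvariantMeasure (Fin d → ℤ) Ω P]

/-- Along a sequence of radii, stationary integrable fields do not grow in the mean. -/
theorem ae_tendsto_average {h : E d × Ω → ℝ≥0∞} (hm : Measurable h)
    (hi : ∫⁻ p, h p ∂(cellMeasure d P) ≠ ⊤) : ∀ᵐ ω ∂P, Tendsto (fun n : ℕ =>
      ENNReal.ofReal ((((n + 1) ^ 2 : ℕ) : ℝ) ^ (d + 1))⁻¹ *
        ∫⁻ x in Metric.closedBall 0 (((n + 1) ^ 2 : ℕ) : ℝ), stExt h (x, ω)) atTop (𝓝 0) := by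
  have hsm : Measurable (stExt h) := hm.comp measurable_foldMap
  refine ae_tendsto_zero_of_tsum (fun n => hsm.lintegral_prod_left'.const_mul _) ?_
  set K := ∫⁻ p, h p ∂(cellMeasure d P)
  -- The expected normalized mass on the ball of radius R is of order 1/R; the radii R = (n+1)² make
  -- these expectations summable.
  have hs : Summable fun n : ℕ => (3 : ℝ) ^ d * (((n + 1 : ℕ) : ℝ) ^ 2)⁻¹ :=
    ((summable_nat_add_iff 1).2 (Real.summable_nat_pow_inv.2 one_lt_two)).mul_left _
  refine ne_top_of_le_ne_top (b := ∑' n : ℕ, ENNReal.ofReal ((3 : ℝ) ^ d *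
    (((n + 1 : ℕ) : ℝ) ^ 2)⁻¹) * K) ?_ (ENNReal.tsum_le_tsum fun n => ?_)
  · rw [ENNReal.tsum_mul_right]
    exact ENNReal.mul_ne_top hs.tsum_ofReal_ne_top hi
  · rw [lintegral_const_mul _ hsm.lintegral_prod_left', ← setLIntegral_prod_univ _ hsm]
    refine (mul_le_mul_right (lintegral_stExt_le h _) _).trans ?_
    rw [← mul_assoc]
    refine mul_le_mul_left ?_ K
    rw [← ENNReal.ofReal_natCast, ← ENNReal.ofReal_mul (by positivity)]
    refine ENNReal.ofReal_le_ofReal ?_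
    have h1 : (1 : ℝ) ≤ ((n + 1 : ℕ) : ℝ) ^ 2 := one_le_pow₀ (by push_cast; linarith [(Nat.cast_nonneg n : (0:ℝ) ≤ n)])
    push_cast at h1 ⊢
    set r : ℝ := ((n : ℝ) + 1) ^ 2
    rw [inv_mul_le_iff₀ (by positivity)]
    calc (2 * r + 1) ^ d ≤ (3 * r) ^ d := by gcongr; linarith
      _ = r ^ (d + 1) * (3 ^ d * r⁻¹) := by
        rw [mul_pow, pow_succ]; field_simp

theorem integral_abs_inner_le {F : E d → E d} (hF : LocL2 F) (i : Fin d) (R : ℝ) :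
    ∫ x in Metric.closedBall 0 R, |inner ℝ (F x) (e i)| ≤
      (∫⁻ x in Metric.closedBall 0 R, ‖F x‖ₑ).toReal := by
  have h1 : IntegrableOn F (Metric.closedBall 0 R) :=
    hF.locallyIntegrable.integrableOn_isCompact (isCompact_closedBall _ _)
  rw [← integral_norm_eq_lintegral_enorm h1.aestronglyMeasurable]
  refine integral_mono_of_nonneg (Eventually.of_forall fun x => abs_nonneg _) h1.norm
    (Eventually.of_forall fun x => ?_)
  refine (abs_real_inner_le_norm _ _).trans ?_
  simp [e]

/-- A stationary field that is curl free and divergence free is constant in space. -/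
theorem ae_const_of_curlFree_divFree {f : Lp (E d) 2 (cellMeasure d P)}
    (hc : ∀ᵐ ω ∂P, CurlFree fun x => stExt f (x, ω))
    (hd : ∀ᵐ ω ∂P, DivFree fun x => stExt f (x, ω)) :
    ∀ᵐ ω ∂P, ∀ᵐ x, stExt f (x, ω) = ∫ y in cube d 1, stExt f (y, ω) := by
  have hm : Measurable fun p => ‖f p‖ₑ := (Lp.stronglyMeasurable f).enorm
  have hi : ∫⁻ p, ‖f p‖ₑ ∂(cellMeasure d P) ≠ ⊤ :=
    ((Lp.memLp f).integrable (by norm_num : (1 : ℝ≥0∞) ≤ 2)).2.ne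
  filter_upwards [hc, hd, ae_tendsto_average hm hi,
    ae_locL2_stExt (Lp.stronglyMeasurable f) (Lp.memLp f)] with ω h1 h2 h3 h4
  have hcomp : ∀ i : Fin d, ∃ c : ℝ, ∀ᵐ x, inner ℝ (stExt f (x, ω)) (e i) = c := by
    intro i
    refine (weaklyHarmonic_of_curlFree_divFree h4 h1 h2 (e i)).ae_eq_const
      (h4.inner_const (e i)).locallyIntegrable (R := fun n : ℕ => (((n + 1) ^ 2 : ℕ) : ℝ))
      (tendsto_natCast_atTop_atTop.comp
        ((tendsto_pow_atTop two_ne_zero).comp (tendsto_add_atTop_nat 1))) ?_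
    have h5 := (ENNReal.tendsto_toReal ENNReal.zero_ne_top).comp h3
    rw [ENNReal.toReal_zero] at h5
    refine tendsto_of_tendsto_of_tendsto_of_le_of_le tendsto_const_nhds h5 (fun n => ?_) fun n => ?_
    · exact mul_nonneg (by positivity) (integral_nonneg fun x => abs_nonneg _)
    · simp only [Function.comp]
      rw [ENNReal.toReal_mul, ENNReal.toReal_ofReal (by positivity)]
      exact mul_le_mul_of_nonneg_left (integral_abs_inner_le h4 i _) (by positivity)
  choose c hcc using hcomp
  let v : E d := ∑ i, c i • e i
  have hv : ∀ᵐ x, stExt f (x, ω) = v := by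
    filter_upwards [ae_all_iff.2 hcc] with x hx
    conv_lhs => rw [← sum_smul_e (stExt f (x, ω))]
    refine Finset.sum_congr rfl fun i _ => ?_
    rw [← hx i, inner_e]
  have : ∫ y in cube d 1, stExt f (y, ω) = v := by
    rw [integral_congr_ae (ae_restrict_of_ae hv)]
    simp
  rw [this]
  exact hv

end

variable [ErgodicVAdd (Fin d → ℤ) Ω P]

/-- Stationary fields of mean zero that are almost surely weak gradients belong to `stV`. -/
theorem toLp_mem_stV {G : E d × Ω → E d} (hm : MemLp G 2 (cellMeasure d P))
    (hst : ∀ k : Fin d → ℤ, ∀ᵐ p ∂((volume : Measure (E d)).prod P),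
      G (p.1 + lat k, p.2) = G (p.1, k +ᵥ p.2)) (h0 : ∫ p, G p ∂(cellMeasure d P) = 0)
    (hpot : ∀ᵐ ω ∂P, ∃ u : E d → ℝ, IsWeakGradient u fun x => G (x, ω)) :
    hm.toLp G ∈ stV d P := by
  set g := hm.toLp G
  set h := (stV d P).starProjection g
  have hh : h ∈ stV d P := Submodule.starProjection_apply_mem _ _
  have hdiv := ae_divFree_of_inner (f := g - h) fun v hv => by
    rw [real_inner_comm]
    exact (Submodule.sub_starProjection_mem_orthogonal (K := stV d P) g) v hv
  have hGg : ∀ᵐ p ∂((volume : Measure (E d)).prod P), stExt (g - h : Lp (E d) 2 (cellMeasure d P)) p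
      = G p - stExt h p := by
    filter_upwards [ae_eq_stExt hst hm.coeFn_toLp.symm, stExt_congr (Lp.coeFn_sub g h)] with p a b
    rw [b, a]; rfl
  have hcurl : ∀ᵐ ω ∂P, CurlFree fun x => stExt (g - h : Lp (E d) 2 (cellMeasure d P)) (x, ω) := by
    filter_upwards [hpot, ae_exists_potential hh, ae_ae_swap hGg] with ω h1 h2 h3
    obtain ⟨u, hu⟩ := h1
    obtain ⟨v, hv⟩ := h2
    refine (weakGradient_curlFree (weakGradient_sub hu hv)).congr ?_
    filter_upwards [h3] with x hx
    rw [hx]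
  have hconst := ae_const_of_curlFree_divFree hcurl hdiv
  set f := g - h
  let c : Ω → E d := fun ω => ∫ y in cube d 1, stExt f (y, ω)
  have hcm : Measurable c :=
    (stronglyMeasurable_stExt (Lp.stronglyMeasurable f)).integral_prod_left'.measurable
  -- For almost every ω the remainder is a constant c(ω) in space. Stationarity makes c invariant
  -- under the shifts, ergodicity makes it deterministic, and the zero mean then forces it to
  -- vanish.
  obtain ⟨c₀, hc₀⟩ := ae_eq_const_of_invariant hcm (P := P) fun k => by
    filter_upwards [hconst, (measurePreserving_vadd k P).quasiMeasurePreserving.ae hconst]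
      with ω h1 h2
    have h3 := (measurePreserving_latShift 1 k (d := d)).quasiMeasurePreserving.ae h1
    obtain ⟨x, a, b⟩ := (h2.and h3).exists
    rw [latShift_apply, Nat.cast_one, one_smul, stExt_add] at b
    exact a.symm.trans b
  have hfi : Integrable f (cellMeasure d P) := (Lp.memLp f).integrable (by norm_num)
  have hfc : ∫ p, f p ∂(cellMeasure d P) = c₀ := by
    rw [← integral_congr_ae (stExt_ae_eq P f),
      integral_prod_symm _ (hfi.congr (stExt_ae_eq P f).symm), integral_congr_ae hc₀]
    simp
  have hf0 : ∫ p, f p ∂(cellMeasure d P) = 0 := by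
    rw [integral_congr_ae (Lp.coeFn_sub g h)]
    have : ∫ p, g p ∂(cellMeasure d P) = 0 := by rw [← h0]; exact integral_congr_ae hm.coeFn_toLp
    simp only [Pi.sub_apply]
    rw [integral_sub ((Lp.memLp g).integrable (by norm_num)) ((Lp.memLp h).integrable (by norm_num)),
      this, integral_eq_zero_of_mem_stV hh, sub_zero]
  have hz : f = 0 := by
    rw [Lp.eq_zero_iff_ae_eq_zero]
    have h6 : ∀ᵐ p : Ω × E d ∂(P.prod (volume.restrict (cube d 1))), f p.swap = 0 := by
      have hms : MeasurableSet {p : Ω × E d | stExt f p.swap = 0} :=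
        (measurableSet_singleton 0).preimage
          ((stronglyMeasurable_stExt (Lp.stronglyMeasurable f)).measurable.comp measurable_swap)
      have h7 : ∀ᵐ p : Ω × E d ∂(P.prod (volume.restrict (cube d 1))), stExt f p.swap = 0 := by
        rw [Measure.ae_prod_iff_ae_ae hms]
        filter_upwards [hconst, hc₀] with ω a b
        filter_upwards [ae_restrict_of_ae a] with x hx
        rw [Prod.swap_prod_mk, hx]
        change c ω = 0
        rw [b, ← hfc, hf0]
      filter_upwards [h7, Measure.measurePreserving_swap.quasiMeasurePreserving.ae
        (stExt_ae_eq P f)] with p a b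
      rw [← b, a]
    have h8 := (Measure.measurePreserving_swap (μ := volume.restrict (cube d 1)) (ν := P)).quasiMeasurePreserving.ae h6
    filter_upwards [h8] with p hp
    simpa using hp
  rw [sub_eq_zero.1 hz]
  exact hh

variable {a : E d → Ω → (E d →L[ℝ] E d)} {F : E d → Ω → E d}

theorem memLp_uncurry_stExt (g : Lp (E d) 2 (cellMeasure d P)) :
    MemLp (stExt g) 2 (cellMeasure d P) := (Lp.memLp g).ae_eq (stExt_ae_eq P g).symm

theorem stExt_solution_ae (ha : MemLp (Function.uncurry a) ⊤ (cellMeasure d P))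
    (has : IsStationary P a) (hF : MemLp (Function.uncurry F) 2 (cellMeasure d P))
    (hFs : IsStationary P F) (g : Lp (E d) 2 (cellMeasure d P)) :
    ∀ᵐ ω ∂P, ∀ᵐ x, stExt (mulL _ (Function.uncurry a) g + hF.toLp _ : Lp (E d) 2 (cellMeasure d P))
      (x, ω) = a x ω (stExt g (x, ω)) + F x ω := by
  have h1 := ae_eq_stExt (P := P) (H := fun p : E d × Ω => a p.1 p.2 (stExt g p) + F p.1 p.2)
    (g := (mulL _ (Function.uncurry a) g + hF.toLp _ : Lp (E d) 2 (cellMeasure d P))) (fun k => by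
      filter_upwards [has k, hFs k] with p h2 h3
      rw [h2, h3, stExt_add]) (by
      filter_upwards [Lp.coeFn_add (mulL _ (Function.uncurry a) g) (hF.toLp _), coeFn_mulL ha g,
        hF.coeFn_toLp, stExt_ae_eq P g] with p h2 h3 h4 h5
      rw [h2, Pi.add_apply, h3, h4, h5]; rfl)
  filter_upwards [ae_ae_swap h1] with ω hω
  filter_upwards [hω] with x hx
  rw [← hx]

theorem isStationarySolution_stExt (ha : MemLp (Function.uncurry a) ⊤ (cellMeasure d P))
    (has : IsStationary P a) (hF : MemLp (Function.uncurry F) 2 (cellMeasure d P))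
    (hFs : IsStationary P F) {g : Lp (E d) 2 (cellMeasure d P)} (hg : g ∈ stV d P)
    (h : ∀ v ∈ stV d P, inner ℝ (mulL _ (Function.uncurry a) g + hF.toLp _) v = 0) :
    IsStationarySolution P a F fun x ω => stExt g (x, ω) := by
  refine ⟨memLp_uncurry_stExt g, fun k => Eventually.of_forall fun p => stExt_add g p.1 k p.2, ?_,
    ae_exists_potential hg, ?_⟩
  · rw [← integral_prod_symm _ ((memLp_uncurry_stExt g).integrable (by norm_num)),
      integral_congr_ae (stExt_ae_eq P g), integral_eq_zero_of_mem_stV hg]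
  · filter_upwards [ae_divFree_of_inner h, stExt_solution_ae ha has hF hFs g] with ω h1 h2
    exact solvesInSpace_iff.2 (h1.congr h2)

/-- Uniqueness of stationary solutions. -/
theorem IsStationarySolution.toLp_eq (ha : MemLp (Function.uncurry a) ⊤ (cellMeasure d P))
    (has : IsStationary P a) (hco : CoerciveOn (stV d P) (mulL _ (Function.uncurry a)))
    (hF : MemLp (Function.uncurry F) 2 (cellMeasure d P)) (hFs : IsStationary P F)
    {G : E d → Ω → E d} (h : IsStationarySolution P a F G) :
    h.1.toLp _ = solOp (stV d P) (mulL _ (Function.uncurry a)) (hF.toLp _) := by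
  obtain ⟨h1, h2, h3, h4, h5⟩ := h
  have h0 : ∫ p, Function.uncurry G p ∂(cellMeasure d P) = 0 := by
    rw [integral_prod_symm _ (h1.integrable (by norm_num)), ← h3]
    rfl
  refine hco.eq_solOp (toLp_mem_stV h1 h2 h0 h4) fun v hv => inner_eq_zero_of_ae_divFree ?_ hv
  have h6 := ae_ae_swap (ae_eq_stExt (P := P) (H := Function.uncurry G) h2 h1.coeFn_toLp.symm)
  filter_upwards [h5, stExt_solution_ae ha has hF hFs (h1.toLp _), h6] with ω h7 h8 h9
  refine (solvesInSpace_iff.1 h7).congr ?_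
  filter_upwards [h8, h9] with x b c
  rw [b, ← c]; rfl

theorem isStationarySolution_stationaryGrad (ha : MemLp (Function.uncurry a) ⊤ (cellMeasure d P))
    (has : IsStationary P a) (hco : CoerciveOn (stV d P) (mulL _ (Function.uncurry a)))
    (hF : MemLp (Function.uncurry F) 2 (cellMeasure d P)) (hFs : IsStationary P F) :
    IsStationarySolution P a F (stationaryGrad P a F) :=
  Classical.epsilon_spec ⟨_, isStationarySolution_stExt ha has hF hFs
    (solOp_mem (mulL _ (Function.uncurry a)) (hF.toLp _)) fun _ hv => hco.inner_solOp _ hv⟩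

theorem stationaryGrad_ae_eq (ha : MemLp (Function.uncurry a) ⊤ (cellMeasure d P))
    (has : IsStationary P a) (hco : CoerciveOn (stV d P) (mulL _ (Function.uncurry a)))
    (hF : MemLp (Function.uncurry F) 2 (cellMeasure d P)) (hFs : IsStationary P F) :
    Function.uncurry (stationaryGrad P a F) =ᵐ[cellMeasure d P]
      solOp (stV d P) (mulL _ (Function.uncurry a)) (hF.toLp _) := by
  have h := isStationarySolution_stationaryGrad ha has hco hF hFs
  rw [← h.toLp_eq ha has hco hF hFs]
  exact h.1.coeFn_toLp.symm

end StationarySolutions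

end WeaklyRandom

namespace WeaklyRandom

/-! ### Small random variables -/

section SmallVariables

set_option linter.unusedSectionVars false

open scoped ENNReal

/-- A family that is weakly `o(η²)` is strongly `O(η²)`. -/
theorem isBigO_of_weak {H : Type*} [NormedAddCommGroup H] [InnerProductSpace ℝ H] [CompleteSpace H]
    {r : ℝ → H} (h : ∀ Y : H, (fun η => (inner ℝ (r η) Y : ℝ)) =o[𝓝[>] 0] fun η : ℝ => η ^ 2) :
    r =O[𝓝[>] 0] fun η : ℝ => η ^ 2 := by
  by_contra hcon
  rw [isBigO_iff] at hcon
  push Not at hcon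
  have h1 : ∀ n : ℕ, ∃ η : ℝ, (n : ℝ) * ‖η ^ 2‖ < ‖r η‖ ∧ 0 < η ∧ η < 1 / (n + 1 : ℝ) := by
    intro n
    have h2 : ∀ᶠ η : ℝ in 𝓝[>] 0, 0 < η ∧ η < 1 / (n + 1 : ℝ) := by
      filter_upwards [Ioo_mem_nhdsGT (show (0 : ℝ) < 1 / (n + 1 : ℝ) by positivity)] with η hη
      exact hη
    exact ((hcon n).and_eventually h2).exists
  choose u hu1 hu2 hu3 using h1
  have hu : Tendsto u atTop (𝓝[>] 0) := by
    refine tendsto_nhdsWithin_iff.2 ⟨?_, Eventually.of_forall hu2⟩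
    exact squeeze_zero (fun n => (hu2 n).le) (fun n => (hu3 n).le)
      tendsto_one_div_add_atTop_nhds_zero_nat
  -- The rescaled functionals are pointwise bounded by the weak hypothesis, hence uniformly bounded
  -- by Banach–Steinhaus. But `u n` was chosen so that their norms exceed n.
  let T : ℕ → H →L[ℝ] ℝ := fun n => innerSL ℝ ((u n ^ 2)⁻¹ • r (u n))
  have hT : ∀ Y, ∃ C, ∀ n, ‖T n Y‖ ≤ C := by
    intro Y
    have h3 := ((h Y).comp_tendsto hu).tendsto_div_nhds_zero
    obtain ⟨C, hC⟩ := (h3.norm.bddAbove_range)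
    refine ⟨C, fun n => (le_of_eq ?_).trans (hC ⟨n, rfl⟩)⟩
    simp only [T, innerSL_apply_apply, inner_smul_left, Function.comp]
    simp [div_eq_inv_mul]
  obtain ⟨C, hC⟩ := banach_steinhaus hT
  obtain ⟨n, hn⟩ := exists_nat_gt C
  have h4 := hC n
  simp only [T] at h4
  rw [innerSL_apply_norm, norm_smul, norm_inv, inv_mul_le_iff₀ (by
    rw [norm_pos_iff]; exact pow_ne_zero _ (hu2 n).ne')] at h4
  have h5 := hu1 n
  have h6 : 0 < ‖u n ^ 2‖ := norm_pos_iff.2 (pow_ne_zero _ (hu2 n).ne')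
  nlinarith

variable {Ω : Type*} [MeasurableSpace Ω] {P : Measure Ω} [IsProbabilityMeasure P]

theorem aestronglyMeasurable_abs_mul (f : Lp ℝ 2 P) {Z : Ω → ℝ} (hZ : AEStronglyMeasurable Z P) :
    AEStronglyMeasurable (fun ω => |f ω| * |Z ω|) P := (Lp.aestronglyMeasurable f).norm.mul hZ.norm

/-- L² convergence gives almost sure convergence along subsequences, and the uniform bound `M`
allows dominated convergence against a weight `Z` that is merely integrable. -/
theorem tendsto_integral_abs_mul {l : Filter ℝ} [l.IsCountablyGenerated] {b : ℝ → Lp ℝ 2 P}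
    (hb : Tendsto b l (𝓝 0)) {M : ℝ} (hM : ∀ᶠ η in l, ∀ᵐ ω ∂P, |b η ω| ≤ M) {Z : Ω → ℝ}
    (hZ : Integrable Z P) : Tendsto (fun η => ∫ ω, |b η ω| * |Z ω| ∂P) l (𝓝 0) := by
  refine Filter.tendsto_of_subseq_tendsto fun ns hns => ?_
  have h1 := tendstoInMeasure_of_tendsto_Lp (hb.comp hns)
  obtain ⟨ms, hms, h2⟩ := h1.exists_seq_tendsto_ae
  refine ⟨ms, ?_⟩
  have h3 : ∫ ω, |(0 : Lp ℝ 2 P) ω| * |Z ω| ∂P = 0 := by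
    refine integral_eq_zero_of_ae ?_
    filter_upwards [Lp.coeFn_zero ℝ 2 P] with ω hω
    rw [hω]
    simp
  rw [← h3]
  refine tendsto_integral_filter_of_dominated_convergence (fun ω => M * |Z ω|)
    (Eventually.of_forall fun n => ?_) ?_ (hZ.abs.const_mul M) ?_
  · exact aestronglyMeasurable_abs_mul _ hZ.1
  · filter_upwards [hms.tendsto_atTop.eventually (hns.eventually hM)] with n hn
    filter_upwards [hn] with ω hω
    rw [Real.norm_eq_abs, abs_mul, abs_abs, abs_abs]
    exact mul_le_mul_of_nonneg_right hω (abs_nonneg _)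
  · filter_upwards [h2] with ω hω
    exact (hω.abs).mul_const _

theorem integral_sq_eq (f : Lp ℝ 2 P) : ∫ ω, f ω ^ 2 ∂P = ‖f‖ ^ 2 := by
  rw [← real_inner_self_eq_norm_sq, L2.inner_def]
  refine integral_congr_ae (Eventually.of_forall fun ω => ?_)
  simp [sq]

theorem integrable_sq_Lp (f : Lp ℝ 2 P) : Integrable (fun ω => f ω ^ 2) P := (Lp.memLp f).integrable_sq

variable {b : ℝ → Lp ℝ 2 P} {β : Lp ℝ 2 P}
  (hb : (fun η => b η - η • β) =O[𝓝[>] 0] fun η : ℝ => η ^ 2)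

include hb

theorem tendsto_inv_smul : Tendsto (fun η => η⁻¹ • b η) (𝓝[>] 0) (𝓝 β) := by
  have h1 : (fun η => b η - η • β) =o[𝓝[>] 0] fun η : ℝ => η :=
    hb.trans_isLittleO ((isLittleO_pow_id one_lt_two).mono nhdsWithin_le_nhds)
  rw [tendsto_iff_norm_sub_tendsto_zero]
  have h2 := h1.norm_left.tendsto_div_nhds_zero
  refine (h2.congr' ?_)
  filter_upwards [self_mem_nhdsWithin] with η (hη : 0 < η)
  have : η⁻¹ • b η - β = η⁻¹ • (b η - η • β) := by
    rw [smul_sub, smul_smul, inv_mul_cancel₀ hη.ne', one_smul]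
  rw [this, norm_smul, norm_inv, Real.norm_eq_abs, abs_of_pos hη, div_eq_inv_mul]

theorem tendsto_zero_of_expansion : Tendsto b (𝓝[>] 0) (𝓝 0) := by
  have h1 := ((tendsto_id (α := ℝ) (x := 𝓝 0)).mono_left nhdsWithin_le_nhds).smul (tendsto_inv_smul hb)
  rw [zero_smul] at h1
  refine h1.congr' ?_
  filter_upwards [self_mem_nhdsWithin] with η (hη : 0 < η)
  rw [id, smul_smul, mul_inv_cancel₀ hη.ne', one_smul]

theorem tendsto_norm_sq : Tendsto (fun η => (η ^ 2)⁻¹ * ‖b η‖ ^ 2) (𝓝[>] 0) (𝓝 (‖β‖ ^ 2)) := by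
  refine ((tendsto_inv_smul hb).norm.pow 2).congr fun η => ?_
  rw [norm_smul, mul_pow, norm_inv, inv_pow, Real.norm_eq_abs, sq_abs]

/-- Write |b|³/η² = |b| (b/η)² with b/η = β + r and r → 0 in L², and use (β + r)² ≤ 2β² + 2r². The
term |b| β² goes by dominated convergence, the term |b| r² by |b| ≤ M. No third moment of β is
required. -/
theorem tendsto_integral_cube {M : ℝ} (hM : ∀ᶠ η in 𝓝[>] (0 : ℝ), ∀ᵐ ω ∂P, |b η ω| ≤ M) :
    Tendsto (fun η => (η ^ 2)⁻¹ * ∫ ω, |b η ω| ^ 3 ∂P) (𝓝[>] 0) (𝓝 0) := by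
  have h1 := tendsto_integral_abs_mul (tendsto_zero_of_expansion hb) hM (integrable_sq_Lp β)
  have h2 : Tendsto (fun η => ‖η⁻¹ • b η - β‖ ^ 2) (𝓝[>] 0) (𝓝 0) := by
    have := (tendsto_iff_norm_sub_tendsto_zero.1 (tendsto_inv_smul hb)).pow 2
    simpa using this
  have h3 := (h1.const_mul 2).add (h2.const_mul (2 * M))
  rw [mul_zero, mul_zero, add_zero] at h3
  refine tendsto_of_tendsto_of_tendsto_of_le_of_le' tendsto_const_nhds h3 ?_ ?_
  · exact Eventually.of_forall fun η => mul_nonneg (by positivity)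
      (integral_nonneg fun ω => by positivity)
  · filter_upwards [self_mem_nhdsWithin, hM] with η (hη : 0 < η) hMη
    set r := η⁻¹ • b η - β
    have hi1 : Integrable (fun ω => |b η ω| * |β ω ^ 2|) P := by
      refine ((integrable_sq_Lp β).abs.const_mul M).mono'
        (aestronglyMeasurable_abs_mul (b η) (integrable_sq_Lp β).1) ?_
      filter_upwards [hMη] with ω hω
      rw [Real.norm_eq_abs, abs_mul, abs_abs, abs_abs]
      exact mul_le_mul_of_nonneg_right hω (abs_nonneg _)
    rw [← integral_sq_eq r, ← integral_const_mul, ← integral_const_mul, ← integral_const_mul,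
      ← integral_add (hi1.const_mul 2) ((integrable_sq_Lp r).const_mul _)]
    refine integral_mono_of_nonneg (Eventually.of_forall fun ω => by positivity)
      ((hi1.const_mul 2).add ((integrable_sq_Lp r).const_mul _)) ?_
    filter_upwards [hMη, Lp.coeFn_sub (η⁻¹ • b η) β, Lp.coeFn_smul η⁻¹ (b η)] with ω w1 w2 w3
    have hr : r ω = η⁻¹ * b η ω - β ω := by
      rw [w2, Pi.sub_apply, w3]; rfl
    have e1 : (η ^ 2)⁻¹ * |b η ω| ^ 3 = |b η ω| * (r ω + β ω) ^ 2 := by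
      rw [hr, sub_add_cancel, pow_succ' |b η ω|, sq_abs, mul_pow, inv_pow]
      ring
    rw [e1, abs_of_nonneg (sq_nonneg (β ω))]
    nlinarith [abs_nonneg (b η ω), sq_nonneg (r ω - β ω), mul_nonneg (abs_nonneg (b η ω)) (sq_nonneg (r ω - β ω)),
      mul_nonneg (sub_nonneg.2 w1) (sq_nonneg (r ω))]

/-- Near zero |g| is at most a small multiple of x². Away from zero g is bounded on [-M, M], hence
at most a multiple of |x|³. Second moments are of order η² and third moments are o(η²). -/
theorem integral_comp_isLittleO {M : ℝ} (hM : ∀ᶠ η in 𝓝[>] (0 : ℝ), ∀ᵐ ω ∂P, |b η ω| ≤ M)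
    {g : ℝ → ℝ} (hg : Continuous g) (hg0 : g =o[𝓝 0] fun x : ℝ => x ^ 2) :
    Tendsto (fun η => (η ^ 2)⁻¹ * ∫ ω, g (b η ω) ∂P) (𝓝[>] 0) (𝓝 0) := by
  rw [Metric.tendsto_nhds]
  intro ε hε
  set L := ‖β‖ ^ 2 + 1
  have hL : 0 < L := by positivity
  have h1 := isLittleO_iff.1 hg0 (show 0 < ε / (4 * L) by positivity)
  obtain ⟨δ, hδ, hball⟩ := Metric.eventually_nhds_iff.1 h1
  obtain ⟨K, hK⟩ := (isCompact_Icc (a := -M) (b := M)).exists_bound_of_continuousOn hg.continuousOn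
  set C := |K| / δ ^ 3
  have hC : 0 ≤ C := by positivity
  have hbd : ∀ x, |x| ≤ M → |g x| ≤ ε / (4 * L) * x ^ 2 + C * |x| ^ 3 := by
    intro x hx
    by_cases hxδ : |x| < δ
    · have := hball (y := x) (by simpa using hxδ)
      rw [Real.norm_eq_abs, Real.norm_eq_abs, abs_of_nonneg (sq_nonneg x)] at this
      have h2 : 0 ≤ C * |x| ^ 3 := by positivity
      linarith
    · have h2 := hK x (abs_le.1 hx)
      rw [Real.norm_eq_abs] at h2
      have h3 : |K| ≤ C * |x| ^ 3 := by
        rw [div_mul_eq_mul_div, le_div_iff₀ (by positivity)]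
        gcongr
        exact not_lt.1 hxδ
      have h4 : 0 ≤ ε / (4 * L) * x ^ 2 := by positivity
      linarith [le_abs_self K]
  have hsq := (tendsto_norm_sq hb).eventually (gt_mem_nhds (show ‖β‖ ^ 2 < L by simp [L]))
  have hcu := ((tendsto_integral_cube hb hM).const_mul C).eventually
    (gt_mem_nhds (show C * 0 < ε / 4 by rw [mul_zero]; positivity))
  filter_upwards [self_mem_nhdsWithin, hM, hsq, hcu] with η (hη : 0 < η) hMη h2 h3
  rw [Real.dist_0_eq_abs, abs_mul, abs_of_nonneg (show 0 ≤ (η ^ 2)⁻¹ by positivity)]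
  have hi3 : Integrable (fun ω => |b η ω| ^ 3) P := by
    have hm : AEStronglyMeasurable (fun ω => |b η ω| ^ 3) P :=
      (continuous_abs.pow 3).comp_aestronglyMeasurable (Lp.aestronglyMeasurable (b η))
    refine Integrable.mono' (integrable_const (M ^ 3)) hm ?_
    filter_upwards [hMη] with ω hω
    rw [Real.norm_eq_abs, abs_pow, abs_abs]
    gcongr
  have h5 : |∫ ω, g (b η ω) ∂P| ≤ ε / (4 * L) * ‖b η‖ ^ 2 + C * ∫ ω, |b η ω| ^ 3 ∂P := by
    rw [← integral_sq_eq, ← integral_const_mul, ← integral_const_mul,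
      ← integral_add ((integrable_sq_Lp _).const_mul _) (hi3.const_mul _)]
    refine abs_integral_le_integral_abs.trans (integral_mono_of_nonneg
      (Eventually.of_forall fun ω => abs_nonneg _)
      (((integrable_sq_Lp _).const_mul _).add (hi3.const_mul _)) ?_)
    filter_upwards [hMη] with ω hω using hbd _ hω
  calc (η ^ 2)⁻¹ * |∫ ω, g (b η ω) ∂P|
      ≤ (η ^ 2)⁻¹ * (ε / (4 * L) * ‖b η‖ ^ 2 + C * ∫ ω, |b η ω| ^ 3 ∂P) := by gcongr
    _ = ε / (4 * L) * ((η ^ 2)⁻¹ * ‖b η‖ ^ 2) + C * ((η ^ 2)⁻¹ * ∫ ω, |b η ω| ^ 3 ∂P) := by ring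
    _ ≤ ε / (4 * L) * L + ε / 4 := by gcongr
    _ < ε := by
        have : ε / (4 * L) * L = ε / 4 := by field_simp
        linarith

theorem tendsto_integral_comp {M : ℝ} (hM : ∀ᶠ η in 𝓝[>] (0 : ℝ), ∀ᵐ ω ∂P, |b η ω| ≤ M)
    {φ : ℝ → ℝ} (hφ : Continuous φ) {a₁ a₂ : ℝ}
    (h : (fun x => φ x - (φ 0 + a₁ * x + a₂ * x ^ 2)) =o[𝓝 0] fun x : ℝ => x ^ 2) :
    Tendsto (fun η => (η ^ 2)⁻¹ * (∫ ω, φ (b η ω) ∂P - φ 0 - a₁ * ∫ ω, b η ω ∂P)) (𝓝[>] 0)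
      (𝓝 (a₂ * ‖β‖ ^ 2)) := by
  have h1 := integral_comp_isLittleO hb hM (by fun_prop) h
  have h2 := h1.add ((tendsto_norm_sq hb).const_mul a₂)
  rw [zero_add] at h2
  refine h2.congr' ?_
  filter_upwards [hM] with η hMη
  have hi1 : Integrable (b η) P := (Lp.memLp (b η)).integrable (by norm_num)
  have hi0 : Integrable (fun ω => φ (b η ω)) P := by
    obtain ⟨K, hK⟩ := (isCompact_Icc (a := -M) (b := M)).exists_bound_of_continuousOn hφ.continuousOn
    refine Integrable.mono' (integrable_const K)
      (hφ.comp_aestronglyMeasurable (Lp.aestronglyMeasurable _)) ?_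
    filter_upwards [hMη] with ω hω using hK _ (abs_le.1 hω)
  have hi2 : Integrable (fun ω => φ 0 + a₁ * b η ω) P := (integrable_const _).add (hi1.const_mul _)
  rw [integral_sub hi0 (show Integrable (fun ω => φ 0 + a₁ * b η ω + a₂ * b η ω ^ 2) P from
    hi2.add ((integrable_sq_Lp (b η)).const_mul a₂)), integral_add hi2 ((integrable_sq_Lp (b η)).const_mul a₂), integral_add (integrable_const _)
    (hi1.const_mul _), integral_const_mul, integral_const_mul, integral_sq_eq]
  simp
  ring

end SmallVariables

end WeaklyRandom

namespace WeaklyRandom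

/-! ### Expansions of the law -/

section LawExpansion

open scoped ENNReal

variable {Ω : Type*} [MeasurableSpace Ω] {P : Measure Ω} [IsProbabilityMeasure P]
  {B : ℝ → Ω → ℝ} {B₀ R₀ : Ω → ℝ} {M : ℝ}

/-- The weak o(η²) remainder is a strong O(η²), and η² R₀ can join it: in norm only b = η B₀ + O(η²)
remains. `R₀` survives through the expectation alone, obtained by testing the weak expansion with 1.
-/
theorem exists_strong_expansion (hB : ∀ η > 0, Measurable (B η)) (hBM : ∀ η > 0, ∀ᵐ ω ∂P, |B η ω| ≤ M)
    (hB₀ : MemLp B₀ 2 P) (hR₀ : MemLp R₀ 2 P) (hexp : HasWeakExpansion P B B₀ R₀) :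
    ∃ b : ℝ → Lp ℝ 2 P, (∀ η > 0, b η =ᵐ[P] B η) ∧
      ((fun η => b η - η • hB₀.toLp B₀) =O[𝓝[>] 0] fun η : ℝ => η ^ 2) ∧
      Tendsto (fun η => (η ^ 2)⁻¹ * ((∫ ω, b η ω ∂P) - η * ∫ ω, B₀ ω ∂P)) (𝓝[>] 0)
        (𝓝 (∫ ω, R₀ ω ∂P)) := by
  classical
  have hBm : ∀ η > 0, MemLp (B η) 2 P := fun η hη =>
    MemLp.of_bound (hB η hη).aestronglyMeasurable M (hBM η hη)
  let b : ℝ → Lp ℝ 2 P := fun η => if h : 0 < η then (hBm η h).toLp (B η) else 0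
  have hbB : ∀ η > 0, b η =ᵐ[P] B η := fun η hη => by
    simp only [b]
    rw [dif_pos hη]
    exact MemLp.coeFn_toLp _
  set β := hB₀.toLp B₀
  set ρ := hR₀.toLp R₀
  have hin : ∀ η > 0, ∀ (Y : Ω → ℝ) (hY : MemLp Y 2 P),
      inner ℝ (b η - (η • β + η ^ 2 • ρ)) (hY.toLp Y) =
        ∫ ω, (B η ω - (η * B₀ ω + η ^ 2 * R₀ ω)) * Y ω ∂P := by
    intro η hη Y hY
    rw [L2.inner_def]
    refine integral_congr_ae ?_
    filter_upwards [hbB η hη, hY.coeFn_toLp, hB₀.coeFn_toLp, hR₀.coeFn_toLp,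
      Lp.coeFn_sub (b η) (η • β + η ^ 2 • ρ), Lp.coeFn_add (η • β) (η ^ 2 • ρ),
      Lp.coeFn_smul η β, Lp.coeFn_smul (η ^ 2) ρ] with ω h1 h2 h3 h4 h5 h6 h7 h8
    rw [h5, Pi.sub_apply, h6, Pi.add_apply, h7, h8, Pi.smul_apply, Pi.smul_apply, h1, h2, h3, h4]
    simp only [smul_eq_mul, RCLike.inner_apply, conj_trivial]
    ring
  have hweak : ∀ Y : Lp ℝ 2 P, (fun η => (inner ℝ (b η - (η • β + η ^ 2 • ρ)) Y : ℝ))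
      =o[𝓝[>] 0] fun η : ℝ => η ^ 2 := by
    intro Y
    refine (hexp Y (Lp.memLp Y)).congr' ?_ EventuallyEq.rfl
    filter_upwards [self_mem_nhdsWithin] with η (hη : 0 < η)
    rw [← hin η hη _ (Lp.memLp Y), Lp.toLp_coeFn]
  have hO := isBigO_of_weak hweak
  refine ⟨b, hbB, ?_, ?_⟩
  · have h1 : (fun η : ℝ => η ^ 2 • ρ) =O[𝓝[>] 0] fun η : ℝ => η ^ 2 :=
      IsBigO.of_bound ‖ρ‖ (Eventually.of_forall fun η => by rw [norm_smul, mul_comm])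
    refine (hO.add h1).congr_left fun η => ?_
    abel
  · have h1 := (hexp (fun _ => 1) (memLp_const 1)).tendsto_div_nhds_zero.add_const (∫ ω, R₀ ω ∂P)
    rw [zero_add] at h1
    refine h1.congr' ?_
    filter_upwards [self_mem_nhdsWithin] with η (hη : 0 < η)
    have i1 : Integrable (B η) P := (hBm η hη).integrable (by norm_num)
    have i2 : Integrable B₀ P := hB₀.integrable (by norm_num)
    have i3 : Integrable R₀ P := hR₀.integrable (by norm_num)
    have i4 : Integrable (fun ω => η * B₀ ω + η ^ 2 * R₀ ω) P := (i2.const_mul _).add (i3.const_mul _)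
    simp only [mul_one]
    rw [integral_congr_ae (hbB η hη), integral_sub i1 i4, integral_add (i2.const_mul _)
      (i3.const_mul _), integral_const_mul, integral_const_mul]
    field_simp
    ring

theorem eq_of_tendsto_expansion {x y q : ℝ}
    (h : Tendsto (fun η : ℝ => (η ^ 2)⁻¹ * (x * η + y * η ^ 2)) (𝓝[>] 0) (𝓝 q)) : x = 0 ∧ y = q := by
  have hid : Tendsto (fun η : ℝ => η) (𝓝[>] 0) (𝓝 0) := tendsto_id.mono_left nhdsWithin_le_nhds
  have h1 := h.mul hid
  have h2 : Tendsto (fun η : ℝ => x + y * η) (𝓝[>] 0) (𝓝 (x + y * 0)) := (hid.const_mul y).const_add x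
  have h3 : x + y * 0 = q * 0 := by
    refine tendsto_nhds_unique h2 (h1.congr' ?_)
    filter_upwards [self_mem_nhdsWithin] with η (hη : 0 < η)
    field_simp
  have hx : x = 0 := by linarith
  refine ⟨hx, tendsto_nhds_unique (tendsto_const_nhds.congr' ?_) h⟩
  filter_upwards [self_mem_nhdsWithin] with η (hη : 0 < η)
  rw [hx]
  field_simp
  ring

theorem exists_radius (hM : 0 < M) {K : Set ℝ} (hK : IsCompact K) (hKM : K ⊆ Ioo (-M) M) :
    ∃ r, 0 < r ∧ r < M ∧ K ⊆ Metric.ball 0 r := by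
  -- Adding 0 covers the case of an empty `K`.
  obtain ⟨m, hm, hmax⟩ := (hK.insert 0).exists_isMaxOn ⟨0, mem_insert _ _⟩ continuous_abs.continuousOn
  have hmM : |m| < M := by
    rcases hm with rfl | hm
    · simpa using hM
    · exact abs_lt.2 (hKM hm)
  refine ⟨(|m| + M) / 2, by positivity, by linarith, fun x hx => ?_⟩
  have := hmax (mem_insert_of_mem 0 hx)
  rw [mem_ofPred_eq] at this
  rw [mem_ball_zero_iff, Real.norm_eq_abs]
  linarith

/-- A smooth function on `(-M, M)` agrees near `K` with a test function. -/
theorem exists_test_extension (hM : 0 < M) {K : Set ℝ} (hK : IsCompact K) (hKM : K ⊆ Ioo (-M) M)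
    {f : ℝ → ℝ} (hf : ContDiffOn ℝ ((⊤ : ℕ∞) : WithTop ℕ∞) f (Ioo (-M) M)) :
    ∃ (ψ : 𝓓(openInterval M, ℝ)) (r : ℝ), 0 < r ∧ K ⊆ Metric.ball 0 r ∧
      ∀ x ∈ Metric.ball (0 : ℝ) r, ψ x = f x := by
  obtain ⟨r, hr, hrM, hKr⟩ := exists_radius hM hK hKM
  let χ : ContDiffBump (0 : ℝ) := ⟨r, (r + M) / 2, hr, by linarith⟩
  have hts : tsupport χ ⊆ Ioo (-M) M := by
    rw [χ.tsupport_eq]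
    intro x hx
    rw [mem_closedBall_zero_iff, Real.norm_eq_abs, abs_le] at hx
    simp only [χ] at hx
    constructor <;> linarith [hx.1, hx.2]
  refine ⟨⟨fun x => χ x * f x, ?_, χ.hasCompactSupport.mul_right,
    (tsupport_mul_subset_left (f := χ)).trans hts⟩, r, hr, hKr, fun x hx => ?_⟩
  · rw [contDiff_iff_contDiffAt]
    intro x
    by_cases hx : x ∈ Ioo (-M) M
    · exact χ.contDiffAt.mul (hf.contDiffAt (isOpen_Ioo.mem_nhds hx))
    · have h1 : χ =ᶠ[𝓝 x] 0 := notMem_tsupport_iff_eventuallyEq.1 fun h => hx (hts h)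
      refine (contDiffAt_const (c := 0)).congr_of_eventuallyEq ?_
      filter_upwards [h1] with y hy
      rw [hy, Pi.zero_apply, zero_mul]
  · change χ x * f x = f x
    rw [χ.one_of_mem_closedBall (Metric.ball_subset_closedBall hx), one_mul]

/-- The action of `dP_1` and `dP_2` on a smooth function. -/
theorem pair_of_expansion (hM : 0 < M) (hB : ∀ η > 0, Measurable (B η))
    (hBM : ∀ η > 0, ∀ᵐ ω ∂P, |B η ω| ≤ M) (hB₀ : MemLp B₀ 2 P) (hR₀ : MemLp R₀ 2 P)
    (hexp : HasWeakExpansion P B B₀ R₀) {P₁ P₂ : CompactDistribution (openInterval M)}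
    (hlaw : HasLawExpansion P B P₁ P₂) {f : ℝ → ℝ}
    (hf : ContDiffOn ℝ ((⊤ : ℕ∞) : WithTop ℕ∞) f (Ioo (-M) M)) {a₁ a₂ : ℝ}
    (h : (fun x => f x - (f 0 + a₁ * x + a₂ * x ^ 2)) =o[𝓝 0] fun x : ℝ => x ^ 2) :
    P₁.pair f = (∫ ω, B₀ ω ∂P) * a₁ ∧
      P₂.pair f = (∫ ω, R₀ ω ∂P) * a₁ + (∫ ω, B₀ ω ^ 2 ∂P) * a₂ := by
  obtain ⟨hK1, hKM1, -⟩ := P₁.exists_compact.choose_spec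
  obtain ⟨hK2, hKM2, -⟩ := P₂.exists_compact.choose_spec
  -- A single test function serves both distributions, and the ball where it equals `f` contains 0,
  -- so it has the Taylor coefficients of `f` there.
  obtain ⟨ψ, r, hr, hKr, hψ⟩ := exists_test_extension hM (hK1.union hK2) (union_subset hKM1 hKM2) hf
  have hsub1 : P₁.carrier ⊆ Metric.ball 0 r := subset_union_left.trans hKr
  have hsub2 : P₂.carrier ⊆ Metric.ball 0 r := subset_union_right.trans hKr
  have e1 : P₁.pair f = P₁.pair ψ := by
    rw [P₁.pair_eq f ψ, P₁.pair_eq ψ ψ (Eventually.of_forall fun _ => rfl)]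
    filter_upwards [Metric.isOpen_ball.mem_nhdsSet.2 hsub1] with x hx using hψ x hx
  have e2 : P₂.pair f = P₂.pair ψ := by
    rw [P₂.pair_eq f ψ, P₂.pair_eq ψ ψ (Eventually.of_forall fun _ => rfl)]
    filter_upwards [Metric.isOpen_ball.mem_nhdsSet.2 hsub2] with x hx using hψ x hx
  have h0 : ψ 0 = f 0 := hψ 0 (Metric.mem_ball_self hr)
  have hψc : ContDiff ℝ ((⊤ : ℕ∞) : WithTop ℕ∞) ψ := ψ.contDiff'
  have hψe : (fun x => ψ x - (ψ 0 + a₁ * x + a₂ * x ^ 2)) =o[𝓝 0] fun x : ℝ => x ^ 2 := by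
    refine h.congr' ?_ EventuallyEq.rfl
    filter_upwards [Metric.ball_mem_nhds 0 hr] with x hx
    rw [hψ x hx, h0]
  obtain ⟨b, hbB, hb, hbR⟩ := exists_strong_expansion hB hBM hB₀ hR₀ hexp
  have hbM : ∀ᶠ η in 𝓝[>] (0 : ℝ), ∀ᵐ ω ∂P, |b η ω| ≤ M := by
    filter_upwards [self_mem_nhdsWithin] with η (hη : 0 < η)
    filter_upwards [hbB η hη, hBM η hη] with ω h1 h2
    rwa [h1]
  have t1 := tendsto_integral_comp hb hbM hψc.continuous hψe
  have t2 := (hlaw ψ hψc).tendsto_div_nhds_zero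
  have t3 := ((t1.add (hbR.const_mul a₁)).sub t2)
  rw [sub_zero] at t3
  -- The expectation of ψ(B_η) now has two expansions up to o(η²), one assumed for the law and one
  -- from Taylor's formula at 0. Their coefficients must agree.
  have t4 := eq_of_tendsto_expansion (x := P₁.pair ψ - (∫ ω, B₀ ω ∂P) * a₁) (y := P₂.pair ψ)
    (t3.congr' (by
      filter_upwards [self_mem_nhdsWithin] with η (hη : 0 < η)
      have e3 : ∫ s, ψ s ∂(P.map (B η)) = ∫ ω, ψ (b η ω) ∂P := by
        rw [integral_map (hB η hη).aemeasurable hψc.continuous.aestronglyMeasurable]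
        refine integral_congr_ae ?_
        filter_upwards [hbB η hη] with ω hω
        rw [hω]
      rw [e3]
      field_simp
      ring))
  rw [e1, e2, t4.2]
  refine ⟨by linarith [t4.1], ?_⟩
  have e4 : ‖hB₀.toLp B₀‖ ^ 2 = ∫ ω, B₀ ω ^ 2 ∂P := by
    rw [← integral_sq_eq]
    refine integral_congr_ae ?_
    filter_upwards [hB₀.coeFn_toLp] with ω hω
    rw [hω]
  rw [e4]
  ring

/-- The action of `dP_1` on a smooth function. -/
theorem pair_of_hasDerivAt (hM : 0 < M) (hB : ∀ η > 0, Measurable (B η))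
    (hBM : ∀ η > 0, ∀ᵐ ω ∂P, |B η ω| ≤ M) (hB₀ : MemLp B₀ 2 P) (hR₀ : MemLp R₀ 2 P)
    (hexp : HasWeakExpansion P B B₀ R₀) {P₁ P₂ : CompactDistribution (openInterval M)}
    (hlaw : HasLawExpansion P B P₁ P₂) {f : ℝ → ℝ}
    (hf : ContDiffOn ℝ ((⊤ : ℕ∞) : WithTop ℕ∞) f (Ioo (-M) M)) {a₁ : ℝ} (h : HasDerivAt f a₁ 0) :
    P₁.pair f = (∫ ω, B₀ ω ∂P) * a₁ := by
  obtain ⟨ψ, r, hr, -, hψ⟩ := exists_test_extension hM isCompact_empty (empty_subset _) hf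
  have hψc : ContDiff ℝ ((⊤ : ℕ∞) : WithTop ℕ∞) ψ := ψ.contDiff'
  have hloc : (ψ : ℝ → ℝ) =ᶠ[𝓝 0] f := by
    filter_upwards [Metric.ball_mem_nhds 0 hr] with x hx using hψ x hx
  -- The cut-off of `f` supplies a quadratic Taylor coefficient; its value does not affect the
  -- action of `P₁`.
  have h2 := taylor_isLittleO_univ (x₀ := 0) (n := 2)
    (hψc.of_le (WithTop.coe_le_coe.2 (le_top : (2 : ℕ∞) ≤ ⊤)))
  refine (pair_of_expansion hM hB hBM hB₀ hR₀ hexp hlaw hf (a₁ := a₁)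
    (a₂ := iteratedDeriv 2 ψ 0 / 2) ?_).1
  refine h2.congr' ?_ ?_
  · filter_upwards [hloc] with x hx
    rw [taylorWithinEval_succ, taylorWithinEval_succ, taylor_within_zero_eval, hx, hloc.eq_of_nhds]
    have h3 : deriv ψ 0 = a₁ := (h.congr_of_eventuallyEq hloc).deriv
    simp only [iteratedDerivWithin_univ, zero_add, iteratedDeriv_one, h3]
    norm_num
    ring
  · exact Eventually.of_forall fun x => by simp

variable {d : ℕ} [AddAction (Fin d → ℤ) Ω] [MeasurableConstVAdd (Fin d → ℤ) Ω]
  [VAddInvariantMeasure (Fin d → ℤ) Ω P]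

/-- For each η independence gives 𝔼(b · b∘τ_k) = (𝔼 b)². Both sides are quadratic in b and
continuous in L², so the identity passes to the limit of b/η. Only this decorrelation of `B₀` is
used afterwards. -/
theorem integral_mul_vadd_eq (hB : ∀ η > 0, Measurable (B η)) (hBM : ∀ η > 0, ∀ᵐ ω ∂P, |B η ω| ≤ M)
    (hindep : ∀ η > 0, iIndepFun (fun (k : Fin d → ℤ) (ω : Ω) => B η (k +ᵥ ω)) P)
    (hB₀ : MemLp B₀ 2 P) (hR₀ : MemLp R₀ 2 P) (hexp : HasWeakExpansion P B B₀ R₀)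
    {k : Fin d → ℤ} (hk : k ≠ 0) :
    ∫ ω, B₀ ω * B₀ (k +ᵥ ω) ∂P = (∫ ω, B₀ ω ∂P) ^ 2 := by
  obtain ⟨b, hbB, hb, -⟩ := exists_strong_expansion hB hBM hB₀ hR₀ hexp
  have hmp : MeasurePreserving (fun ω : Ω => k +ᵥ ω) P P := measurePreserving_vadd k P
  let U := Lp.compMeasurePreservingₗᵢ ℝ (E := ℝ) (p := 2) (fun ω : Ω => k +ᵥ ω) hmp
  have hU : ∀ f : Lp ℝ 2 P, U f =ᵐ[P] fun ω => f (k +ᵥ ω) := fun f =>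
    Lp.coeFn_compMeasurePreserving f hmp
  have hone : ∀ f : Lp ℝ 2 P, inner ℝ f ((memLp_const (μ := P) (p := 2) (1 : ℝ)).toLp _) =
      ∫ ω, f ω ∂P := by
    intro f
    rw [L2.inner_def]
    refine integral_congr_ae ?_
    filter_upwards [(memLp_const (μ := P) (p := 2) (1 : ℝ)).coeFn_toLp] with ω hω
    rw [hω]; simp
  have hin : ∀ f : Lp ℝ 2 P, inner ℝ f (U f) = ∫ ω, f ω * f (k +ᵥ ω) ∂P := by
    intro f
    rw [L2.inner_def]
    refine integral_congr_ae ?_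
    filter_upwards [hU f] with ω hω
    rw [hω]; simp [mul_comm]
  have hind : ∀ η > 0, inner ℝ (b η) (U (b η)) =
      inner ℝ (b η) ((memLp_const (μ := P) (p := 2) (1 : ℝ)).toLp _) ^ 2 := by
    intro η hη
    rw [hone, hin, integral_congr_ae (hbB η hη)]
    have h1 := ((hindep η hη).indepFun hk.symm).integral_mul_eq_mul_integral
      ((hB η hη).comp (measurable_const_vadd 0)).aestronglyMeasurable
      ((hB η hη).comp (measurable_const_vadd k)).aestronglyMeasurable
    simp only [Pi.mul_apply, zero_vadd] at h1
    rw [hmp.integral_comp (MeasurableEquiv.vadd k).measurableEmbedding] at h1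
    rw [sq, ← h1]
    refine integral_congr_ae ?_
    filter_upwards [hbB η hη, hmp.quasiMeasurePreserving.ae (hbB η hη)] with ω h2 h3
    rw [h2, h3]
  have ht := tendsto_inv_smul hb
  have t1 := ht.inner (𝕜 := ℝ) ((U.continuous.tendsto _).comp ht)
  have t2 := (ht.inner (𝕜 := ℝ) (tendsto_const_nhds
    (x := (memLp_const (μ := P) (p := 2) (1 : ℝ)).toLp _))).pow 2
  have e1 : inner ℝ (hB₀.toLp B₀) (U (hB₀.toLp B₀)) = inner ℝ (hB₀.toLp B₀)
      ((memLp_const (μ := P) (p := 2) (1 : ℝ)).toLp _) ^ 2 := by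
    refine tendsto_nhds_unique t1 (t2.congr' ?_)
    filter_upwards [self_mem_nhdsWithin] with η (hη : 0 < η)
    simp only [Function.comp]
    rw [map_smul, inner_smul_left, inner_smul_left, inner_smul_right, hind η hη]
    simp only [conj_trivial]
    ring
  rw [hone, hin, integral_congr_ae hB₀.coeFn_toLp] at e1
  rw [← e1]
  refine integral_congr_ae ?_
  filter_upwards [hB₀.coeFn_toLp, hmp.quasiMeasurePreserving.ae hB₀.coeFn_toLp] with ω h2 h3
  rw [h2, h3]

theorem covariance_vadd_eq_zero (hB₀ : MemLp B₀ 2 P) {k : Fin d → ℤ}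
    (h : ∫ ω, B₀ ω * B₀ (k +ᵥ ω) ∂P = (∫ ω, B₀ ω ∂P) ^ 2) :
    covariance B₀ (fun ω => B₀ (k +ᵥ ω)) P = 0 := by
  have hmp : MeasurePreserving (fun ω : Ω => k +ᵥ ω) P P := measurePreserving_vadd k P
  have h1 : MemLp (fun ω => B₀ (k +ᵥ ω)) 2 P := hB₀.comp_measurePreserving hmp
  rw [covariance_eq_sub hB₀ h1]
  simp only [Pi.mul_apply]
  rw [h, hmp.integral_comp (MeasurableEquiv.vadd k).measurableEmbedding]
  ring

end LawExpansion

end WeaklyRandom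

namespace WeaklyRandom

/-! ### Correctors and fluxes in a Hilbert space -/

section HilbertFlux

open ContinuousLinearMap (adjoint)

variable {H : Type*} [NormedAddCommGroup H] [InnerProductSpace ℝ H] [CompleteSpace H]

/-- The element `z` of `x + V` such that `T z` is orthogonal to `V`. -/
noncomputable def corrector (V : Submodule ℝ H) [V.HasOrthogonalProjection] (T : H →L[ℝ] H) (x : H) :
    H := solOp V T (T x) + x

/-- The flux of the corrector of `x` in the direction `y`. -/
noncomputable def flux (V : Submodule ℝ H) [V.HasOrthogonalProjection] (T : H →L[ℝ] H) (x y : H) :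
    ℝ := inner ℝ (T (corrector V T x)) y

variable {V : Submodule ℝ H} [V.HasOrthogonalProjection] {T T' C : H →L[ℝ] H}

theorem CoerciveOn.inner_corrector (hT : CoerciveOn V T) (x : H) {v : H} (hv : v ∈ V) :
    inner ℝ (T (corrector V T x)) v = 0 := by
  rw [corrector, map_add]
  exact hT.inner_solOp _ hv

theorem inner_corrector_adjoint (hT : CoerciveOn V T) (x y : H) :
    inner ℝ (T (corrector V T x)) (corrector V (adjoint T) y) = flux V T x y := by
  rw [flux, corrector.eq_1 V (adjoint T), inner_add_right, hT.inner_corrector x (solOp_mem _ _), zero_add]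

/-- Exact perturbation identity. A flux may be tested with y plus any element of `V`, in particular
with the adjoint corrector of the unperturbed operator. Against the latter, T applied to `corrector
V T' x` does not depend on T', since two correctors of x differ by an element of `V`. -/
theorem flux_eq (hT : CoerciveOn V T) (hT' : CoerciveOn V T') (x y : H) :
    flux V T' x y = flux V T x y +
      inner ℝ ((T' - T) (corrector V T' x)) (corrector V (adjoint T) y) := by
  have h1 : inner ℝ (T' (corrector V T' x)) (corrector V (adjoint T) y) = flux V T' x y := by
    rw [flux, corrector.eq_1 V (adjoint T), inner_add_right,
      hT'.inner_corrector x (solOp_mem _ _), zero_add]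
  have h2 : ∀ S : H →L[ℝ] H, inner ℝ (T (corrector V S x)) (corrector V (adjoint T) y) =
      inner ℝ (T x) (corrector V (adjoint T) y) := by
    intro S
    rw [corrector.eq_1 V S, map_add, inner_add_left, ← ContinuousLinearMap.adjoint_inner_right T,
      real_inner_comm, hT.adjoint.inner_corrector y (solOp_mem _ _), zero_add]
  rw [sub_apply, inner_sub_left, h1, h2, ← h2 T, inner_corrector_adjoint hT]
  ring

theorem hasDerivAt_corrector (hT : CoerciveOn V T) (x : H) :
    HasDerivAt (fun t : ℝ => corrector V (T + t • C) x) (solOp V T (C (corrector V T x))) 0 := by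
  have h1 := (hasDerivAt_solOp (C := C) hT).clm_apply
    ((hasDerivAt_add_smul T C).clm_apply (hasDerivAt_const (0 : ℝ) x))
  have h2 := h1.add_const x
  convert! h2 using 1
  simp [corrector]

theorem contDiffAt_corrector {s : ℝ} (hT : CoerciveOn V (T + s • C)) (x : H) :
    ContDiffAt ℝ ((⊤ : ℕ∞) : WithTop ℕ∞) (fun s : ℝ => corrector V (T + s • C) x) s := by
  have h : ContDiffAt ℝ ((⊤ : ℕ∞) : WithTop ℕ∞) (fun s : ℝ => T + s • C) s :=
    contDiffAt_const.add (contDiffAt_id.smul contDiffAt_const)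
  exact ((contDiffAt_solOp h hT).clm_apply (h.clm_apply contDiffAt_const)).add contDiffAt_const

theorem contDiffAt_flux {s : ℝ} (hT : CoerciveOn V (T + s • C)) (x y : H) :
    ContDiffAt ℝ ((⊤ : ℕ∞) : WithTop ℕ∞) (fun s : ℝ => flux V (T + s • C) x y) s := by
  have h : ContDiffAt ℝ ((⊤ : ℕ∞) : WithTop ℕ∞) (fun s : ℝ => T + s • C) s :=
    contDiffAt_const.add (contDiffAt_id.smul contDiffAt_const)
  exact (h.clm_apply (contDiffAt_corrector hT x)).inner ℝ contDiffAt_const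

theorem flux_add_smul (hT : CoerciveOn V T) {s : ℝ} (hs : CoerciveOn V (T + s • C)) (x y : H) :
    flux V (T + s • C) x y = flux V T x y +
      s * inner ℝ (C (corrector V (T + s • C) x)) (corrector V (adjoint T) y) := by
  rw [flux_eq hT hs, add_sub_cancel_left, smul_apply, real_inner_smul_left]

/-- The flux is its unperturbed value plus s times a function differentiable at 0. Its quadratic
coefficient is therefore a first derivative, with no factor 1/2 and no second derivative to compute.
-/
theorem isLittleO_of_eq_add_mul {f h : ℝ → ℝ} {c h' : ℝ} (hf : ∀ᶠ s in 𝓝 0, f s = c + s * h s)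
    (hh : HasDerivAt h h' 0) :
    (fun s => f s - (f 0 + h 0 * s + h' * s ^ 2)) =o[𝓝 0] fun s : ℝ => s ^ 2 := by
  have h1 := hasDerivAt_iff_isLittleO.1 hh
  have h2 := (isBigO_refl (fun s : ℝ => s) (𝓝 0)).mul_isLittleO h1
  have h0 := hf.self_of_nhds
  refine h2.congr' ?_ (Eventually.of_forall fun s => by ring)
  filter_upwards [hf] with s hs
  rw [hs, h0]
  simp only [sub_zero, smul_eq_mul]
  ring

theorem isLittleO_flux (hT : ∀ᶠ s : ℝ in 𝓝 0, CoerciveOn V (T + s • C)) (x y : H) :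
    (fun s : ℝ => flux V (T + s • C) x y - (flux V (T + (0 : ℝ) • C) x y +
      inner ℝ (C (corrector V T x)) (corrector V (adjoint T) y) * s +
      inner ℝ (C (solOp V T (C (corrector V T x)))) (corrector V (adjoint T) y) * s ^ 2))
      =o[𝓝 0] fun s : ℝ => s ^ 2 := by
  have h0 : CoerciveOn V T := by simpa using hT.self_of_nhds
  have h1 := isLittleO_of_eq_add_mul (hT.mono fun s hs => flux_add_smul h0 hs x y)
    (((C.hasFDerivAt.comp_hasDerivAt (0 : ℝ) (hasDerivAt_corrector (C := C) h0 x))).inner ℝ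
      (hasDerivAt_const (0 : ℝ) (corrector V (adjoint T) y)))
  simpa using h1

theorem hasDerivAt_flux (hT : ∀ᶠ s : ℝ in 𝓝 0, CoerciveOn V (T + s • C)) (x y : H) :
    HasDerivAt (fun s : ℝ => flux V (T + s • C) x y)
      (inner ℝ (C (corrector V T x)) (corrector V (adjoint T) y)) 0 := by
  have h0 : CoerciveOn V T := by simpa using hT.self_of_nhds
  have h1 := ((hasDerivAt_id (0 : ℝ)).mul
    (((C.hasFDerivAt.comp_hasDerivAt (0 : ℝ) (hasDerivAt_corrector (C := C) h0 x))).inner ℝ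
      (hasDerivAt_const (0 : ℝ) (corrector V (adjoint T) y)))).const_add (flux V T x y)
  have h2 := h1.congr_of_eventuallyEq (hT.mono fun s hs => flux_add_smul h0 hs x y)
  simpa using h2

theorem adjoint_add_smul (T C : H →L[ℝ] H) (s : ℝ) :
    adjoint (T + s • C) = adjoint T + s • adjoint C := by
  rw [map_add, map_smulₛₗ]; rfl

/-- The derivative of the flux in one direction, as a function of the parameter in another one. -/
theorem hasDerivAt_inner_corrector {C' : H →L[ℝ] H} (hT : CoerciveOn V T) (x y : H) :
    HasDerivAt (fun s : ℝ => inner ℝ (C' (corrector V (T + s • C) x))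
        (corrector V (adjoint (T + s • C)) y))
      (inner ℝ (C' (solOp V T (C (corrector V T x)))) (corrector V (adjoint T) y)
        + inner ℝ (C (solOp V T (C' (corrector V T x)))) (corrector V (adjoint T) y)) 0 := by
  simp_rw [adjoint_add_smul]
  have h1 := (C'.hasFDerivAt.comp_hasDerivAt (0 : ℝ) (hasDerivAt_corrector (C := C) hT x)).inner ℝ
    (hasDerivAt_corrector (C := adjoint C) hT.adjoint y)
  convert! h1 using 1
  simp only [Function.comp_apply, zero_smul, add_zero]
  rw [add_comm]
  congr 1
  -- The derivative of the adjoint corrector is moved back to the direct side by duality, which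
  -- produces the same expression with the two perturbations exchanged.
  rw [real_inner_comm _ (C' _), ← hT.inner_solOp_comm, ContinuousLinearMap.adjoint_inner_right]

theorem contDiffAt_inner_corrector {C' : H →L[ℝ] H} {s : ℝ} (hT : CoerciveOn V (T + s • C))
    (x y : H) :
    ContDiffAt ℝ ((⊤ : ℕ∞) : WithTop ℕ∞) (fun s : ℝ => inner ℝ (C' (corrector V (T + s • C) x))
        (corrector V (adjoint (T + s • C)) y)) s := by
  have h2 := hT.adjoint
  simp_rw [adjoint_add_smul] at h2 ⊢
  exact (contDiffAt_const.clm_apply (contDiffAt_corrector hT x)).inner ℝ (contDiffAt_corrector h2 y)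

end HilbertFlux

end WeaklyRandom

namespace WeaklyRandom

/-! ### Correctors and fluxes of periodic fields -/

section PeriodicFlux

open ContinuousLinearMap (adjoint)

variable {d : ℕ}

/-- The constant field `v` on the cube `I_N`. -/
noncomputable def constL (N : ℕ) (v : E d) : Lp (E d) 2 (volume.restrict (cube d N)) :=
  (memLp_const v).toLp _

theorem coeFn_constL (N : ℕ) (v : E d) :
    constL N v =ᵐ[volume.restrict (cube d N)] fun _ => v := MemLp.coeFn_toLp _

theorem mulL_constL {N : ℕ} {a : TensorField d} (ha : MemLp a ⊤ (volume.restrict (cube d N)))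
    (v : E d) : mulL _ a (constL N v) = (memLp_mul ha (memLp_const v)).toLp fun x => a x v :=
  mulL_toLp ha (memLp_const v)

theorem correctorGrad_ae_eq {N : ℕ} (hN : 0 < N) {a : TensorField d}
    (ha : MemLp a ⊤ (volume.restrict (cube d N))) (hco : CoerciveOn (perV d N) (mulL _ a))
    (i : Fin d) : (fun x => correctorGrad N a i x + e i) =ᵐ[volume.restrict (cube d N)]
      (corrector (perV d N) (mulL (volume.restrict (cube d N)) a) (constL N (e i)) :) := by
  have h := periodicGrad_ae_eq hN ha hco (memLp_mul ha (memLp_const (e i)))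
  rw [← mulL_constL ha] at h
  filter_upwards [h, coeFn_constL N (e i), Lp.coeFn_add
    (solOp (perV d N) (mulL _ a) (mulL _ a (constL N (e i)))) (constL N (e i))] with x h1 h2 h3
  rw [corrector, h3, Pi.add_apply, h2, ← h1, correctorGrad]

theorem cellFlux_eq_flux {N : ℕ} (hN : 0 < N) {a : TensorField d}
    (ha : MemLp a ⊤ (volume.restrict (cube d N))) (hco : CoerciveOn (perV d N) (mulL _ a))
    (i j : Fin d) : cellFlux N a j i =
      flux (perV d N) (mulL _ a) (constL N (e i)) (constL N (e j)) := by
  rw [flux, L2.inner_def, cellFlux, Matrix.of_apply]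
  refine integral_congr_ae ?_
  filter_upwards [correctorGrad_ae_eq hN ha hco i, coeFn_constL N (e j),
    coeFn_mulL ha (corrector (perV d N) (mulL _ a) (constL N (e i)))] with x h1 h2 h3
  rw [h2, h3, inner_e, ← h1]

theorem cube_subset (n : ℕ) : cube d 1 ⊆ cube d (2 * n + 1) := by
  intro x hx
  rw [mem_cube_iff_cellIdx, (mem_cube_iff one_pos).1 hx, mem_cellsIn_iff]
  simp

theorem memLp_top_indicator {X F : Type*} [MeasurableSpace X] {μ : Measure X} [NormedAddCommGroup F]
    {a : X → F} (ha : MemLp a ⊤ μ) {S : Set X} (hS : MeasurableSet S) :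
    MemLp (S.indicator a) ⊤ μ := ha.indicator hS

theorem memLp_indicator {C : TensorField d} (hC : MemLp C ⊤ volume) {S : Set (E d)}
    (hS : MeasurableSet S) : MemLp (S.indicator C) ⊤ volume := memLp_top_indicator hC hS

theorem inner_mulL_indicator {N : ℕ} {S : Set (E d)} (hS : MeasurableSet S) (hSN : S ⊆ cube d N)
    {C : TensorField d} (hC : MemLp C ⊤ volume) (f g : Lp (E d) 2 (volume.restrict (cube d N))) :
    inner ℝ (mulL _ (S.indicator C) f) g = ∫ x in S, inner ℝ (C x (f x)) (g x) := by
  rw [L2.inner_def, ← inter_eq_left.2 hSN, ← Measure.restrict_restrict hS, ← integral_indicator hS]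
  refine integral_congr_ae ?_
  filter_upwards [coeFn_mulL ((memLp_indicator hC hS).restrict (cube d N)) f] with x hx
  rw [inter_eq_left.2 hSN, hx]
  by_cases h : x ∈ S <;> simp [h]

theorem cell_subset {n : ℕ} {k : Fin d → ℤ} (hk : k ∈ cellsIn d (2 * n + 1)) :
    (cell k : Set (E d)) ⊆ cube d (2 * n + 1) := by
  intro x hx
  rwa [mem_cube_iff_cellIdx, mem_cell_iff.1 hx]

/-- The cells of the box partition the supercell, so single-cell perturbations add up to the
perturbation by C everywhere. -/
theorem sum_inner_mulL_cell {n : ℕ} {C : TensorField d} (hC : MemLp C ⊤ volume)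
    (f g : Lp (E d) 2 (volume.restrict (cube d (2 * n + 1)))) :
    ∑ k ∈ cellsIn d (2 * n + 1), inner ℝ (mulL _ ((cell k).indicator C) f) g =
      inner ℝ (mulL _ C f) g := by
  have hint : IntegrableOn (fun x => inner ℝ (C x (f x)) (g x)) (cube d (2 * n + 1)) :=
    integrable_inner_of_memLp (memLp_mul (hC.restrict _) (Lp.memLp f)) (Lp.memLp g)
  have h0 : cube d (2 * n + 1) = ⋃ k ∈ cellsIn d (2 * n + 1), (cell k : Set (E d)) := by
    ext x
    rw [mem_cube_iff_cellIdx]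
    simp [mem_cell_iff]
  have h1 : inner ℝ (mulL _ C f) g = ∫ x in cube d (2 * n + 1), inner ℝ (C x (f x)) (g x) := by
    rw [L2.inner_def]
    refine integral_congr_ae ?_
    filter_upwards [coeFn_mulL (hC.restrict (cube d (2 * n + 1))) f] with x hx
    rw [hx]
  rw [h1, Finset.sum_congr rfl fun k hk =>
    inner_mulL_indicator (measurableSet_cell k) (cell_subset hk) hC f g]
  refine (congrArg (fun S => ∫ x in S, inner ℝ (C x (f x)) (g x)) h0).trans ?_ |>.symm
  refine (integral_biUnion_finset _ (fun k _ => measurableSet_cell k) ?_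
    fun k hk => hint.mono_set (cell_subset hk))
  intro k _ k' _ hkk
  refine Set.disjoint_left.2 fun x h1 h2 => hkk ?_
  rw [mem_cell_iff] at h1 h2
  rw [← h1, h2]

/-- The standing assumptions on the unperturbed field `A` and the perturbation `C`. -/
structure Admissible (A C : TensorField d) (M α : ℝ) : Prop where
  memLp : MemLp A ⊤ volume
  memLp' : MemLp C ⊤ volume
  isPeriodic : IsPeriodic 1 A
  isPeriodic' : IsPeriodic 1 C
  radius_pos : 0 < M
  pos : 0 < α
  coercive : ∀ᵐ x : E d, ∀ s ∈ Icc (-M) M, ∀ ξ : E d, α * ‖ξ‖ ^ 2 ≤ inner ℝ ((A x + s • C x) ξ) ξ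

theorem add_zero_smul (a c : E d →L[ℝ] E d) : a + (0 : ℝ) • c = a := by
  ext1 v; simp

/-- The bound on `C` comes from the amplitudes 0 and M, through C = M⁻¹((A + M C) - A). -/
theorem admissible_of_bounds {A C : TensorField d} {M α β : ℝ} (hA : Measurable A)
    (hC : Measurable C) (hAper : IsPeriodic 1 A) (hCper : IsPeriodic 1 C) (hM : 0 < M) (hα : 0 < α)
    (hαβ : α ≤ β)
    (hcoercive : ∀ᵐ x : E d, ∀ s ∈ Icc (-M) M, ∀ ξ : E d,
      α * ‖ξ‖ ^ 2 ≤ inner ℝ ((A x + s • C x) ξ) ξ)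
    (hbounded : ∀ᵐ x : E d, ∀ s ∈ Icc (-M) M, ∀ ξ : E d, ‖(A x + s • C x) ξ‖ ≤ β * ‖ξ‖) :
    Admissible A C M α := by
  have hβ : 0 ≤ β := hα.le.trans hαβ
  have hb : ∀ᵐ x : E d, ∀ s ∈ Icc (-M) M, ‖A x + s • C x‖ ≤ β :=
    hbounded.mono fun x hx s hs => ContinuousLinearMap.opNorm_le_bound _ hβ (hx s hs)
  refine ⟨memLp_top_of_bound hA.aestronglyMeasurable β ?_,
    memLp_top_of_bound hC.aestronglyMeasurable (M⁻¹ * (β + β)) ?_, hAper, hCper, hM, hα, hcoercive⟩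
  · filter_upwards [hb] with x hx
    have h0 := hx 0 ⟨by linarith, hM.le⟩
    rwa [add_zero_smul] at h0
  · filter_upwards [hb] with x hx
    have h0 := hx 0 ⟨by linarith, hM.le⟩
    rw [add_zero_smul] at h0
    have h1 := hx M ⟨by linarith, le_rfl⟩
    have h2 : C x = M⁻¹ • ((A x + M • C x) - A x) := by
      rw [add_sub_cancel_left, smul_smul, inv_mul_cancel₀ hM.ne', one_smul]
    rw [h2, norm_smul, norm_inv, Real.norm_of_nonneg hM.le]
    exact mul_le_mul_of_nonneg_left ((norm_sub_le _ _).trans (add_le_add h1 h0)) (by positivity)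

variable {A C : TensorField d} {M α : ℝ}

namespace Admissible

theorem coercive_zero (h : Admissible A C M α) :
    ∀ᵐ x : E d, ∀ ξ : E d, α * ‖ξ‖ ^ 2 ≤ inner ℝ (A x ξ) ξ := by
  filter_upwards [h.coercive] with x hx ξ
  simpa using hx 0 ⟨by linarith [h.radius_pos], h.radius_pos.le⟩ ξ

theorem coerciveOn (h : Admissible A C M α) (N : ℕ) (V : Submodule ℝ (Lp (E d) 2 _)) :
    CoerciveOn V (mulL (volume.restrict (cube d N)) A) :=
  ⟨α, h.pos, fun v _ => coercive_mulL (h.memLp.restrict _) (ae_restrict_of_ae h.coercive_zero) v⟩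

theorem memLp_oneDefect (h : Admissible A C M α) (s : ℝ) :
    MemLp (fun x => A x + s • (cube d 1).indicator C x) ⊤ volume :=
  memLp_add_smul h.memLp (memLp_indicator h.memLp' (measurableSet_cube 1)) s

theorem memLp_twoDefects (h : Admissible A C M α) (s t : ℝ) (k : Fin d → ℤ) :
    MemLp (fun x => (A x + s • (cube d 1).indicator C x) + t • (cell k).indicator C x) ⊤ volume :=
  memLp_add_smul (h.memLp_oneDefect s) (memLp_indicator h.memLp' (measurableSet_cell k)) t

theorem mulL_twoDefects (h : Admissible A C M α) (N : ℕ) (s t : ℝ) (k : Fin d → ℤ) :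
    mulL (volume.restrict (cube d N))
        (fun x => (A x + s • (cube d 1).indicator C x) + t • (cell k).indicator C x) =
      (mulL (volume.restrict (cube d N)) A
        + s • mulL (volume.restrict (cube d N)) ((cube d 1).indicator C))
        + t • mulL (volume.restrict (cube d N)) ((cell k).indicator C) := by
  rw [mulL_add_smul ((h.memLp_oneDefect s).restrict _)
    ((memLp_indicator h.memLp' (measurableSet_cell k)).restrict _),
    mulL_add_smul (h.memLp.restrict _) ((memLp_indicator h.memLp' (measurableSet_cube 1)).restrict _)]

/-- Since k ≠ 0 the two cells are disjoint: at each point the amplitude is s, t or 0, never s + t,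
and so stays within [-M, M]. -/
theorem coerciveOn_twoDefects (h : Admissible A C M α) (N : ℕ) (V : Submodule ℝ (Lp (E d) 2 _))
    {s t : ℝ} (hs : s ∈ Icc (-M) M) (ht : t ∈ Icc (-M) M) {k : Fin d → ℤ} (hk : k ≠ 0) :
    CoerciveOn V ((mulL (volume.restrict (cube d N)) A
        + s • mulL (volume.restrict (cube d N)) ((cube d 1).indicator C))
        + t • mulL (volume.restrict (cube d N)) ((cell k).indicator C)) := by
  rw [← h.mulL_twoDefects]
  refine ⟨α, h.pos, fun v _ => coercive_mulL ((h.memLp_twoDefects s t k).restrict _)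
    (ae_restrict_of_ae ?_) v⟩
  filter_upwards [h.coercive] with x hx
  by_cases h1 : x ∈ cube d 1
  · have h2 : x ∉ cell k := by
      rw [← cell_zero, mem_cell_iff] at h1
      rw [mem_cell_iff, h1]
      exact hk.symm
    simpa [h1, h2] using hx s hs
  · by_cases h2 : x ∈ cell k
    · simpa [h1, h2] using hx t ht
    · simpa [h1, h2] using hx 0 ⟨by linarith [h.radius_pos], h.radius_pos.le⟩

theorem coerciveOn_oneDefect (h : Admissible A C M α) (N : ℕ) (V : Submodule ℝ (Lp (E d) 2 _))
    {s : ℝ} (hs : s ∈ Icc (-M) M) :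
    CoerciveOn V (mulL (volume.restrict (cube d N)) A
        + s • mulL (volume.restrict (cube d N)) ((cube d 1).indicator C)) := by
  rw [← mulL_add_smul (h.memLp.restrict _)
    ((memLp_indicator h.memLp' (measurableSet_cube 1)).restrict _)]
  refine ⟨α, h.pos, fun v _ => coercive_mulL ((h.memLp_oneDefect s).restrict _)
    (ae_restrict_of_ae ?_) v⟩
  filter_upwards [h.coercive] with x hx
  by_cases h1 : x ∈ cube d 1
  · simpa [h1] using hx s hs
  · simpa [h1] using hx 0 ⟨by linarith [h.radius_pos], h.radius_pos.le⟩

theorem cellFlux_oneDefect (h : Admissible A C M α) {N : ℕ} (hN : 0 < N) {s : ℝ}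
    (hs : s ∈ Icc (-M) M) (i j : Fin d) : cellFlux N (oneDefect A C s) j i =
      flux (perV d N) (mulL (volume.restrict (cube d N)) A
        + s • mulL (volume.restrict (cube d N)) ((cube d 1).indicator C))
        (constL N (e i)) (constL N (e j)) := by
  have h1 : oneDefect A C s = fun x => A x + s • (cube d 1).indicator C x := by
    funext x
    ext1 v
    by_cases hx : x ∈ cube d 1 <;> simp [oneDefect, hx]
  have h2 := mulL_add_smul (h.memLp.restrict (cube d N))
    ((memLp_indicator h.memLp' (measurableSet_cube 1)).restrict (cube d N)) s
  rw [h1, ← h2]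
  exact cellFlux_eq_flux hN ((h.memLp_oneDefect s).restrict _)
    (h2 ▸ h.coerciveOn_oneDefect N _ hs) i j

theorem cellFlux_twoDefects (h : Admissible A C M α) {N : ℕ} (hN : 0 < N) {s t : ℝ}
    (hs : s ∈ Icc (-M) M) (ht : t ∈ Icc (-M) M) {k : Fin d → ℤ} (hk : k ≠ 0) (i j : Fin d) :
    cellFlux N (twoDefects A C s t k) j i =
      flux (perV d N) ((mulL (volume.restrict (cube d N)) A
        + s • mulL (volume.restrict (cube d N)) ((cube d 1).indicator C))
        + t • mulL (volume.restrict (cube d N)) ((cell k).indicator C))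
        (constL N (e i)) (constL N (e j)) := by
  have h1 : twoDefects A C s t k =
      fun x => (A x + s • (cube d 1).indicator C x) + t • (cell k).indicator C x := by
    funext x
    ext1 v
    by_cases hx : x ∈ cube d 1 <;> by_cases hx' : x ∈ cell k <;> simp [twoDefects, hx, hx']
  have h2 := h.mulL_twoDefects N s t k
  rw [h1, ← h2]
  exact cellFlux_eq_flux hN ((h.memLp_twoDefects s t k).restrict _)
    (h2 ▸ h.coerciveOn_twoDefects N _ hs ht hk) i j

end Admissible

/-- On any odd period, the variational solution with `1`-periodic data is the `1`-periodic one. -/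
theorem solOp_ae_eq_periodicGrad_one {a : TensorField d} (ha : MemLp a ⊤ volume)
    (hap : IsPeriodic 1 a) {α : ℝ} (hα : 0 < α)
    (hco : ∀ᵐ x : E d, ∀ ξ : E d, α * ‖ξ‖ ^ 2 ≤ inner ℝ (a x ξ) ξ) {F : E d → E d} (hF : LocL2 F)
    (hFp : IsPeriodic 1 F) (n : ℕ) :
    solOp (perV d (2 * n + 1)) (mulL (volume.restrict (cube d (2 * n + 1))) a)
        ((hF.memLp_cube (2 * n + 1)).toLp F)
      =ᵐ[volume.restrict (cube d (2 * n + 1))] periodicGrad 1 a F := by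
  have hcoN : ∀ N, CoerciveOn (perV d N) (mulL (volume.restrict (cube d N)) a) := fun N =>
    ⟨α, hα, fun v _ => coercive_mulL (ha.restrict _) (ae_restrict_of_ae hco) v⟩
  have h1 := (isPeriodicSolution_periodicGrad one_pos (ha.restrict _) (hcoN 1)
    (hF.memLp_cube 1)).of_one (n := n) ha hap hF hFp
  rw [← h1.toLp_eq (by omega) (ha.restrict _) (hcoN _) (hF.memLp_cube _)]
  exact h1.memLp.coeFn_toLp

theorem isPeriodicSolution_one {a : TensorField d} (ha : MemLp a ⊤ volume) {α : ℝ} (hα : 0 < α)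
    (hco : ∀ᵐ x : E d, ∀ ξ : E d, α * ‖ξ‖ ^ 2 ≤ inner ℝ (a x ξ) ξ) {F : E d → E d} (hF : LocL2 F) :
    IsPeriodicSolution 1 a F (periodicGrad 1 a F) :=
  isPeriodicSolution_periodicGrad one_pos (ha.restrict _)
    ⟨α, hα, fun v _ => coercive_mulL (ha.restrict _) (ae_restrict_of_ae hco) v⟩ (hF.memLp_cube 1)

theorem isPeriodic_apply {N : ℕ} {a : TensorField d} {F : E d → E d} (ha : IsPeriodic N a)
    (hF : IsPeriodic N F) : IsPeriodic N fun x => a x (F x) := fun k => by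
  filter_upwards [ha k, hF k] with x h1 h2
  rw [h1, h2]

theorem isPeriodic_add_const {N : ℕ} {F : E d → E d} (hF : IsPeriodic N F) (v : E d) :
    IsPeriodic N fun x => F x + v := fun k => by
  filter_upwards [hF k] with x h1
  rw [h1]

theorem locL2_const (v : E d) : LocL2 fun _ : E d => v := fun K hK => by
  have : IsFiniteMeasure (volume.restrict K) := ⟨by
    rw [Measure.restrict_apply_univ]; exact hK.measure_lt_top⟩
  exact memLp_const v

theorem isPeriodic_adjoint {N : ℕ} {a : TensorField d} (ha : IsPeriodic N a) :
    IsPeriodic N fun x => adjoint (a x) := fun k => by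
  filter_upwards [ha k] with x h1
  rw [h1]

theorem coercive_adjoint {a : TensorField d} {α : ℝ}
    (hco : ∀ᵐ x : E d, ∀ ξ : E d, α * ‖ξ‖ ^ 2 ≤ inner ℝ (a x ξ) ξ) :
    ∀ᵐ x : E d, ∀ ξ : E d, α * ‖ξ‖ ^ 2 ≤ inner ℝ (adjoint (a x) ξ) ξ := by
  filter_upwards [hco] with x hx ξ
  rw [ContinuousLinearMap.adjoint_inner_left, real_inner_comm]
  exact hx ξ

theorem locL2_correctorGrad {a : TensorField d} (ha : MemLp a ⊤ volume) {α : ℝ} (hα : 0 < α)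
    (hco : ∀ᵐ x : E d, ∀ ξ : E d, α * ‖ξ‖ ^ 2 ≤ inner ℝ (a x ξ) ξ) (i : Fin d) :
    LocL2 fun x => correctorGrad 1 a i x + e i :=
  (isPeriodicSolution_one ha hα hco ((locL2_const (e i)).mul ha)).locL2.add (locL2_const _)

theorem isPeriodic_correctorGrad {a : TensorField d} (ha : MemLp a ⊤ volume) {α : ℝ} (hα : 0 < α)
    (hco : ∀ᵐ x : E d, ∀ ξ : E d, α * ‖ξ‖ ^ 2 ≤ inner ℝ (a x ξ) ξ) (i : Fin d) :
    IsPeriodic 1 fun x => correctorGrad 1 a i x + e i :=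
  isPeriodic_add_const
    (isPeriodicSolution_one ha hα hco ((locL2_const (e i)).mul ha)).isPeriodic _

/-- In an unperturbed supercell the corrector is the one-cell corrector, by uniqueness. This is the
source of all independence of N. -/
theorem corrector_eq_toLp {a : TensorField d} (ha : MemLp a ⊤ volume) (hap : IsPeriodic 1 a) {α : ℝ}
    (hα : 0 < α) (hco : ∀ᵐ x : E d, ∀ ξ : E d, α * ‖ξ‖ ^ 2 ≤ inner ℝ (a x ξ) ξ) (i : Fin d) (n : ℕ) :
    corrector (perV d (2 * n + 1)) (mulL (volume.restrict (cube d (2 * n + 1))) a)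
        (constL (2 * n + 1) (e i)) =
      ((locL2_correctorGrad ha hα hco i).memLp_cube (2 * n + 1)).toLp _ := by
  have hp : IsPeriodic 1 fun x => a x (e i) :=
    isPeriodic_apply hap fun k => Eventually.of_forall fun x => rfl
  have h := solOp_ae_eq_periodicGrad_one ha hap hα hco ((locL2_const (e i)).mul ha) hp n
  refine Lp.ext ?_
  rw [corrector, mulL_constL (ha.restrict _)]
  filter_upwards [h, coeFn_constL (2 * n + 1) (e i), Lp.coeFn_add (solOp (perV d (2 * n + 1))
    (mulL (volume.restrict (cube d (2 * n + 1))) a)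
    ((((locL2_const (e i)).mul ha).memLp_cube (2 * n + 1)).toLp _)) (constL (2 * n + 1) (e i)),
    ((locL2_correctorGrad ha hα hco i).memLp_cube (2 * n + 1)).coeFn_toLp] with x h1 h2 h3 h4
  rw [h4, h3, Pi.add_apply, h2, h1, correctorGrad]

end PeriodicFlux

end WeaklyRandom

namespace WeaklyRandom

/-! ### Pairings of fluxes with one or two defects -/

section Pairing

open ContinuousLinearMap (adjoint)

variable {H : Type*} [NormedAddCommGroup H] [InnerProductSpace ℝ H] [CompleteSpace H]
variable {V : Submodule ℝ H} [V.HasOrthogonalProjection] {T C C' : H →L[ℝ] H} {M : ℝ}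

theorem CoerciveOn.inner_apply_solOp (hT : CoerciveOn V T) (C : H →L[ℝ] H) (F q : H) :
    inner ℝ (C (solOp V T F)) q =
      inner ℝ F (solOp V (ContinuousLinearMap.adjoint T) (ContinuousLinearMap.adjoint C q)) := by
  rw [← ContinuousLinearMap.adjoint_inner_right, hT.inner_solOp_comm, real_inner_comm]

theorem eventually_mem_Ioo (hM : 0 < M) : ∀ᶠ s : ℝ in 𝓝 0, s ∈ Ioo (-M) M :=
  Ioo_mem_nhds (by linarith) hM

/-- The distributions enter only through their action on Taylor coefficients at 0, so the pairing
reduces to the first two coefficients of the flux in the amplitude. -/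
theorem pair_flux (hM : 0 < M) {x y : H} {p₁ p₂ : (ℝ → ℝ) → ℝ} {m r σ : ℝ}
    (hp : ∀ (f : ℝ → ℝ) (a₁ a₂ : ℝ), ContDiffOn ℝ ((⊤ : ℕ∞) : WithTop ℕ∞) f (Ioo (-M) M) →
      (fun x => f x - (f 0 + a₁ * x + a₂ * x ^ 2)) =o[𝓝 0] (fun x : ℝ => x ^ 2) →
      p₁ f = m * a₁ ∧ p₂ f = r * a₁ + σ * a₂)
    (hT : ∀ s ∈ Ioo (-M) M, CoerciveOn V (T + s • C)) {f : ℝ → ℝ}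
    (hf : ∀ s ∈ Ioo (-M) M, f s = flux V (T + s • C) x y) :
    p₁ f = m * inner ℝ (C (corrector V T x)) (corrector V (adjoint T) y) ∧
    p₂ f = r * inner ℝ (C (corrector V T x)) (corrector V (adjoint T) y)
      + σ * inner ℝ (C (solOp V T (C (corrector V T x)))) (corrector V (adjoint T) y) := by
  have h0 := eventually_mem_Ioo hM
  refine hp f _ _ ?_ ((isLittleO_flux (h0.mono hT) x y).congr' ?_ EventuallyEq.rfl)
  · exact ContDiffOn.congr
      (fun s hs => (contDiffAt_flux (hT s hs) x y).contDiffWithinAt) hf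
  · filter_upwards [h0] with s hs
    rw [hf s hs, hf 0 h0.self_of_nhds]

/-- The inner pairing extracts the derivative in t at 0, which is still smooth in s; the outer one
differentiates it in s. The result is the mixed second derivative, with the two perturbations in
both orders. -/
theorem pair_pair_flux (hM : 0 < M) {x y : H} {p₁ : (ℝ → ℝ) → ℝ} {m : ℝ}
    (hp : ∀ (f : ℝ → ℝ) (a₁ : ℝ), ContDiffOn ℝ ((⊤ : ℕ∞) : WithTop ℕ∞) f (Ioo (-M) M) →
      HasDerivAt f a₁ 0 → p₁ f = m * a₁)
    (hT : ∀ s ∈ Ioo (-M) M, ∀ t ∈ Ioo (-M) M, CoerciveOn V ((T + s • C) + t • C')) {f : ℝ → ℝ → ℝ}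
    (hf : ∀ s ∈ Ioo (-M) M, ∀ t ∈ Ioo (-M) M, f s t = flux V ((T + s • C) + t • C') x y) :
    p₁ (fun s => p₁ (f s)) = m ^ 2 *
      (inner ℝ (C' (solOp V T (C (corrector V T x)))) (corrector V (adjoint T) y)
        + inner ℝ (C (solOp V T (C' (corrector V T x)))) (corrector V (adjoint T) y)) := by
  have h0 := eventually_mem_Ioo hM
  have hT1 : ∀ s ∈ Ioo (-M) M, CoerciveOn V (T + s • C) := fun s hs => by
    simpa using hT s hs 0 h0.self_of_nhds
  have hT0 : CoerciveOn V T := by simpa using hT1 0 h0.self_of_nhds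
  have h1 : ∀ s ∈ Ioo (-M) M, p₁ (f s) = m * inner ℝ (C' (corrector V (T + s • C) x))
        (corrector V (adjoint (T + s • C)) y) := by
    intro s hs
    refine hp (f s) _ ?_ ?_
    · exact ContDiffOn.congr
        (fun t ht => (contDiffAt_flux (hT s hs t ht) x y).contDiffWithinAt) (hf s hs)
    · exact (hasDerivAt_flux (h0.mono (hT s hs)) x y).congr_of_eventuallyEq
        (h0.mono fun t ht => hf s hs t ht)
  rw [sq, mul_assoc]
  refine hp _ _ ?_ ?_
  · exact ContDiffOn.congr (fun s hs => (contDiffAt_const.mul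
      (contDiffAt_inner_corrector (hT1 s hs) x y)).contDiffWithinAt) h1
  · exact ((hasDerivAt_inner_corrector hT0 x y).const_mul m).congr_of_eventuallyEq (h0.mono h1)

end Pairing

/-! ### The supercell coefficients -/

section Supercell

open ContinuousLinearMap (adjoint)

variable {d : ℕ} {A C : TensorField d} {M α : ℝ}

theorem solOp_mulL_corrector_ae {a c : TensorField d} (ha : MemLp a ⊤ volume)
    (hap : IsPeriodic 1 a) (hα : 0 < α)
    (hco : ∀ᵐ x : E d, ∀ ξ : E d, α * ‖ξ‖ ^ 2 ≤ inner ℝ (a x ξ) ξ) (hc : MemLp c ⊤ volume)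
    (hcp : IsPeriodic 1 c) (i : Fin d) (n : ℕ) :
    (solOp (perV d (2 * n + 1)) (mulL (volume.restrict (cube d (2 * n + 1))) a)
        (mulL (volume.restrict (cube d (2 * n + 1))) c (corrector (perV d (2 * n + 1))
          (mulL (volume.restrict (cube d (2 * n + 1))) a) (constL (2 * n + 1) (e i)))) :)
      =ᵐ[volume.restrict (cube d (2 * n + 1))]
        periodicGrad 1 a fun x => c x (correctorGrad 1 a i x + e i) := by
  have hl := locL2_correctorGrad ha hα hco i
  rw [corrector_eq_toLp ha hap hα hco i n,
    mulL_toLp (hc.restrict (cube d (2 * n + 1))) (hl.memLp_cube (2 * n + 1))]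
  exact solOp_ae_eq_periodicGrad_one ha hap hα hco (hl.mul hc)
    (isPeriodic_apply hcp (isPeriodic_correctorGrad ha hα hco i)) n

namespace Admissible

theorem locL2_corrector (h : Admissible A C M α) (i : Fin d) :
    LocL2 fun x => correctorGrad 1 A i x + e i :=
  locL2_correctorGrad h.memLp h.pos h.coercive_zero i

theorem isPeriodic_corrector (h : Admissible A C M α) (i : Fin d) :
    IsPeriodic 1 fun x => correctorGrad 1 A i x + e i :=
  isPeriodic_correctorGrad h.memLp h.pos h.coercive_zero i

theorem locL2_adjointCorrector (h : Admissible A C M α) (j : Fin d) :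
    LocL2 fun x => adjointCorrectorGrad A j x + e j :=
  locL2_correctorGrad (memLp_adjoint h.memLp) h.pos (coercive_adjoint h.coercive_zero) j

theorem isPeriodic_adjointCorrector (h : Admissible A C M α) (j : Fin d) :
    IsPeriodic 1 fun x => adjointCorrectorGrad A j x + e j :=
  isPeriodic_correctorGrad (memLp_adjoint h.memLp) h.pos (coercive_adjoint h.coercive_zero) j

theorem corrector_ae (h : Admissible A C M α) (n : ℕ) (i : Fin d) :
    (corrector (perV d (2 * n + 1)) (mulL (volume.restrict (cube d (2 * n + 1))) A)
        (constL (2 * n + 1) (e i)) :)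
      =ᵐ[volume.restrict (cube d (2 * n + 1))] fun x => correctorGrad 1 A i x + e i := by
  rw [corrector_eq_toLp h.memLp h.isPeriodic h.pos h.coercive_zero i n]
  exact MemLp.coeFn_toLp _

theorem adjointCorrector_eq (h : Admissible A C M α) (n : ℕ) (j : Fin d) :
    corrector (perV d (2 * n + 1)) (adjoint (mulL (volume.restrict (cube d (2 * n + 1))) A))
        (constL (2 * n + 1) (e j)) =
      ((h.locL2_adjointCorrector j).memLp_cube (2 * n + 1)).toLp _ := by
  rw [← mulL_adjoint (h.memLp.restrict _), corrector_eq_toLp (memLp_adjoint h.memLp)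
    (isPeriodic_adjoint h.isPeriodic) h.pos (coercive_adjoint h.coercive_zero) j n]
  rfl

theorem adjointCorrector_ae (h : Admissible A C M α) (n : ℕ) (j : Fin d) :
    (corrector (perV d (2 * n + 1)) (adjoint (mulL (volume.restrict (cube d (2 * n + 1))) A))
        (constL (2 * n + 1) (e j)) :)
      =ᵐ[volume.restrict (cube d (2 * n + 1))] fun x => adjointCorrectorGrad A j x + e j := by
  rw [h.adjointCorrector_eq]
  exact MemLp.coeFn_toLp _

theorem sGrad_ae (h : Admissible A C M α) (n : ℕ) (i : Fin d) :
    (solOp (perV d (2 * n + 1)) (mulL (volume.restrict (cube d (2 * n + 1))) A)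
        (mulL (volume.restrict (cube d (2 * n + 1))) C (corrector (perV d (2 * n + 1))
          (mulL (volume.restrict (cube d (2 * n + 1))) A) (constL (2 * n + 1) (e i)))) :)
      =ᵐ[volume.restrict (cube d (2 * n + 1))] sGrad A C i :=
  solOp_mulL_corrector_ae h.memLp h.isPeriodic h.pos h.coercive_zero h.memLp' h.isPeriodic' i n

theorem adjoint_sGrad_ae (h : Admissible A C M α) (n : ℕ) (j : Fin d) :
    (solOp (perV d (2 * n + 1)) (adjoint (mulL (volume.restrict (cube d (2 * n + 1))) A))
        (adjoint (mulL (volume.restrict (cube d (2 * n + 1))) C) (corrector (perV d (2 * n + 1))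
          (adjoint (mulL (volume.restrict (cube d (2 * n + 1))) A))
          (constL (2 * n + 1) (e j)))) :)
      =ᵐ[volume.restrict (cube d (2 * n + 1))]
        periodicGrad 1 (fun x => adjoint (A x))
          fun x => adjoint (C x) (adjointCorrectorGrad A j x + e j) := by
  have h1 := solOp_mulL_corrector_ae (memLp_adjoint h.memLp) (isPeriodic_adjoint h.isPeriodic) h.pos
    (coercive_adjoint h.coercive_zero) (memLp_adjoint h.memLp') (isPeriodic_adjoint h.isPeriodic')
    j n
  rw [mulL_adjoint (h.memLp.restrict (cube d (2 * n + 1))),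
    mulL_adjoint (h.memLp'.restrict (cube d (2 * n + 1)))] at h1
  exact h1

/-- The defect only sees the unit cell, where the adjoint corrector does not depend on the
supercell; so the size of the supercell disappears. -/
theorem inner_defect_corrector (h : Admissible A C M α) (n : ℕ) (j : Fin d)
    {f : Lp (E d) 2 (volume.restrict (cube d (2 * n + 1)))} {H : E d → E d}
    (hf : f =ᵐ[volume.restrict (cube d (2 * n + 1))] H) :
    inner ℝ (mulL (volume.restrict (cube d (2 * n + 1))) ((cube d 1).indicator C) f)
        (corrector (perV d (2 * n + 1)) (adjoint (mulL (volume.restrict (cube d (2 * n + 1))) A))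
          (constL (2 * n + 1) (e j))) = adjointFlux A C j H := by
  rw [inner_mulL_indicator (measurableSet_cube 1) (cube_subset n) h.memLp', adjointFlux]
  refine integral_congr_ae ?_
  filter_upwards [ae_restrict_of_ae_restrict_of_subset (cube_subset n) hf,
    ae_restrict_of_ae_restrict_of_subset (cube_subset n) (h.adjointCorrector_ae n j)] with x h1 h2
  rw [h1, h2]

set_option maxHeartbeats 1000000 in
-- The response to one defect, tested with C over the whole supercell, is by duality an integral
-- over Q of the adjoint response to C, which is 1-periodic. Hence the value does not depend on n,
-- and for n = 0 a defect in Q is C itself.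
theorem inner_solOp_defect (h : Admissible A C M α) (n : ℕ) (i j : Fin d) :
    inner ℝ (mulL (volume.restrict (cube d (2 * n + 1))) C
        (solOp (perV d (2 * n + 1)) (mulL (volume.restrict (cube d (2 * n + 1))) A)
          (mulL (volume.restrict (cube d (2 * n + 1))) ((cube d 1).indicator C)
            (corrector (perV d (2 * n + 1)) (mulL (volume.restrict (cube d (2 * n + 1))) A)
              (constL (2 * n + 1) (e i))))))
        (corrector (perV d (2 * n + 1)) (adjoint (mulL (volume.restrict (cube d (2 * n + 1))) A))
          (constL (2 * n + 1) (e j))) = adjointFlux A C j (sGrad A C i) := by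
  have key : ∀ n : ℕ, inner ℝ (mulL (volume.restrict (cube d (2 * n + 1))) C
        (solOp (perV d (2 * n + 1)) (mulL (volume.restrict (cube d (2 * n + 1))) A)
          (mulL (volume.restrict (cube d (2 * n + 1))) ((cube d 1).indicator C)
            (corrector (perV d (2 * n + 1)) (mulL (volume.restrict (cube d (2 * n + 1))) A)
              (constL (2 * n + 1) (e i))))))
        (corrector (perV d (2 * n + 1)) (adjoint (mulL (volume.restrict (cube d (2 * n + 1))) A))
          (constL (2 * n + 1) (e j))) =
      ∫ x in cube d 1, inner ℝ (C x (correctorGrad 1 A i x + e i))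
        (periodicGrad 1 (fun x => adjoint (A x))
          (fun x => adjoint (C x) (adjointCorrectorGrad A j x + e j)) x) := by
    intro n
    rw [(h.coerciveOn _ _).inner_apply_solOp, inner_mulL_indicator (measurableSet_cube 1) (cube_subset n) h.memLp']
    refine integral_congr_ae ?_
    filter_upwards [ae_restrict_of_ae_restrict_of_subset (cube_subset n) (h.corrector_ae n i),
      ae_restrict_of_ae_restrict_of_subset (cube_subset n) (h.adjoint_sGrad_ae n j)] with x h1 h2
    rw [h1, h2]
  have h1 : mulL (volume.restrict (cube d (2 * 0 + 1))) ((cube d 1).indicator C) =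
      mulL (volume.restrict (cube d (2 * 0 + 1))) C :=
    mulL_congr (indicator_ae_eq_restrict (measurableSet_cube 1))
  rw [key n, ← key 0, ← h.inner_defect_corrector 0 j (h.sGrad_ae 0 i), h1]

/-- The contribution of a single defect in the supercell of size `N`. -/
theorem inner_defect_solOp_defect (h : Admissible A C M α) (n : ℕ) (i j : Fin d) :
    inner ℝ (mulL (volume.restrict (cube d (2 * n + 1))) ((cube d 1).indicator C)
        (solOp (perV d (2 * n + 1)) (mulL (volume.restrict (cube d (2 * n + 1))) A)
          (mulL (volume.restrict (cube d (2 * n + 1))) ((cube d 1).indicator C)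
            (corrector (perV d (2 * n + 1)) (mulL (volume.restrict (cube d (2 * n + 1))) A)
              (constL (2 * n + 1) (e i))))))
        (corrector (perV d (2 * n + 1)) (adjoint (mulL (volume.restrict (cube d (2 * n + 1))) A))
          (constL (2 * n + 1) (e j))) =
      ∫ x in cube d (2 * n + 1), inner ℝ (periodicGrad (2 * n + 1) A
        ((cube d 1).indicator fun x => C x (correctorGrad 1 A i x + e i)) x)
        ((cube d 1).indicator (fun x => adjoint (C x) (adjointCorrectorGrad A j x + e j)) x) := by
  have hF : MemLp ((cube d 1).indicator fun x => C x (correctorGrad 1 A i x + e i)) 2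
      (volume.restrict (cube d (2 * n + 1))) :=
    (((h.locL2_corrector i).mul h.memLp').memLp_cube _).indicator (measurableSet_cube 1)
  have e1 : mulL (volume.restrict (cube d (2 * n + 1))) ((cube d 1).indicator C)
            (corrector (perV d (2 * n + 1)) (mulL (volume.restrict (cube d (2 * n + 1))) A)
              (constL (2 * n + 1) (e i))) = hF.toLp _ := by
    refine Lp.ext ?_
    filter_upwards [hF.coeFn_toLp, h.corrector_ae n i, coeFn_mulL
      ((memLp_indicator h.memLp' (measurableSet_cube 1)).restrict (cube d (2 * n + 1)))
      (corrector (perV d (2 * n + 1)) (mulL (volume.restrict (cube d (2 * n + 1))) A)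
              (constL (2 * n + 1) (e i)))] with x h1 h2 h3
    rw [h1, h3, h2]
    by_cases hx : x ∈ cube d 1 <;> simp [hx]
  have e2 := periodicGrad_ae_eq (by omega : 0 < 2 * n + 1) (h.memLp.restrict _)
    (h.coerciveOn _ _) hF
  rw [e1, h.inner_defect_corrector n j e2.symm, adjointFlux,
    ← inter_eq_left.2 (cube_subset (d := d) n), ← Measure.restrict_restrict (measurableSet_cube 1),
    ← integral_indicator (measurableSet_cube 1), inter_eq_left.2 (cube_subset (d := d) n)]
  refine integral_congr_ae (Eventually.of_forall fun x => ?_)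
  by_cases hx : x ∈ cube d 1
  · simp only [indicator_of_mem hx, ContinuousLinearMap.adjoint_inner_right]
  · simp [hx]

/-- This is the only term of the supercell coefficients that depends on N. The test field is fixed
and supported in Q, so weak convergence is enough. -/
theorem tendsto_defect (h : Admissible A C M α) (i j : Fin d) :
    Tendsto (fun n : ℕ => ∫ x in cube d (2 * n + 1), inner ℝ (periodicGrad (2 * n + 1) A
        ((cube d 1).indicator fun x => C x (correctorGrad 1 A i x + e i)) x)
        ((cube d 1).indicator (fun x => adjoint (C x) (adjointCorrectorGrad A j x + e j)) x)) atTop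
      (𝓝 (adjointFlux A C j (tGrad A C i))) := by
  have hF : MemLp ((cube d 1).indicator fun x => C x (correctorGrad 1 A i x + e i)) 2 volume :=
    (memLp_indicator_iff_restrict (measurableSet_cube 1)).2
      (((h.locL2_corrector i).mul h.memLp').memLp_cube _)
  have hZ : MemLp ((cube d 1).indicator fun x => adjoint (C x) (adjointCorrectorGrad A j x + e j)) 2
      volume := (memLp_indicator_iff_restrict (measurableSet_cube 1)).2
      (((h.locL2_adjointCorrector j).mul (memLp_adjoint h.memLp')).memLp_cube _)
  have h1 := tendsto_periodicGrad h.memLp h.pos h.coercive_zero hF hZ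
  convert! h1 using 2
  rw [adjointFlux, ← integral_indicator (measurableSet_cube 1)]
  refine integral_congr_ae (Eventually.of_forall fun x => ?_)
  by_cases hx : x ∈ cube d 1
  · simp only [indicator_of_mem hx, ContinuousLinearMap.adjoint_inner_right, tGrad]
  · simp [hx]

theorem supercellFirst_eq (h : Admissible A C M α) {P₁ : CompactDistribution (openInterval M)}
    {m : ℝ} (hp : ∀ (f : ℝ → ℝ) (a₁ a₂ : ℝ), ContDiffOn ℝ ((⊤ : ℕ∞) : WithTop ℕ∞) f (Ioo (-M) M) →
      (fun x => f x - (f 0 + a₁ * x + a₂ * x ^ 2)) =o[𝓝 0] (fun x : ℝ => x ^ 2) →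
      P₁.pair f = m * a₁) (n : ℕ) (i j : Fin d) :
    supercellFirst A C P₁ (2 * n + 1) j i =
      m * adjointFlux A C j fun x => correctorGrad 1 A i x + e i := by
  rw [← h.inner_defect_corrector n j (h.corrector_ae n i), supercellFirst, Matrix.of_apply]
  exact (pair_flux (p₂ := fun _ => 0) (r := 0) (σ := 0) h.radius_pos
    (fun f a₁ a₂ h1 h2 => ⟨hp f a₁ a₂ h1 h2, by simp⟩)
    (fun s hs => h.coerciveOn_oneDefect _ _ (Ioo_subset_Icc_self hs))
    fun s hs => h.cellFlux_oneDefect (by omega) (Ioo_subset_Icc_self hs) i j).1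

/-- Bookkeeping for the two orders of the defects: each full sum is U, each diagonal term is T, and
only the off-diagonal part is paired. -/
theorem _root_.WeaklyRandom.sum_erase_eq {ι : Type*} [DecidableEq ι] {s : Finset ι} {k : ι} (hk : k ∈ s)
    {a b g : ι → ℝ} {U T c : ℝ} (ha : ∑ i ∈ s, a i = U) (hb : ∑ i ∈ s, b i = U) (ha0 : a k = T)
    (hb0 : b k = T) (hg : ∀ i ∈ s.erase k, g i = c * (a i + b i)) :
    ∑ i ∈ s.erase k, g i = c * (2 * U - 2 * T) := by
  rw [Finset.sum_congr rfl hg, ← Finset.mul_sum, Finset.sum_erase_eq_sub hk,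
    Finset.sum_add_distrib, ha, hb, ha0, hb0, two_mul, two_mul]

/-- After duality the source enters linearly through its cell, so the sum over cells is the source C
on the whole supercell, whose response is the 1-periodic gradient of s_i. -/
theorem sum_inner_solOp_cell (h : Admissible A C M α) (n : ℕ) (i j : Fin d) :
    ∑ k ∈ cellsIn d (2 * n + 1), inner ℝ (mulL (volume.restrict (cube d (2 * n + 1))) ((cube d 1).indicator C)
        (solOp (perV d (2 * n + 1)) (mulL (volume.restrict (cube d (2 * n + 1))) A)
          (mulL (volume.restrict (cube d (2 * n + 1))) ((cell k).indicator C)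
            (corrector (perV d (2 * n + 1)) (mulL (volume.restrict (cube d (2 * n + 1))) A)
              (constL (2 * n + 1) (e i))))))
        (corrector (perV d (2 * n + 1)) (adjoint (mulL (volume.restrict (cube d (2 * n + 1))) A))
          (constL (2 * n + 1) (e j))) =
      adjointFlux A C j (sGrad A C i) := by
  rw [Finset.sum_congr rfl fun k _ => (h.coerciveOn (2 * n + 1) (perV d (2 * n + 1))).inner_apply_solOp
    (mulL _ ((cube d 1).indicator C)) _ _, sum_inner_mulL_cell h.memLp',
    ← (h.coerciveOn _ _).inner_apply_solOp, h.inner_defect_corrector n j (h.sGrad_ae n i)]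

theorem pair_pair_twoDefects (h : Admissible A C M α) {P₁ : CompactDistribution (openInterval M)}
    {m : ℝ} (hp : ∀ (f : ℝ → ℝ) (a₁ : ℝ), ContDiffOn ℝ ((⊤ : ℕ∞) : WithTop ℕ∞) f (Ioo (-M) M) →
      HasDerivAt f a₁ 0 → P₁.pair f = m * a₁) (n : ℕ) (i j : Fin d) {k : Fin d → ℤ} (hk : k ≠ 0) :
    P₁.pair (fun s => P₁.pair fun t => cellFlux (2 * n + 1) (twoDefects A C s t k) j i) = m ^ 2 *
      (inner ℝ (mulL (volume.restrict (cube d (2 * n + 1))) ((cell k).indicator C)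
        (solOp (perV d (2 * n + 1)) (mulL (volume.restrict (cube d (2 * n + 1))) A)
          (mulL (volume.restrict (cube d (2 * n + 1))) ((cube d 1).indicator C)
            (corrector (perV d (2 * n + 1)) (mulL (volume.restrict (cube d (2 * n + 1))) A)
              (constL (2 * n + 1) (e i))))))
        (corrector (perV d (2 * n + 1)) (adjoint (mulL (volume.restrict (cube d (2 * n + 1))) A))
          (constL (2 * n + 1) (e j)))
      + inner ℝ (mulL (volume.restrict (cube d (2 * n + 1))) ((cube d 1).indicator C)
        (solOp (perV d (2 * n + 1)) (mulL (volume.restrict (cube d (2 * n + 1))) A)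
          (mulL (volume.restrict (cube d (2 * n + 1))) ((cell k).indicator C)
            (corrector (perV d (2 * n + 1)) (mulL (volume.restrict (cube d (2 * n + 1))) A)
              (constL (2 * n + 1) (e i))))))
        (corrector (perV d (2 * n + 1)) (adjoint (mulL (volume.restrict (cube d (2 * n + 1))) A))
          (constL (2 * n + 1) (e j)))) :=
  pair_pair_flux h.radius_pos hp
    (fun s hs t ht => h.coerciveOn_twoDefects _ _ (Ioo_subset_Icc_self hs)
      (Ioo_subset_Icc_self ht) hk)
    fun s hs t ht => h.cellFlux_twoDefects (by omega) (Ioo_subset_Icc_self hs)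
      (Ioo_subset_Icc_self ht) hk i j

theorem sum_pair_pair_twoDefects (h : Admissible A C M α)
    {P₁ : CompactDistribution (openInterval M)}
    {m : ℝ} (hp : ∀ (f : ℝ → ℝ) (a₁ : ℝ), ContDiffOn ℝ ((⊤ : ℕ∞) : WithTop ℕ∞) f (Ioo (-M) M) →
      HasDerivAt f a₁ 0 → P₁.pair f = m * a₁) (n : ℕ) (i j : Fin d) :
    ∑ k ∈ (cellsIn d (2 * n + 1)).erase 0,
      P₁.pair (fun s => P₁.pair fun t => cellFlux (2 * n + 1) (twoDefects A C s t k) j i) =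
    m ^ 2 * (2 * adjointFlux A C j (sGrad A C i) - 2 *
      ∫ x in cube d (2 * n + 1), inner ℝ (periodicGrad (2 * n + 1) A
        ((cube d 1).indicator fun x => C x (correctorGrad 1 A i x + e i)) x)
        ((cube d 1).indicator (fun x => adjoint (C x) (adjointCorrectorGrad A j x + e j)) x)) := by
  have h0 : (0 : Fin d → ℤ) ∈ cellsIn d (2 * n + 1) := by rw [mem_cellsIn_iff]; simp
  have h1 := h.sum_inner_solOp_cell n i j
  have h2 := (sum_inner_mulL_cell h.memLp' _ _).trans (h.inner_solOp_defect n i j)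
  have h3 := h.inner_defect_solOp_defect n i j
  refine sum_erase_eq h0 h2 h1 ?_ ?_ fun k hk =>
    h.pair_pair_twoDefects hp n i j (Finset.ne_of_mem_erase hk)
  · simpa only [cell_zero] using h3
  · simpa only [cell_zero] using h3

/-- Half of the sum over pairs is m² times the s_i term minus m² times the diagonal term. The
single-defect pairing supplies σ times the same diagonal term, and σ - m² is the variance when m and
σ are the first two moments of B₀. -/
theorem supercellSecond_eq (h : Admissible A C M α) {P₁ P₂ : CompactDistribution (openInterval M)}
    {m r σ : ℝ} (hp : ∀ (f : ℝ → ℝ) (a₁ a₂ : ℝ),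
      ContDiffOn ℝ ((⊤ : ℕ∞) : WithTop ℕ∞) f (Ioo (-M) M) →
      (fun x => f x - (f 0 + a₁ * x + a₂ * x ^ 2)) =o[𝓝 0] (fun x : ℝ => x ^ 2) →
      P₁.pair f = m * a₁ ∧ P₂.pair f = r * a₁ + σ * a₂)
    (hp' : ∀ (f : ℝ → ℝ) (a₁ : ℝ), ContDiffOn ℝ ((⊤ : ℕ∞) : WithTop ℕ∞) f (Ioo (-M) M) →
      HasDerivAt f a₁ 0 → P₁.pair f = m * a₁) (n : ℕ) (i j : Fin d) :
    supercellSecond A C P₁ P₂ (2 * n + 1) j i =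
      r * (adjointFlux A C j fun x => correctorGrad 1 A i x + e i)
        + m ^ 2 * adjointFlux A C j (sGrad A C i)
        + (σ - m ^ 2) * ∫ x in cube d (2 * n + 1), inner ℝ (periodicGrad (2 * n + 1) A
        ((cube d 1).indicator fun x => C x (correctorGrad 1 A i x + e i)) x)
        ((cube d 1).indicator (fun x => adjoint (C x) (adjointCorrectorGrad A j x + e j)) x) := by
  have h2 := (pair_flux h.radius_pos hp
    (fun s hs => h.coerciveOn_oneDefect (2 * n + 1) (perV d (2 * n + 1)) (Ioo_subset_Icc_self hs))
    fun s hs => h.cellFlux_oneDefect (by omega) (Ioo_subset_Icc_self hs) i j).2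
  rw [h.inner_defect_corrector n j (h.corrector_ae n i), h.inner_defect_solOp_defect] at h2
  rw [supercellSecond, Matrix.of_apply, h2, h.sum_pair_pair_twoDefects hp']
  ring

end Admissible

end Supercell

end WeaklyRandom

namespace WeaklyRandom

/-! ### Periodic gradients have mean zero -/

section MeanZero

variable {d : ℕ}

/-- Every smooth periodic function is the periodization of a test function. -/
theorem exists_periodize_eq {N : ℕ} (hN : 0 < N) {Φ : E d → ℝ}
    (h1 : ContDiff ℝ ((⊤ : ℕ∞) : WithTop ℕ∞) Φ)
    (h2 : ∀ (k : Fin d → ℤ) (x : E d), Φ (x + (N : ℝ) • lat k) = Φ x) :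
    ∃ φ : E d → ℝ, IsTest φ ∧ periodize N (fun _ => 1) φ = Φ := by
  -- The bump equals 1 on the whole cube I_N, so its periodization S is positive everywhere and φ =
  -- Φψ/S periodizes to Φ.
  let ψ : ContDiffBump (0 : E d) := ⟨(d * N : ℕ) + 1, (d * N : ℕ) + 2, by positivity, by linarith⟩
  have hψ : IsTest (ψ : E d → ℝ) := ⟨ψ.contDiff, ψ.hasCompactSupport⟩
  set S := periodize N (fun _ => 1) (ψ : E d → ℝ)
  have hS : ContDiff ℝ ((⊤ : ℕ∞) : WithTop ℕ∞) S := hψ.contDiff_periodize hN _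
  have hpos : ∀ x, 0 < S x := by
    intro x
    obtain ⟨m, hm⟩ := hψ.exists_cells hN (‖x‖ + 1)
    change 0 < periodize N (fun _ => 1) (ψ : E d → ℝ) x
    rw [(hψ.periodize_eq hm (fun _ => 1) x (by simp)).1]
    have hone : ψ (x + (N : ℝ) • lat (-cellIdx N x)) = 1 := by
      refine ψ.one_of_mem_closedBall (Metric.closedBall_subset_closedBall (by simp [ψ])
        (cube_subset_closedBall N ?_))
      rw [lat_neg, smul_neg, ← sub_eq_add_neg]
      exact red_mem hN x
    have hmem : -cellIdx N x ∈ cellsIn d (2 * m + 1) := by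
      by_contra h
      have := image_eq_zero_of_notMem_tsupport (hm x (by simp) _ h)
      rw [hone] at this
      exact one_ne_zero this
    refine Finset.sum_pos' (fun k _ => ?_) ⟨_, hmem, ?_⟩
    · rw [one_mul]; exact ψ.nonneg
    · rw [one_mul, hone]; exact one_pos
  refine ⟨fun x => Φ x / S x * ψ x, ⟨(h1.div hS fun x => (hpos x).ne').mul hψ.1, hψ.2.mul_left⟩, ?_⟩
  funext x
  have hSp : ∀ k : Fin d → ℤ, S (x + (N : ℝ) • lat k) = S x := fun k => periodize_one_add N _ k x
  simp only [periodize, h2, hSp, one_mul]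
  rw [tsum_mul_left]
  have h3 : ∑' k : Fin d → ℤ, ψ (x + (N : ℝ) • lat k) = S x := by simp [S, periodize]
  rw [h3, div_mul_cancel₀ _ (hpos x).ne']

/-- The gradient of a periodic function has mean zero. -/
theorem IsPeriodicSolution.integral_eq_zero {N : ℕ} (hN : 0 < N) {a : TensorField d}
    {F G : E d → E d} (h : IsPeriodicSolution N a F G) : ∫ x in cube d N, G x = 0 := by
  obtain ⟨u, hu, hp, -⟩ := id h
  have h0 : MemLp (fun _ : E d => (0 : E d →L[ℝ] E d)) ⊤ (volume.restrict (cube d N)) :=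
    memLp_const _
  have hi : Integrable G (volume.restrict (cube d N)) := h.memLp.integrable (by norm_num)
  ext i
  rw [PiLp.zero_apply, ← inner_e, real_inner_comm, ← integral_inner hi]
  -- With the zero tensor and the constant source e_i, every periodic gradient is a solution,
  -- because constants are divergence free. The weak form then says exactly that e_i is orthogonal
  -- to periodic gradients.
  have hsol : IsPeriodicSolution N (fun _ => (0 : E d →L[ℝ] E d)) (fun _ => e i) G := by
    refine ⟨u, hu, hp, fun Φ h1 h2 => ?_⟩
    obtain ⟨φ, hφ, rfl⟩ := exists_periodize_eq hN h1 h2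
    simp only [zero_apply, zero_add]
    rw [← integral_fderiv_periodic hN (locL2_const (e i))
      (fun k => Eventually.of_forall fun x => rfl) hφ, hφ.integral_fderiv]
  have h3 := hsol.inner_eq h0 (memLp_const (e i)) (h.toLp_mem hN)
  rw [L2.inner_def] at h3
  rw [← h3]
  refine integral_congr_ae ?_
  filter_upwards [h.memLp.coeFn_toLp, (memLp_const (μ := volume.restrict (cube d N)) (p := 2)
    (e i)).coeFn_toLp, coeFn_mulL h0 (hsol.memLp.toLp G), Lp.coeFn_add
    (mulL (volume.restrict (cube d N)) (fun _ => (0 : E d →L[ℝ] E d)) (hsol.memLp.toLp G))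
    ((memLp_const (μ := volume.restrict (cube d N)) (p := 2) (e i)).toLp _)] with x a1 a2 a3 a4
  rw [a1, a4, Pi.add_apply, a2, a3]
  simp

end MeanZero

/-! ### The second-order expansion of a flux -/

section FluxExpansion

open ContinuousLinearMap (adjoint)

variable {H : Type*} [NormedAddCommGroup H] [InnerProductSpace ℝ H] [CompleteSpace H]
  {V : Submodule ℝ H} [V.HasOrthogonalProjection] {T S : H →L[ℝ] H}

theorem corrector_sub_corrector (hT : CoerciveOn V T) (hS : CoerciveOn V S) (x : H) :
    corrector V S x - corrector V T x = solOp V S ((S - T) (corrector V T x)) := by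
  refine hS.eq_solOp ?_ fun v hv => ?_
  · rw [corrector, corrector, add_sub_add_right_eq_sub]
    exact V.sub_mem (solOp_mem _ _) (solOp_mem _ _)
  · have : S (corrector V S x - corrector V T x) + (S - T) (corrector V T x) =
        S (corrector V S x) - T (corrector V T x) := by
      rw [map_sub, sub_apply]; abel
    rw [this, inner_sub_left, hS.inner_corrector x hv, hT.inner_corrector x hv, sub_zero]

/-- Resolvent identity. The difference of the operators acts on the unperturbed solution only, which
is a fixed vector in the limit η → 0, so strong convergence of the perturbation will be enough. -/
theorem solOp_sub_solOp (hT : CoerciveOn V T) (hS : CoerciveOn V S) (F F' : H) :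
    solOp V S F' - solOp V T F = solOp V S (F' - F + (S - T) (solOp V T F)) := by
  refine hS.eq_solOp (V.sub_mem (solOp_mem _ _) (solOp_mem _ _)) fun v hv => ?_
  have : S (solOp V S F' - solOp V T F) + (F' - F + (S - T) (solOp V T F)) =
      (S (solOp V S F') + F') - (T (solOp V T F) + F) := by
    rw [map_sub, sub_apply]; abel
  rw [this, inner_sub_left, hS.inner_solOp _ hv, hT.inner_solOp _ hv, sub_zero]

/-- Second-order expansion of the flux, when the perturbation tends to zero only strongly. -/
theorem tendsto_flux_expansion {α : ℝ} (hα : 0 < α) (hT : ∀ v ∈ V, α * ‖v‖ ^ 2 ≤ inner ℝ (T v) v)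
    {D : ℝ → H →L[ℝ] H} {l : Filter ℝ}
    (hD : ∀ᶠ η in l, ∀ v ∈ V, α * ‖v‖ ^ 2 ≤ inner ℝ ((T + D η) v) v) {x y F K : H}
    (hF : Tendsto (fun η => η⁻¹ • D η (corrector V T x)) l (𝓝 F))
    (hK : Tendsto (fun η => η⁻¹ • adjoint (D η) (corrector V (adjoint T) y)) l (𝓝 K))
    (h0 : Tendsto (fun η => D η (solOp V T F)) l (𝓝 0)) :
    Tendsto (fun η => (η ^ 2)⁻¹ * (flux V (T + D η) x y - flux V T x y -
      inner ℝ (D η (corrector V T x)) (corrector V (adjoint T) y))) l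
      (𝓝 (inner ℝ (solOp V T F) K)) := by
  have hT' : CoerciveOn V T := ⟨α, hα, hT⟩
  -- The operators do not converge in norm. By the resolvent identity the error solves a problem
  -- whose source is an error of the data plus `D η` applied to a fixed vector. Both tend to zero,
  -- and the energy bound is uniform in η.
  have h1 : Tendsto (fun η => solOp V (T + D η) (η⁻¹ • D η (corrector V T x))) l
      (𝓝 (solOp V T F)) := by
    rw [tendsto_iff_norm_sub_tendsto_zero]
    have h2 : Tendsto (fun η => α⁻¹ * ‖(η⁻¹ • D η (corrector V T x) - F) + D η (solOp V T F)‖) l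
        (𝓝 0) := by
      simpa using (((hF.sub_const F).add h0).norm.const_mul α⁻¹)
    refine squeeze_zero' (Eventually.of_forall fun η => norm_nonneg _) ?_ h2
    filter_upwards [hD] with η hη
    rw [solOp_sub_solOp hT' ⟨α, hα, hη⟩, add_sub_cancel_left]
    exact norm_solOp_le hα hη _
  refine (h1.inner hK).congr' ?_
  filter_upwards [hD] with η hη
  have hη' : CoerciveOn V (T + D η) := ⟨α, hα, hη⟩
  have h3 := corrector_sub_corrector hT' hη' x
  rw [add_sub_cancel_left] at h3
  rw [flux_eq hT' hη', add_sub_cancel_left, add_sub_cancel_left, ← inner_sub_left, ← map_sub, h3,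
    map_smul, real_inner_smul_left, real_inner_smul_right,
    ContinuousLinearMap.adjoint_inner_right (D η)]
  ring

end FluxExpansion

/-! ### Product fields -/

section Product

open scoped ENNReal
open ContinuousLinearMap (adjoint)

variable {d : ℕ} {Ω : Type*} [MeasurableSpace Ω] {P : Measure Ω} [IsProbabilityMeasure P]
  {g h : E d → E d}

theorem lintegral_enorm_tens {b : Ω → ℝ} (hb : AEStronglyMeasurable b P)
    (hg : AEStronglyMeasurable g (volume.restrict (cube d 1))) :
    ∫⁻ p, ‖b p.2 • g p.1‖ₑ ^ 2 ∂(cellMeasure d P) =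
      (∫⁻ x in cube d 1, ‖g x‖ₑ ^ 2) * ∫⁻ ω, ‖b ω‖ₑ ^ 2 ∂P := by
  simp_rw [enorm_smul, mul_pow, mul_comm (‖b _‖ₑ ^ 2)]
  exact lintegral_prod_mul (hg.enorm.pow_const 2) (hb.enorm.pow_const 2)

theorem memLp_tens {b : Ω → ℝ} (hb : MemLp b 2 P) (hg : MemLp g 2 (volume.restrict (cube d 1))) :
    MemLp (fun p : E d × Ω => b p.2 • g p.1) 2 (cellMeasure d P) := by
  refine ⟨hb.1.comp_snd.smul hg.1.comp_fst, ?_⟩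
  have h1 : eLpNorm (fun p : E d × Ω => b p.2 • g p.1) 2 (cellMeasure d P) ^ 2 < ⊤ := by
    rw [eLpNorm_two_sq, lintegral_enorm_tens hb.1 hg.1, ← eLpNorm_two_sq, ← eLpNorm_two_sq]
    exact ENNReal.mul_lt_top (ENNReal.pow_lt_top hg.2) (ENNReal.pow_lt_top hb.2)
  by_contra h2
  rw [not_lt_top_iff.1 h2] at h1
  simp at h1

variable (P) in
/-- The product `b(ω) g(x)`, as a function of `b`. -/
noncomputable def tens (hg : MemLp g 2 (volume.restrict (cube d 1))) :
    Lp ℝ 2 P →L[ℝ] Lp (E d) 2 (cellMeasure d P) :=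
  LinearMap.mkContinuous
    { toFun := fun b => (memLp_tens (Lp.memLp b) hg).toLp _
      map_add' := fun b c => by
        rw [← MemLp.toLp_add]
        refine (MemLp.toLp_eq_toLp_iff _ _).2 ?_
        filter_upwards [Measure.quasiMeasurePreserving_snd.ae (Lp.coeFn_add b c)] with p hp
        rw [hp, Pi.add_apply, add_smul]; rfl
      map_smul' := fun r b => by
        rw [RingHom.id_apply, ← MemLp.toLp_const_smul]
        refine (MemLp.toLp_eq_toLp_iff _ _).2 ?_
        filter_upwards [Measure.quasiMeasurePreserving_snd.ae (Lp.coeFn_smul r b)] with p hp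
        rw [hp, Pi.smul_apply, smul_assoc]; rfl }
    (eLpNorm g 2 (volume.restrict (cube d 1))).toReal fun b => by
      change ‖(memLp_tens (Lp.memLp b) hg).toLp _‖ ≤ _
      rw [Lp.norm_toLp, Lp.norm_def, ← ENNReal.toReal_mul]
      refine ENNReal.toReal_mono (ENNReal.mul_ne_top hg.2.ne (Lp.memLp b).2.ne) ?_
      refine le_of_eq ((ENNReal.pow_right_strictMono two_ne_zero).injective ?_)
      rw [mul_pow, eLpNorm_two_sq, lintegral_enorm_tens (Lp.memLp b).1 hg.1, ← eLpNorm_two_sq,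
        ← eLpNorm_two_sq]

theorem coeFn_tens (hg : MemLp g 2 (volume.restrict (cube d 1))) (b : Lp ℝ 2 P) :
    tens P hg b =ᵐ[cellMeasure d P] fun p => b p.2 • g p.1 :=
  (memLp_tens (Lp.memLp b) hg).coeFn_toLp

theorem inner_tens (hg : MemLp g 2 (volume.restrict (cube d 1)))
    (hh : MemLp h 2 (volume.restrict (cube d 1))) (b c : Lp ℝ 2 P) :
    inner ℝ (tens P hg b) (tens P hh c) =
      (∫ x in cube d 1, inner ℝ (g x) (h x)) * inner ℝ b c := by
  rw [L2.inner_def, L2.inner_def, ← integral_prod_mul]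
  refine integral_congr_ae ?_
  filter_upwards [coeFn_tens hg b, coeFn_tens hh c] with p h1 h2
  rw [h1, h2, real_inner_smul_left, real_inner_smul_right]
  simp
  ring

variable (P) in
theorem memLp_fst {a : TensorField d} (ha : MemLp a ⊤ volume) :
    MemLp (fun p : E d × Ω => a p.1) ⊤ (cellMeasure d P) := (ha.restrict (cube d 1)).comp_fst P

theorem mulL_tens {a : TensorField d} (ha : MemLp a ⊤ volume)
    (hg : MemLp g 2 (volume.restrict (cube d 1))) (b : Lp ℝ 2 P) :
    mulL (cellMeasure d P) (fun p => a p.1) (tens P hg b) =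
      tens P (memLp_mul (ha.restrict (cube d 1)) hg) b := by
  refine Lp.ext ?_
  filter_upwards [coeFn_mulL (memLp_fst P ha) (tens P hg b), coeFn_tens hg b,
    coeFn_tens (memLp_mul (ha.restrict (cube d 1)) hg) b] with p h1 h2 h3
  rw [h1, h2, h3, map_smul]

theorem memLp_smul_fst {c : TensorField d} (hc : MemLp c ⊤ volume) {X : Ω → ℝ}
    (hX : MemLp X ⊤ P) :
    MemLp (fun p : E d × Ω => X p.2 • c p.1) ⊤ (cellMeasure d P) :=
  MemLp.smul (p := ⊤) (q := ⊤) (r := ⊤) (memLp_fst P hc) (hX.comp_snd (volume.restrict (cube d 1)))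

variable (P) in
/-- The constant `1`, in `L²(Ω)`. -/
noncomputable def oneL : Lp ℝ 2 P := (memLp_const 1).toLp _

theorem coeFn_oneL : oneL P =ᵐ[P] fun _ => (1 : ℝ) := MemLp.coeFn_toLp _

theorem inner_oneL (b : Lp ℝ 2 P) : inner ℝ b (oneL P) = ∫ ω, b ω ∂P := by
  rw [L2.inner_def]
  refine integral_congr_ae ?_
  filter_upwards [coeFn_oneL (P := P)] with ω hω
  rw [hω]; simp

theorem mulL_smul_tens_one {c : TensorField d} (hc : MemLp c ⊤ volume) {X : Ω → ℝ} (hX : MemLp X ⊤ P)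
    (hg : MemLp g 2 (volume.restrict (cube d 1))) {b : Lp ℝ 2 P} (hb : b =ᵐ[P] X) :
    mulL (cellMeasure d P) (fun p => X p.2 • c p.1) (tens P hg (oneL P)) =
      tens P (memLp_mul (hc.restrict (cube d 1)) hg) b := by
  refine Lp.ext ?_
  filter_upwards [coeFn_mulL (memLp_smul_fst hc hX) (tens P hg (oneL P)), coeFn_tens hg (oneL P),
    coeFn_tens (memLp_mul (hc.restrict (cube d 1)) hg) b,
    Measure.quasiMeasurePreserving_snd.ae hb,
    Measure.quasiMeasurePreserving_snd.ae (coeFn_oneL (P := P))] with p h1 h2 h3 h4 h5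
  rw [h1, h2, h3, h4, h5, smul_apply, one_smul]

end Product

end WeaklyRandom

namespace WeaklyRandom

/-! ### Periodic data in the stationary setting -/

section PeriodicStationary

set_option linter.unusedSectionVars false

open ContinuousLinearMap (adjoint)

variable {d : ℕ} {Ω : Type*} [MeasurableSpace Ω] [AddAction (Fin d → ℤ) Ω]

theorem cellField_eq (X : Ω → ℝ) (x : E d) (ω : Ω) :
    cellField X x ω = X (cellIdx 1 x +ᵥ ω) := by
  rw [cellField, tsum_eq_single (cellIdx 1 x)]
  · rw [indicator_of_mem (mem_cell_iff.2 rfl)]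
  · intro k hk
    rw [indicator_of_notMem]
    exact fun h => hk (mem_cell_iff.1 h).symm

theorem cellField_add (X : Ω → ℝ) (x : E d) (k : Fin d → ℤ) (ω : Ω) :
    cellField X (x + lat k) ω = cellField X x (k +ᵥ ω) := by
  have h := cellIdx_add one_pos x k
  simp only [Nat.cast_one, one_smul] at h
  rw [cellField_eq, cellField_eq, h, add_vadd]

theorem cellField_of_mem (X : Ω → ℝ) {x : E d} (hx : x ∈ cube d 1) (ω : Ω) :
    cellField X x ω = X ω := by
  rw [cellField_eq, (mem_cube_iff one_pos).1 hx, zero_vadd]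

theorem isStationary_of_isPeriodic {F : Type*} (P : Measure Ω) [SFinite P] {f : E d → F}
    (hf : IsPeriodic 1 f) : IsStationary P fun x _ => f x := fun k => by
  have h := Measure.quasiMeasurePreserving_fst (μ := (volume : Measure (E d))) (ν := P) |>.ae (hf k)
  filter_upwards [h] with p hp
  rw [← hp, Nat.cast_one, one_smul]

variable {P : Measure Ω} [IsProbabilityMeasure P]

theorem isStationary_perturbedField {A C : TensorField d} (hA : IsPeriodic 1 A)
    (hC : IsPeriodic 1 C) (X : Ω → ℝ) : IsStationary P (perturbedField A C X) := fun k => by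
  filter_upwards [isStationary_of_isPeriodic P hA k, isStationary_of_isPeriodic P hC k] with p h1 h2
  rw [perturbedField, perturbedField, h1, h2, cellField_add]

variable (P) in
theorem perturbedField_ae (A C : TensorField d) (X : Ω → ℝ) :
    Function.uncurry (perturbedField A C X) =ᵐ[cellMeasure d P] fun p => A p.1 + X p.2 • C p.1 := by
  filter_upwards [ae_cellMeasure_mem P] with p hp
  rw [Function.uncurry, perturbedField, cellField_of_mem X hp]

theorem tens_oneL {g : E d → E d} (hg : MemLp g 2 (volume.restrict (cube d 1)))
    (h : MemLp (fun p : E d × Ω => g p.1) 2 (cellMeasure d P)) :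
    tens P hg (oneL P) = h.toLp _ := by
  refine Lp.ext ?_
  filter_upwards [coeFn_tens hg (oneL P), h.coeFn_toLp,
    Measure.quasiMeasurePreserving_snd.ae (coeFn_oneL (P := P))] with p h1 h2 h3
  rw [h1, h2, h3, one_smul]

variable [MeasurableConstVAdd (Fin d → ℤ) Ω]

variable (P) in
/-- Periodic solutions are stationary solutions. -/
theorem IsPeriodicSolution.isStationarySolution {a : TensorField d} {F G : E d → E d}
    (h : IsPeriodicSolution 1 a F G) (ha : MemLp a ⊤ volume) (hap : IsPeriodic 1 a) (hF : LocL2 F)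
    (hFp : IsPeriodic 1 F) :
    IsStationarySolution P (fun x _ => a x) (fun x _ => F x) fun x _ => G x := by
  refine ⟨h.memLp.comp_fst P, isStationary_of_isPeriodic P h.isPeriodic, ?_, ?_, ?_⟩
  · simp [h.integral_eq_zero one_pos]
  · obtain ⟨u, hu, -⟩ := h
    exact Eventually.of_forall fun _ => ⟨u, hu⟩
  · exact Eventually.of_forall fun _ => solvesInSpace_iff.2 (h.divFree one_pos ha hap hF hFp)

variable [ErgodicVAdd (Fin d → ℤ) Ω P]

/-- Deterministic periodic data have the periodic solution also in the stationary class, by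
uniqueness. So the unperturbed stochastic correctors are the periodic ones. -/
theorem solOp_tens_oneL {a : TensorField d} {F G : E d → E d} (ha : MemLp a ⊤ volume)
    (hap : IsPeriodic 1 a) (hco : CoerciveOn (stV d P) (mulL (cellMeasure d P) fun p => a p.1))
    (h : IsPeriodicSolution 1 a F G) (hF : LocL2 F) (hFp : IsPeriodic 1 F) :
    solOp (stV d P) (mulL (cellMeasure d P) fun p => a p.1)
      (tens P (hF.memLp_cube 1) (oneL P)) = tens P h.memLp (oneL P) := by
  have hs := h.isStationarySolution P ha hap hF hFp
  have h2 : MemLp (Function.uncurry fun (x : E d) (_ : Ω) => F x) 2 (cellMeasure d P) :=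
    (hF.memLp_cube 1).comp_fst P
  have h1 := hs.toLp_eq (memLp_fst P ha) (isStationary_of_isPeriodic P hap) hco h2
    (isStationary_of_isPeriodic P hFp)
  rw [tens_oneL h.memLp hs.1, tens_oneL (hF.memLp_cube 1) h2]
  exact h1.symm

variable (P) in
/-- The constant field `v` in `L²(Q × Ω)`. -/
noncomputable def stConst (v : E d) : Lp (E d) 2 (cellMeasure d P) :=
  tens P (memLp_const v) (oneL P)

theorem coeFn_stConst (v : E d) : stConst P v =ᵐ[cellMeasure d P] fun _ => v := by
  filter_upwards [coeFn_tens (memLp_const v) (oneL P),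
    Measure.quasiMeasurePreserving_snd.ae (coeFn_oneL (P := P))] with p h1 h2
  rw [stConst, h1, h2, one_smul]

theorem corrector_stConst {a : TensorField d} (ha : MemLp a ⊤ volume) (hap : IsPeriodic 1 a) {α : ℝ}
    (hα : 0 < α) (hco : ∀ᵐ x : E d, ∀ ξ : E d, α * ‖ξ‖ ^ 2 ≤ inner ℝ (a x ξ) ξ)
    (hco' : CoerciveOn (stV d P) (mulL (cellMeasure d P) fun p => a p.1)) (i : Fin d) :
    corrector (stV d P) (mulL (cellMeasure d P) fun p => a p.1) (stConst P (e i)) =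
      tens P ((locL2_correctorGrad ha hα hco i).memLp_cube 1) (oneL P) := by
  have hF : LocL2 fun x => a x (e i) := (locL2_const (e i)).mul ha
  have hFp : IsPeriodic 1 fun x => a x (e i) :=
    isPeriodic_apply hap fun k => Eventually.of_forall fun x => rfl
  have h := isPeriodicSolution_one ha hα hco hF
  have h1 := solOp_tens_oneL (P := P) ha hap hco' h hF hFp
  have h2 : mulL (cellMeasure d P) (fun p => a p.1) (stConst P (e i)) =
      tens P (hF.memLp_cube 1) (oneL P) := mulL_tens ha _ _
  rw [corrector, h2, h1]
  refine Lp.ext ?_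
  filter_upwards [Lp.coeFn_add (tens P h.memLp (oneL P)) (stConst P (e i)),
    coeFn_tens h.memLp (oneL P), coeFn_stConst (P := P) (e i),
    coeFn_tens ((locL2_correctorGrad ha hα hco i).memLp_cube 1) (oneL P),
    Measure.quasiMeasurePreserving_snd.ae (coeFn_oneL (P := P))] with p h1 h2 h3 h4 h5
  rw [h1, Pi.add_apply, h2, h3, h4, h5, one_smul, one_smul, correctorGrad]

theorem homogenizedTensor_eq_flux {a : E d → Ω → (E d →L[ℝ] E d)}
    (ha : MemLp (Function.uncurry a) ⊤ (cellMeasure d P)) (has : IsStationary P a)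
    (hco : CoerciveOn (stV d P) (mulL _ (Function.uncurry a))) (i j : Fin d) :
    homogenizedTensor P a j i =
      flux (stV d P) (mulL _ (Function.uncurry a)) (stConst P (e i)) (stConst P (e j)) := by
  have hF : MemLp (Function.uncurry fun (x : E d) (ω : Ω) => a x ω (e i)) 2 (cellMeasure d P) :=
    memLp_mul ha (memLp_const (e i))
  have hFs : IsStationary P fun (x : E d) (ω : Ω) => a x ω (e i) := fun k => by
    filter_upwards [has k] with p hp
    rw [hp]
  have h1 := stationaryGrad_ae_eq ha has hco hF hFs
  have h2 : mulL _ (Function.uncurry a) (stConst P (e i)) = hF.toLp _ := by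
    refine Lp.ext ?_
    filter_upwards [coeFn_mulL ha (stConst P (e i)), coeFn_stConst (P := P) (e i), hF.coeFn_toLp]
      with p h1 h2 h3
    rw [h1, h2, h3]; rfl
  rw [flux, L2.inner_def, homogenizedTensor, Matrix.of_apply]
  have hfi := L2.integrable_inner (𝕜 := ℝ) (mulL (cellMeasure d P) (Function.uncurry a)
    (corrector (stV d P) (mulL _ (Function.uncurry a)) (stConst P (e i)))) (stConst P (e j))
  have h3 : (fun p : E d × Ω => (a p.1 p.2
      (stationaryGrad P a (fun y ω' => a y ω' (e i)) p.1 p.2 + e i)) j) =ᵐ[cellMeasure d P]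
      fun p => inner ℝ (mulL (cellMeasure d P) (Function.uncurry a)
    (corrector (stV d P) (mulL _ (Function.uncurry a)) (stConst P (e i))) p) (stConst P (e j) p) := by
    filter_upwards [h1, coeFn_stConst (P := P) (e i), coeFn_stConst (P := P) (e j),
      coeFn_mulL ha (corrector (stV d P) (mulL _ (Function.uncurry a)) (stConst P (e i))),
      Lp.coeFn_add (solOp (stV d P) (mulL _ (Function.uncurry a)) (hF.toLp _)) (stConst P (e i))]
      with p h4 h5 h6 h7 h8
    rw [h7, h6, inner_e, corrector, h2, h8, Pi.add_apply, h5, ← h4]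
    rfl
  rw [← integral_congr_ae h3, integral_prod_symm _ (hfi.congr h3.symm)]

end PeriodicStationary

end WeaklyRandom

namespace WeaklyRandom

/-! ### Correlation of a stationary field with a random variable -/

section Correlation

set_option linter.unusedSectionVars false

open scoped ENNReal

/-- Bessel's inequality for an orthogonal family of vectors of equal length. -/
theorem sum_inner_sq_le {ι H : Type*} [NormedAddCommGroup H] [InnerProductSpace ℝ H] {X : ι → H}
    {σ : ℝ} (hσ0 : 0 ≤ σ) (h : ∀ k l, k ≠ l → inner ℝ (X k) (X l) = 0) (hσ : ∀ k, inner ℝ (X k) (X k) = σ) (u : H)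
    (s : Finset ι) : ∑ k ∈ s, inner ℝ (X k) u ^ 2 ≤ σ * ‖u‖ ^ 2 := by
  classical
  set y := ∑ k ∈ s, inner ℝ (X k) u • X k
  set S := ∑ k ∈ s, inner ℝ (X k) u ^ 2
  have h1 : inner ℝ y u = S := by
    rw [sum_inner]
    exact Finset.sum_congr rfl fun k _ => by rw [real_inner_smul_left, sq]
  have h2 : ‖y‖ ^ 2 = σ * S := by
    rw [← real_inner_self_eq_norm_sq, sum_inner, Finset.mul_sum]
    refine Finset.sum_congr rfl fun k hk => ?_
    rw [real_inner_smul_left, inner_sum, Finset.sum_eq_single k]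
    · rw [real_inner_smul_right, hσ]; ring
    · intro l _ hl
      rw [real_inner_smul_right, h k l hl.symm, mul_zero]
    · exact fun hk' => absurd hk hk'
  -- Cauchy–Schwarz for y and u, where ⟨y, u⟩ = S and |y|² = σS; dividing by S avoids normalizing
  -- the family and covers σ = 0.
  have h3 : S ^ 2 ≤ σ * S * ‖u‖ ^ 2 := by
    rw [← h2, ← mul_pow, ← h1, sq_le_sq, abs_of_nonneg (by positivity : 0 ≤ ‖y‖ * ‖u‖)]
    exact abs_real_inner_le_norm y u
  have hS : 0 ≤ S := Finset.sum_nonneg fun k _ => sq_nonneg _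
  rcases hS.eq_or_lt with h0 | h0
  · rw [← h0]; positivity
  · nlinarith

variable {d : ℕ} {Ω : Type*} [MeasurableSpace Ω] [AddAction (Fin d → ℤ) Ω]
  [MeasurableConstVAdd (Fin d → ℤ) Ω] {P : Measure Ω} [IsProbabilityMeasure P]
  [VAddInvariantMeasure (Fin d → ℤ) Ω P]

variable (P) in
/-- Composition with the shift `τ_k`, on `L²(Ω)`. -/
noncomputable def shiftL (k : Fin d → ℤ) : Lp ℝ 2 P →ₗᵢ[ℝ] Lp ℝ 2 P :=
  Lp.compMeasurePreservingₗᵢ ℝ (fun ω : Ω => k +ᵥ ω) (measurePreserving_vadd k P)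

theorem coeFn_shiftL (k : Fin d → ℤ) (X : Lp ℝ 2 P) :
    shiftL P k X =ᵐ[P] fun ω => X (k +ᵥ ω) :=
  Lp.coeFn_compMeasurePreserving X (measurePreserving_vadd k P)

theorem inner_shiftL (k l : Fin d → ℤ) (X : Lp ℝ 2 P) :
    inner ℝ (shiftL P k X) (shiftL P l X) = ∫ ω, X ω * X ((l - k) +ᵥ ω) ∂P := by
  have h := (measurePreserving_vadd k P).integral_comp (MeasurableEquiv.vadd k).measurableEmbedding
    fun ω => X ω * X ((l - k) +ᵥ ω)
  rw [L2.inner_def, ← h]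
  refine integral_congr_ae ?_
  filter_upwards [coeFn_shiftL k X, coeFn_shiftL l X] with ω h1 h2
  rw [h1, h2, vadd_vadd, sub_add_cancel]
  simp [mul_comm]

/-- The correlation `𝔼 (X u(x, ·))` of the stationary extension of `u` with `X`. -/
noncomputable def correl (X : Lp ℝ 2 P) (u : Lp (E d) 2 (cellMeasure d P)) (x : E d) : E d :=
  ∫ ω, X ω • stExt u (x, ω) ∂P

theorem stronglyMeasurable_correl (X : Lp ℝ 2 P) (u : Lp (E d) 2 (cellMeasure d P)) :
    StronglyMeasurable (correl X u) :=
  StronglyMeasurable.integral_prod_right'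
    (f := fun p : E d × Ω => X p.2 • stExt u p)
    (((Lp.stronglyMeasurable X).comp_measurable measurable_snd).smul
      (stronglyMeasurable_stExt (Lp.stronglyMeasurable u)))

theorem ae_memLp_stExt_slice (u : Lp (E d) 2 (cellMeasure d P)) :
    ∀ᵐ x : E d, MemLp (fun ω => stExt u (x, ω)) 2 P := by
  have hs := stronglyMeasurable_stExt (Lp.stronglyMeasurable u)
  have h : ∀ m : ℕ, ∀ᵐ x ∂((volume : Measure (E d)).restrict (Metric.closedBall 0 (m : ℝ))),
      MemLp (fun ω => stExt u (x, ω)) 2 P := fun m =>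
    ae_memLp_slice (f := fun p : Ω × E d => stExt u p.swap) (hs.comp_measurable measurable_swap)
      ((memLp_stExt (Lp.stronglyMeasurable u) (Lp.memLp u) m).comp_measurePreserving
        Measure.measurePreserving_swap)
  have h2 : ∀ m : ℕ, ∀ᵐ x : E d, x ∈ Metric.closedBall (0 : E d) (m : ℝ) →
      MemLp (fun ω => stExt u (x, ω)) 2 P := fun m =>
    (ae_restrict_iff' Metric.isClosed_closedBall.measurableSet).1 (h m)
  filter_upwards [ae_all_iff.2 h2] with x hx
  obtain ⟨m, hm⟩ := exists_nat_ge ‖x‖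
  exact hx m (by simpa using hm)

theorem ae_integrable_correl (X : Lp ℝ 2 P) (u : Lp (E d) 2 (cellMeasure d P)) :
    ∀ᵐ x : E d, Integrable (fun ω => X ω • stExt u (x, ω)) P := by
  filter_upwards [ae_memLp_stExt_slice u] with x hx
  exact memLp_one_iff_integrable.1 (hx.smul (r := 1) (Lp.memLp X))

/-- The coordinates of the coefficients of a random vector on the shifts of `X`. -/
theorem sum_norm_sq_integral_le {X : Lp ℝ 2 P}
    (hX : ∀ k : Fin d → ℤ, k ≠ 0 → ∫ ω, X ω * X (k +ᵥ ω) ∂P = 0) {U : Ω → E d} (hU : MemLp U 2 P)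
    (s : Finset (Fin d → ℤ)) :
    ∑ k ∈ s, ‖∫ ω, X (-k +ᵥ ω) • U ω ∂P‖ ^ 2 ≤ ‖X‖ ^ 2 * ∫ ω, ‖U ω‖ ^ 2 ∂P := by
  have hUj : ∀ j, MemLp (fun ω => U ω j) 2 P := fun j =>
    hU.continuousLinearMap_comp (EuclideanSpace.proj (𝕜 := ℝ) j)
  have hi : ∀ k : Fin d → ℤ, Integrable (fun ω => X (-k +ᵥ ω) • U ω) P := fun k =>
    memLp_one_iff_integrable.1 (hU.smul (r := 1)
      ((Lp.memLp X).comp_measurePreserving (measurePreserving_vadd (-k) P)))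
  have hc : ∀ (k : Fin d → ℤ) (j : Fin d), (∫ ω, X (-k +ᵥ ω) • U ω ∂P) j =
      inner ℝ (shiftL P (-k) X) ((hUj j).toLp _) := by
    intro k j
    have h1 := (EuclideanSpace.proj (𝕜 := ℝ) j : E d →L[ℝ] ℝ).integral_comp_comm (hi k)
    change _ = (∫ ω, X (-k +ᵥ ω) • U ω ∂P) j at h1
    rw [← h1, L2.inner_def]
    refine integral_congr_ae ?_
    filter_upwards [coeFn_shiftL (-k) X, (hUj j).coeFn_toLp] with ω h2 h3
    rw [h2, h3]
    simp [mul_comm]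
  simp_rw [EuclideanSpace.real_norm_sq_eq, hc]
  rw [Finset.sum_comm, integral_finsetSum _ fun j _ => (hUj j).integrable_sq, Finset.mul_sum]
  refine Finset.sum_le_sum fun j _ => ?_
  have h2 : ∫ ω, U ω j ^ 2 ∂P = ‖(hUj j).toLp _‖ ^ 2 := by
    rw [← integral_sq_eq]
    refine integral_congr_ae ?_
    filter_upwards [(hUj j).coeFn_toLp] with ω h
    rw [h]
  rw [h2]
  refine sum_inner_sq_le (by positivity) (fun k l hkl => ?_) (fun k => ?_) _ s
  · rw [inner_shiftL]
    exact hX _ (by rw [sub_ne_zero]; exact fun h => hkl (neg_injective h).symm)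
  · rw [LinearIsometry.inner_map_map, real_inner_self_eq_norm_sq]

/-- By invariance of `P`, a lattice translation in space becomes a shift of X. The values of the
correlation on x + ℤ^d are thus coefficients of one random vector on the shifts of X. -/
theorem correl_add {X : Lp ℝ 2 P} (u : Lp (E d) 2 (cellMeasure d P)) (x : E d) (k : Fin d → ℤ) :
    correl X u (x + lat k) = ∫ ω, X (-k +ᵥ ω) • stExt u (x, ω) ∂P := by
  rw [correl, ← (measurePreserving_vadd (-k) P).integral_comp
    (MeasurableEquiv.vadd (-k)).measurableEmbedding]
  refine integral_congr_ae (Eventually.of_forall fun ω => ?_)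
  simp only
  rw [stExt_add, vadd_vadd, add_neg_cancel, zero_vadd]

theorem lintegral_eq_tsum_cell (h : E d → ℝ≥0∞) :
    ∫⁻ x, h x = ∑' k : Fin d → ℤ, ∫⁻ x in cube d 1, h (x + lat k) := by
  have h1 : (⋃ k : Fin d → ℤ, cell k) = (univ : Set (E d)) :=
    eq_univ_of_forall fun x => mem_iUnion.2 ⟨cellIdx 1 x, mem_cell_iff.2 rfl⟩
  rw [← setLIntegral_univ, ← h1, lintegral_iUnion (fun k => measurableSet_cell k)]
  · refine tsum_congr fun k => ?_
    have h2 := (measurePreserving_latShift 1 k (d := d)).setLIntegral_comp_preimage_emb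
      (latShift 1 k).measurableEmbedding h (cell k)
    rw [← h2]
    have h3 : (latShift 1 k) ⁻¹' (cell k) = cube d 1 := by
      ext x
      simp [latShift_apply, cell]
    rw [h3]
    simp [latShift_apply]
  · intro k l hkl
    exact Set.disjoint_left.2 fun x hk hl => hkl ((mem_cell_iff.1 hk).symm.trans (mem_cell_iff.1 hl))

/-- The shifts of X are orthogonal, so Bessel's inequality bounds the squares of the correlation
over x + ℤ^d by |X|² 𝔼|u(x,·)|². Integration over x in Q sums the squares over all of ℝ^d:
decorrelation in probability becomes decay in space. -/
theorem memLp_correl {X : Lp ℝ 2 P}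
    (hX : ∀ k : Fin d → ℤ, k ≠ 0 → ∫ ω, X ω * X (k +ᵥ ω) ∂P = 0)
    (u : Lp (E d) 2 (cellMeasure d P)) : MemLp (correl X u) 2 volume := by
  refine ⟨(stronglyMeasurable_correl X u).aestronglyMeasurable, ?_⟩
  have h1 : eLpNorm (correl X u) 2 volume ^ 2 < ⊤ := by
    have hm : Measurable fun p : E d × Ω => ‖stExt u p‖ₑ ^ 2 :=
      (stronglyMeasurable_stExt (Lp.stronglyMeasurable u)).enorm.pow_const 2
    have hk : ∀ k : Fin d → ℤ, Measurable fun x => ‖correl X u (x + lat k)‖ₑ ^ 2 := fun k =>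
      ((stronglyMeasurable_correl X u).measurable.comp (measurable_add_const _)).enorm.pow_const 2
    rw [eLpNorm_two_sq, lintegral_eq_tsum_cell, ← lintegral_tsum fun k => (hk k).aemeasurable]
    refine lt_of_le_of_lt (b := ∫⁻ x in cube d 1, ENNReal.ofReal (‖X‖ ^ 2) *
      ∫⁻ ω, ‖stExt u (x, ω)‖ₑ ^ 2 ∂P) ?_ ?_
    · refine lintegral_mono_ae (ae_restrict_of_ae ?_)
      filter_upwards [ae_memLp_stExt_slice u] with x hx
      rw [ENNReal.tsum_eq_iSup_sum]
      refine iSup_le fun s => ?_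
      have h2 := ENNReal.ofReal_le_ofReal (sum_norm_sq_integral_le hX hx s)
      rw [ENNReal.ofReal_mul (by positivity), ofReal_integral_eq_lintegral_ofReal
        hx.norm.integrable_sq (Eventually.of_forall fun ω => sq_nonneg _),
        ENNReal.ofReal_sum_of_nonneg fun k _ => by positivity] at h2
      simp_rw [ENNReal.ofReal_pow (norm_nonneg _), ofReal_norm] at h2
      simp_rw [correl_add]
      rw [ENNReal.ofReal_pow (norm_nonneg _), ofReal_norm]
      exact h2
    · rw [lintegral_const_mul _ hm.lintegral_prod_right', ← lintegral_prod _ hm.aemeasurable]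
      refine ENNReal.mul_lt_top ENNReal.ofReal_lt_top ?_
      have h3 := (Lp.memLp u).ae_eq (stExt_ae_eq P u).symm
      change ∫⁻ p, ‖stExt u p‖ₑ ^ 2 ∂(cellMeasure d P) < ⊤
      rw [← eLpNorm_two_sq]
      exact ENNReal.pow_lt_top h3.2
  simpa using h1

end Correlation

end WeaklyRandom

namespace WeaklyRandom

/-! ### The decaying equation satisfied by correlations -/

section CorrelationEquation

set_option linter.unusedSectionVars false

open ContinuousLinearMap (adjoint)

variable {d : ℕ} {Ω : Type*} [MeasurableSpace Ω] [AddAction (Fin d → ℤ) Ω]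
  [MeasurableConstVAdd (Fin d → ℤ) Ω] {P : Measure Ω} [IsProbabilityMeasure P]
  [VAddInvariantMeasure (Fin d → ℤ) Ω P]

theorem IsTest.integral_fderiv_correl {φ : E d → ℝ} (hφ : IsTest φ) (X : Lp ℝ 2 P)
    (u : Lp (E d) 2 (cellMeasure d P)) :
    ∫ x, fderiv ℝ φ x (correl X u x) = ∫ ω, X ω * (∫ x, fderiv ℝ φ x (stExt u (x, ω))) ∂P := by
  have hi := hφ.integrable_fderiv_stExt u (Lp.memLp X)
  have h1 := integral_prod _ hi
  rw [integral_prod_symm _ hi] at h1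
  simp_rw [integral_const_mul] at h1
  rw [h1]
  refine integral_congr_ae ?_
  filter_upwards [ae_integrable_correl X u] with x hx
  rw [correl, ← (fderiv ℝ φ x).integral_comp_comm hx]
  simp

theorem divFree_correl (X : Lp ℝ 2 P) {u : Lp (E d) 2 (cellMeasure d P)}
    (h : ∀ v ∈ stV d P, inner ℝ u v = 0) : DivFree (correl X u) := by
  intro φ hφ
  rw [hφ.integral_fderiv_correl X u]
  refine integral_eq_zero_of_ae ?_
  filter_upwards [ae_divFree_of_inner h] with ω hω
  rw [hω φ hφ, mul_zero]; rfl

theorem stExt_mulL_ae {a : TensorField d} (ha : MemLp a ⊤ volume) (hap : IsPeriodic 1 a)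
    (u : Lp (E d) 2 (cellMeasure d P)) :
    (fun p : E d × Ω => a p.1 (stExt u p)) =ᵐ[(volume : Measure (E d)).prod P]
      stExt (mulL (cellMeasure d P) (fun p => a p.1) u) := by
  refine ae_eq_stExt (fun k => ?_) ?_
  · filter_upwards [isStationary_of_isPeriodic P hap k] with p hp
    rw [hp, stExt_add]
  · filter_upwards [coeFn_mulL (memLp_fst P ha) u, stExt_ae_eq P u] with p h1 h2
    rw [h1, h2]

theorem correl_mulL_ae {a : TensorField d} (ha : MemLp a ⊤ volume) (hap : IsPeriodic 1 a)
    (X : Lp ℝ 2 P) (u : Lp (E d) 2 (cellMeasure d P)) :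
    correl X (mulL (cellMeasure d P) (fun p => a p.1) u) =ᵐ[volume] fun x => a x (correl X u x) := by
  filter_upwards [Measure.ae_ae_of_ae_prod (stExt_mulL_ae ha hap u), ae_integrable_correl X u]
    with x h1 h2
  rw [correl, correl, ← (a x).integral_comp_comm h2]
  refine integral_congr_ae ?_
  filter_upwards [h1] with ω h
  rw [← h, map_smul]

theorem correl_add_ae (X : Lp ℝ 2 P) (u v : Lp (E d) 2 (cellMeasure d P)) :
    correl X (u + v) =ᵐ[volume] fun x => correl X u x + correl X v x := by
  filter_upwards [Measure.ae_ae_of_ae_prod (stExt_congr (P := P) (Lp.coeFn_add u v)),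
    ae_integrable_correl X u, ae_integrable_correl X v] with x h1 h2 h3
  rw [correl, correl, correl, ← integral_add h2 h3]
  refine integral_congr_ae ?_
  filter_upwards [h1] with ω h
  rw [h, ← smul_add]; rfl

/-- On the cell Q + k the source is X∘τ_k times f, and its correlation with X vanishes unless k = 0.
The random source over all cells thus becomes a deterministic defect in Q. -/
theorem correl_tens_ae {X : Lp ℝ 2 P}
    (hX : ∀ k : Fin d → ℤ, k ≠ 0 → ∫ ω, X ω * X (k +ᵥ ω) ∂P = 0) {f : E d → E d} (hf : LocL2 f)
    (hfp : IsPeriodic 1 f) :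
    correl X (tens P (hf.memLp_cube 1) X) =ᵐ[volume]
      fun x => ‖X‖ ^ 2 • (cube d 1).indicator f x := by
  have h1 : (fun p : E d × Ω => cellField X p.1 p.2 • f p.1) =ᵐ[(volume : Measure (E d)).prod P]
      stExt (tens P (hf.memLp_cube 1) X) := by
    refine ae_eq_stExt (fun k => ?_) ?_
    · filter_upwards [isStationary_of_isPeriodic P hfp k] with p hp
      rw [hp, cellField_add]
    · filter_upwards [coeFn_tens (hf.memLp_cube 1) X, ae_cellMeasure_mem P] with p h2 h3
      rw [h2, cellField_of_mem _ h3]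
  filter_upwards [Measure.ae_ae_of_ae_prod h1] with x h2
  have h3 : correl X (tens P (hf.memLp_cube 1) X) x =
      (∫ ω, X ω * X (cellIdx 1 x +ᵥ ω) ∂P) • f x := by
    rw [correl, ← integral_smul_const]
    refine integral_congr_ae ?_
    filter_upwards [h2] with ω h
    rw [← h, cellField_eq, smul_smul]
  rw [h3]
  by_cases hx : x ∈ cube d 1
  · rw [indicator_of_mem hx, (mem_cube_iff one_pos).1 hx, ← integral_sq_eq]
    simp [sq]
  · rw [indicator_of_notMem hx, hX _ fun h => hx ((mem_cube_iff one_pos).2 h), zero_smul, smul_zero]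

theorem curlFree_correl (X : Lp ℝ 2 P) {u : Lp (E d) 2 (cellMeasure d P)} (hu : u ∈ stV d P) :
    CurlFree (correl X u) := by
  intro φ hφ v w
  have h1 : ∀ v w : E d, ∫ x, inner ℝ (correl X u x) v * fderiv ℝ φ x w =
      ∫ ω, X ω * (∫ x, inner ℝ (stExt u (x, ω)) v * fderiv ℝ φ x w) ∂P := by
    intro v w
    -- The component along v, redirected along w, is multiplication by a constant rank-one tensor.
    -- The curl test is then an instance of the divergence test, for which exchanging the
    -- expectation and the integral is already available.
    let c : TensorField d := fun _ => (innerSL ℝ v).smulRight w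
    have hc : MemLp c ⊤ volume := memLp_top_const _
    have hcp : IsPeriodic 1 c := fun k => Eventually.of_forall fun x => rfl
    have h2 := hφ.integral_fderiv_correl X (mulL (cellMeasure d P) (fun p => c p.1) u)
    have hcv : ∀ x y, fderiv ℝ φ x (c x y) = inner ℝ y v * fderiv ℝ φ x w := fun x y => by
      simp [c, real_inner_comm]
    rw [integral_congr_ae (g := fun x => inner ℝ (correl X u x) v * fderiv ℝ φ x w)] at h2
    · rw [h2]
      refine integral_congr_ae ?_
      filter_upwards [ae_ae_swap (stExt_mulL_ae (P := P) hc hcp u)] with ω hω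
      congr 1
      refine integral_congr_ae ?_
      filter_upwards [hω] with x hx
      rw [← hx, hcv]
    · filter_upwards [correl_mulL_ae hc hcp X u] with x hx
      rw [hx, hcv]
  rw [h1, h1]
  refine integral_congr_ae ?_
  filter_upwards [ae_exists_potential hu] with ω ⟨p, hp⟩
  rw [weakGradient_curlFree hp φ hφ v w]

theorem memLp_volume_indicator {f : E d → E d} (hf : LocL2 f) :
    MemLp ((cube d 1).indicator f) 2 volume :=
  (memLp_indicator_iff_restrict (measurableSet_cube 1)).2 (hf.memLp_cube 1)

theorem decayingGrad_smul {a : TensorField d} (ha : MemLp a ⊤ volume)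
    (hco : CoerciveOn (decV d) (mulL volume a)) {F : E d → E d} (hF : MemLp F 2 volume) (r : ℝ) :
    (fun x => r • decayingGrad a F x) =ᵐ[volume] decayingGrad a fun x => r • F x := by
  obtain ⟨⟨u, hu⟩, h1, h2⟩ := isDecayingSolution_decayingGrad ha hco hF
  refine ae_eq_decayingGrad ha hco (hF.const_smul r) (h1.const_smul r) ?_ ?_
  · intro φ hφ v w
    have := weakGradient_curlFree hu φ hφ v w
    simp_rw [real_inner_smul_left, mul_assoc, integral_const_mul, this]
  · intro φ hφ
    have := solvesInSpace_iff.1 h2 φ hφ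
    simp_rw [map_smul, ← smul_add, map_smul, smul_eq_mul, integral_const_mul]
    rw [this, mul_zero]

/-- The correlation of a stationary solution with its random source solves a decaying problem. -/
theorem correl_solOp_ae {a : TensorField d} (ha : MemLp a ⊤ volume) (hap : IsPeriodic 1 a)
    (hco : CoerciveOn (decV d) (mulL volume a))
    (hco' : CoerciveOn (stV d P) (mulL (cellMeasure d P) fun p => a p.1)) {X : Lp ℝ 2 P}
    (hX : ∀ k : Fin d → ℤ, k ≠ 0 → ∫ ω, X ω * X (k +ᵥ ω) ∂P = 0) {f : E d → E d} (hf : LocL2 f)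
    (hfp : IsPeriodic 1 f) :
    correl X (solOp (stV d P) (mulL (cellMeasure d P) fun p => a p.1)
        (tens P (hf.memLp_cube 1) X)) =ᵐ[volume]
      fun x => ‖X‖ ^ 2 • decayingGrad a ((cube d 1).indicator f) x := by
  set v := solOp (stV d P) (mulL (cellMeasure d P) fun p => a p.1) (tens P (hf.memLp_cube 1) X)
  have hF := memLp_volume_indicator hf
  refine (ae_eq_decayingGrad ha hco (hF.const_smul (‖X‖ ^ 2)) (memLp_correl hX v)
    (curlFree_correl X (solOp_mem _ _)) ?_).trans (decayingGrad_smul ha hco hF _).symm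
  refine (divFree_correl X (u := mulL (cellMeasure d P) (fun p => a p.1) v +
    tens P (hf.memLp_cube 1) X) fun w hw => hco'.inner_solOp _ hw).congr ?_
  filter_upwards [correl_add_ae X (mulL (cellMeasure d P) (fun p => a p.1) v)
    (tens P (hf.memLp_cube 1) X), correl_mulL_ae ha hap X v, correl_tens_ae hX hf hfp]
    with x h1 h2 h3
  rw [h1, h2, h3]; rfl

theorem inner_tens_eq_correl (X : Lp ℝ 2 P) (v : Lp (E d) 2 (cellMeasure d P)) {g : E d → E d}
    (hg : MemLp g 2 (volume.restrict (cube d 1))) :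
    inner ℝ v (tens P hg X) = ∫ x in cube d 1, inner ℝ (correl X v x) (g x) := by
  have hi := L2.integrable_inner (𝕜 := ℝ) v (tens P hg X)
  have h1 : (fun p => inner ℝ (v p) (tens P hg X p)) =ᵐ[cellMeasure d P]
      fun p => inner ℝ (X p.2 • stExt v p) (g p.1) := by
    filter_upwards [coeFn_tens hg X, stExt_ae_eq P v] with p h2 h3
    rw [h2, h3, real_inner_smul_left, real_inner_smul_right]
  rw [L2.inner_def, integral_congr_ae h1, integral_prod _ (hi.congr h1)]
  refine integral_congr_ae (ae_restrict_of_ae ?_)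
  filter_upwards [ae_integrable_correl X v] with x hx
  rw [real_inner_comm, correl, ← integral_inner hx]
  simp_rw [real_inner_comm]

/-- The second-order contribution of uncorrelated fluctuations is that of one defect. -/
theorem inner_solOp_tens_of_uncorrelated {a : TensorField d} (ha : MemLp a ⊤ volume)
    (hap : IsPeriodic 1 a) (hco : CoerciveOn (decV d) (mulL volume a))
    (hco' : CoerciveOn (stV d P) (mulL (cellMeasure d P) fun p => a p.1)) {X : Lp ℝ 2 P}
    (hX : ∀ k : Fin d → ℤ, k ≠ 0 → ∫ ω, X ω * X (k +ᵥ ω) ∂P = 0) {f g : E d → E d} (hf : LocL2 f)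
    (hfp : IsPeriodic 1 f) (hg : MemLp g 2 (volume.restrict (cube d 1))) :
    inner ℝ (solOp (stV d P) (mulL (cellMeasure d P) fun p => a p.1) (tens P (hf.memLp_cube 1) X))
        (tens P hg X) =
      ‖X‖ ^ 2 * ∫ x in cube d 1, inner ℝ (decayingGrad a ((cube d 1).indicator f) x) (g x) := by
  rw [inner_tens_eq_correl, ← integral_const_mul]
  refine integral_congr_ae (ae_restrict_of_ae ?_)
  filter_upwards [correl_solOp_ae ha hap hco hco' hX hf hfp] with x hx
  rw [hx, real_inner_smul_left]

end CorrelationEquation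

end WeaklyRandom

namespace WeaklyRandom

/-! ### The second-order expansion of the homogenized tensor -/

section SecondOrder

set_option linter.unusedSectionVars false

open ContinuousLinearMap (adjoint)

variable {d : ℕ} {Ω : Type*} [MeasurableSpace Ω] [AddAction (Fin d → ℤ) Ω]
  [MeasurableConstVAdd (Fin d → ℤ) Ω] {P : Measure Ω} [IsProbabilityMeasure P]
  [ErgodicVAdd (Fin d → ℤ) Ω P] {A C : TensorField d} {M α : ℝ}

theorem inner_oneL_oneL : inner ℝ (oneL P) (oneL P) = 1 := by
  rw [inner_oneL, integral_congr_ae coeFn_oneL]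
  simp

theorem integral_sub_smul_oneL (β : Lp ℝ 2 P) (m : ℝ) (k : Fin d → ℤ) :
    ∫ ω, (β - m • oneL P : Lp ℝ 2 P) ω * (β - m • oneL P : Lp ℝ 2 P) (k +ᵥ ω) ∂P =
      (∫ ω, β ω * β (k +ᵥ ω) ∂P) - 2 * m * (∫ ω, β ω ∂P) + m ^ 2 := by
  have hmp := measurePreserving_vadd k P
  have h1 : (β - m • oneL P : Lp ℝ 2 P) =ᵐ[P] fun ω => β ω - m := by
    filter_upwards [Lp.coeFn_sub β (m • oneL P), Lp.coeFn_smul m (oneL P), coeFn_oneL (P := P)]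
      with ω a b c
    rw [a, Pi.sub_apply, b, Pi.smul_apply, c]
    simp
  have h2 : (fun ω => (β - m • oneL P : Lp ℝ 2 P) ω * (β - m • oneL P : Lp ℝ 2 P) (k +ᵥ ω)) =ᵐ[P]
      fun ω => β ω * β (k +ᵥ ω) - (m * β ω + m * β (k +ᵥ ω)) + m ^ 2 := by
    filter_upwards [h1, hmp.quasiMeasurePreserving.ae h1] with ω a b
    rw [a, b]; ring
  have hi := (Lp.memLp β).integrable (by norm_num)
  have hk := (Lp.memLp β).comp_measurePreserving hmp
  have hik : Integrable (fun ω => β (k +ᵥ ω)) P := hk.integrable (by norm_num)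
  have hp : Integrable (fun ω => β ω * β (k +ᵥ ω)) P := (Lp.memLp β).integrable_mul hk
  have hs : Integrable (fun ω => m * β ω + m * β (k +ᵥ ω)) P := (hi.const_mul m).add (hik.const_mul m)
  have hps : Integrable (fun ω => β ω * β (k +ᵥ ω) - (m * β ω + m * β (k +ᵥ ω))) P := hp.sub hs
  rw [integral_congr_ae h2, integral_add hps (integrable_const _), integral_sub hp hs,
    integral_add (hi.const_mul m) (hik.const_mul m), integral_const_mul, integral_const_mul,
    hmp.integral_comp (MeasurableEquiv.vadd k).measurableEmbedding]
  simp
  ring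

/-- Split β into its mean m and a centred part X. The mean has the periodic solution, X has
uncorrelated shifts and behaves as a single defect, and the cross terms contain the expectation of
X, which is zero. -/
theorem inner_solOp_tens {a : TensorField d} (ha : MemLp a ⊤ volume)
    (hap : IsPeriodic 1 a) (hα : 0 < α)
    (hco : ∀ᵐ x : E d, ∀ ξ : E d, α * ‖ξ‖ ^ 2 ≤ inner ℝ (a x ξ) ξ) {β : Lp ℝ 2 P} {m : ℝ}
    (hm : ∫ ω, β ω ∂P = m) (hβ : ∀ k : Fin d → ℤ, k ≠ 0 → ∫ ω, β ω * β (k +ᵥ ω) ∂P = m ^ 2)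
    {f g : E d → E d} (hf : LocL2 f) (hfp : IsPeriodic 1 f) (hg : LocL2 g) (hgp : IsPeriodic 1 g) :
    inner ℝ (solOp (stV d P) (mulL (cellMeasure d P) fun p => a p.1) (tens P (hf.memLp_cube 1) β))
        (tens P (hg.memLp_cube 1) β) =
      m ^ 2 * (∫ x in cube d 1, inner ℝ (periodicGrad 1 a f x) (g x)) +
      (‖β‖ ^ 2 - m ^ 2) *
        ∫ x in cube d 1, inner ℝ (decayingGrad a ((cube d 1).indicator f) x) (g x) := by
  have hdec : CoerciveOn (decV d) (mulL volume a) := ⟨α, hα, fun v _ => coercive_mulL ha hco v⟩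
  have hst : CoerciveOn (stV d P) (mulL (cellMeasure d P) fun p => a p.1) :=
    ⟨α, hα, fun v _ => coercive_mulL (memLp_fst P ha)
      (Measure.quasiMeasurePreserving_fst.ae (ae_restrict_of_ae hco)) v⟩
  set X := β - m • oneL P with hXdef
  have hX1 : inner ℝ X (oneL P) = 0 := by
    rw [hXdef, inner_sub_left, real_inner_smul_left, inner_oneL_oneL, inner_oneL, hm]; ring
  have hX : ∀ k : Fin d → ℤ, k ≠ 0 → ∫ ω, X ω * X (k +ᵥ ω) ∂P = 0 := fun k hk => by
    rw [hXdef, integral_sub_smul_oneL, hβ k hk, hm]; ring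
  have hXn : ‖X‖ ^ 2 = ‖β‖ ^ 2 - m ^ 2 := by
    rw [hXdef, ← real_inner_self_eq_norm_sq, inner_sub_left, inner_sub_right, inner_sub_right,
      real_inner_smul_left, real_inner_smul_left, real_inner_smul_right, real_inner_smul_right,
      inner_oneL_oneL, real_inner_comm β (oneL P), inner_oneL, hm, real_inner_self_eq_norm_sq]
    ring
  have hβX : β = m • oneL P + X := by rw [hXdef]; abel
  set S := solOp (stV d P) (mulL (cellMeasure d P) fun p => a p.1)
  have hsol := isPeriodicSolution_one ha hα hco hf
  have hS1 : S (tens P (hf.memLp_cube 1) (oneL P)) = tens P hsol.memLp (oneL P) :=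
    solOp_tens_oneL ha hap hst hsol hf hfp
  have hsol' := isPeriodicSolution_one (memLp_adjoint ha) hα (coercive_adjoint hco) hg
  -- Duality puts the solution operator on the deterministic side, where the solution is again
  -- deterministic.
  have e1 : inner ℝ (S (tens P (hf.memLp_cube 1) X)) (tens P (hg.memLp_cube 1) (oneL P)) = 0 := by
    have hadj : CoerciveOn (stV d P) (mulL (cellMeasure d P) fun p => adjoint (a p.1)) := by
      rw [mulL_adjoint (memLp_fst P ha)]; exact hst.adjoint
    rw [hst.inner_solOp_comm, ← mulL_adjoint (memLp_fst P ha),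
      solOp_tens_oneL (memLp_adjoint ha) (isPeriodic_adjoint hap) hadj hsol' hg hgp, inner_tens,
      real_inner_comm, hX1, mul_zero]
  have e2 : inner ℝ (S (tens P (hf.memLp_cube 1) (oneL P))) (tens P (hg.memLp_cube 1) X) = 0 := by
    rw [hS1, inner_tens, real_inner_comm, hX1, mul_zero]
  have e3 : inner ℝ (S (tens P (hf.memLp_cube 1) (oneL P))) (tens P (hg.memLp_cube 1) (oneL P)) =
      ∫ x in cube d 1, inner ℝ (periodicGrad 1 a f x) (g x) := by
    rw [hS1, inner_tens, inner_oneL_oneL, mul_one]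
  have e4 := inner_solOp_tens_of_uncorrelated ha hap hdec hst hX hf hfp (hg.memLp_cube 1)
  rw [hXn] at e4
  rw [hβX, map_add, map_add, map_add, map_smul, map_smul, map_smul, inner_add_left, inner_add_right,
    inner_add_right, real_inner_smul_left, real_inner_smul_left, real_inner_smul_right,
    real_inner_smul_right, e1, e2, e3, e4, ← hβX]
  ring

/-- Multiplication by bounded random variables tending to zero in `L²` tends to zero strongly. -/
theorem tendsto_mulL_smul_fst {c : TensorField d} (hc : MemLp c ⊤ volume) {l : Filter ℝ}
    [l.IsCountablyGenerated] {b : ℝ → Lp ℝ 2 P} (hb : Tendsto b l (𝓝 0)) {M : ℝ} {B : ℝ → Ω → ℝ}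
    (hB : ∀ᶠ η in l, MemLp (B η) ⊤ P ∧ b η =ᵐ[P] B η ∧ ∀ᵐ ω ∂P, |B η ω| ≤ M)
    (v : Lp (E d) 2 (cellMeasure d P)) :
    Tendsto (fun η => mulL (cellMeasure d P) (fun p => B η p.2 • c p.1) v) l (𝓝 0) := by
  set y := mulL (cellMeasure d P) (fun p => c p.1) v
  have hy : Integrable (fun p => ‖y p‖ ^ 2) (cellMeasure d P) := (Lp.memLp y).norm.integrable_sq
  have hZ : Integrable (fun ω => ∫ x in cube d 1, ‖y (x, ω)‖ ^ 2) P := hy.integral_prod_right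
  have h1 := tendsto_integral_abs_mul hb (M := M) (hB.mono fun η h => by
    filter_upwards [h.2.1, h.2.2] with ω h2 h3
    rwa [h2]) hZ
  have h2 : Tendsto (fun η => ‖mulL (cellMeasure d P) (fun p => B η p.2 • c p.1) v‖ ^ 2) l (𝓝 0) := by
    refine squeeze_zero' (Eventually.of_forall fun η => sq_nonneg _) ?_
      (by simpa using h1.const_mul M)
    filter_upwards [hB] with η ⟨h3, h4, h5⟩
    have hm := coeFn_mulL (memLp_smul_fst hc h3) v
    have hy' := coeFn_mulL (memLp_fst P hc) v
    have h5' := Measure.quasiMeasurePreserving_snd (μ := volume.restrict (cube d 1)) |>.ae h5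
    have h4' := Measure.quasiMeasurePreserving_snd (μ := volume.restrict (cube d 1)) |>.ae h4
    have hi : Integrable (fun p : E d × Ω => |b η p.2| * ‖y p‖ ^ 2) (cellMeasure d P) := by
      refine (hy.const_mul M).mono' ?_ ?_
      · exact ((Lp.aestronglyMeasurable (b η)).comp_snd.norm).mul hy.aestronglyMeasurable
      · filter_upwards [h4', h5'] with p h6 h7
        rw [Real.norm_of_nonneg (by positivity), h6]
        exact mul_le_mul_of_nonneg_right h7 (by positivity)
    have h6 : ∫ ω, |b η ω| * |∫ x in cube d 1, ‖y (x, ω)‖ ^ 2| ∂P =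
        ∫ p, |b η p.2| * ‖y p‖ ^ 2 ∂(cellMeasure d P) := by
      rw [integral_prod_symm _ hi]
      refine integral_congr_ae (Eventually.of_forall fun ω => ?_)
      simp only
      rw [integral_const_mul, abs_of_nonneg (integral_nonneg fun x => by positivity)]
    rw [h6, ← integral_const_mul, ← real_inner_self_eq_norm_sq, L2.inner_def]
    refine integral_mono_ae (L2.integrable_inner _ _) (hi.const_mul M) ?_
    filter_upwards [hm, hy', h4', h5'] with p a1 a2 a3 a4
    rw [a1, real_inner_self_eq_norm_sq, smul_apply, ← a2, norm_smul, mul_pow, a3, Real.norm_eq_abs,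
      ← mul_assoc, sq]
    gcongr
  rw [tendsto_zero_iff_norm_tendsto_zero]
  simpa using h2.sqrt

theorem inner_adjoint_flux (A C : TensorField d) (j : Fin d) (H : E d → E d) :
    ∫ x in cube d 1, inner ℝ (H x) (adjoint (C x) (adjointCorrectorGrad A j x + e j)) =
      adjointFlux A C j H := by
  simp_rw [ContinuousLinearMap.adjoint_inner_right]
  rfl

namespace Admissible

theorem coercive_perturbed (h : Admissible A C M α) {X : Ω → ℝ} (hX : ∀ᵐ ω ∂P, |X ω| ≤ M) :
    ∀ᵐ p ∂(cellMeasure d P), ∀ ξ : E d,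
      α * ‖ξ‖ ^ 2 ≤ inner ℝ ((A p.1 + X p.2 • C p.1) ξ) ξ := by
  filter_upwards [Measure.quasiMeasurePreserving_fst.ae (ae_restrict_of_ae h.coercive),
    Measure.quasiMeasurePreserving_snd.ae hX] with p h1 h2
  exact h1 _ (abs_le.1 h2)

theorem coerciveOn_stV (h : Admissible A C M α) :
    CoerciveOn (stV d P) (mulL (cellMeasure d P) fun p => A p.1) :=
  ⟨α, h.pos, fun v _ => coercive_mulL (memLp_fst P h.memLp)
    (Measure.quasiMeasurePreserving_fst.ae (ae_restrict_of_ae h.coercive_zero)) v⟩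

theorem memLp_perturbed (h : Admissible A C M α) {X : Ω → ℝ} (hX : MemLp X ⊤ P) :
    MemLp (fun p : E d × Ω => A p.1 + X p.2 • C p.1) ⊤ (cellMeasure d P) := by
  simpa only [one_smul] using memLp_add_smul (memLp_fst P h.memLp) (memLp_smul_fst h.memLp' hX) 1

theorem mulL_perturbed (h : Admissible A C M α) {X : Ω → ℝ} (hX : MemLp X ⊤ P) :
    (mulL (cellMeasure d P) fun p => A p.1 + X p.2 • C p.1) =
      (mulL (cellMeasure d P) fun p => A p.1) + mulL (cellMeasure d P) fun p => X p.2 • C p.1 := by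
  simpa only [one_smul] using mulL_add_smul (memLp_fst P h.memLp) (memLp_smul_fst h.memLp' hX) 1

theorem homogenizedTensor_eq (h : Admissible A C M α) {X : Ω → ℝ} (hX : MemLp X ⊤ P)
    (hXM : ∀ᵐ ω ∂P, |X ω| ≤ M) (i j : Fin d) :
    homogenizedTensor P (perturbedField A C X) j i =
      flux (stV d P) ((mulL (cellMeasure d P) fun p => A p.1) +
        mulL (cellMeasure d P) fun p => X p.2 • C p.1) (stConst P (e i)) (stConst P (e j)) := by
  have hae := perturbedField_ae P A C X
  rw [← h.mulL_perturbed hX, ← mulL_congr hae]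
  refine homogenizedTensor_eq_flux ((h.memLp_perturbed hX).ae_eq hae.symm)
    (isStationary_perturbedField h.isPeriodic h.isPeriodic' X)
    ⟨α, h.pos, fun v _ => ?_⟩ i j
  rw [mulL_congr hae]
  exact coercive_mulL (h.memLp_perturbed hX) (h.coercive_perturbed hXM) v

theorem corrector_stConst (h : Admissible A C M α) (i : Fin d) :
    corrector (stV d P) (mulL (cellMeasure d P) fun p => A p.1) (stConst P (e i)) =
      tens P ((h.locL2_corrector i).memLp_cube 1) (oneL P) :=
  WeaklyRandom.corrector_stConst h.memLp h.isPeriodic h.pos h.coercive_zero h.coerciveOn_stV i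

theorem adjoint_corrector_stConst (h : Admissible A C M α) (j : Fin d) :
    corrector (stV d P) (adjoint (mulL (cellMeasure d P) fun p => A p.1)) (stConst P (e j)) =
      tens P ((h.locL2_adjointCorrector j).memLp_cube 1) (oneL P) := by
  have hadj : CoerciveOn (stV d P) (mulL (cellMeasure d P) fun p => adjoint (A p.1)) := by
    rw [mulL_adjoint (memLp_fst P h.memLp)]; exact h.coerciveOn_stV.adjoint
  rw [← mulL_adjoint (memLp_fst P h.memLp)]
  exact WeaklyRandom.corrector_stConst (memLp_adjoint h.memLp) (isPeriodic_adjoint h.isPeriodic)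
    h.pos (coercive_adjoint h.coercive_zero) hadj j

theorem flux_stConst (h : Admissible A C M α) (i j : Fin d) :
    flux (stV d P) (mulL (cellMeasure d P) fun p => A p.1) (stConst P (e i)) (stConst P (e j)) =
      cellFlux 1 A j i := by
  rw [flux, h.corrector_stConst, mulL_tens h.memLp, stConst, inner_tens, inner_oneL_oneL, mul_one,
    cellFlux, Matrix.of_apply]
  simp_rw [inner_e]

/-- The term linear in the perturbation is exactly 𝔼(B_η) times ⟨C z, z̃⟩, so the second-order part
r of the expectation enters here. The quadratic limit only needs the first-order profile β of B_η.
-/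
theorem tendsto_homogenizedTensor (h : Admissible A C M α) {B : ℝ → Ω → ℝ} {b : ℝ → Lp ℝ 2 P}
    {β : Lp ℝ 2 P} {m r : ℝ} (hB : ∀ η > 0, MemLp (B η) ⊤ P) (hBM : ∀ η > 0, ∀ᵐ ω ∂P, |B η ω| ≤ M)
    (hbB : ∀ η > 0, b η =ᵐ[P] B η)
    (hb : (fun η => b η - η • β) =O[𝓝[>] 0] fun η : ℝ => η ^ 2) (hm : ∫ ω, β ω ∂P = m)
    (hr : Tendsto (fun η => (η ^ 2)⁻¹ * ((∫ ω, b η ω ∂P) - η * m)) (𝓝[>] 0) (𝓝 r))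
    (hβ : ∀ k : Fin d → ℤ, k ≠ 0 → ∫ ω, β ω * β (k +ᵥ ω) ∂P = m ^ 2) (i j : Fin d) :
    Tendsto (fun η => (η ^ 2)⁻¹ * (homogenizedTensor P (perturbedField A C (B η)) j i -
        cellFlux 1 A j i - η * (m * adjointFlux A C j fun x => correctorGrad 1 A i x + e i)))
      (𝓝[>] 0) (𝓝 (r * adjointFlux A C j (fun x => correctorGrad 1 A i x + e i) +
        (m ^ 2 * adjointFlux A C j (sGrad A C i) +
          (‖β‖ ^ 2 - m ^ 2) * adjointFlux A C j (tGrad A C i)))) := by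
  have hz := h.locL2_corrector i
  have hq := h.locL2_adjointCorrector j
  have hf : LocL2 fun x => C x (correctorGrad 1 A i x + e i) := hz.mul h.memLp'
  have hg : LocL2 fun x => adjoint (C x) (adjointCorrectorGrad A j x + e j) :=
    hq.mul (memLp_adjoint h.memLp')
  have hpos : ∀ᶠ η : ℝ in 𝓝[>] 0, 0 < η := self_mem_nhdsWithin
  set T := mulL (cellMeasure d P) fun p => A p.1 with hTdef
  let D : ℝ → (Lp (E d) 2 (cellMeasure d P) →L[ℝ] Lp (E d) 2 (cellMeasure d P)) := fun η =>
    mulL (cellMeasure d P) fun p => B η p.2 • C p.1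
  have hDz : ∀ η > 0, D η (corrector (stV d P) T (stConst P (e i))) =
      tens P (hf.memLp_cube 1) (b η) := fun η hη => by
    rw [h.corrector_stConst]
    exact mulL_smul_tens_one h.memLp' (hB η hη) _ (hbB η hη)
  have hDq : ∀ η > 0, adjoint (D η) (corrector (stV d P) (adjoint T) (stConst P (e j))) =
      tens P (hg.memLp_cube 1) (b η) := fun η hη => by
    rw [h.adjoint_corrector_stConst, ← mulL_adjoint (memLp_smul_fst h.memLp' (hB η hη))]
    simp only [map_smul]
    exact mulL_smul_tens_one (memLp_adjoint h.memLp') (hB η hη) _ (hbB η hη)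
  have hlim : ∀ {f : E d → E d} (hf : MemLp f 2 (volume.restrict (cube d 1))),
      Tendsto (fun η => η⁻¹ • tens P hf (b η)) (𝓝[>] 0) (𝓝 (tens P hf β)) := fun hf => by
    simp_rw [← map_smul]
    exact ((tens P hf).continuous.tendsto _).comp (tendsto_inv_smul hb)
  have key := tendsto_flux_expansion (V := stV d P) (T := T) (D := D) (l := 𝓝[>] 0)
    (x := stConst P (e i)) (y := stConst P (e j)) h.pos
    (fun v _ => coercive_mulL (memLp_fst P h.memLp)
      (Measure.quasiMeasurePreserving_fst.ae (ae_restrict_of_ae h.coercive_zero)) v)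
    (by
      filter_upwards [hpos] with η hη v _
      have h3 := coercive_mulL (h.memLp_perturbed (hB η hη)) (h.coercive_perturbed (hBM η hη)) v
      rwa [h.mulL_perturbed (hB η hη)] at h3)
    ((hlim (hf.memLp_cube 1)).congr' (hpos.mono fun η hη => by beta_reduce; rw [hDz η hη]))
    ((hlim (hg.memLp_cube 1)).congr' (hpos.mono fun η hη => by beta_reduce; rw [hDq η hη]))
    (tendsto_mulL_smul_fst h.memLp' (tendsto_zero_of_expansion hb)
      (hpos.mono fun η hη => ⟨hB η hη, hbB η hη, hBM η hη⟩) _)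
  have hU := inner_solOp_tens h.memLp h.isPeriodic h.pos h.coercive_zero hm hβ hf
    (isPeriodic_apply h.isPeriodic' (h.isPeriodic_corrector i)) hg
    (isPeriodic_apply (isPeriodic_adjoint h.isPeriodic') (h.isPeriodic_adjointCorrector j))
  rw [hU, inner_adjoint_flux, inner_adjoint_flux] at key
  refine ((hr.mul_const (adjointFlux A C j fun x => correctorGrad 1 A i x + e i)).add key).congr' ?_
  filter_upwards [hpos] with η hη
  have h4 : inner ℝ (D η (corrector (stV d P) T (stConst P (e i))))
      (corrector (stV d P) (adjoint T) (stConst P (e j))) =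
      adjointFlux A C j (fun x => correctorGrad 1 A i x + e i) * ∫ ω, b η ω ∂P := by
    rw [hDz η hη, h.adjoint_corrector_stConst, inner_tens, inner_oneL]
    rfl
  rw [h4, h.flux_stConst, h.homogenizedTensor_eq (hB η hη) (hBM η hη)]
  ring

end Admissible

end SecondOrder

end WeaklyRandom

namespace WeaklyRandom

/-! ### The rigorous coefficients in terms of adjoint fluxes -/

section RigorousCoefficients

set_option linter.unusedSectionVars false

open ContinuousLinearMap (adjoint)

variable {d : ℕ} {Ω : Type*} [MeasurableSpace Ω] [AddAction (Fin d → ℤ) Ω]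
  [MeasurableConstVAdd (Fin d → ℤ) Ω] {P : Measure Ω} [IsProbabilityMeasure P]
  [ErgodicVAdd (Fin d → ℤ) Ω P] {A C : TensorField d} {M α : ℝ} {B₀ R₀ : Ω → ℝ}

/-- T u + F is orthogonal to `V`, so y may be replaced by its adjoint corrector; against that
corrector T u vanishes because u lies in `V`. Only the source remains. -/
theorem inner_solOp_add_const {H : Type*} [NormedAddCommGroup H] [InnerProductSpace ℝ H]
    [CompleteSpace H] {V : Submodule ℝ H} [V.HasOrthogonalProjection] {T : H →L[ℝ] H}
    (hT : CoerciveOn V T) (F y : H) :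
    inner ℝ (T (solOp V T F) + F) y = inner ℝ F (corrector V (adjoint T) y) := by
  have h1 := hT.inner_solOp F (solOp_mem (adjoint T) (adjoint T y) (V := V))
  have h2 := hT.adjoint.inner_corrector y (solOp_mem T F (V := V))
  rw [ContinuousLinearMap.adjoint_inner_left, real_inner_comm] at h2
  have h3 : inner ℝ (T (solOp V T F) + F) (corrector V (adjoint T) y) =
      inner ℝ (T (solOp V T F) + F) y := by
    rw [corrector, inner_add_right, h1, zero_add]
  rw [← h3, inner_add_left, h2, zero_add]

namespace Admissible

theorem rigorousFirst_eq (h : Admissible A C M α) (hB₀ : MemLp B₀ 2 P) (i j : Fin d) :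
    rigorousFirst P A C B₀ j i =
      (∫ ω, B₀ ω ∂P) * adjointFlux A C j fun x => correctorGrad 1 A i x + e i := by
  have hf : LocL2 fun x => C x (correctorGrad 1 A i x + e i) := (h.locL2_corrector i).mul h.memLp'
  set f : E d → E d := fun x => C x (correctorGrad 1 A i x + e i) with hfdef
  have hfp : IsPeriodic 1 f := isPeriodic_apply h.isPeriodic' (h.isPeriodic_corrector i)
  set β := hB₀.toLp B₀
  have hβ : ∫ ω, β ω ∂P = ∫ ω, B₀ ω ∂P := integral_congr_ae hB₀.coeFn_toLp
  set T := mulL (cellMeasure d P) fun p : E d × Ω => A p.1 with hT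
  set V₀ := solOp (stV d P) T (tens P (hf.memLp_cube 1) β) with hV₀
  have h0 : (fun p : E d × Ω => cellField B₀ p.1 p.2 • f p.1) =ᵐ[cellMeasure d P]
      tens P (hf.memLp_cube 1) β := by
    filter_upwards [coeFn_tens (hf.memLp_cube 1) β, ae_cellMeasure_mem P,
      Measure.quasiMeasurePreserving_snd.ae hB₀.coeFn_toLp] with p h1 h2 h3
    rw [h1, h3, cellField_of_mem _ h2]
  have hF : MemLp (Function.uncurry fun (x : E d) (ω : Ω) => cellField B₀ x ω • f x) 2
      (cellMeasure d P) := (Lp.memLp (tens P (hf.memLp_cube 1) β)).ae_eq h0.symm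
  have hFs : IsStationary P fun (x : E d) (ω : Ω) => cellField B₀ x ω • f x := fun k => by
    filter_upwards [isStationary_of_isPeriodic P hfp k] with p hp
    rw [hp, cellField_add]
  have hFL : hF.toLp _ = tens P (hf.memLp_cube 1) β := Lp.ext (hF.coeFn_toLp.trans h0)
  have hG : Function.uncurry (firstOrderGrad P A C B₀ i) =ᵐ[cellMeasure d P] V₀ := by
    rw [hV₀, ← hFL]
    exact stationaryGrad_ae_eq (memLp_fst P h.memLp) (isStationary_of_isPeriodic P h.isPeriodic)
      h.coerciveOn_stV hF hFs
  -- On Q the cell field is `B₀` itself, so its expectation is the constant 𝔼 B₀.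
  have e1 : ∫ x in cube d 1, (∫ ω, cellField B₀ x ω ∂P) * (f x) j =
      inner ℝ (tens P (hf.memLp_cube 1) β) (stConst P (e j)) := by
    rw [stConst, inner_tens, inner_oneL, hβ, mul_comm, ← integral_const_mul]
    refine setIntegral_congr_fun (measurableSet_cube 1) fun x hx => ?_
    simp only [cellField_of_mem B₀ hx, inner_e]
  have e2 : ∫ x in cube d 1, (A x (∫ ω, firstOrderGrad P A C B₀ i x ω ∂P)) j =
      inner ℝ (T V₀) (stConst P (e j)) := by
    have hi := L2.integrable_inner (𝕜 := ℝ) (T V₀) (stConst P (e j))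
    have h1 : (fun p => inner ℝ (T V₀ p) (stConst P (e j) p)) =ᵐ[cellMeasure d P]
        fun p => inner ℝ (A p.1 (firstOrderGrad P A C B₀ i p.1 p.2)) (e j) := by
      filter_upwards [coeFn_mulL (memLp_fst P h.memLp) V₀, coeFn_stConst (P := P) (e j), hG]
        with p h2 h3 h4
      rw [h2, h3, ← h4]; rfl
    have hGi : Integrable (Function.uncurry (firstOrderGrad P A C B₀ i)) (cellMeasure d P) :=
      ((Lp.memLp V₀).integrable (by norm_num)).congr hG.symm
    rw [L2.inner_def, integral_congr_ae h1, integral_prod _ (hi.congr h1)]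
    refine integral_congr_ae ?_
    filter_upwards [hGi.prod_right_ae] with x hx
    have h5 : Integrable (fun ω => firstOrderGrad P A C B₀ i x ω) P := hx
    rw [← inner_e, ← (A x).integral_comp_comm h5, real_inner_comm,
      ← integral_inner ((A x).integrable_comp h5)]
    simp_rw [real_inner_comm]
  rw [rigorousFirst, Matrix.of_apply, e1, e2, add_comm, ← inner_add_left,
    inner_solOp_add_const h.coerciveOn_stV, h.adjoint_corrector_stConst, inner_tens, inner_oneL, hβ,
    mul_comm]
  rfl

/-- The decorrelation of the shifts annihilates every covariance, so the infinite sum vanishes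
without any convergence argument. -/
theorem rigorousSecond_eq (hB₀ : MemLp B₀ 2 P)
    (hcov : ∀ k : Fin d → ℤ, k ≠ 0 → ∫ ω, B₀ ω * B₀ (k +ᵥ ω) ∂P = (∫ ω, B₀ ω ∂P) ^ 2)
    (i j : Fin d) : rigorousSecond P A C B₀ R₀ j i =
      (∫ ω, R₀ ω ∂P) * adjointFlux A C j (fun x => correctorGrad 1 A i x + e i) +
        (∫ ω, B₀ ω ∂P) ^ 2 * adjointFlux A C j (sGrad A C i) +
        ((∫ ω, B₀ ω ^ 2 ∂P) - (∫ ω, B₀ ω ∂P) ^ 2) * adjointFlux A C j (tGrad A C i) := by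
  have h1 : ∀ k : {k : Fin d → ℤ // k ≠ 0}, covariance B₀ (fun ω => B₀ (k.1 +ᵥ ω)) P = 0 :=
    fun k => covariance_vadd_eq_zero hB₀ (hcov k.1 k.2)
  rw [rigorousSecond, Matrix.of_apply]
  simp_rw [h1, zero_mul, tsum_zero, variance_eq_sub hB₀, Pi.pow_apply]
  ring

end Admissible

end RigorousCoefficients

end WeaklyRandom

/-! ### The main theorem -/

theorem mainTheorem5 {d : ℕ} {Ω : Type*} [MeasurableSpace Ω] (P : Measure Ω)
    [IsProbabilityMeasure P] [AddAction (Fin d → ℤ) Ω] [MeasurableConstVAdd (Fin d → ℤ) Ω]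
    [ErgodicVAdd (Fin d → ℤ) Ω P]
    (A C : TensorField d) (hA : Measurable A) (hC : Measurable C)
    (hAper : IsPeriodic 1 A) (hCper : IsPeriodic 1 C)
    (M α β : ℝ) (hM : 0 < M) (hα : 0 < α) (hαβ : α ≤ β)
    (hcoercive : ∀ᵐ x : E d, ∀ s ∈ Icc (-M) M, ∀ ξ : E d,
      α * ‖ξ‖ ^ 2 ≤ inner ℝ ((A x + s • C x) ξ) ξ)
    (hbounded : ∀ᵐ x : E d, ∀ s ∈ Icc (-M) M, ∀ ξ : E d, ‖(A x + s • C x) ξ‖ ≤ β * ‖ξ‖)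
    (B : ℝ → Ω → ℝ) (hB : ∀ η > 0, Measurable (B η))
    (hBM : ∀ η > 0, ∀ᵐ ω ∂P, |B η ω| ≤ M)
    (hindep : ∀ η > 0, iIndepFun (fun (k : Fin d → ℤ) (ω : Ω) => B η (k +ᵥ ω)) P)
    (B₀ R₀ : Ω → ℝ) (hB₀ : MemLp B₀ 2 P) (hR₀ : MemLp R₀ 2 P)
    (hexp : HasWeakExpansion P B B₀ R₀)
    (P₁ P₂ : CompactDistribution (openInterval M)) (hlaw : HasLawExpansion P B P₁ P₂) :
    (∀ N : ℕ, Odd N → supercellFirst A C P₁ N = rigorousFirst P A C B₀) ∧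
    Tendsto (fun n : ℕ => supercellSecond A C P₁ P₂ (2 * n + 1)) atTop
      (𝓝 (rigorousSecond P A C B₀ R₀)) ∧
    ∀ i j : Fin d,
      (fun η : ℝ => homogenizedTensor P (perturbedField A C (B η)) j i
          - (cellFlux 1 A j i + η * rigorousFirst P A C B₀ j i
            + η ^ 2 * rigorousSecond P A C B₀ R₀ j i))
        =o[𝓝[>] 0] fun η : ℝ => η ^ 2 := by
  have h := admissible_of_bounds hA hC hAper hCper hM hα hαβ hcoercive hbounded
  have hcov : ∀ k : Fin d → ℤ, k ≠ 0 → ∫ ω, B₀ ω * B₀ (k +ᵥ ω) ∂P = (∫ ω, B₀ ω ∂P) ^ 2 :=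
    fun k hk => integral_mul_vadd_eq hB hBM hindep hB₀ hR₀ hexp hk
  have hp := fun (f : ℝ → ℝ) (a₁ a₂ : ℝ)
    (hf : ContDiffOn ℝ ((⊤ : ℕ∞) : WithTop ℕ∞) f (Ioo (-M) M))
    (hl : (fun x => f x - (f 0 + a₁ * x + a₂ * x ^ 2)) =o[𝓝 0] (fun x : ℝ => x ^ 2)) =>
    pair_of_expansion hM hB hBM hB₀ hR₀ hexp hlaw hf hl
  refine ⟨?_, ?_, fun i j => ?_⟩
  · rintro N ⟨n, rfl⟩
    ext j i
    rw [h.supercellFirst_eq (fun f a₁ a₂ h1 h2 => (hp f a₁ a₂ h1 h2).1) n i j,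
      h.rigorousFirst_eq hB₀ i j]
  · refine tendsto_pi_nhds.2 fun j => tendsto_pi_nhds.2 fun i => ?_
    rw [Admissible.rigorousSecond_eq hB₀ hcov i j]
    have h1 := fun n => h.supercellSecond_eq hp (fun f a₁ h1 h2 =>
      pair_of_hasDerivAt hM hB hBM hB₀ hR₀ hexp hlaw h1 h2) n i j
    simp_rw [h1]
    -- Everything except the diagonal defect term is already equal to its limit.
    exact ((h.tendsto_defect i j).const_mul _).const_add _
  · obtain ⟨b, hbB, hb, hr⟩ := exists_strong_expansion hB hBM hB₀ hR₀ hexp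
    have hBt : ∀ η > 0, MemLp (B η) ⊤ P := fun η hη =>
      memLp_top_of_bound (hB η hη).aestronglyMeasurable M (hBM η hη)
    have hm : ∫ ω, hB₀.toLp B₀ ω ∂P = ∫ ω, B₀ ω ∂P := integral_congr_ae hB₀.coeFn_toLp
    have hβ : ∀ k : Fin d → ℤ, k ≠ 0 →
        ∫ ω, hB₀.toLp B₀ ω * hB₀.toLp B₀ (k +ᵥ ω) ∂P = (∫ ω, B₀ ω ∂P) ^ 2 := fun k hk => by
      rw [← hcov k hk]
      refine integral_congr_ae ?_
      filter_upwards [hB₀.coeFn_toLp,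
        (measurePreserving_vadd k P).quasiMeasurePreserving.ae hB₀.coeFn_toLp] with ω h1 h2
      rw [h1, h2]
    have hn : ‖hB₀.toLp B₀‖ ^ 2 = ∫ ω, B₀ ω ^ 2 ∂P := by
      rw [← integral_sq_eq]
      refine integral_congr_ae ?_
      filter_upwards [hB₀.coeFn_toLp] with ω h1
      rw [h1]
    have key := h.tendsto_homogenizedTensor hBt hBM hbB hb hm hr hβ i j
    rw [hn, ← h.rigorousFirst_eq hB₀ i j, ← add_assoc,
      ← Admissible.rigorousSecond_eq hB₀ hcov i j] at key
    -- The limit of the second-order quotient is the rigorous coefficient; subtracting it puts the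
    -- convergence in little-o form.
    have key' := key.sub_const (rigorousSecond P A C B₀ R₀ j i)
    rw [sub_self] at key'
    refine (isLittleO_iff_tendsto' ?_).2 (key'.congr' ?_)
    · filter_upwards [self_mem_nhdsWithin] with η (hη : 0 < η) h0
      exact absurd h0 (by positivity)
    · filter_upwards [self_mem_nhdsWithin] with η (hη : 0 < η)
      field_simp
      ring
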